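/- Let $f(u)=u^3-3u$, regarded also as a self-map of $\widehat{\mathbb C}$ with $f(\infty)=\infty$. For $a\in\mathbb C$ let $\Delta_a=B(a,|a-1|)$, and let $S$ be the set of $a\in\mathbb C$ with $\frac32<\operatorname{Re}a<4$ for which $f(\partial\Delta_a)$ is a Jordan curve (i.e. $f$ is injective on the circle $\partial\Delta_a$); then $f$ is injective on $\overline{\Delta_a}$. For $a\in S$ put $\Omega_a=f(\Delta_a)$, let $\iota_a$ be the reflection in the circle $\partial\Delta_a$ (so $\iota_a(a)=\infty$), and let $$\sigma_a=f\circ\iota_a\circ (f|_{\overline{\Delta_a}})^{-1}:\overline{\Omega_a}\to\widehat{\mathbb C}$$ be the Schwarz reflection map of $\Omega_a$. Let $T_a^0=\widehat{\mathbb C}\setminus(\Omega_a\cup\{-2\})$ be the fundamental tile and $T_a^\infty=\bigcup_{n\ge0}\sigma_a^{-n}(T_a^0)$ the tiling set. Let $\mathcal C(\mathcal S)=\{a\in S: 2\notin T_a^\infty\}$, and for $a\in S\setminus\mathcal C(\mathcal S)$ let the depth $n(a)$ be the smallest integer $n\ge1$ with $\sigma_a^{\circ n}(2)\in T_a^0$.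 Let $\omega=e^{2\pi i/3}$, and let $\mathcal Q=\mathbb D/\langle\omega\rangle$ be the quotient Riemann surface of the unit disk by the rotations of order three. Let $C_1,C_2,C_3$ be the circles of radius $\sqrt3$ with centers $1+i\sqrt3,\ -2,\ 1-i\sqrt3$; let $\Pi\subset\mathbb D$ be the ideal triangle (closed in $\mathbb D$) bounded by the geodesics $C_i\cap\mathbb D$, let $\widetilde C_2=C_2\cap\mathbb D$, let $\mathbb D_2$ be the part of $\mathbb D$ inside $C_2$, and let $\rho_2$ be the reflection in $C_2$. The set $\mathbb D_2\cup\widetilde C_2$ embeds in $\mathcal Q$, and $\rho_2$ induces the map $\rho:\mathbb D_2\cup\widetilde C_2\to\mathcal Q$, $\rho(z)=[\rho_2(z)]$. Put $\mathcal Q_1=\Pi/\langle\omega\rangle\subset\mathcal Q$. For $A,B\subset\widehat{\mathbb C}$ and $A',B'\subset\mathcal Q$, maps $g:A\to B$ and $h:A'\to B'$ are called conformally conjugate if there is a homeomorphism $\psi:A\cup B\to A'\cup B'$, conformal on the interior of $A\cup B$, with $\psi(A)=A'$, $\psi(B)=B'$ and $\psi\circ g=h\circ\psi$ on $A$. **Proposition.**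 1. For every $a\in\mathcal C(\mathcal S)$, the map $\sigma_a:T_a^\infty\setminus\operatorname{int}T_a^0\to T_a^\infty$ is conformally conjugate to $\rho:\mathbb D_2\cup\widetilde C_2\to\mathcal Q$. 2. For every $a\in S\setminus\mathcal C(\mathcal S)$, the map $$\sigma_a:\bigcup_{n=1}^{n(a)}\sigma_a^{-n}(T_a^0)\to\bigcup_{n=0}^{n(a)-1}\sigma_a^{-n}(T_a^0)$$ is conformally conjugate to $$\rho:\bigcup_{n=1}^{n(a)}\rho^{-n}(\mathcal Q_1)\to\bigcup_{n=0}^{n(a)-1}\rho^{-n}(\mathcal Q_1).$$ -/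

import Mathlib

open scoped Complex.UnitDisc

noncomputable section

namespace SchwarzCubic

/-! ### The Riemann sphere -/

/-- The Riemann sphere, as a topological space. -/
abbrev Sphere : Type := OnePoint ℂ

/-- The coordinate `w ↦ 1 / w` around the point at infinity (`0 ↦ ∞`). -/
def invCoord (w : ℂ) : Sphere := if w = 0 then OnePoint.infty else ((w⁻¹ : ℂ) : Sphere)

/-- Reflection in the circle with centre `c` and radius `r > 0`, exchanging `c` and `∞`. -/
def circleReflection (c : ℂ) (r : ℝ) : Sphere → Sphere
  | OnePoint.infty => (c : Sphere)
  | OnePoint.some u =>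
      if u = c then OnePoint.infty else ((EuclideanGeometry.inversion c r u : ℂ) : Sphere)

/-! ### The Schwarz reflection maps -/

/-- The cubic Chebyshev polynomial. -/
def cheb (u : ℂ) : ℂ := u ^ 3 - 3 * u

/-- The cubic Chebyshev polynomial as a self-map of the sphere, fixing `∞`. -/
def chebSphere : Sphere → Sphere := OnePoint.map cheb

/-- The open disk `Δ_a` centred at `a` whose boundary circle passes through `1`. -/
def disk (a : ℂ) : Set ℂ := Metric.ball a ‖a - 1‖

/-- The parameters with `0 < Re a`, `a ≠ 1`, for which the image under the Chebyshev polynomial of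
the circle `∂Δ_a` is a (simple closed) Jordan curve. -/
def univalentParams : Set ℂ :=
  {a | 0 < a.re ∧ a ≠ 1 ∧ Set.InjOn cheb (Metric.sphere a ‖a - 1‖)}

/-- The parameter space `S`. -/
def parameterSpace : Set ℂ := {a ∈ univalentParams | 3 / 2 < a.re ∧ a.re < 4}

/-- The quadrature domain `Ω_a`, image of `Δ_a`. -/
def Omega (a : ℂ) : Set Sphere := (fun u : ℂ => ((cheb u : ℂ) : Sphere)) '' disk a

/-- The Schwarz reflection map `σ_a = f ∘ ι_a ∘ (f|closure Δ_a)⁻¹`. It is meant on `closure (Ω_a)`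
only; its values elsewhere are irrelevant and never used. -/
def sigma (a : ℂ) (w : Sphere) : Sphere :=
  chebSphere (circleReflection a ‖a - 1‖
    (Function.invFunOn chebSphere
      ((fun u : ℂ => (u : Sphere)) '' Metric.closedBall a ‖a - 1‖) w))

/-- The fundamental tile `T_a^0`: the complement of `Ω_a` with the cusp `-2` removed. -/
def fundamentalTile (a : ℂ) : Set Sphere := (Omega a)ᶜ \ {((-2 : ℂ) : Sphere)}

/-- The set `σ_a^{-n}(T_a^0)`, for the map `σ_a` with domain `closure (Ω_a)`. -/
def sigmaPreimage (a : ℂ) : ℕ → Set Sphere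
  | 0 => fundamentalTile a
  | n + 1 => {w ∈ closure (Omega a) | sigma a w ∈ sigmaPreimage a n}

/-- The tiling set `T_a^∞`. -/
def tilingSet (a : ℂ) : Set Sphere := ⋃ n : ℕ, sigmaPreimage a n

/-- The connectedness locus: the parameters in `S` whose free critical value `2` does not lie in
the tiling set. -/
def connectednessLocus : Set ℂ := {a ∈ parameterSpace | ((2 : ℂ) : Sphere) ∉ tilingSet a}

/-- The depth `n(a)` of a parameter in the escape locus: the smallest `n ≥ 1` with
`σ_a^{∘ n}(2) ∈ T_a^0`. -/
def depth (a : ℂ) : ℕ := sInf {n : ℕ | 1 ≤ n ∧ ((2 : ℂ) : Sphere) ∈ sigmaPreimage a n}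

/-! ### The model map -/

/-- The primitive cube root of unity `ω = exp (2πi/3)`. -/
def omega : Circle := Circle.exp (2 * Real.pi / 3)

theorem omega_pow_three : omega ^ 3 = 1 := by
  rw [omega, ← Circle.exp_nsmul]
  have h : (3 : ℕ) • (2 * Real.pi / 3) = 2 * Real.pi := by simp; ring
  rw [h, Circle.exp_two_pi]

/-- The quotient `𝒬 = 𝔻 / ⟨ω⟩` of the unit disc by the rotations of order three, with the quotient
topology. -/
abbrev Q : Type := MulAction.orbitRel.Quotient (Subgroup.zpowers omega) 𝔻

/-- The projection `𝔻 → 𝒬`. -/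
def toQ (z : 𝔻) : Q := Quotient.mk (MulAction.orbitRel (Subgroup.zpowers omega) 𝔻) z

/-- The global holomorphic coordinate `[z] ↦ z³` of the Riemann surface `𝒬`. It is injective, and
its composition with `𝔻 → 𝒬` is holomorphic, branched exactly at `0` with local degree three, so it
defines the quotient complex structure. -/
def coordQ : Q → ℂ :=
  Quotient.lift (fun z : 𝔻 => (z : ℂ) ^ 3) (by
    rintro _ w ⟨⟨g, k, rfl⟩, rfl⟩
    have h : ((omega ^ k : Circle) : ℂ) ^ 3 = 1 := by
      rw [← Circle.coe_pow, ← zpow_natCast, zpow_comm]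
      simp [omega_pow_three]
    change (((omega ^ k : Circle) : ℂ) * (w : ℂ)) ^ 3 = (w : ℂ) ^ 3
    rw [mul_pow, h, one_mul])

/-- The centres `2e^{iπ/3}`, `-2`, `2e^{-iπ/3}` of the three circles `C_1`, `C_2`, `C_3`, all of
radius `√3`, which bound the ideal triangle. -/
def centre : Fin 3 → ℂ := ![⟨1, √3⟩, -2, ⟨1, -√3⟩]

/-- The closed (in `𝔻`) ideal triangle `Π`, bounded by the geodesics `𝔻 ∩ C_i`. -/
def idealTriangle : Set 𝔻 := {z | ∀ i, √3 ≤ dist (z : ℂ) (centre i)}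

/-- The component `𝔻_2` of `𝔻 \ Π`, cut off by the geodesic `𝔻 ∩ C_2`. -/
def disc2 : Set 𝔻 := {z | dist (z : ℂ) (centre 1) < √3}

/-- The geodesic `𝔻 ∩ C_2`. -/
def geodesic2 : Set 𝔻 := {z | dist (z : ℂ) (centre 1) = √3}

theorem norm_inversion_lt_one (z : 𝔻) :
    ‖EuclideanGeometry.inversion (centre 1) (√3) (z : ℂ)‖ < 1 := by
  have hz := z.normSq_lt_one
  rw [Complex.normSq_apply] at hz
  have h3 : (√3) ^ 2 = 3 := Real.sq_sqrt (by norm_num)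
  set x := (z : ℂ).re
  set y := (z : ℂ).im
  have hd : dist (z : ℂ) (centre 1) ^ 2 = (x + 2) ^ 2 + y ^ 2 := by
    rw [Complex.dist_eq, Complex.sq_norm, Complex.normSq_apply]
    simp [centre, x, y]
    ring
  have hpos : 0 < (x + 2) ^ 2 + y ^ 2 := by nlinarith [sq_nonneg (x + 1), sq_nonneg y]
  have hsq : ‖EuclideanGeometry.inversion (centre 1) (√3) (z : ℂ)‖ ^ 2 < 1 := by
    rw [Complex.sq_norm, EuclideanGeometry.inversion, div_pow, h3, hd, Complex.normSq_apply]
    set t := 3 / ((x + 2) ^ 2 + y ^ 2) with ht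
    have e : t * ((x + 2) ^ 2 + y ^ 2) = 3 := by rw [ht]; field_simp
    have htp : 0 < t := by positivity
    have h1 : (t • ((z : ℂ) -ᵥ centre 1) +ᵥ centre 1).re = t * (x + 2) - 2 := by
      simp [centre, x]; ring
    have h2 : (t • ((z : ℂ) -ᵥ centre 1) +ᵥ centre 1).im = t * y := by
      simp [centre, y]
    rw [h1, h2]
    nlinarith [mul_pos htp (sub_pos.2 hz)]
  nlinarith [norm_nonneg (EuclideanGeometry.inversion (centre 1) (√3) (z : ℂ))]

/-- The anti-Möbius reflection `ρ_2` of `𝔻` in the circle `C_2`. -/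
def rho2 (z : 𝔻) : 𝔻 :=
  Complex.UnitDisc.mk (EuclideanGeometry.inversion (centre 1) (√3) (z : ℂ))
    (norm_inversion_lt_one z)

/-- The image of `𝔻_2 ∪ (𝔻 ∩ C_2)` in `𝒬`, into which that set embeds; the domain of `ρ`. -/
def rhoDomain : Set Q := toQ '' (disc2 ∪ geodesic2)

/-- The model map `ρ` induced by `ρ_2`: `ρ [z] = [ρ_2 z]` for the unique representative `z` of the
class in `𝔻_2 ∪ (𝔻 ∩ C_2)`. It is meant on `rhoDomain` only; its values elsewhere are irrelevant
and never used. -/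
def rho (q : Q) : Q := toQ (rho2 (Function.invFunOn toQ (disc2 ∪ geodesic2) q))

/-- The set `ρ^{-n}(𝒬_1)`, where `𝒬_1 = Π / ⟨ω⟩`, for the map `ρ` with domain `rhoDomain`. -/
def rhoPreimage : ℕ → Set Q
  | 0 => toQ '' idealTriangle
  | n + 1 => {q ∈ rhoDomain | rho q ∈ rhoPreimage n}

/-! ### Conformal conjugacy -/

/-- A map from the sphere to `𝒬` is holomorphic at a point, expressed in the coordinate `u` or
`1 / u` of the sphere and the coordinate `[z] ↦ z³` of `𝒬`. -/
def HolomorphicAt (ψ : Sphere → Q) : Sphere → Prop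
  | OnePoint.infty => DifferentiableAt ℂ (fun w : ℂ => coordQ (ψ (invCoord w))) 0
  | OnePoint.some u => DifferentiableAt ℂ (fun w : ℂ => coordQ (ψ (w : Sphere))) u

/-- The map `g : A → B` between subsets of the sphere is conformally conjugate to the map
`h : A' → B'` between subsets of `𝒬`: there is a homeomorphism `ψ : A ∪ B → A' ∪ B'`, conformal on
the interior of `A ∪ B`, which carries `A` onto `A'`, `B` onto `B'`, and satisfies `ψ ∘ g = h ∘ ψ`
on `A`. (A holomorphic homeomorphism is biholomorphic.) -/
def ConformallyConjugate (g : Sphere → Sphere) (A B : Set Sphere)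
    (h : Q → Q) (A' B' : Set Q) : Prop :=
  Set.MapsTo g A B ∧ Set.MapsTo h A' B' ∧
  ∃ ψ : PartialEquiv Sphere Q,
    ψ.source = A ∪ B ∧ ψ.target = A' ∪ B' ∧ ψ '' A = A' ∧ ψ '' B = B' ∧
    ContinuousOn ψ ψ.source ∧ ContinuousOn ψ.symm ψ.target ∧
    (∀ x ∈ interior ψ.source, HolomorphicAt ψ x) ∧
    ∀ x ∈ A, ψ (g x) = h (ψ x)

end SchwarzCubic

end

/-!
The coordinates `Z = 1 / (u - 1)` at the source and `X = 1 / (w + 2)` at the target of `f` send the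
boundary point `1` of `Δ_a` and the cusp `-2` of `Ω_a` to infinity. With `b = a - 1`, the disc `Δ_a`
becomes the half plane `Re (b Z) > 1 / 2`, `f` becomes the map `cubic Z = Z³ / (1 + 3 Z)`, the
critical value `2` becomes `1 / 4`, and the Schwarz reflection becomes
`cubic Z ↦ cubic (mirror b Z)`, with `mirror b` the reflection in the boundary line. The quotient
`𝒬` has the global coordinate `ξ = z³`. In these coordinates a conjugacy is a map of planar sets.

Injectivity of `cubic` on the line propagates to the closed half plane (`Admissible.injOn_closed`):
the real parts `Re (b W)` of the other two solutions of `cubic W = cubic Z` cannot cross `1 / 2`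
while `Z` moves along the line, and are below `1 / 2` far out on it because `Re b < 3`; it follows
that they do not reach `1 / 2` inside the half plane either.

*The fundamental tile.* The interior `cap b (1 / 2)` of the fundamental tile is the kernel of the
decreasing regions `cap b c`, `c > 1 / 2`. Each of these is a retract of the plane, hence has
continuous logarithms and a Riemann map (`exists_riemann_map`), and a normal family argument gives a
Riemann map of the tile itself (`exists_isRiemannPair_of_kernel`). After a Möbius map the tile is
bounded, and its boundary consists of analytic arcs and the cusp; Schwarz reflection extends the
Riemann map to the closed tile without the cusp (`IsRiemannPair.exists_extension`). The quotient of
the ideal triangle by rotations is uniformized in the same way, with its ideal vertex in place of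
the cusp. Comparing the two uniformizations, with `0` sent to `0`, gives a conformal isomorphism of
the fundamental tiles (`Admissible.exists_stage_zero`). Both maps to be conjugated are the identity
on the boundary, so this is the conjugacy of generation zero.

*The induction step.* Let `χ` be a conjugacy on the points `quot n` that reach the fundamental tile
in at most `n` steps. The covering `z ↦ z³` is branched over `0` only, whereas `cubic` is branched
over `0`, over the cusp and over `1 / 4`. If `1 / 4` has not been reached, `χ` therefore lifts to a
bijection `Y` with `cubic (Y z) = χ (z³)`. Explicitly (`exists_cube_root_koebe`): a function that
omits `1 / 4` is `s / (1 + s)²` with `s` single-valued, the function `s` has a cube root `t` in the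
variable `z`, and `cubic (t / (1 - t + t²)) = t³ / (1 + t³)²`. The three rotations of `z`
correspond to the three preimages under `cubic`, and one chooses the lift that maps the edge of the
triangle to the line `Re (b Z) = 1 / 2` (`Stage.exists_isLift`). Then
`z ↦ mirror b (Y (ρ₂ z))`, followed by `cubic`, extends `χ` to the tiles of the next generation
(`Stage.exists_next`). The two definitions agree on the edge, and the extension is holomorphic
across it because circles are removable for continuous functions (`differentiableOn_of_off_circle`).

*Conclusion.* If `2` escapes at depth `N`, then `1 / 4` is not reached in `N - 1` steps, and the
conjugacy of generation `N` is the one of the second part (`Admissible.exists_isConjugacy`). If `2`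
never escapes, conjugacies of all generations exist. Since they agree with each other by the identity
theorem (`eqOn_quot`), and since the reflected triangles fill the disc (`exists_mem_model`), their
union is a conjugacy on all of `𝒬` (`Admissible.exists_isConjugacy_iUnion`).
-/


open Complex Metric Set Filter Topology
open scoped ComplexConjugate Interval

namespace SchwarzCubic

/-! ### Continuous logarithms, normal families and injective holomorphic maps -/

/-- Every nowhere vanishing continuous function on `A` has a continuous logarithm. -/
def HasContLog (A : Set ℂ) : Prop :=
  ∀ g : ℂ → ℂ, ContinuousOn g A → (∀ z ∈ A, g z ≠ 0) →
    ∃ L : ℂ → ℂ, ContinuousOn L A ∧ ∀ z ∈ A, exp (L z) = g z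

/-- On a star-shaped set the logarithm is obtained by lifting the radial homotopy of `g` to a constant
through the covering map `exp`. -/
theorem hasContLog_of_star {A : Set ℂ} (h0 : (0 : ℂ) ∈ A)
    (hA : ∀ z ∈ A, ∀ s : ℝ, 0 ≤ s → s ≤ 1 → (s : ℂ) * z ∈ A) : HasContLog A := by
  intro g hg hne
  let H : C(unitInterval × A, {z : ℂ // z ≠ 0}) :=
    ⟨fun p => ⟨g ((p.1 : ℝ) * p.2.1), hne _ (hA _ p.2.2 _ p.1.2.1 p.1.2.2)⟩, by
      refine Continuous.subtype_mk ?_ _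
      refine hg.comp_continuous (by fun_prop) fun p => hA _ p.2.2 _ p.1.2.1 p.1.2.2⟩
  let f : C(A, ℂ) := ContinuousMap.const A (log (g 0))
  have H0 : ∀ a, H (0, a) = (fun z : ℂ ↦ (⟨_, z.exp_ne_zero⟩ : {z : ℂ // z ≠ 0})) (f a) := by
    intro a
    apply Subtype.ext
    simp [H, f, exp_log (hne 0 h0)]
  have hl := isCoveringMap_exp.liftHomotopy_lifts H f H0
  set Φ := isCoveringMap_exp.liftHomotopy H f H0 with hΦ
  classical
  refine ⟨fun z => if hz : z ∈ A then Φ (1, ⟨z, hz⟩) else 0, ?_, ?_⟩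
  · rw [continuousOn_iff_continuous_domRestrict]
    have : A.domRestrict (fun z => if hz : z ∈ A then Φ (1, ⟨z, hz⟩) else 0)
        = fun a => Φ (1, a) := by
      ext a
      simp
    rw [this]
    fun_prop
  · intro z hz
    have := congrArg Subtype.val (congrFun hl (1, ⟨z, hz⟩))
    simpa [H, hz] using this

/-- If the identity of `A` factors continuously through `ℂ`, then `A` inherits the logarithms
of `ℂ`. -/
theorem hasContLog_of_retract {A : Set ℂ} {i r : ℂ → ℂ} (hi : ContinuousOn i A)
    (hr : Continuous r) (hrA : ∀ z, r z ∈ A) (hri : ∀ z ∈ A, r (i z) = z) : HasContLog A := by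
  intro g hg hne
  obtain ⟨L, hL, hLe⟩ := hasContLog_of_star (A := univ) trivial (fun _ _ _ _ _ => trivial)
    (g ∘ r) (hg.comp_continuous hr hrA).continuousOn (fun z _ => hne _ (hrA z))
  refine ⟨L ∘ i, hL.comp hi (fun _ _ => trivial), fun z hz => ?_⟩
  simpa [hri z hz] using hLe (i z) trivial

/-- **Montel's theorem** in ultrafilter form: a uniformly bounded family of holomorphic functions
converges locally uniformly along every ultrafilter. -/
theorem exists_tendstoLocallyUniformlyOn_of_bounded {ι : Type*} (p : Ultrafilter ι)
    {F : ι → ℂ → ℂ} {U : Set ℂ} (hU : IsOpen U) (hF : ∀ i, DifferentiableOn ℂ (F i) U)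
    {M : ℝ} (hM : ∀ i, ∀ z ∈ U, ‖F i z‖ ≤ M) :
    ∃ f : ℂ → ℂ, TendstoLocallyUniformlyOn F f p U := by
  have key : ∀ z, ∃ x, z ∈ U → Tendsto (fun i => F i z) p (𝓝 x) := by
    intro z
    by_cases hz : z ∈ U
    · obtain ⟨x, -, hx⟩ := (isCompact_closedBall (0 : ℂ) M).ultrafilter_le_nhds
        (p.map fun i => F i z) (by
          rw [le_principal_iff, Ultrafilter.coe_map, Filter.mem_map]
          exact Filter.Eventually.of_forall fun i => by simpa using hM i z hz)
      exact ⟨x, fun _ => hx⟩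
    · exact ⟨0, fun h => (hz h).elim⟩
  choose f hf using key
  refine ⟨f, Metric.tendstoLocallyUniformlyOn_iff.2 fun ε hε z₀ hz₀ => ?_⟩
  obtain ⟨r, hr, hrU⟩ : ∃ r > 0, ball z₀ (2 * r) ⊆ U := by
    obtain ⟨r, hr, h⟩ := Metric.isOpen_iff.1 hU z₀ hz₀
    exact ⟨r / 2, by positivity, by convert h using 2; ring⟩
  have hlip : ∀ i, ∀ z ∈ ball z₀ r, dist (F i z) (F i z₀) ≤ M / (r / 2) * dist z z₀ := by
    intro i z hz
    rw [dist_eq_norm, dist_eq_norm]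
    refine (convex_ball z₀ r).norm_image_sub_le_of_norm_deriv_le (𝕜 := ℂ) (fun w hw => ?_)
      (fun w hw => ?_) (mem_ball_self hr) hz
    · exact (hF i).differentiableAt (hU.mem_nhds (hrU (ball_subset_ball (by linarith) hw)))
    · have hsub : closedBall w (r / 2) ⊆ U := by
        refine Subset.trans ?_ hrU
        intro x hx
        simp only [mem_ball, mem_closedBall] at *
        linarith [dist_triangle x w z₀]
      refine norm_deriv_le_of_forall_mem_sphere_norm_le (by positivity) ?_ ?_
      · exact ((hF i).mono hsub).diffContOnCl_ball (U := closedBall w (r/2)) Subset.rfl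
      · exact fun x hx => hM i x (hsub (sphere_subset_closedBall hx))
  have hM0 : 0 ≤ M / (r / 2) := by
    have : 0 ≤ M := by
      obtain ⟨i⟩ : Nonempty ι := by
        by_contra h
        rw [not_nonempty_iff] at h
        exact p.neBot.ne (Filter.filter_eq_bot_of_isEmpty _)
      exact (norm_nonneg _).trans (hM i z₀ hz₀)
    positivity
  have hlipf : ∀ z ∈ ball z₀ r, dist (f z) (f z₀) ≤ M / (r / 2) * dist z z₀ := by
    intro z hz
    have hzU : z ∈ U := hrU (ball_subset_ball (by linarith) hz)
    exact le_of_tendsto' ((hf z hzU).dist (hf z₀ hz₀)) fun i => hlip i z hz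
  set C := M / (r / 2)
  refine ⟨ball z₀ (min r (ε / (3 * (C + 1)))), mem_nhdsWithin_of_mem_nhds
    (ball_mem_nhds _ (by positivity)), ?_⟩
  filter_upwards [Metric.tendsto_nhds.1 (hf z₀ hz₀) (ε / 3) (by positivity)] with i hi z hz
  have h1 : dist z z₀ < r := (mem_ball.1 hz).trans_le (min_le_left _ _)
  have h2 : dist z z₀ < ε / (3 * (C + 1)) := (mem_ball.1 hz).trans_le (min_le_right _ _)
  have h3 : C * dist z z₀ ≤ ε / 3 := by
    rw [lt_div_iff₀ (by positivity)] at h2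
    nlinarith [dist_nonneg (x := z) (y := z₀)]
  have := hlip i z h1
  have := hlipf z h1
  have t1 := dist_triangle (f z) (f z₀) (F i z)
  have t2 := dist_triangle (f z₀) (F i z₀) (F i z)
  rw [dist_comm (f z₀) (F i z₀), dist_comm (F i z₀) (F i z)] at t2
  linarith

/-- **Hurwitz's theorem** for zeros. -/
theorem eqOn_zero_or_ne_zero_of_tendsto {ι : Type*} {p : Filter ι} [p.NeBot] {F : ι → ℂ → ℂ}
    {f : ℂ → ℂ} {U : Set ℂ} (hU : IsOpen U) (hc : IsPreconnected U)
    (hF : ∀ i, DifferentiableOn ℂ (F i) U) (hlim : TendstoLocallyUniformlyOn F f p U)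
    (hne : ∀ i, ∀ z ∈ U, F i z ≠ 0) : EqOn f 0 U ∨ ∀ z ∈ U, f z ≠ 0 := by
  by_contra! hcon
  obtain ⟨hnz, z₀, hz₀, hfz⟩ := hcon
  have hfd : DifferentiableOn ℂ f U := hlim.differentiableOn (.of_forall hF) hU
  have hfa : AnalyticOnNhd ℂ f U := hfd.analyticOnNhd hU
  rcases (hfa z₀ hz₀).eventually_eq_zero_or_eventually_ne_zero with h | h
  · exact hnz (hfa.eqOn_zero_of_preconnected_of_eventuallyEq_zero hc hz₀ h)
  rw [eventually_nhdsWithin_iff] at h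
  obtain ⟨r, hr, hball⟩ := Metric.eventually_nhds_iff_ball.1 (h.and (hU.mem_nhds hz₀))
  have hsub : closedBall z₀ (r / 2) ⊆ ball z₀ r := closedBall_subset_ball (by linarith)
  have hsubU : closedBall z₀ (r / 2) ⊆ U := fun z hz => (hball z (hsub hz)).2
  have hsne : (sphere z₀ (r / 2)).Nonempty := NormedSpace.sphere_nonempty.2 (by positivity)
  obtain ⟨x, hx, hmin⟩ := (isCompact_sphere z₀ (r / 2)).exists_isMinOn hsne
    (hfd.continuousOn.norm.mono (sphere_subset_closedBall.trans hsubU))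
  have hxne : f x ≠ 0 := by
    refine (hball x (hsub (sphere_subset_closedBall hx))).1 ?_
    rintro rfl
    have := mem_sphere.1 hx
    simp at this
    linarith
  set m := ‖f x‖
  have hm : 0 < m := norm_pos_iff.2 hxne
  have hunif := (tendstoLocallyUniformlyOn_iff_forall_isCompact hU).1 hlim _ hsubU
    (isCompact_closedBall z₀ (r / 2))
  obtain ⟨i, hi⟩ := (Metric.tendstoUniformlyOn_iff.1 hunif (m / 2) (by positivity)).exists
  have hd : DiffContOnCl ℂ (fun z => (F i z)⁻¹) (ball z₀ (r / 2)) := by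
    refine DifferentiableOn.diffContOnCl_ball (U := closedBall z₀ (r / 2)) ?_ Subset.rfl
    exact ((hF i).mono hsubU).fun_inv fun z hz => hne i z (hsubU hz)
  have hb := norm_le_of_forall_mem_frontier_norm_le (isBounded_ball) hd (C := 2 / m) (z := z₀) (by
    intro z hz
    rw [frontier_ball _ (by positivity)] at hz
    have h1 := hi z (sphere_subset_closedBall hz)
    have h2 : m ≤ ‖f z‖ := hmin hz
    rw [dist_eq_norm] at h1
    have h3 : m / 2 ≤ ‖F i z‖ := by
      have := norm_sub_norm_le (f z) (F i z)
      linarith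
    rw [norm_inv]
    rw [inv_le_comm₀ (by linarith) (by positivity), inv_div]
    exact h3) (subset_closure (mem_ball_self (by positivity)))
  have h1 := hi z₀ (mem_closedBall_self (by positivity))
  rw [hfz, dist_zero_left] at h1
  rw [norm_inv, inv_le_comm₀ (norm_pos_iff.2 (hne i z₀ hz₀)) (by positivity), inv_div] at hb
  linarith

/-- **Hurwitz's theorem** for injective functions. -/
theorem injOn_or_const_of_tendsto {ι : Type*} {p : Filter ι} [p.NeBot] {F : ι → ℂ → ℂ}
    {f : ℂ → ℂ} {U : Set ℂ} (hU : IsOpen U) (hc : IsPreconnected U)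
    (hF : ∀ i, DifferentiableOn ℂ (F i) U) (hlim : TendstoLocallyUniformlyOn F f p U)
    (hinj : ∀ i, InjOn (F i) U) : InjOn f U ∨ ∃ c, ∀ z ∈ U, f z = c := by
  by_contra! hcon
  obtain ⟨hni, hnc⟩ := hcon
  simp only [InjOn, not_forall] at hni
  obtain ⟨z₁, h₁, z₂, h₂, heq, hne⟩ := hni
  obtain ⟨r, hr, hrU⟩ := Metric.isOpen_iff.1 (hU.sdiff isClosed_singleton) z₂
    (show z₂ ∈ U \ {z₁} from ⟨h₂, Ne.symm hne⟩)
  have hsub : ball z₂ r ⊆ U := fun z hz => (hrU hz).1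
  have hlim' : TendstoLocallyUniformlyOn (fun i z => F i z - F i z₁) (fun z => f z - f z₁) p
      (ball z₂ r) := by
    refine (hlim.mono hsub).sub ?_
    have := (hlim.tendsto_at h₁)
    rw [Metric.tendstoLocallyUniformlyOn_iff]
    intro ε hε x _
    refine ⟨univ, univ_mem, ?_⟩
    filter_upwards [Metric.tendsto_nhds.1 this ε hε] with i hi y _
    rwa [dist_comm]
  rcases eqOn_zero_or_ne_zero_of_tendsto isOpen_ball (convex_ball z₂ r).isPreconnected
    (fun i => ((hF i).mono hsub).sub_const _) hlim' (fun i z hz h => (hrU hz).2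
      (hinj i (hsub hz) h₁ (sub_eq_zero.1 h))) with h | h
  · obtain ⟨w, hw, hwne⟩ := hnc (f z₁)
    have hfa : AnalyticOnNhd ℂ f U :=
      (hlim.differentiableOn (.of_forall hF) hU).analyticOnNhd hU
    refine hwne (hfa.eqOn_of_preconnected_of_eventuallyEq analyticOnNhd_const hc h₂ ?_ hw)
    filter_upwards [ball_mem_nhds z₂ hr] with z hz
    exact sub_eq_zero.1 (h hz)
  · exact h z₂ (mem_ball_self hr) (sub_eq_zero.2 heq.symm)

theorem nhds_le_map_of_injOn {f : ℂ → ℂ} {U : Set ℂ} (hU : IsOpen U)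
    (hf : DifferentiableOn ℂ f U) (hinj : InjOn f U) {z : ℂ} (hz : z ∈ U) :
    𝓝 (f z) ≤ map f (𝓝 z) := by
  rcases (hf.analyticAt (hU.mem_nhds hz)).eventually_constant_or_nhds_le_map_nhds with h | h
  · exfalso
    have h' : ∀ᶠ w in 𝓝[≠] z, w ∈ U ∧ f w = f z :=
      (nhdsWithin_le_nhds ((hU.eventually_mem hz).and h))
    obtain ⟨w, ⟨hwU, hw⟩, hne⟩ := (h'.and self_mem_nhdsWithin).exists
    exact hne (hinj hwU hz hw)
  · exact h

theorem isOpen_image_of_injOn {f : ℂ → ℂ} {U : Set ℂ} (hU : IsOpen U)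
    (hf : DifferentiableOn ℂ f U) (hinj : InjOn f U) : IsOpen (f '' U) := by
  rw [isOpen_iff_mem_nhds]
  rintro _ ⟨z, hz, rfl⟩
  exact nhds_le_map_of_injOn hU hf hinj hz (image_mem_map (hU.mem_nhds hz))

theorem continuousAt_of_leftInvOn {f g : ℂ → ℂ} {U : Set ℂ} (hU : IsOpen U)
    (hf : DifferentiableOn ℂ f U) (hinj : InjOn f U) (hg : LeftInvOn g f U) {z : ℂ} (hz : z ∈ U) :
    ContinuousAt g (f z) := by
  intro V hV
  rw [hg hz] at hV
  have := nhds_le_map_of_injOn hU hf hinj hz (image_mem_map (inter_mem hV (hU.mem_nhds hz)))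
  rw [Filter.mem_map]
  filter_upwards [this]
  rintro _ ⟨w, ⟨hwV, hwU⟩, rfl⟩
  rw [mem_preimage, hg hwU]
  exact hwV

theorem differentiableAt_of_leftInvOn {f g : ℂ → ℂ} {U : Set ℂ} (hU : IsOpen U)
    (hf : DifferentiableOn ℂ f U) (hinj : InjOn f U) (hg : LeftInvOn g f U) {z : ℂ} (hz : z ∈ U) :
    DifferentiableAt ℂ g (f z) := by
  have hgood : ∀ w ∈ U, deriv f w ≠ 0 → DifferentiableAt ℂ g (f w) := by
    intro w hw hd
    refine (HasStrictDerivAt.of_local_left_inverse (f := f)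
      (continuousAt_of_leftInvOn hU hf hinj hg hw) ?_ hd ?_).hasDerivAt.differentiableAt
    · rw [hg hw]
      exact (hf.analyticAt (hU.mem_nhds hw)).hasStrictDerivAt
    · filter_upwards [(isOpen_image_of_injOn hU hf hinj).mem_nhds (mem_image_of_mem f hw)]
      rintro _ ⟨x, hx, rfl⟩
      rw [hg hx]
  have hfa := hf.analyticAt (hU.mem_nhds hz)
  -- the critical points of `f` are isolated, so their images are removable for `g`
  rcases hfa.deriv.eventually_eq_zero_or_eventually_ne_zero with h | h
  · exfalso
    obtain ⟨r, hr, hball⟩ := Metric.eventually_nhds_iff_ball.1 (h.and (hU.eventually_mem hz))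
    have hz' : z + (r / 2 : ℝ) ∈ ball z r := by
      simp [abs_of_pos hr]; linarith
    have := (convex_ball z r).is_const_of_fderivWithin_eq_zero (𝕜 := ℂ) (f := f)
      (hf.mono fun w hw => (hball w hw).2) (fun w hw => by
        rw [fderivWithin_of_isOpen isOpen_ball hw]
        ext
        simpa using (hball w hw).1) (mem_ball_self hr) hz'
    have h2 := hinj hz (hball _ hz').2 this
    simp at h2
    linarith
  · refine (analyticAt_of_differentiable_on_punctured_nhds_of_continuousAt ?_
      (continuousAt_of_leftInvOn hU hf hinj hg hz)).differentiableAt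
    rw [eventually_nhdsWithin_iff] at h ⊢
    have := nhds_le_map_of_injOn hU hf hinj hz (image_mem_map (h.and (hU.eventually_mem hz)))
    filter_upwards [this]
    rintro _ ⟨w, ⟨hw, hwU⟩, rfl⟩ hne
    exact hgood w hwU (hw fun e => hne (by rw [e]; rfl))

theorem deriv_ne_zero_of_injOn {f : ℂ → ℂ} {U : Set ℂ} (hU : IsOpen U)
    (hf : DifferentiableOn ℂ f U) (hinj : InjOn f U) {z : ℂ} (hz : z ∈ U) : deriv f z ≠ 0 := by
  intro h0
  have hg : LeftInvOn (Function.invFunOn f U) f U := hinj.leftInvOn_invFunOn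
  have h1 := differentiableAt_of_leftInvOn hU hf hinj hg hz
  have h2 := h1.hasDerivAt.comp z (hf.differentiableAt (hU.mem_nhds hz)).hasDerivAt
  have h3 : HasDerivAt (Function.invFunOn f U ∘ f) 1 z := by
    refine (hasDerivAt_id z).congr_of_eventuallyEq ?_
    filter_upwards [hU.mem_nhds hz] with w hw
    exact hg hw
  have := h2.unique h3
  simp [h0] at this

/-! ### The Riemann mapping theorem -/

/-- A continuous lift of a holomorphic function through a locally biholomorphic one is
holomorphic. -/
theorem differentiableAt_of_lift {F k h : ℂ → ℂ} {z F' : ℂ} (hF : HasStrictDerivAt F F' (k z))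
    (hF' : F' ≠ 0) (hk : ContinuousAt k z) (hh : DifferentiableAt ℂ h z)
    (heq : ∀ᶠ w in 𝓝 z, F (k w) = h w) : DifferentiableAt ℂ k z := by
  have h1 := hF.to_localInverse hF'
  have h2 : ∀ᶠ y in 𝓝 (k z), hF.localInverse F F' (k z) hF' (F y) = y :=
    (hF.hasStrictFDerivAt_equiv hF').eventually_left_inverse
  have h3 : k =ᶠ[𝓝 z] (hF.localInverse F F' (k z) hF') ∘ h := by
    filter_upwards [hk.eventually h2, heq] with w hw hw'
    rw [Function.comp_apply, ← hw', hw]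
  refine DifferentiableAt.congr_of_eventuallyEq ?_ h3
  refine DifferentiableAt.comp z ?_ hh
  rw [← heq.self_of_nhds]
  exact h1.hasDerivAt.differentiableAt

theorem exists_sqrt {U : Set ℂ} (hU : IsOpen U) (hL : HasContLog U) {h : ℂ → ℂ}
    (hh : DifferentiableOn ℂ h U) (hne : ∀ z ∈ U, h z ≠ 0) :
    ∃ k : ℂ → ℂ, DifferentiableOn ℂ k U ∧ ∀ z ∈ U, k z ^ 2 = h z := by
  obtain ⟨L, hLc, hLe⟩ := hL h hh.continuousOn hne
  have hsq : ∀ z ∈ U, exp (L z / 2) ^ 2 = h z := by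
    intro z hz
    rw [← exp_nat_mul, ← hLe z hz]
    congr 1
    push_cast
    ring
  refine ⟨fun z => exp (L z / 2), fun z hz => DifferentiableAt.differentiableWithinAt ?_, hsq⟩
  refine differentiableAt_of_lift (F := fun y => y ^ 2) (h := h)
    (hasStrictDerivAt_pow 2 _) (by simp) ?_
    (hh.differentiableAt (hU.mem_nhds hz)) ?_
  · have := (hLc.continuousAt (hU.mem_nhds hz))
    fun_prop
  · filter_upwards [hU.mem_nhds hz] with w hw using hsq w hw

/-- The automorphism of the unit disc carrying `c` to `0`. -/
noncomputable def blaschke (c z : ℂ) : ℂ := (z - c) / (1 - conj c * z)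

theorem one_sub_conj_mul_ne_zero {c z : ℂ} (hc : ‖c‖ < 1) (hz : ‖z‖ < 1) :
    1 - conj c * z ≠ 0 := by
  intro h
  have : ‖conj c * z‖ = 1 := by rw [← sub_eq_zero.1 h]; simp
  rw [norm_mul, RCLike.norm_conj] at this
  nlinarith [norm_nonneg c, norm_nonneg z]

theorem norm_blaschke_lt_one {c z : ℂ} (hc : ‖c‖ < 1) (hz : ‖z‖ < 1) : ‖blaschke c z‖ < 1 := by
  rw [blaschke, norm_div, div_lt_one (norm_pos_iff.2 (one_sub_conj_mul_ne_zero hc hz))]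
  have hc2 : normSq c < 1 := by
    rw [normSq_eq_norm_sq]; nlinarith [norm_nonneg c]
  have hz2 : normSq z < 1 := by
    rw [normSq_eq_norm_sq]; nlinarith [norm_nonneg z]
  rw [← abs_norm, ← abs_norm (1 - conj c * z), ← sq_lt_sq, ← normSq_eq_norm_sq,
    ← normSq_eq_norm_sq]
  simp only [normSq_apply, sub_re, sub_im, mul_re, mul_im, conj_re, conj_im, one_re, one_im]
    at hc2 hz2 ⊢
  nlinarith [mul_pos (sub_pos.2 hc2) (sub_pos.2 hz2)]

theorem injOn_blaschke {c : ℂ} (hc : ‖c‖ < 1) : InjOn (blaschke c) (ball 0 1) := by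
  intro z hz w hw h
  rw [mem_ball_zero_iff] at hz hw
  have h1 := one_sub_conj_mul_ne_zero hc hz
  have h2 := one_sub_conj_mul_ne_zero hc hw
  rw [blaschke, blaschke, div_eq_div_iff h1 h2] at h
  have h3 : (z - w) * (1 - conj c * c) = 0 := by linear_combination h
  rcases mul_eq_zero.1 h3 with h | h
  · exact sub_eq_zero.1 h
  · exact (one_sub_conj_mul_ne_zero hc hc h).elim

theorem hasDerivAt_blaschke {c z : ℂ} (hc : ‖c‖ < 1) (hz : ‖z‖ < 1) :
    HasDerivAt (blaschke c) ((1 - conj c * c) / (1 - conj c * z) ^ 2) z := by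
  have h1 := one_sub_conj_mul_ne_zero hc hz
  have := ((hasDerivAt_id z).sub_const c).div
    ((hasDerivAt_const z (1 : ℂ)).sub ((hasDerivAt_id z).const_mul (conj c))) h1
  refine this.congr_deriv ?_
  simp
  ring

/-- Injective holomorphic maps of `U` into the unit disc, fixing `0`. -/
def schlichtMaps (U : Set ℂ) : Set (ℂ → ℂ) :=
  {φ | DifferentiableOn ℂ φ U ∧ InjOn φ U ∧ MapsTo φ U (ball 0 1) ∧ φ 0 = 0}

/-- Koebe's square root trick: an injective map of `U` into the disc which omits a value is not
extremal. -/
theorem exists_larger_deriv {U : Set ℂ} (hU : IsOpen U) (h0 : (0 : ℂ) ∈ U) (hL : HasContLog U)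
    {φ : ℂ → ℂ} (hφ : φ ∈ schlichtMaps U) {c : ℂ} (hc : ‖c‖ < 1) (hcφ : ∀ z ∈ U, φ z ≠ c) :
    ∃ φ₂ ∈ schlichtMaps U, ‖deriv φ 0‖ < ‖deriv φ₂ 0‖ := by
  obtain ⟨hd, hinj, hmaps, hφ0⟩ := hφ
  have hc0 : c ≠ 0 := fun h => hcφ 0 h0 (by rw [hφ0, h])
  have hmaps' : ∀ z ∈ U, ‖φ z‖ < 1 := fun z hz => by simpa using hmaps hz
  have hhd : DifferentiableOn ℂ (fun z => blaschke c (φ z)) U := fun z hz =>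
    ((hasDerivAt_blaschke hc (hmaps' z hz)).differentiableAt.comp z
      (hd.differentiableAt (hU.mem_nhds hz))).differentiableWithinAt
  obtain ⟨k, hkd, hk⟩ := exists_sqrt hU hL hhd (by
    intro z hz h
    rw [blaschke, div_eq_zero_iff] at h
    rcases h with h | h
    · exact hcφ z hz (sub_eq_zero.1 h)
    · exact one_sub_conj_mul_ne_zero hc (hmaps' z hz) h)
  have hk1 : ∀ z ∈ U, ‖k z‖ < 1 := by
    intro z hz
    have := norm_blaschke_lt_one hc (hmaps' z hz)
    rw [← hk z hz, norm_pow] at this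
    exact lt_of_pow_lt_pow_left₀ 2 zero_le_one (by simpa using this)
  have hkinj : InjOn k U := by
    intro z hz w hw h
    have h2 : blaschke c (φ z) = blaschke c (φ w) := by rw [← hk z hz, ← hk w hw, h]
    exact hinj hz hw (injOn_blaschke hc (hmaps hz) (hmaps hw) h2)
  set k₀ := k 0
  have hk0 : ‖k₀‖ < 1 := hk1 0 h0
  have hk0sq : k₀ ^ 2 = -c := by
    rw [hk 0 h0, hφ0]; simp [blaschke]
  have hk0n : ‖k₀‖ ^ 2 = ‖c‖ := by rw [← norm_pow, hk0sq, norm_neg]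
  have hcpos : 0 < ‖c‖ := norm_pos_iff.2 hc0
  have hk0pos : 0 < ‖k₀‖ := by
    rw [norm_pos_iff]; intro h; rw [h] at hk0n; simp at hk0n; exact hcpos.ne hk0n
  refine ⟨fun z => blaschke k₀ (k z), ⟨fun z hz => ((hasDerivAt_blaschke hk0
      (hk1 z hz)).differentiableAt.comp z
      (hkd.differentiableAt (hU.mem_nhds hz))).differentiableWithinAt, ?_, ?_, ?_⟩, ?_⟩
  · exact fun z hz w hw h => hkinj hz hw (injOn_blaschke hk0 (by simpa using hk1 z hz)
      (by simpa using hk1 w hw) h)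
  · exact fun z hz => by simpa using norm_blaschke_lt_one hk0 (hk1 z hz)
  · simp [blaschke, k₀]
  have hφd := (hd.differentiableAt (hU.mem_nhds h0)).hasDerivAt
  have hkd0 := (hkd.differentiableAt (hU.mem_nhds h0)).hasDerivAt
  have e1 : 2 * k₀ * deriv k 0 = (1 - conj c * c) * deriv φ 0 := by
    have a1 := hkd0.pow 2
    have a2 := (hasDerivAt_blaschke hc (hmaps' 0 h0)).comp (0 : ℂ) hφd
    have a3 := a1.unique (a2.congr_of_eventuallyEq (by
      filter_upwards [hU.mem_nhds h0] with w hw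
      simpa using hk w hw))
    simp [hφ0] at a3
    simpa [k₀] using a3
  have e2 : deriv (fun z => blaschke k₀ (k z)) 0
      = (1 - conj k₀ * k₀) / (1 - conj k₀ * k₀) ^ 2 * deriv k 0 :=
    ((hasDerivAt_blaschke hk0 (hk1 0 h0)).comp (0 : ℂ) hkd0).deriv
  have n1 : ∀ x : ℂ, 1 - conj x * x = ((1 - ‖x‖ ^ 2 : ℝ) : ℂ) := by
    intro x
    rw [mul_comm, mul_conj, normSq_eq_norm_sq]; push_cast; ring
  have e1n : 2 * ‖k₀‖ * ‖deriv k 0‖ = (1 - ‖c‖ ^ 2) * ‖deriv φ 0‖ := by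
    have := congrArg norm e1
    rw [n1 c] at this
    simp only [norm_mul, norm_real, Real.norm_eq_abs] at this
    rw [abs_of_pos (by nlinarith)] at this
    simpa using this
  have e2n : ‖deriv (fun z => blaschke k₀ (k z)) 0‖ * (1 - ‖c‖) = ‖deriv k 0‖ := by
    have hpos : 0 < 1 - ‖c‖ := by linarith
    rw [e2, n1 k₀, norm_mul, norm_div, norm_pow, norm_real, Real.norm_eq_abs, hk0n,
      abs_of_pos hpos]
    field_simp
  have hφpos : 0 < ‖deriv φ 0‖ := norm_pos_iff.2 (deriv_ne_zero_of_injOn hU hd hinj h0)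
  set A := ‖deriv (fun z => blaschke k₀ (k z)) 0‖
  have e3 : 2 * ‖k₀‖ * A = (1 + ‖c‖) * ‖deriv φ 0‖ := by
    have hpos : (1 - ‖c‖) ≠ 0 := by linarith
    apply mul_left_cancel₀ hpos
    rw [← e2n] at e1n
    linear_combination e1n
  -- `1 + |c| > 2 √|c|`
  have e4 : 2 * ‖k₀‖ < 1 + ‖c‖ := by rw [← hk0n]; nlinarith [sq_pos_of_pos (sub_pos.2 hk0)]
  nlinarith [norm_nonneg (deriv (fun z => blaschke k₀ (k z)) 0)]

theorem norm_lt_one_of_norm_le_one {U : Set ℂ} (hU : IsOpen U) (hc : IsPreconnected U)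
    (h0 : (0 : ℂ) ∈ U) {φ : ℂ → ℂ} (hd : DifferentiableOn ℂ φ U) (hφ0 : φ 0 = 0)
    (hle : ∀ z ∈ U, ‖φ z‖ ≤ 1) {z : ℂ} (hz : z ∈ U) : ‖φ z‖ < 1 := by
  refine lt_of_le_of_ne (hle z hz) fun h => ?_
  have := eqOn_of_isPreconnected_of_isMaxOn_norm hc hU hd hz (fun w hw => by
    rw [mem_ofPred_eq, Function.comp_apply, Function.comp_apply, h]; exact hle w hw) h0
  simp [hφ0] at this
  rw [← this] at h
  simp at h

/-- The **Riemann mapping theorem**, for connected open sets with continuous logarithms whose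
complement has interior: among the injective maps into the disc fixing `0`, one with the largest
derivative at `0` is onto. -/
theorem exists_riemann_map {U : Set ℂ} (hU : IsOpen U) (hc : IsPreconnected U)
    (h0 : (0 : ℂ) ∈ U) (hL : HasContLog U) {x₀ : ℂ} {η : ℝ} (hη : 0 < η)
    (hx : ∀ z ∈ U, η ≤ ‖z - x₀‖) :
    ∃ φ g : ℂ → ℂ, DifferentiableOn ℂ φ U ∧ DifferentiableOn ℂ g (ball 0 1) ∧
      MapsTo φ U (ball 0 1) ∧ MapsTo g (ball 0 1) U ∧ LeftInvOn g φ U ∧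
      LeftInvOn φ g (ball 0 1) ∧ φ 0 = 0 := by
  have hx' : ∀ z ∈ U, z - x₀ ≠ 0 := fun z hz h => by
    have := hx z hz; rw [h, norm_zero] at this; linarith
  -- the family of competitors is nonempty: `1 / (z - x₀)` is bounded by `1 / η`, and the factor
  -- `η / 3` makes differences of two values smaller than `1`
  have hne : (schlichtMaps U).Nonempty := by
    have hb : ∀ z ∈ U, ‖((z - x₀)⁻¹ : ℂ)‖ ≤ η⁻¹ := fun z hz => by
      rw [norm_inv]; exact inv_anti₀ hη (hx z hz)
    have hη3 : ((η / 3 : ℝ) : ℂ) ≠ 0 := by exact_mod_cast (by positivity : η / 3 ≠ 0)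
    refine ⟨fun z => ((η / 3 : ℝ) : ℂ) * ((z - x₀)⁻¹ - (0 - x₀)⁻¹), ?_, ?_, ?_, by simp⟩
    · intro z hz
      have := hx' z hz
      exact ((((differentiableAt_id.sub_const x₀).fun_inv this).sub_const _).const_mul
        _).differentiableWithinAt
    · intro z hz w hw h
      have h := mul_left_cancel₀ hη3 h
      exact sub_left_injective (inv_injective (sub_left_injective h))
    · intro z hz
      rw [mem_ball_zero_iff, norm_mul, norm_real, Real.norm_eq_abs, abs_of_pos (by positivity)]
      have h1 := norm_sub_le ((z - x₀)⁻¹ : ℂ) (0 - x₀)⁻¹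
      have h2 := hb z hz
      have h3 := hb 0 h0
      calc η / 3 * _ ≤ η / 3 * (η⁻¹ + η⁻¹) := by gcongr; linarith
        _ < 1 := by field_simp; norm_num
  obtain ⟨r, hr, hrU⟩ := Metric.isOpen_iff.1 hU 0 h0
  set D : Set ℝ := (fun φ : ℂ → ℂ => ‖deriv φ 0‖) '' schlichtMaps U
  have hbdd : BddAbove D := by
    refine ⟨1 / r, ?_⟩
    rintro _ ⟨φ, ⟨hd, -, hm, hφ0⟩, rfl⟩
    refine norm_deriv_le_div_of_mapsTo_ball (hd.mono hrU) (fun z hz => ?_) hr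
    rw [hφ0]
    exact ball_subset_closedBall (hm (hrU hz))
  obtain ⟨u, -, hu, huD⟩ := exists_seq_tendsto_sSup (hne.image _) hbdd
  choose φs hφs hφu using huD
  let p : Ultrafilter ℕ := Ultrafilter.of atTop
  have hp : (p : Filter ℕ) ≤ atTop := Ultrafilter.of_le _
  obtain ⟨φ, hφ⟩ := exists_tendstoLocallyUniformlyOn_of_bounded p hU (fun i => (hφs i).1) (M := 1)
    (fun i z hz => (mem_ball_zero_iff.1 ((hφs i).2.2.1 hz)).le)
  have hd : DifferentiableOn ℂ φ U := hφ.differentiableOn (.of_forall fun i => (hφs i).1) hU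
  have hφ0 : φ 0 = 0 := tendsto_nhds_unique (hφ.tendsto_at h0)
    (by simp [(hφs _).2.2.2])
  have hder : ‖deriv φ 0‖ = sSup D := by
    have h1 := ((hφ.deriv (.of_forall fun i => (hφs i).1) hU).tendsto_at h0).norm
    refine tendsto_nhds_unique h1 ((hu.mono_left hp).congr fun n => (hφu n).symm)
  have hpos : 0 < ‖deriv φ 0‖ := by
    obtain ⟨φ₁, h₁⟩ := hne
    rw [hder]
    exact (norm_pos_iff.2 (deriv_ne_zero_of_injOn hU h₁.1 h₁.2.1 h0)).trans_le
      (le_csSup hbdd (mem_image_of_mem _ h₁))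
  have hinj : InjOn φ U := by
    rcases injOn_or_const_of_tendsto hU hc (fun i => (hφs i).1) hφ (fun i => (hφs i).2.1) with h | h
    · exact h
    · obtain ⟨c, hcst⟩ := h
      have : deriv φ 0 = 0 := by
        have : φ =ᶠ[𝓝 0] fun _ => c := by
          filter_upwards [hU.mem_nhds h0] with z hz using hcst z hz
        rw [this.deriv_eq, deriv_const]
      simp [this] at hpos
  have hle : ∀ z ∈ U, ‖φ z‖ ≤ 1 := fun z hz =>
    le_of_tendsto' (hφ.tendsto_at hz).norm fun i => (mem_ball_zero_iff.1 ((hφs i).2.2.1 hz)).le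
  have hmaps : MapsTo φ U (ball 0 1) := fun z hz => by
    simpa using norm_lt_one_of_norm_le_one hU hc h0 hd hφ0 hle hz
  have hmem : φ ∈ schlichtMaps U := ⟨hd, hinj, hmaps, hφ0⟩
  have hsurj : SurjOn φ U (ball 0 1) := by
    intro c hcb
    by_contra hcon
    obtain ⟨φ₂, h₂, hlt⟩ := exists_larger_deriv hU h0 hL hmem (c := c) (by simpa using hcb)
      (fun z hz h => hcon ⟨z, hz, h⟩)
    have := le_csSup hbdd (mem_image_of_mem _ h₂)
    simp only [← hder] at this
    linarith
  have hg : LeftInvOn (Function.invFunOn φ U) φ U := hinj.leftInvOn_invFunOn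
  refine ⟨φ, Function.invFunOn φ U, hd, ?_, hmaps, hsurj.mapsTo_invFunOn, hg,
    hsurj.rightInvOn_invFunOn, hφ0⟩
  intro y hy
  obtain ⟨z, hz, rfl⟩ := hsurj hy
  exact (differentiableAt_of_leftInvOn hU hd hinj hg hz).differentiableWithinAt

/-! ### Removability of lines and circles, and Schwarz reflection -/

/-- Removability of the real line for continuous functions, by Morera's theorem: a
rectangle crossing the line is cut along it. -/
theorem differentiableOn_of_off_real {f : ℂ → ℂ} {U : Set ℂ} (hU : IsOpen U)
    (hc : ContinuousOn f U) (hd : ∀ z ∈ U, z.im ≠ 0 → DifferentiableAt ℂ f z) :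
    DifferentiableOn ℂ f U := by
  refine (isConservativeOn_and_continuousOn_iff_isDifferentiableOn hU).1 ⟨?_, hc⟩
  intro z w hzw
  rw [← add_eq_zero_iff_eq_neg, wedgeIntegral_add_wedgeIntegral_eq]
  have hzw' : [[z.re, w.re]] ×ℂ [[z.im, w.im]] ⊆ U := hzw
  have hrect : ∀ y₀ y₁ : ℝ, [[y₀, y₁]] ⊆ [[z.im, w.im]] → (0 : ℝ) ∉ Ioo (min y₀ y₁) (max y₀ y₁) →
      (∫ x : ℝ in z.re..w.re, f (x + y₀ * I)) - (∫ x : ℝ in z.re..w.re, f (x + y₁ * I)) +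
      I • (∫ y : ℝ in y₀..y₁, f (w.re + y * I)) - I • (∫ y : ℝ in y₀..y₁, f (z.re + y * I)) = 0 := by
    intro y₀ y₁ hsub h0
    have hsub' : [[z.re, w.re]] ×ℂ [[y₀, y₁]] ⊆ U :=
      (inter_subset_inter Subset.rfl (preimage_mono hsub)).trans hzw'
    have := integral_boundary_rect_eq_zero_of_continuousOn_of_differentiableOn f ⟨z.re, y₀⟩
      ⟨w.re, y₁⟩ (hc.mono hsub') (fun x hx => (hd x (hsub' ?_) ?_).differentiableWithinAt)
    · simpa using this
    · exact ⟨Ioo_subset_Icc_self hx.1, Ioo_subset_Icc_self hx.2⟩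
    · intro h
      exact h0 (h ▸ hx.2)
  by_cases h0 : (0 : ℝ) ∈ [[z.im, w.im]]
  · have h1 := hrect z.im 0 (uIcc_subset_uIcc left_mem_uIcc h0) (by
      rintro ⟨ha, hb⟩
      rcases le_total z.im 0 with h | h <;> simp [h] at ha hb)
    have h2 := hrect 0 w.im (uIcc_subset_uIcc h0 right_mem_uIcc) (by
      rintro ⟨ha, hb⟩
      rcases le_total w.im 0 with h | h <;> simp [h] at ha hb)
    have hint : ∀ x ∈ [[z.re, w.re]], ∀ y₀ ∈ [[z.im, w.im]], ∀ y₁ ∈ [[z.im, w.im]],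
        IntervalIntegrable (fun y : ℝ => f (x + y * I)) MeasureTheory.volume y₀ y₁ := by
      intro x hx y₀ h₀ y₁ h₁
      refine ContinuousOn.intervalIntegrable (hc.comp (by fun_prop) fun y hy => hzw' ?_)
      refine ⟨by simpa using hx, ?_⟩
      simpa using uIcc_subset_uIcc h₀ h₁ hy
    have e1 := intervalIntegral.integral_add_adjacent_intervals
      (hint w.re right_mem_uIcc _ left_mem_uIcc _ h0) (hint w.re right_mem_uIcc _ h0 _ right_mem_uIcc)
    have e2 := intervalIntegral.integral_add_adjacent_intervals
      (hint z.re left_mem_uIcc _ left_mem_uIcc _ h0) (hint z.re left_mem_uIcc _ h0 _ right_mem_uIcc)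
    rw [← e1, ← e2, smul_add, smul_add]
    linear_combination h1 + h2
  · refine hrect z.im w.im Subset.rfl fun h => h0 ?_
    exact Ioo_subset_Icc_self h

/-- Removability of a circle for continuous functions. -/
theorem differentiableOn_of_off_circle {f : ℂ → ℂ} {U : Set ℂ} (hU : IsOpen U) {c : ℂ} {r : ℝ}
    (hr : 0 < r) (hc : ContinuousOn f U)
    (hd : ∀ z ∈ U, ‖z - c‖ ≠ r → DifferentiableAt ℂ f z) : DifferentiableOn ℂ f U := by
  intro z₀ hz₀
  by_cases hzr : ‖z₀ - c‖ = r
  swap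
  · exact (hd z₀ hz₀ hzr).differentiableWithinAt
  -- `ζ ↦ c + (z₀ - c) exp (-iζ)` carries the real line to the circle
  set e : ℂ → ℂ := fun ζ => c + (z₀ - c) * exp (-I * ζ) with he
  have hz0c : z₀ - c ≠ 0 := by rw [← norm_pos_iff, hzr]; exact hr
  have hed : ∀ ζ, HasStrictDerivAt e ((z₀ - c) * (exp (-I * ζ) * -I)) ζ := by
    intro ζ
    have h1 : HasStrictDerivAt (fun ζ : ℂ => -I * ζ) (-I) ζ := by
      simpa using (hasStrictDerivAt_id ζ).const_mul (-I)
    exact ((h1.cexp).const_mul (z₀ - c)).const_add c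
  have hecont : Continuous e := by fun_prop
  have he0 : e 0 = z₀ := by simp [he]
  have hD : DifferentiableOn ℂ (f ∘ e) (e ⁻¹' U) := by
    refine differentiableOn_of_off_real (hU.preimage hecont)
      (hc.comp hecont.continuousOn fun _ h => h) fun ζ hζ him => ?_
    refine (hd _ hζ ?_).comp ζ (hed ζ).hasDerivAt.differentiableAt
    simp only [he, add_sub_cancel_left, norm_mul, hzr, norm_exp]
    intro h
    have : Real.exp ((-I * ζ).re) = 1 := by
      apply mul_left_cancel₀ hr.ne'
      rw [h, mul_one]
    rw [Real.exp_eq_one_iff] at this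
    simp at this
    exact him this
  have hD0 : DifferentiableAt ℂ (f ∘ e) 0 :=
    hD.differentiableAt ((hU.preimage hecont).mem_nhds (by rwa [mem_preimage, he0]))
  have hs := hed 0
  have hne : (z₀ - c) * (exp (-I * 0) * -I) ≠ 0 := by simp [hz0c]
  have hl := (hs.to_localInverse hne).hasDerivAt
  rw [he0] at hl
  have hri : ∀ᶠ y in 𝓝 z₀, e (hs.localInverse e _ 0 hne y) = y := by
    have := (hs.hasStrictFDerivAt_equiv hne).eventually_right_inverse
    rwa [he0] at this
  have hl0 : hs.localInverse e _ 0 hne z₀ = 0 := by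
    have := (hs.hasStrictFDerivAt_equiv hne).localInverse_apply_image
    rwa [he0] at this
  refine DifferentiableAt.differentiableWithinAt ?_
  have : f =ᶠ[𝓝 z₀] (f ∘ e) ∘ hs.localInverse e _ 0 hne := by
    filter_upwards [hri] with y hy
    rw [Function.comp_apply, Function.comp_apply, hy]
  refine DifferentiableAt.congr_of_eventuallyEq ?_ this
  refine DifferentiableAt.comp z₀ ?_ hl.differentiableAt
  rwa [hl0]

/-- The open upper half of the disc of radius `δ`. -/
def upperHalfBall (δ : ℝ) : Set ℂ := {ζ | ‖ζ‖ < δ ∧ 0 < ζ.im}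

theorem isOpen_upperHalfBall (δ : ℝ) : IsOpen (upperHalfBall δ) :=
  (isOpen_lt continuous_norm continuous_const).inter (isOpen_lt continuous_const continuous_im)

theorem convex_upperHalfBall (δ : ℝ) : Convex ℝ (upperHalfBall δ) := by
  have : upperHalfBall δ = ball 0 δ ∩ {ζ | 0 < ζ.im} := by ext; simp [upperHalfBall]
  rw [this]
  exact (convex_ball _ _).inter (convex_halfSpace_im_gt 0)

theorem tendsto_add_mul_I (x : ℝ) {δ : ℝ} (hx : |x| < δ) :
    Tendsto (fun y : ℝ => (x : ℂ) + y * I) (𝓝[>] 0) (𝓝[upperHalfBall δ] (x : ℂ)) := by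
  have hcont : Continuous fun y : ℝ => (x : ℂ) + y * I := by fun_prop
  have h1 : Tendsto (fun y : ℝ => (x : ℂ) + y * I) (𝓝[>] 0) (𝓝 (x : ℂ)) := by
    simpa using (hcont.tendsto 0).mono_left nhdsWithin_le_nhds
  refine tendsto_nhdsWithin_iff.2 ⟨h1, ?_⟩
  have h2 : ∀ᶠ y : ℝ in 𝓝[>] 0, ‖(x : ℂ) + y * I‖ < δ := by
    refine h1.norm.eventually_lt_const ?_
    rwa [norm_real]
  filter_upwards [h2, self_mem_nhdsWithin] with y h2 hy
  exact ⟨h2, by simpa using hy⟩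

/-- If `P' = h` and `Q' = 1 / h` on an upper half disc, where `|h| → 1` at the real axis, then the
boundary values of `P - conj Q` are constant. -/
theorem boundary_const {h P Q P' Q' : ℂ → ℂ} {δ : ℝ} (hδ : 0 < δ)
    (hge : ∀ ζ ∈ upperHalfBall δ, 1 / 2 ≤ ‖h ζ‖) (hlt : ∀ ζ ∈ upperHalfBall δ, ‖h ζ‖ < 1)
    (hlim : ∀ x : ℝ, |x| < δ → Tendsto (fun ζ => ‖h ζ‖) (𝓝[upperHalfBall δ] (x : ℂ)) (𝓝 1))
    (hP : ∀ ζ ∈ upperHalfBall δ, HasDerivAt P' (h ζ) ζ)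
    (hQ : ∀ ζ ∈ upperHalfBall δ, HasDerivAt Q' (h ζ)⁻¹ ζ)
    (hPc : Continuous P) (hQc : Continuous Q) (hPe : EqOn P' P (upperHalfBall δ))
    (hQe : EqOn Q' Q (upperHalfBall δ)) (x : ℝ) (hx : |x| < δ) :
    P x - conj (Q x) = P 0 - conj (Q 0) := by
  set D : ℂ → ℂ := fun ζ => P ζ - conj (Q ζ) with hD
  have hDc : Continuous D := by fun_prop
  have hderiv : ∀ x : ℝ, |x| < δ → HasDerivAt (fun t : ℝ => D t) 0 x := by
    intro x hx
    rw [hasDerivAt_iff_isLittleO, Asymptotics.isLittleO_iff]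
    intro ε hε
    -- near `x` the `x`-derivative of `D` is at most `ε`
    have hev : ∀ᶠ ζ in 𝓝[upperHalfBall δ] (x : ℂ), 2 * (1 - ‖h ζ‖ ^ 2) < ε := by
      have : Tendsto (fun ζ => 2 * (1 - ‖h ζ‖ ^ 2)) (𝓝[upperHalfBall δ] (x : ℂ)) (𝓝 0) := by
        have := (((hlim x hx).pow 2).const_sub 1).const_mul 2
        simpa using this
      exact this.eventually_lt_const hε
    obtain ⟨ρ, hρ, hρs⟩ := Metric.mem_nhdsWithin_iff.1 hev
    have hmin : 0 < min (ρ / 2) ((δ - |x|) / 2) := lt_min (by linarith) (by linarith)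
    filter_upwards [Metric.ball_mem_nhds x hmin] with x₁ hx₁
    have hb1 : |x₁ - x| < ρ / 2 := (mem_ball.1 hx₁).trans_le (min_le_left _ _)
    have hb2 : |x₁ - x| < (δ - |x|) / 2 := (mem_ball.1 hx₁).trans_le (min_le_right _ _)
    have hy : ∀ᶠ y : ℝ in 𝓝[>] 0, ‖D (x₁ + y * I) - D (x + y * I)‖ ≤ ε * |x₁ - x| := by
      filter_upwards [Ioo_mem_nhdsGT hmin] with y hy
      have hy1 : y < ρ / 2 := hy.2.trans_le (min_le_left _ _)
      have hy2 : y < (δ - |x|) / 2 := hy.2.trans_le (min_le_right _ _)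
      have hnear : ∀ t ∈ [[x, x₁]], |t - x| ≤ |x₁ - x| := fun t ht => abs_sub_left_of_mem_uIcc ht
      have hmemC : ∀ t ∈ [[x, x₁]], (t : ℂ) + y * I ∈ upperHalfBall δ := by
        intro t ht
        refine ⟨?_, by simpa using hy.1⟩
        calc ‖(t : ℂ) + y * I‖ ≤ |t| + y := by
              refine (norm_add_le _ _).trans ?_
              simp [abs_of_pos hy.1]
          _ < δ := by
              have := abs_sub_abs_le_abs_sub t x
              linarith [hnear t ht]
      have hsmall : ∀ t ∈ [[x, x₁]], ‖h (t + y * I) - conj (h (t + y * I))⁻¹‖ ≤ ε := by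
        intro t ht
        have hm := hmemC t ht
        have hρm : (t : ℂ) + y * I ∈ ball (x : ℂ) ρ := by
          rw [mem_ball, dist_eq_norm]
          have : (t : ℂ) + y * I - x = ((t - x : ℝ) : ℂ) + y * I := by push_cast; ring
          rw [this]
          calc _ ≤ |t - x| + y := by
                refine (norm_add_le _ _).trans ?_
                rw [norm_real]
                simp [abs_of_pos hy.1]
            _ < ρ := by linarith [hnear t ht]
        have h1 : 2 * (1 - ‖h (t + y * I)‖ ^ 2) < ε := hρs ⟨hρm, hm⟩
        have h2 := hge _ hm
        have h3 := hlt _ hm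
        set w := h (t + y * I)
        have hw : w ≠ 0 := by rw [← norm_pos_iff]; linarith
        have hcw : conj w ≠ 0 := by simpa using hw
        have e : w - conj w⁻¹ = ((‖w‖ ^ 2 - 1 : ℝ) : ℂ) / conj w := by
          rw [eq_div_iff hcw, sub_mul, mul_conj, normSq_eq_norm_sq, map_inv₀, inv_mul_cancel₀ hcw]
          push_cast; ring
        rw [e, norm_div, RCLike.norm_conj, norm_real, Real.norm_eq_abs,
          abs_of_nonpos (by nlinarith), div_le_iff₀ (by linarith)]
        nlinarith
      have hder : ∀ t ∈ [[x, x₁]], HasDerivWithinAt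
          (fun t : ℝ => P' (t + y * I) - conj (Q' (t + y * I)))
          (h (t + y * I) - conj (h (t + y * I))⁻¹) [[x, x₁]] t := by
        intro t ht
        have hm := hmemC t ht
        have hl : HasDerivAt (fun t : ℝ => (t : ℂ) + y * I) 1 t :=
          (hasDerivAt_id t).ofReal_comp.add_const _
        have a1 : HasDerivAt (fun t : ℝ => P' (t + y * I)) (h (t + y * I)) t := by
          have := (hP _ hm).comp_of_eq t hl rfl
          rw [mul_one] at this
          exact this
        have a2 : HasDerivAt (fun t : ℝ => Q' (t + y * I)) (h (t + y * I))⁻¹ t := by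
          have := (hQ _ hm).comp_of_eq t hl rfl
          rw [mul_one] at this
          exact this
        exact (a1.sub a2.star).hasDerivWithinAt
      have := (convex_uIcc x x₁).norm_image_sub_le_of_norm_hasDerivWithin_le hder hsmall
        left_mem_uIcc right_mem_uIcc
      simp only [hPe (hmemC _ left_mem_uIcc), hPe (hmemC _ right_mem_uIcc),
        hQe (hmemC _ left_mem_uIcc), hQe (hmemC _ right_mem_uIcc)] at this
      exact this
    have hl : Tendsto (fun y : ℝ => ‖D (x₁ + y * I) - D (x + y * I)‖) (𝓝[>] 0)
        (𝓝 ‖D x₁ - D x‖) := by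
      have : Continuous fun y : ℝ => ‖D (x₁ + y * I) - D (x + y * I)‖ := by fun_prop
      simpa using (this.tendsto 0).mono_left nhdsWithin_le_nhds
    simpa using le_of_tendsto hl hy
  have := (convex_Ioo (-δ) δ).norm_image_sub_le_of_norm_hasDerivWithin_le (f := fun t : ℝ => D t)
    (f' := fun _ => 0) (C := 0) (x := 0) (y := x)
    (fun t ht => (hderiv t (abs_lt.2 ht)).hasDerivWithinAt) (by simp) (mem_Ioo.2 ⟨by linarith, hδ⟩)
    (abs_lt.1 hx)
  simpa [sub_eq_zero] using this

/-- **Schwarz reflection principle** for the unit circle: a holomorphic map of a half disc into the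
unit disc whose modulus tends to `1` at the diameter extends across the diameter. The extension is
the derivative of the primitive obtained by gluing `∫ h` and the reflection of `∫ 1 / h`, which is
continuous without any assumption on the boundary behaviour of `arg h`. -/
theorem exists_reflection {h : ℂ → ℂ} {δ : ℝ} (hδ : 0 < δ)
    (hd : DifferentiableOn ℂ h (upperHalfBall δ)) (hlt : ∀ ζ ∈ upperHalfBall δ, ‖h ζ‖ < 1)
    (hlim : ∀ x : ℝ, |x| < δ → Tendsto (fun ζ => ‖h ζ‖) (𝓝[upperHalfBall δ] (x : ℂ)) (𝓝 1)) :
    ∃ δ' > 0, δ' ≤ δ ∧ ∃ H : ℂ → ℂ, DifferentiableOn ℂ H (ball 0 δ') ∧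
      (∀ ζ ∈ ball (0 : ℂ) δ', 0 < ζ.im → H ζ = h ζ) ∧
      (∀ ζ ∈ ball (0 : ℂ) δ', ζ.im = 0 → ‖H ζ‖ = 1) ∧
      (∀ ζ ∈ ball (0 : ℂ) δ', ζ.im < 0 → 1 < ‖H ζ‖) := by
  obtain ⟨δ', hδ', hδδ', hge⟩ : ∃ δ' > 0, δ' ≤ δ ∧ ∀ ζ ∈ upperHalfBall δ', 1 / 2 ≤ ‖h ζ‖ := by
    have h0 := (hlim 0 (by simpa using hδ)).eventually_const_lt (show (1 / 2 : ℝ) < 1 by norm_num)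
    obtain ⟨ρ, hρ, hρs⟩ := Metric.mem_nhdsWithin_iff.1 h0
    refine ⟨min ρ δ, lt_min hρ hδ, min_le_right _ _, fun ζ hζ => le_of_lt (hρs ⟨?_, ?_⟩)⟩
    · simpa using hζ.1.trans_le (min_le_left _ _)
    · exact ⟨hζ.1.trans_le (min_le_right _ _), hζ.2⟩
  have hsub : upperHalfBall δ' ⊆ upperHalfBall δ := fun ζ hζ => ⟨hζ.1.trans_le hδδ', hζ.2⟩
  have hopen := isOpen_upperHalfBall δ'
  have hconv := convex_upperHalfBall δ'
  have hne : ∀ ζ ∈ upperHalfBall δ', h ζ ≠ 0 := fun ζ hζ => by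
    rw [← norm_pos_iff]; linarith [hge ζ hζ]
  have hd' := hd.mono hsub
  obtain ⟨P', hP'⟩ := hconv.exists_forall_hasDerivWithinAt hd'
  obtain ⟨Q', hQ'⟩ := hconv.exists_forall_hasDerivWithinAt (hd'.fun_inv hne)
  have hPl : LipschitzOnWith 2 P' (upperHalfBall δ') :=
    hconv.lipschitzOnWith_of_nnnorm_hasDerivWithin_le hP' fun ζ hζ => by
      rw [← NNReal.coe_le_coe]
      simpa using (hlt ζ (hsub hζ)).le.trans one_le_two
  have hQl : LipschitzOnWith 2 Q' (upperHalfBall δ') :=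
    hconv.lipschitzOnWith_of_nnnorm_hasDerivWithin_le hQ' fun ζ hζ => by
      rw [← NNReal.coe_le_coe]
      have := inv_anti₀ (by norm_num) (hge ζ hζ)
      simpa using this
  obtain ⟨P, hPL, hPe⟩ := hPl.extend_finite_dimension
  obtain ⟨Q, hQL, hQe⟩ := hQl.extend_finite_dimension
  have hPc := hPL.continuous
  have hQc := hQL.continuous
  have hP : ∀ ζ ∈ upperHalfBall δ', HasDerivAt P' (h ζ) ζ := fun ζ hζ =>
    (hP' ζ hζ).hasDerivAt (hopen.mem_nhds hζ)
  have hQ : ∀ ζ ∈ upperHalfBall δ', HasDerivAt Q' (h ζ)⁻¹ ζ := fun ζ hζ =>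
    (hQ' ζ hζ).hasDerivAt (hopen.mem_nhds hζ)
  have hlim' : ∀ x : ℝ, |x| < δ' →
      Tendsto (fun ζ => ‖h ζ‖) (𝓝[upperHalfBall δ'] (x : ℂ)) (𝓝 1) := fun x hx =>
    (hlim x (hx.trans_le hδδ')).mono_left (nhdsWithin_mono _ hsub)
  have hconst := boundary_const hδ' hge (fun ζ hζ => hlt ζ (hsub hζ)) hlim' hP hQ hPc hQc hPe hQe
  set C₀ := P 0 - conj (Q 0)
  set R : ℂ → ℂ := fun z => if 0 ≤ z.im then P z else conj (Q (conj z)) + C₀ with hR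
  have hRc : ContinuousOn R (ball 0 δ') := by
    refine ContinuousOn.if ?_ hPc.continuousOn (by fun_prop)
    rintro z ⟨hz, hzf⟩
    have him : z.im = 0 := by
      have : z ∈ frontier {z : ℂ | 0 ≤ z.im} := hzf
      rw [frontier_setOfPred_le_im] at this
      exact this
    obtain ⟨x, rfl⟩ : ∃ x : ℝ, z = x := ⟨z.re, by apply Complex.ext <;> simp [him]⟩
    have := hconst x (by simpa using hz)
    rw [conj_ofReal, ← this]
    ring
  have hup : ∀ ζ ∈ upperHalfBall δ', HasDerivAt R (h ζ) ζ := by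
    intro ζ hζ
    refine (hP ζ hζ).congr_of_eventuallyEq ?_
    filter_upwards [hopen.mem_nhds hζ] with z hz
    simp only [hR, if_pos hz.2.le, hPe hz]
  have hlow : ∀ ζ, conj ζ ∈ upperHalfBall δ' → HasDerivAt R (conj (h (conj ζ))⁻¹) ζ := by
    intro ζ hζ
    have h1 : HasDerivAt (conj ∘ Q' ∘ conj) (conj (h (conj ζ))⁻¹) ζ := by
      simpa using (hQ _ hζ).conj_conj
    refine (h1.add_const C₀).congr_of_eventuallyEq ?_
    filter_upwards [(hopen.preimage continuous_conj).mem_nhds hζ] with z hz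
    have him : ¬ 0 ≤ z.im := by
      have := hz.2; rw [conj_im] at this; linarith
    simp only [hR, if_neg him, Function.comp_apply, hQe hz]
  have hlowmem : ∀ ζ ∈ ball (0 : ℂ) δ', ζ.im < 0 → conj ζ ∈ upperHalfBall δ' := fun ζ hζ him =>
    ⟨by simpa using hζ, by simpa using him⟩
  have hRd : DifferentiableOn ℂ R (ball 0 δ') := by
    refine differentiableOn_of_off_real isOpen_ball hRc fun z hz him => ?_
    rcases lt_or_gt_of_ne him with h | h
    · exact (hlow z (hlowmem z hz h)).differentiableAt
    · exact (hup z ⟨by simpa using hz, h⟩).differentiableAt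
  have hHd : DifferentiableOn ℂ (deriv R) (ball 0 δ') := hRd.deriv isOpen_ball
  have hH : ∀ ζ ∈ upperHalfBall δ', deriv R ζ = h ζ := fun ζ hζ => (hup ζ hζ).deriv
  refine ⟨δ', hδ', hδδ', deriv R, hHd, fun ζ hζ him => hH ζ ⟨by simpa using hζ, him⟩,
    fun ζ hζ him => ?_, fun ζ hζ him => ?_⟩
  · obtain ⟨x, rfl⟩ : ∃ x : ℝ, ζ = x := ⟨ζ.re, by apply Complex.ext <;> simp [him]⟩
    have hx : |x| < δ' := by simpa using hζ
    have h1 := (hHd.differentiableAt (isOpen_ball.mem_nhds hζ)).continuousAt.norm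
    have h2 := (h1.tendsto.mono_left nhdsWithin_le_nhds).comp (tendsto_add_mul_I x hx)
    have h3 := (hlim' x hx).comp (tendsto_add_mul_I x hx)
    refine tendsto_nhds_unique (h2.congr' ?_) h3
    filter_upwards [(tendsto_nhdsWithin_iff.1 (tendsto_add_mul_I x hx)).2] with y hy
    simp [hH _ hy]
  · have hm := hlowmem ζ hζ him
    rw [(hlow ζ hm).deriv, RCLike.norm_conj, norm_inv]
    exact (one_lt_inv₀ (norm_pos_iff.2 (hne _ hm))).2 (hlt _ (hsub hm))

/-! ### Boundary extension of Riemann maps -/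

/-- `φ : U → 𝔻` and `g : 𝔻 → U` are mutually inverse holomorphic maps. -/
structure IsRiemannPair (U : Set ℂ) (φ g : ℂ → ℂ) : Prop where
  isOpen : IsOpen U
  diff : DifferentiableOn ℂ φ U
  diff_inv : DifferentiableOn ℂ g (ball 0 1)
  maps : MapsTo φ U (ball 0 1)
  maps_inv : MapsTo g (ball 0 1) U
  left_inv : LeftInvOn g φ U
  right_inv : LeftInvOn φ g (ball 0 1)

/-- Near `x` the boundary of `U` is a real-analytic arc with `U` on exactly one side: there is a
biholomorphic chart carrying the upper half disc into `U` and the rest of the disc outside `U`. -/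
def IsAnalyticBoundaryPt (U : Set ℂ) (x : ℂ) : Prop :=
  ∃ (κ : ℂ → ℂ) (δ : ℝ), 0 < δ ∧ DifferentiableOn ℂ κ (ball 0 δ) ∧ InjOn κ (ball 0 δ) ∧
    κ 0 = x ∧ ∀ ζ ∈ ball (0 : ℂ) δ, κ ζ ∈ U ↔ 0 < ζ.im

namespace IsRiemannPair

variable {U : Set ℂ} {φ g : ℂ → ℂ}

theorem tendsto_norm (h : IsRiemannPair U φ g) {x : ℂ} (hx : x ∉ U) :
    Tendsto (fun z => ‖φ z‖) (𝓝[U] x) (𝓝 1) := by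
  refine tendsto_order.2 ⟨fun r hr => ?_, fun r hr => ?_⟩
  · have hsub : closedBall (0 : ℂ) r ⊆ ball 0 1 := closedBall_subset_ball hr
    have hK : IsCompact (g '' closedBall 0 r) :=
      (isCompact_closedBall 0 r).image_of_continuousOn (h.diff_inv.continuousOn.mono hsub)
    have hxK : x ∉ g '' closedBall 0 r := by
      rintro ⟨y, hy, rfl⟩
      exact hx (h.maps_inv (hsub hy))
    filter_upwards [nhdsWithin_le_nhds (hK.isClosed.isOpen_compl.mem_nhds hxK),
      self_mem_nhdsWithin] with z hz hzU
    by_contra! hle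
    exact hz ⟨φ z, by simpa using hle, h.left_inv hzU⟩
  · filter_upwards [self_mem_nhdsWithin] with z hz
    exact (mem_ball_zero_iff.1 (h.maps hz)).trans hr

/-- At an analytic boundary point both maps have a limit, and nearby points of the circle are
boundary values as well. -/
theorem exists_boundary_value (h : IsRiemannPair U φ g) {x : ℂ} (hx : IsAnalyticBoundaryPt U x) :
    ∃ y : ℂ, ‖y‖ = 1 ∧ Tendsto φ (𝓝[U] x) (𝓝 y) ∧ Tendsto g (𝓝[ball 0 1] y) (𝓝 x) ∧
      ∀ V ∈ 𝓝 x, ∀ᶠ y' in 𝓝 y, ‖y'‖ = 1 →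
        ∃ x' ∈ V, x' ∈ closure U \ U ∧ Tendsto φ (𝓝[U] x') (𝓝 y') := by
  obtain ⟨κ, δ, hδ, hκd, hκi, hκ0, hκU⟩ := hx
  have hsubB : upperHalfBall δ ⊆ ball 0 δ := fun ζ hζ => by simpa using hζ.1
  have hmaps : MapsTo κ (upperHalfBall δ) U := fun ζ hζ => (hκU ζ (hsubB hζ)).2 hζ.2
  have hdc : DifferentiableOn ℂ (φ ∘ κ) (upperHalfBall δ) :=
    h.diff.comp (hκd.mono hsubB) hmaps
  have hκat : ∀ ζ ∈ ball (0 : ℂ) δ, ContinuousAt κ ζ := fun ζ hζ =>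
    (hκd.differentiableAt (isOpen_ball.mem_nhds hζ)).continuousAt
  have htd : ∀ s : ℝ, |s| < δ → Tendsto κ (𝓝[upperHalfBall δ] (s : ℂ)) (𝓝[U] (κ s)) := by
    intro s hs
    refine tendsto_nhdsWithin_iff.2 ⟨?_, ?_⟩
    · exact (hκat s (by simpa using hs)).mono_left nhdsWithin_le_nhds
    · filter_upwards [self_mem_nhdsWithin] with ζ hζ using hmaps hζ
  have hnotU : ∀ s : ℝ, |s| < δ → κ s ∉ U := fun s hs hU => by
    have := (hκU s (by simpa using hs)).1 hU
    simp at this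
  obtain ⟨δ', hδ', hδδ', H, hHd, hHup, hHre, hHlow⟩ := exists_reflection hδ hdc
    (fun ζ hζ => mem_ball_zero_iff.1 (h.maps (hmaps hζ)))
    (fun s hs => (h.tendsto_norm (hnotU s hs)).comp (htd s hs))
  have hsub' : ball (0 : ℂ) δ' ⊆ ball 0 δ := ball_subset_ball hδδ'
  have hHopen : ∀ s : ℝ, |s| < δ' → 𝓝 (H s) ≤ map H (𝓝 (s : ℂ)) := by
    intro s hs
    have hsm : (s : ℂ) ∈ ball (0 : ℂ) δ' := by simpa using hs
    rcases (hHd.analyticAt (isOpen_ball.mem_nhds hsm)).eventually_constant_or_nhds_le_map_nhds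
      with hc | hc
    · exfalso
      have h1 := (tendsto_add_mul_I s hs).mono_right nhdsWithin_le_nhds |>.eventually hc
      have h2 := (tendsto_nhdsWithin_iff.1 (tendsto_add_mul_I s hs)).2
      obtain ⟨y, hy, hym⟩ := (h1.and h2).exists
      have hb : (s : ℂ) + y * I ∈ ball (0 : ℂ) δ' := by simpa using hym.1
      have h3 := hHre s hsm (by simp)
      rw [← hy, hHup _ hb hym.2] at h3
      have := mem_ball_zero_iff.1 (h.maps ((hκU _ (hsub' hb)).2 hym.2))
      exact absurd h3 this.ne
    · exact hc
  have key : ∀ s : ℝ, |s| < δ' → Tendsto φ (𝓝[U] (κ s)) (𝓝 (H s)) := by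
    intro s hs
    have hsm : (s : ℂ) ∈ ball (0 : ℂ) δ' := by simpa using hs
    intro W hW
    have hH : ContinuousAt H s := (hHd.differentiableAt (isOpen_ball.mem_nhds hsm)).continuousAt
    have h1 := nhds_le_map_of_injOn isOpen_ball hκd hκi (hsub' hsm)
      (image_mem_map (inter_mem (hH hW) (isOpen_ball.mem_nhds hsm)))
    rw [Filter.mem_map]
    filter_upwards [nhdsWithin_le_nhds h1, self_mem_nhdsWithin]
    rintro _ ⟨ζ, ⟨hζW, hζ⟩, rfl⟩ hU
    have := hHup ζ hζ ((hκU ζ (hsub' hζ)).1 hU)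
    rw [mem_preimage, show φ (κ ζ) = H ζ from this.symm]
    exact hζW
  have h0 : |(0 : ℝ)| < δ' := by simpa using hδ'
  have key0 := key 0 h0
  have hopen0 := hHopen 0 h0
  simp only [ofReal_zero, hκ0] at key0 hopen0
  have hzero : (0 : ℂ) ∈ ball (0 : ℂ) δ' := mem_ball_self hδ'
  have hclass : ∀ ζ ∈ ball (0 : ℂ) δ', ‖H ζ‖ < 1 → 0 < ζ.im := by
    intro ζ hζ hlt
    by_contra! hle
    rcases hle.lt_or_eq with hl | he
    · exact absurd (hHlow ζ hζ hl) hlt.le.not_gt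
    · exact absurd (hHre ζ hζ he) hlt.ne
  have hclass' : ∀ ζ ∈ ball (0 : ℂ) δ', ‖H ζ‖ = 1 → ζ.im = 0 := by
    intro ζ hζ he
    rcases lt_trichotomy ζ.im 0 with hl | h0 | hg
    · exact absurd he (hHlow ζ hζ hl).ne'
    · exact h0
    · have := mem_ball_zero_iff.1 (h.maps ((hκU _ (hsub' hζ)).2 hg))
      rw [hHup ζ hζ hg] at he
      exact absurd he this.ne
  refine ⟨H 0, hHre 0 hzero rfl, key0, ?_, ?_⟩
  · intro V hV
    have hκ0' : κ ⁻¹' V ∈ 𝓝 (0 : ℂ) := hκat 0 (mem_ball_self hδ) (by rwa [hκ0])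
    have h1 := hopen0 (image_mem_map (inter_mem hκ0' (isOpen_ball.mem_nhds hzero)))
    rw [Filter.mem_map]
    filter_upwards [nhdsWithin_le_nhds h1, self_mem_nhdsWithin]
    rintro _ ⟨ζ, ⟨hζV, hζ⟩, rfl⟩ hlt
    have him := hclass ζ hζ (by simpa using hlt)
    have hU := (hκU ζ (hsub' hζ)).2 him
    rw [mem_preimage, hHup ζ hζ him, Function.comp_apply, h.left_inv hU]
    exact hζV
  · intro V hV
    have hκ0' : κ ⁻¹' V ∈ 𝓝 (0 : ℂ) := hκat 0 (mem_ball_self hδ) (by rwa [hκ0])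
    have h1 := hopen0 (image_mem_map (inter_mem hκ0' (isOpen_ball.mem_nhds hzero)))
    filter_upwards [h1]
    rintro _ ⟨ζ, ⟨hζV, hζ⟩, rfl⟩ he
    have him := hclass' ζ hζ he
    obtain ⟨s, rfl⟩ : ∃ s : ℝ, ζ = s := ⟨ζ.re, by apply Complex.ext <;> simp [him]⟩
    have hs : |s| < δ' := by simpa using hζ
    have hs' : |s| < δ := hs.trans_le hδδ'
    refine ⟨κ s, hζV, ⟨?_, hnotU s hs'⟩, key s hs⟩
    rw [mem_closure_iff_nhdsWithin_neBot]
    exact ((htd s hs').comp (tendsto_add_mul_I s hs')).neBot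

end IsRiemannPair

/-- A bounded holomorphic function on the disc which tends to `p` along an open arc of the circle
takes the value `p`. -/
theorem exists_eq_of_tendsto_arc {g : ℂ → ℂ} (hg : DifferentiableOn ℂ g (ball 0 1)) {M : ℝ}
    (hM : ∀ z ∈ ball (0 : ℂ) 1, ‖g z‖ ≤ M) {p : ℂ} {A : Set ℂ} (hA : IsOpen A) {y₀ : ℂ}
    (hy₀ : ‖y₀‖ = 1) (hy₀A : y₀ ∈ A)
    (hlim : ∀ y ∈ A, ‖y‖ = 1 → Tendsto g (𝓝[ball 0 1] y) (𝓝 p)) :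
    ∃ z ∈ ball (0 : ℂ) 1, g z = p := by
  by_contra! hne
  obtain ⟨t, ht⟩ := (isCompact_sphere (0 : ℂ) 1).elim_finite_subcover
    (fun c : sphere (0 : ℂ) 1 => (fun y => (c : ℂ) * y) ⁻¹' A)
    (fun c => hA.preimage (by fun_prop)) (by
      intro y hy
      have hy1 : ‖y‖ = 1 := by simpa using hy
      have hy0 : y ≠ 0 := by rw [← norm_pos_iff, hy1]; exact one_pos
      refine mem_iUnion.2 ⟨⟨y₀ / y, by simp [hy₀, hy1]⟩, ?_⟩
      simpa [hy0] using hy₀A)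
  have hnorm : ∀ c : sphere (0 : ℂ) 1, ‖(c : ℂ)‖ = 1 := fun c => by simp
  have hrot : ∀ (c : sphere (0 : ℂ) 1), MapsTo (fun z => (c : ℂ) * z) (ball 0 1) (ball 0 1) := by
    intro c z hz
    simpa [hnorm c] using hz
  -- the product of rotated copies of `g - p` tends to `0` at every point of the circle
  set P : ℂ → ℂ := fun z => ∏ c ∈ t, (g ((c : ℂ) * z) - p) with hP
  have hPd : DifferentiableOn ℂ P (ball 0 1) := by
    refine DifferentiableOn.fun_finsetProd fun c _ => ?_
    exact (hg.comp (by fun_prop) (hrot c)).sub_const p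
  have hPlim : ∀ y : ℂ, ‖y‖ = 1 → Tendsto P (𝓝[ball 0 1] y) (𝓝 0) := by
    intro y hy
    obtain ⟨c, hc, hcy⟩ := mem_iUnion₂.1 (ht (show y ∈ sphere (0 : ℂ) 1 by simpa using hy))
    have h1 : Tendsto (fun z => g ((c : ℂ) * z) - p) (𝓝[ball 0 1] y) (𝓝 0) := by
      have hl := hlim _ hcy (by simp [hnorm c, hy])
      have hr : Tendsto (fun z => (c : ℂ) * z) (𝓝[ball 0 1] y) (𝓝[ball 0 1] ((c : ℂ) * y)) := by
        refine tendsto_nhdsWithin_iff.2 ⟨?_, ?_⟩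
        · exact ((continuous_const.mul continuous_id).tendsto y).mono_left nhdsWithin_le_nhds
        · filter_upwards [self_mem_nhdsWithin] with z hz using hrot c hz
      simpa using (hl.comp hr).sub_const p
    have h2 : P = fun z => (g ((c : ℂ) * z) - p) * ∏ c ∈ t.erase c, (g ((c : ℂ) * z) - p) := by
      ext z
      exact (Finset.mul_prod_erase t _ hc).symm
    rw [h2]
    refine h1.zero_mul_isBoundedUnder_le ⟨∏ c ∈ t.erase c, (M + ‖p‖), ?_⟩
    rw [eventually_map]
    filter_upwards [self_mem_nhdsWithin] with z hz
    rw [Function.comp_apply, norm_prod]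
    refine Finset.prod_le_prod (fun _ _ => norm_nonneg _) fun c _ => ?_
    exact (norm_sub_le _ _).trans (by gcongr; exact hM _ (hrot c hz))
  classical
  set R : ℂ → ℂ := fun z => if z ∈ ball (0 : ℂ) 1 then P z else 0 with hR
  have hRP : EqOn R P (ball 0 1) := fun z hz => if_pos hz
  have hRd : DiffContOnCl ℂ R (ball 0 1) := by
    refine ⟨hPd.congr hRP, ?_⟩
    rw [closure_ball _ one_ne_zero]
    intro y hy
    by_cases hyb : y ∈ ball (0 : ℂ) 1
    · have : R =ᶠ[𝓝 y] P := by
        filter_upwards [isOpen_ball.mem_nhds hyb] with z hz using hRP hz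
      exact ((hPd.differentiableAt (isOpen_ball.mem_nhds hyb)).continuousAt.congr
        this.symm).continuousWithinAt
    · have hy1 : ‖y‖ = 1 := by
        simp only [mem_closedBall, mem_ball, dist_zero_right, not_lt] at hy hyb
        exact le_antisymm hy hyb
      rw [ContinuousWithinAt, show R y = 0 from if_neg hyb]
      intro W hW
      have h1 := hPlim y hy1 hW
      rw [Filter.mem_map, mem_nhdsWithin_iff_eventually] at h1
      rw [Filter.mem_map]
      filter_upwards [nhdsWithin_le_nhds h1] with z hz
      rw [mem_preimage]
      by_cases hzb : z ∈ ball (0 : ℂ) 1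
      · rw [hRP hzb]; exact hz hzb
      · rw [show R z = 0 from if_neg hzb]; exact mem_of_mem_nhds hW
  have h0 : (0 : ℂ) ∈ ball (0 : ℂ) 1 := mem_ball_self one_pos
  have hzero := norm_le_of_forall_mem_frontier_norm_le isBounded_ball hRd (C := 0) (z := 0) (by
    intro z hz
    rw [frontier_ball _ one_ne_zero] at hz
    have : z ∉ ball (0 : ℂ) 1 := fun h => absurd (mem_ball.1 h) (mem_sphere.1 hz).ge.not_gt
    rw [show R z = 0 from if_neg this]; simp) (subset_closure h0)
  rw [hRP h0, norm_le_zero_iff, hP, Finset.prod_eq_zero_iff] at hzero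
  obtain ⟨c, -, hc⟩ := hzero
  exact hne _ (hrot c h0) (sub_eq_zero.1 hc)

/-- The chord through two points `q ≠ q'` of the unit circle is `{chord q q' = 0}`. -/
noncomputable def chord (q q' z : ℂ) : ℝ := ((z - q) * conj (q' - q)).im

theorem eq_or_eq_of_chord_eq_zero {q q' z : ℂ} (hq : ‖q‖ = 1) (hq' : ‖q'‖ = 1) (hz : ‖z‖ = 1)
    (hne : q ≠ q') (h : chord q q' z = 0) : z = q ∨ z = q' := by
  have hd : q' - q ≠ 0 := sub_ne_zero.2 hne.symm
  -- `z = q + t (q' - q)` with `t` real, and `|z| = 1` forces `t (t - 1) = 0`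
  obtain ⟨t, ht⟩ : ∃ t : ℝ, z = q + t * (q' - q) := by
    refine ⟨((z - q) * conj (q' - q)).re / normSq (q' - q), ?_⟩
    have h1 : (z - q) * conj (q' - q) = (((z - q) * conj (q' - q)).re : ℂ) := by
      apply Complex.ext
      · simp
      · rw [ofReal_im]; exact h
    have h2 : ((normSq (q' - q) : ℝ) : ℂ) ≠ 0 := by
      exact_mod_cast (normSq_pos.2 hd).ne'
    push_cast
    rw [← h1, div_mul_eq_mul_div, mul_assoc, mul_comm (conj _), mul_conj, mul_div_assoc,
      div_self h2]
    ring
  have e : ∀ w : ℂ, ‖w‖ = 1 → w.re * w.re + w.im * w.im = 1 := fun w hw => by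
    rw [← normSq_apply, normSq_eq_norm_sq, hw]; norm_num
  have e1 := e q hq
  have e2 := e q' hq'
  have e3 := e z hz
  have e4 : 0 < (q'.re - q.re) * (q'.re - q.re) + (q'.im - q.im) * (q'.im - q.im) := by
    have := normSq_pos.2 hd
    rwa [normSq_apply, sub_re, sub_im] at this
  rw [ht] at e3
  simp only [add_re, add_im, mul_re, mul_im, ofReal_re, ofReal_im, sub_re, sub_im] at e3
  have e5 : t * (t - 1) * ((q'.re - q.re) * (q'.re - q.re) + (q'.im - q.im) * (q'.im - q.im))
      = 0 := by
    linear_combination e3 - (1 - t) * e1 - t * e2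
  rcases mul_eq_zero.1 e5 with h5 | h5
  · rcases mul_eq_zero.1 h5 with h6 | h6
    · left; rw [ht, h6]; simp
    · right; rw [ht, sub_eq_zero.1 h6]; simp
  · exact absurd h5 e4.ne'

theorem exists_chord_pos {q q' : ℂ} (hq : ‖q‖ = 1) (hq' : ‖q'‖ = 1) (hne : q ≠ q') {σ : ℝ}
    (hσ : σ = 1 ∨ σ = -1) : ∃ y : ℂ, ‖y‖ = 1 ∧ 0 < σ * chord q q' y := by
  have hd : q' - q ≠ 0 := sub_ne_zero.2 hne.symm
  set d := q' - q
  have hdpos : 0 < ‖d‖ := norm_pos_iff.2 hd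
  refine ⟨(σ : ℂ) * I * d / ‖d‖, ?_, ?_⟩
  · rw [norm_div, norm_mul, norm_mul, norm_I, norm_real, norm_real]
    rcases hσ with rfl | rfl <;> simp [hdpos.ne']
  have h1 : (σ : ℂ) * I * d / ‖d‖ * conj d = σ * I * ‖d‖ := by
    have : d * conj d = (‖d‖ : ℂ) ^ 2 := by rw [mul_conj, normSq_eq_norm_sq]; push_cast; ring
    have hc : (‖d‖ : ℂ) ≠ 0 := by exact_mod_cast hdpos.ne'
    rw [div_mul_eq_mul_div, mul_assoc, this]
    field_simp
  have h2 : chord q q' ((σ : ℂ) * I * d / ‖d‖) = σ * ‖d‖ - (q * conj d).im := by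
    rw [chord, sub_mul, sub_im, h1]
    simp [d]
  have hσ2 : σ * σ = 1 := by rcases hσ with rfl | rfl <;> norm_num
  have e : ∀ w : ℂ, ‖w‖ = 1 → w.re * w.re + w.im * w.im = 1 := fun w hw => by
    rw [← normSq_apply, normSq_eq_norm_sq, hw]; norm_num
  have e1 := e q hq
  have e2 := e q' hq'
  have h3 : (q * conj d).im ^ 2 < ‖d‖ ^ 2 := by
    have hd2 : ‖d‖ ^ 2 = (q'.re - q.re) * (q'.re - q.re) + (q'.im - q.im) * (q'.im - q.im) := by
      rw [← normSq_eq_norm_sq, normSq_apply]; simp [d]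
    have hp : 0 < ‖d‖ ^ 2 := by positivity
    set ρ := q.re * q'.re + q.im * q'.im with hρ
    have hd3 : ‖d‖ ^ 2 = 2 - 2 * ρ := by rw [hd2, hρ]; linear_combination e1 + e2
    have him : (q * conj d).im = q.im * q'.re - q.re * q'.im := by simp [d]; ring
    have : (q * conj d).im ^ 2 = 1 - ρ ^ 2 := by
      rw [him, hρ]
      linear_combination (q'.re * q'.re + q'.im * q'.im) * e1 + e2
    rw [this, hd3]
    rw [hd3] at hp
    nlinarith
  rw [h2, mul_sub, ← mul_assoc, hσ2, one_mul]
  have h4 := abs_lt_of_sq_lt_sq h3 hdpos.le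
  have h5 : |σ * (q * conj d).im| < ‖d‖ := by
    rw [abs_mul, show |σ| = 1 by rcases hσ with rfl | rfl <;> simp, one_mul]
    exact h4
  linarith [(abs_lt.1 h5).2]

/-- **Boundary extension of Riemann maps**: if all but one boundary point `p` of a bounded domain
are analytic boundary points, and they form a connected set, then the Riemann map extends to a
homeomorphism of the closure without `p` onto the closed disc without one boundary point. -/
theorem IsRiemannPair.exists_extension {U : Set ℂ} {φ g : ℂ → ℂ} (h : IsRiemannPair U φ g)
    (hb : Bornology.IsBounded U) {p : ℂ} (hp : p ∈ closure U \ U)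
    (hconn : IsPreconnected ((closure U \ U) \ {p}))
    (hsm : ∀ x ∈ (closure U \ U) \ {p}, IsAnalyticBoundaryPt U x) :
    ∃ (q : ℂ) (Φ G : ℂ → ℂ), ‖q‖ = 1 ∧ EqOn Φ φ U ∧ EqOn G g (ball 0 1) ∧
      ContinuousOn Φ (closure U \ {p}) ∧ ContinuousOn G (closedBall 0 1 \ {q}) ∧
      MapsTo Φ (closure U \ {p}) (closedBall 0 1 \ {q}) ∧
      MapsTo G (closedBall 0 1 \ {q}) (closure U \ {p}) ∧
      LeftInvOn G Φ (closure U \ {p}) ∧ LeftInvOn Φ G (closedBall 0 1 \ {q}) := by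
  set Γ := (closure U \ U) \ {p} with hΓ
  have hY : ∀ x, ∃ y : ℂ, x ∈ Γ → ‖y‖ = 1 ∧ Tendsto φ (𝓝[U] x) (𝓝 y) ∧
      Tendsto g (𝓝[ball 0 1] y) (𝓝 x) ∧ ∀ V ∈ 𝓝 x, ∀ᶠ y' in 𝓝 y, ‖y'‖ = 1 →
        ∃ x' ∈ V, x' ∈ closure U \ U ∧ Tendsto φ (𝓝[U] x') (𝓝 y') := by
    intro x
    by_cases hx : x ∈ Γ
    · obtain ⟨y, hy⟩ := h.exists_boundary_value (hsm x hx)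
      exact ⟨y, fun _ => hy⟩
    · exact ⟨0, fun h => (hx h).elim⟩
  choose Y hY using hY
  have hNB : ∀ x ∈ closure U, (𝓝[U] x).NeBot := fun x hx => mem_closure_iff_nhdsWithin_neBot.1 hx
  have hNBD : ∀ y : ℂ, ‖y‖ ≤ 1 → (𝓝[ball 0 1] y).NeBot := fun y hy => by
    rw [← mem_closure_iff_nhdsWithin_neBot, closure_ball _ one_ne_zero]; simpa using hy
  set Φ := extendFrom U φ with hΦ
  set G := extendFrom (ball 0 1) g with hG
  have hUcl : U ⊆ closure U := subset_closure
  have hpU : ∀ x ∈ U, x ≠ p := fun x hx e => hp.2 (e ▸ hx)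
  have hdec : ∀ x ∈ closure U \ {p}, x ∈ U ∨ x ∈ Γ := fun x hx => by
    by_cases hxU : x ∈ U
    · exact Or.inl hxU
    · exact Or.inr ⟨⟨hx.1, hxU⟩, hx.2⟩
  have hΦU : EqOn Φ φ U := fun x hx => extendFrom_eq (hUcl hx) (h.diff.continuousOn x hx)
  have hΦΓ : EqOn Φ Y Γ := fun x hx => extendFrom_eq hx.1.1 (hY x hx).2.1
  have hφlim : ∀ x ∈ closure U \ {p}, Tendsto φ (𝓝[U] x) (𝓝 (Φ x)) := by
    intro x hx
    rcases hdec x hx with hxU | hxΓ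
    · rw [hΦU hxU]; exact h.diff.continuousOn x hxU
    · rw [hΦΓ hxΓ]; exact (hY x hxΓ).2.1
  have hΦc : ContinuousOn Φ (closure U \ {p}) :=
    continuousOn_extendFrom sdiff_subset fun x hx => ⟨_, hφlim x hx⟩
  set J := Y '' Γ with hJ
  have hJnorm : ∀ y ∈ J, ‖y‖ = 1 := by rintro _ ⟨x, hx, rfl⟩; exact (hY x hx).1
  have hJpre : IsPreconnected J := by
    rw [hJ, ← image_congr hΦΓ]
    exact hconn.image _ (hΦc.mono fun x hx => ⟨hx.1.1, hx.2⟩)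
  have hgG : ∀ y, ‖y‖ < 1 → Tendsto g (𝓝[ball 0 1] y) (𝓝 (g y)) := fun y hy =>
    h.diff_inv.continuousOn y (by simpa using hy)
  -- away from `J` the inverse map tends to `p`
  have hclust : ∀ y : ℂ, ‖y‖ = 1 → y ∉ J → Tendsto g (𝓝[ball 0 1] y) (𝓝 p) := by
    intro y hy hyJ
    refine (hb.isCompact_closure).tendsto_nhds_of_unique_mapClusterPt
      (eventually_nhdsWithin_of_forall fun z hz => hUcl (h.maps_inv hz)) fun x hx hcl => ?_
    by_contra hxp
    obtain ⟨f, hf, hfx⟩ := mapClusterPt_iff_ultrafilter.1 hcl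
    have hfD : ∀ᶠ z in (f : Filter ℂ), z ∈ ball (0 : ℂ) 1 := hf self_mem_nhdsWithin
    have h1 : Tendsto g f (𝓝[U] x) := tendsto_nhdsWithin_iff.2
      ⟨hfx, hfD.mono fun z hz => h.maps_inv hz⟩
    have h2 := (hφlim x ⟨hx, hxp⟩).comp h1
    have h3 : Tendsto (φ ∘ g) f (𝓝 y) := by
      refine Tendsto.congr' (hfD.mono fun z hz => (h.right_inv hz).symm) ?_
      exact tendsto_id'.2 (hf.trans nhdsWithin_le_nhds)
    have h4 := tendsto_nhds_unique h2 h3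
    rcases hdec x ⟨hx, hxp⟩ with hxU | hxΓ
    · rw [hΦU hxU] at h4
      have := mem_ball_zero_iff.1 (h.maps hxU)
      rw [h4, hy] at this
      exact lt_irrefl _ this
    · rw [hΦΓ hxΓ] at h4
      exact hyJ ⟨x, hxΓ, h4⟩
  -- a cluster value of `φ` at `p` is not in `J`
  obtain ⟨q, hq1, hqJ⟩ : ∃ q : ℂ, ‖q‖ = 1 ∧ q ∉ J := by
    have := hNB p hp.1
    obtain ⟨f, hf⟩ := Ultrafilter.exists_le (𝓝[U] p)
    have hfU : ∀ᶠ z in (f : Filter ℂ), z ∈ U := hf self_mem_nhdsWithin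
    obtain ⟨y, -, hy⟩ := (isCompact_closedBall (0 : ℂ) 1).ultrafilter_le_nhds (f.map φ) (by
      rw [le_principal_iff, Ultrafilter.coe_map, Filter.mem_map]
      exact hfU.mono fun z hz => ball_subset_closedBall (h.maps hz))
    have hy' : Tendsto φ f (𝓝 y) := hy
    have hy1 : ‖y‖ = 1 := tendsto_nhds_unique hy'.norm ((h.tendsto_norm hp.2).mono_left hf)
    refine ⟨y, hy1, ?_⟩
    rintro ⟨x, hx, hxy⟩
    have h1 := (hY x hx).2.2.1
    rw [hxy] at h1
    have h2 : Tendsto (g ∘ φ) f (𝓝 x) := h1.comp (tendsto_nhdsWithin_iff.2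
      ⟨hy', hfU.mono fun z hz => h.maps hz⟩)
    have h3 : Tendsto (g ∘ φ) f (𝓝 p) := by
      refine Tendsto.congr' (hfU.mono fun z hz => (h.left_inv hz).symm) ?_
      exact tendsto_id'.2 (hf.trans nhdsWithin_le_nhds)
    exact hx.2 (tendsto_nhds_unique h2 h3)
  -- if `J` omitted two points, it would omit an arc between them, on which `g` tends to `p`; then
  -- `g` would take the value `p`
  have huniq : ∀ q' : ℂ, ‖q'‖ = 1 → q' ≠ q → q' ∈ J := by
    intro q' hq' hne
    by_contra hq'J
    have hcont : Continuous (chord q q') := by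
      unfold chord; fun_prop
    have hsubJ : J ⊆ {z | chord q q' z < 0} ∪ {z | 0 < chord q q' z} := by
      intro z hz
      rcases lt_trichotomy (chord q q' z) 0 with h' | h' | h'
      · exact Or.inl h'
      · rcases eq_or_eq_of_chord_eq_zero hq1 hq' (hJnorm z hz) hne.symm h' with rfl | rfl
        · exact (hqJ hz).elim
        · exact (hq'J hz).elim
      · exact Or.inr h'
    obtain ⟨σ, hσ, hσJ⟩ : ∃ σ : ℝ, (σ = 1 ∨ σ = -1) ∧ ∀ y ∈ J, ¬ 0 < σ * chord q q' y := by
      rcases hJpre.subset_or_subset (isOpen_lt hcont continuous_const)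
        (isOpen_lt continuous_const hcont)
        (disjoint_left.2 fun z (h1 : chord q q' z < 0) (h2 : 0 < chord q q' z) =>
          absurd h1 h2.le.not_gt) hsubJ with h' | h'
      · refine ⟨1, Or.inl rfl, fun y hy => ?_⟩
        have : chord q q' y < 0 := h' hy
        linarith
      · refine ⟨-1, Or.inr rfl, fun y hy => ?_⟩
        have : 0 < chord q q' y := h' hy
        linarith
    obtain ⟨y₀, hy₀, hy₀A⟩ := exists_chord_pos hq1 hq' hne.symm hσ
    obtain ⟨M, hM⟩ := hb.exists_norm_le
    obtain ⟨z, hz, hzp⟩ := exists_eq_of_tendsto_arc h.diff_inv (fun z hz => hM _ (h.maps_inv hz))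
      (p := p) (A := {y | 0 < σ * chord q q' y})
      (isOpen_lt continuous_const (continuous_const.mul hcont)) hy₀ hy₀A
      (fun y hyA hy1 => hclust y hy1 fun hyJ => hσJ y hyJ hyA)
    exact hp.2 (hzp ▸ h.maps_inv hz)
  have hdecD : ∀ y ∈ closedBall (0 : ℂ) 1 \ {q}, y ∈ ball (0 : ℂ) 1 ∨ y ∈ J := by
    intro y hy
    rcases (mem_closedBall_zero_iff.1 hy.1).lt_or_eq with hlt | heq
    · exact Or.inl (by simpa using hlt)
    · exact Or.inr (huniq y heq hy.2)
  have hGD : EqOn G g (ball 0 1) := fun y hy =>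
    extendFrom_eq (subset_closure hy) (hgG y (by simpa using hy))
  have hGY : ∀ x ∈ Γ, G (Y x) = x := fun x hx =>
    extendFrom_eq (by rw [closure_ball _ one_ne_zero]; simp [(hY x hx).1]) (hY x hx).2.2.1
  have hGlim : ∀ y ∈ closedBall (0 : ℂ) 1 \ {q}, ∃ x, Tendsto g (𝓝[ball 0 1] y) (𝓝 x) := by
    intro y hy
    rcases hdecD y hy with hyD | ⟨x, hx, rfl⟩
    · exact ⟨_, hgG y (by simpa using hyD)⟩
    · exact ⟨_, (hY x hx).2.2.1⟩
  refine ⟨q, Φ, G, hq1, hΦU, hGD, hΦc, continuousOn_extendFrom ?_ hGlim, ?_, ?_, ?_, ?_⟩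
  · rw [closure_ball _ one_ne_zero]; exact sdiff_subset
  · intro x hx
    rcases hdec x hx with hxU | hxΓ
    · rw [hΦU hxU]
      have := h.maps hxU
      refine ⟨ball_subset_closedBall this, ?_⟩
      rintro rfl
      rw [mem_ball_zero_iff, hq1] at this
      exact lt_irrefl _ this
    · rw [hΦΓ hxΓ]
      refine ⟨by simp [(hY x hxΓ).1], ?_⟩
      intro e
      exact hqJ ⟨x, hxΓ, e⟩
  · intro y hy
    rcases hdecD y hy with hyD | ⟨x, hx, rfl⟩
    · rw [hGD hyD]
      exact ⟨hUcl (h.maps_inv hyD), hpU _ (h.maps_inv hyD)⟩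
    · rw [hGY x hx]
      exact ⟨hx.1.1, hx.2⟩
  · intro x hx
    rcases hdec x hx with hxU | hxΓ
    · rw [hΦU hxU, hGD (h.maps hxU), h.left_inv hxU]
    · rw [hΦΓ hxΓ, hGY x hxΓ]
  · intro y hy
    rcases hdecD y hy with hyD | ⟨x, hx, rfl⟩
    · rw [hGD hyD, hΦU (h.maps_inv hyD), h.right_inv hyD]
    · rw [hGY x hx, hΦΓ hx]

/-! ### The cubic on a half plane -/

/-- The cubic map in the coordinates `Z = 1 / (u - 1)` at the source and `X = 1 / (w + 2)` at the
target: `w = u³ - 3u` becomes `X = Z³ / (1 + 3Z)`. -/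
noncomputable def cubic (Z : ℂ) : ℂ := Z ^ 3 / (1 + 3 * Z)

/-- The parameters `b = a - 1` of `S`, with the univalence condition in the coordinate `Z`, in
which the circle `∂Δ_a` without `1` is the line `Re (b Z) = 1 / 2`. -/
structure Admissible (b : ℂ) : Prop where
  half_lt : 1 / 2 < b.re
  lt_three : b.re < 3
  injOn : InjOn cubic {Z | (b * Z).re = 1 / 2}

theorem hasDerivAt_cubic {Z : ℂ} (h : 1 + 3 * Z ≠ 0) :
    HasStrictDerivAt cubic (3 * Z ^ 2 * (1 + 2 * Z) / (1 + 3 * Z) ^ 2) Z := by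
  have h1 : HasStrictDerivAt (fun Z : ℂ => Z ^ 3) (3 * Z ^ 2) Z := by
    simpa using hasStrictDerivAt_pow 3 Z
  have h2 : HasStrictDerivAt (fun Z : ℂ => 1 + 3 * Z) 3 Z := by
    simpa using ((hasStrictDerivAt_id Z).const_mul (3 : ℂ)).const_add 1
  have h3 := h1.div h2 h
  rwa [show (3 * Z ^ 2 * (1 + 3 * Z) - Z ^ 3 * 3) = 3 * Z ^ 2 * (1 + 2 * Z) by ring] at h3

theorem continuousAt_cubic {Z : ℂ} (h : 1 + 3 * Z ≠ 0) : ContinuousAt cubic Z :=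
  (hasDerivAt_cubic h).hasDerivAt.continuousAt

/-- `(Z - W) * divided Z W` is the numerator of `cubic Z - cubic W`. -/
def divided (Z W : ℂ) : ℂ := Z ^ 2 + Z * W + W ^ 2 + 3 * Z * W * (Z + W)

theorem cubic_eq_cubic_iff {Z W : ℂ} (hZ : 1 + 3 * Z ≠ 0) (hW : 1 + 3 * W ≠ 0) :
    cubic Z = cubic W ↔ Z = W ∨ divided Z W = 0 := by
  rw [cubic, cubic, div_eq_div_iff hZ hW, ← sub_eq_zero, ← sub_eq_zero (a := Z), ← mul_eq_zero]
  rw [show Z ^ 3 * (1 + 3 * W) - W ^ 3 * (1 + 3 * Z) = (Z - W) * divided Z W by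
    rw [divided]; ring]

theorem norm_le_of_norm_cubic_le {Z : ℂ} {M : ℝ} (hZ : 1 + 3 * Z ≠ 0) (h : ‖cubic Z‖ ≤ M) :
    ‖Z‖ ≤ 1 + 4 * M := by
  have hM : 0 ≤ M := (norm_nonneg _).trans h
  rw [cubic, norm_div, norm_pow, div_le_iff₀ (norm_pos_iff.2 hZ)] at h
  have h2 : ‖1 + 3 * Z‖ ≤ 1 + 3 * ‖Z‖ := (norm_add_le _ _).trans (by simp)
  by_contra! hlt
  have h3 : ‖Z‖ ^ 3 ≤ M * (1 + 3 * ‖Z‖) := h.trans (by gcongr)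
  have h4 : M * (1 + 3 * ‖Z‖) ≤ 4 * M * ‖Z‖ := by nlinarith
  have h5 : (1 : ℝ) ≤ ‖Z‖ := by linarith
  have h6 : ‖Z‖ ≤ ‖Z‖ ^ 2 := by nlinarith
  nlinarith [mul_le_mul_of_nonneg_left h6 (norm_nonneg Z)]

/-- The largest real part `Re (b W)` over the two solutions `W` of `divided Z W = 0`,
which are `-Z / 2 ± √D` with `D = (Z ^ 2 - 4 Z ^ 2 / (1 + 3 Z)) / 4`. -/
noncomputable def maxRe (b Z : ℂ) : ℝ :=
  -(b * Z).re / 2 +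
    √((‖b ^ 2 * (Z ^ 2 - 4 * (Z ^ 2 / (1 + 3 * Z))) / 4‖ +
      (b ^ 2 * (Z ^ 2 - 4 * (Z ^ 2 / (1 + 3 * Z))) / 4).re) / 2)

theorem abs_re_eq_sqrt (u : ℂ) : |u.re| = √((‖u ^ 2‖ + (u ^ 2).re) / 2) := by
  rw [← Real.sqrt_sq_eq_abs, norm_pow, ← normSq_eq_norm_sq, normSq_apply, sq u, mul_re]
  congr 1
  ring

theorem re_le_maxRe {b Z W : ℂ} (hZ : 1 + 3 * Z ≠ 0) (h : divided Z W = 0) :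
    (b * W).re ≤ maxRe b Z := by
  have h1 : (b * W + b * Z / 2) ^ 2 = b ^ 2 * (Z ^ 2 - 4 * (Z ^ 2 / (1 + 3 * Z))) / 4 := by
    have : (1 + 3 * Z) * (W ^ 2 + Z * W) + Z ^ 2 = 0 := by rw [← h, divided]; ring
    have e : Z ^ 2 / (1 + 3 * Z) = -(W ^ 2 + Z * W) := by
      rw [div_eq_iff hZ]; linear_combination this
    rw [e]
    ring
  have h2 := le_abs_self (b * W + b * Z / 2).re
  rw [abs_re_eq_sqrt, h1] at h2
  rw [maxRe]
  have h3 : (b * W + b * Z / 2).re = (b * W).re + (b * Z).re / 2 := by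
    rw [add_re]; norm_num
  linarith

theorem exists_re_eq_maxRe {b Z : ℂ} (hb : b ≠ 0) (hZ : 1 + 3 * Z ≠ 0) :
    ∃ W, divided Z W = 0 ∧ (b * W).re = maxRe b Z := by
  obtain ⟨u, hu⟩ := IsAlgClosed.exists_pow_nat_eq
    (b ^ 2 * (Z ^ 2 - 4 * (Z ^ 2 / (1 + 3 * Z))) / 4) (n := 2) two_pos
  wlog hre : 0 ≤ u.re generalizing u
  · exact this (-u) (by rw [neg_sq, hu]) (by rw [neg_re]; linarith)
  refine ⟨u / b - Z / 2, ?_, ?_⟩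
  · have h1 : (u / b) ^ 2 = (Z ^ 2 - 4 * (Z ^ 2 / (1 + 3 * Z))) / 4 := by
      rw [div_pow, hu]; field_simp
    have h2 : (1 + 3 * Z) * (u / b) ^ 2 = ((1 + 3 * Z) * Z ^ 2 - 4 * Z ^ 2) / 4 := by
      rw [h1]; field_simp
    rw [divided]
    linear_combination h2
  · have h1 : b * (u / b - Z / 2) = u - b * Z / 2 := by field_simp
    have h2 := abs_re_eq_sqrt u
    rw [abs_of_nonneg hre, hu] at h2
    rw [h1, maxRe, ← h2, sub_re, show (b * Z / 2).re = (b * Z).re / 2 by norm_num]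
    ring

theorem continuousAt_maxRe (b : ℂ) {Z : ℂ} (hZ : 1 + 3 * Z ≠ 0) : ContinuousAt (maxRe b) Z := by
  have h : ContinuousAt (fun Z : ℂ => b ^ 2 * (Z ^ 2 - 4 * (Z ^ 2 / (1 + 3 * Z))) / 4) Z := by
    fun_prop (disch := exact hZ)
  have h1 : ContinuousAt (fun Z : ℂ => (b * Z).re) Z := by fun_prop
  unfold maxRe
  exact (h1.neg.div_const 2).add (((h.norm.add (continuous_re.continuousAt.comp h)).div_const
    2).sqrt)

theorem divided_comm (Z W : ℂ) : divided Z W = divided W Z := by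
  rw [divided, divided]; ring

namespace Admissible

variable {b : ℂ}

theorem ne_zero (hb : Admissible b) : b ≠ 0 := by
  rintro rfl
  have := hb.half_lt
  norm_num at this

theorem norm_pos (hb : Admissible b) : 0 < ‖b‖ := norm_pos_iff.2 hb.ne_zero

theorem pole_ne (hb : Admissible b) {Z : ℂ} (hZ : 0 ≤ (b * Z).re) : 1 + 3 * Z ≠ 0 := by
  intro h
  have : b * Z = -b / 3 := by linear_combination b / 3 * h
  rw [this, show (-b / 3).re = -b.re / 3 by norm_num] at hZ
  linarith [hb.half_lt]

theorem deriv_ne (hb : Admissible b) {Z : ℂ} (hZ : 0 < (b * Z).re) :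
    3 * Z ^ 2 * (1 + 2 * Z) / (1 + 3 * Z) ^ 2 ≠ 0 := by
  have h0 : Z ≠ 0 := by rintro rfl; simp at hZ
  have h1 : 1 + 2 * Z ≠ 0 := by
    intro h
    have : b * Z = -b / 2 := by linear_combination b / 2 * h
    rw [this, show (-b / 2).re = -b.re / 2 by norm_num] at hZ
    linarith [hb.half_lt]
  exact div_ne_zero (mul_ne_zero (mul_ne_zero three_ne_zero (pow_ne_zero _ h0)) h1)
    (pow_ne_zero _ (hb.pole_ne hZ.le))

theorem divided_self_ne (hb : Admissible b) {Z : ℂ} (hZ : 0 < (b * Z).re) : divided Z Z ≠ 0 := by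
  have h := hb.deriv_ne hZ
  intro h0
  apply h
  rw [div_eq_zero_iff]
  left
  rw [← h0, divided]
  ring

theorem line_eq_range (hb : Admissible b) :
    {Z : ℂ | (b * Z).re = 1 / 2} = range fun t : ℝ => ((1 / 2 : ℝ) + t * I) / b := by
  have h0 := hb.ne_zero
  ext Z
  constructor
  · intro hZ
    refine ⟨(b * Z).im, ?_⟩
    have : ((1 / 2 : ℝ) : ℂ) + ((b * Z).im : ℝ) * I = b * Z := by
      rw [← show (b * Z).re = 1 / 2 from hZ]; exact re_add_im _
    simp only [this]
    field_simp
  · rintro ⟨t, rfl⟩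
    rw [mem_ofPred_eq, mul_div_cancel₀ _ h0]
    simp

theorem isPreconnected_line (hb : Admissible b) : IsPreconnected {Z : ℂ | (b * Z).re = 1 / 2} := by
  rw [hb.line_eq_range, ← image_univ]
  exact isPreconnected_univ.image _ (by fun_prop)

/-- The cubic is univalent near infinity on the line; this is where `Re b < 3` is used. -/
theorem exists_maxRe_lt (hb : Admissible b) : ∃ Z : ℂ, (b * Z).re = 1 / 2 ∧ maxRe b Z < 1 / 2 := by
  have h0 := hb.ne_zero
  have hnp := hb.norm_pos
  have hε : 0 < 1 / 2 * (1 - b.re / 3) := by linarith [hb.lt_three]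
  set ε := 1 / 2 * (1 - b.re / 3) with hεd
  set T : ℝ := ‖b‖ * (1 + ‖b‖ ^ 2 / ε) with hT
  refine ⟨((1 / 2 : ℝ) + T * I) / b, ?_, ?_⟩
  · rw [mul_div_cancel₀ _ h0]; simp
  set Z : ℂ := ((1 / 2 : ℝ) + T * I) / b with hZ
  have hbZ : b * Z = (1 / 2 : ℝ) + T * I := by rw [hZ, mul_div_cancel₀ _ h0]
  have hre : (b * Z).re = 1 / 2 := by rw [hbZ]; simp
  have hp := hb.pole_ne (Z := Z) (by rw [hre]; norm_num)
  obtain ⟨W, hW, hWm⟩ := exists_re_eq_maxRe h0 hp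
  rw [← hWm]
  by_contra! hge
  -- the product of the first two factors is small for large `Z`, but their real parts are bounded
  -- away from `0`
  have hprod : (b * (W + 1 / 3)) * (b * (-Z - W + 1 / 3)) * (9 * (1 + 3 * Z)) = b ^ 2 := by
    rw [divided] at hW
    linear_combination (-9 * b ^ 2) * hW
  have h1 : (b * (W + 1 / 3)).re = (b * W).re + b.re / 3 := by
    rw [mul_add, add_re, mul_one_div]; norm_num
  have h2 : (b * (-Z - W + 1 / 3)).re = -(b * Z).re - (b * W).re + b.re / 3 := by
    rw [show b * (-Z - W + 1 / 3) = -(b * Z) - b * W + b / 3 by ring, add_re, sub_re, neg_re]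
    norm_num
  have h3 : 1 / 2 ≤ ‖b * (W + 1 / 3)‖ := by
    refine le_trans ?_ (re_le_norm _)
    rw [h1]; linarith [hb.half_lt]
  have h4 : 1 - b.re / 3 ≤ ‖b * (-Z - W + 1 / 3)‖ := by
    refine le_trans ?_ ((neg_le_abs _).trans (abs_re_le_norm _))
    rw [h2, hre]; linarith
  have h5 : ε ≤ ‖b * (W + 1 / 3)‖ * ‖b * (-Z - W + 1 / 3)‖ := by
    rw [hεd]
    exact mul_le_mul h3 h4 (by linarith [hb.lt_three]) (norm_nonneg _)
  have hZn : 1 + ‖b‖ ^ 2 / ε ≤ ‖Z‖ := by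
    have : T ≤ ‖b * Z‖ := by
      refine le_trans ?_ ((le_abs_self _).trans (abs_im_le_norm _))
      rw [hbZ]; simp
    rw [norm_mul, hT] at this
    exact le_of_mul_le_mul_left this hnp
  have h6 : ‖b‖ ^ 2 / ε < ‖9 * (1 + 3 * Z)‖ := by
    have e1 : 3 * ‖Z‖ ≤ ‖1 + 3 * Z‖ + 1 := by
      have := norm_sub_le (1 + 3 * Z) 1
      rwa [add_sub_cancel_left, norm_mul, norm_one, show ‖(3 : ℂ)‖ = 3 by norm_num] at this
    rw [norm_mul, show ‖(9 : ℂ)‖ = 9 by norm_num]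
    have e2 : 0 ≤ ‖b‖ ^ 2 / ε := by positivity
    linarith
  have h7 := congrArg norm hprod
  rw [norm_mul, norm_mul, norm_pow] at h7
  rw [div_lt_iff₀ hε] at h6
  nlinarith [norm_nonneg (9 * (1 + 3 * Z))]

theorem maxRe_ne (hb : Admissible b) {Z : ℂ} (hZ : (b * Z).re = 1 / 2) : maxRe b Z ≠ 1 / 2 := by
  intro h
  have hp := hb.pole_ne (Z := Z) (by rw [hZ]; norm_num)
  obtain ⟨W, hW, hWm⟩ := exists_re_eq_maxRe hb.ne_zero hp
  rw [h] at hWm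
  have hp' := hb.pole_ne (Z := W) (by rw [hWm]; norm_num)
  have := hb.injOn hZ hWm ((cubic_eq_cubic_iff hp hp').2 (Or.inr hW))
  subst this
  exact hb.divided_self_ne (by rw [hZ]; norm_num) hW

/-- Univalence on the boundary line propagates to the closed half plane, by connectedness: `maxRe b`
is continuous and never equal to `1 / 2` there. -/
theorem maxRe_lt (hb : Admissible b) {Z : ℂ} (hZ : 1 / 2 ≤ (b * Z).re) : maxRe b Z < 1 / 2 := by
  obtain ⟨Z₀, hZ₀, hm₀⟩ := hb.exists_maxRe_lt
  have key : ∀ C : Set ℂ, IsPreconnected C → Z₀ ∈ C → (∀ Z ∈ C, 1 / 2 ≤ (b * Z).re) →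
      (∀ Z ∈ C, maxRe b Z ≠ 1 / 2) → ∀ Z ∈ C, maxRe b Z < 1 / 2 := by
    intro C hC hZ₀C hsub hne Z hZC
    by_contra! hge
    have hcont : ContinuousOn (maxRe b) C := fun W hW =>
      (continuousAt_maxRe b (hb.pole_ne (by linarith [hsub W hW]))).continuousWithinAt
    obtain ⟨W, hW, hWe⟩ := hC.intermediate_value hZ₀C hZC hcont ⟨hm₀.le, hge⟩
    exact hne W hW hWe
  have hline : ∀ Z : ℂ, (b * Z).re = 1 / 2 → maxRe b Z < 1 / 2 :=
    key {Z | (b * Z).re = 1 / 2} hb.isPreconnected_line hZ₀ (fun Z hZ => (show _ = _ from hZ).ge)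
      fun Z hZ => hb.maxRe_ne hZ
  refine key {Z | 1 / 2 ≤ (b * Z).re} ?_ hZ₀.ge (fun Z hZ => hZ) ?_ Z hZ
  · have : Convex ℝ {Z : ℂ | 1 / 2 ≤ (b * Z).re} := by
      have := convex_halfSpace_ge (𝕜 := ℝ) (f := fun Z : ℂ => (b * Z).re)
        ⟨fun x y => by simp [mul_add], fun c x => by simp; ring⟩ (1 / 2 : ℝ)
      exact this
    exact this.isPreconnected
  · intro Z hZ hm
    have hp := hb.pole_ne (Z := Z) (by linarith [show 1 / 2 ≤ (b * Z).re from hZ])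
    obtain ⟨W, hW, hWm⟩ := exists_re_eq_maxRe hb.ne_zero hp
    rw [hm] at hWm
    rw [divided_comm] at hW
    have h1 := re_le_maxRe (b := b) (hb.pole_ne (Z := W) (by rw [hWm]; norm_num)) hW
    have h2 := hline W hWm
    linarith [show 1 / 2 ≤ (b * Z).re from hZ]

/-- Near the closed half plane, points outside it have no image in common with it. -/
theorem eq_of_cubic_eq (hb : Admissible b) {Z W : ℂ} (hZp : 1 + 3 * Z ≠ 0)
    (hZ : maxRe b Z < 1 / 2) (hW : 1 / 2 ≤ (b * W).re) (h : cubic Z = cubic W) : Z = W := by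
  rcases (cubic_eq_cubic_iff hZp (hb.pole_ne (by linarith))).1 h with h | h
  · exact h
  · linarith [re_le_maxRe (b := b) hZp h]

theorem injOn_closed (hb : Admissible b) : InjOn cubic {Z | 1 / 2 ≤ (b * Z).re} :=
  fun Z hZ W hW h => hb.eq_of_cubic_eq
    (hb.pole_ne (by linarith [show 1 / 2 ≤ (b * Z).re from hZ])) (hb.maxRe_lt hZ) hW h

theorem continuousOn_cubic (hb : Admissible b) : ContinuousOn cubic {Z | 1 / 2 ≤ (b * Z).re} :=
  fun Z hZ => (continuousAt_cubic
    (hb.pole_ne (by linarith [show 1 / 2 ≤ (b * Z).re from hZ]))).continuousWithinAt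

theorem differentiableOn_cubic (hb : Admissible b) :
    DifferentiableOn ℂ cubic {Z | 1 / 2 < (b * Z).re} :=
  fun Z hZ => (hasDerivAt_cubic (hb.pole_ne (by
    linarith [show 1 / 2 < (b * Z).re from hZ]))).hasDerivAt.differentiableAt.differentiableWithinAt

theorem isClosed_image_cubic (hb : Admissible b) {C : Set ℂ} (hC : IsClosed C)
    (hsub : C ⊆ {Z | 1 / 2 ≤ (b * Z).re}) : IsClosed (cubic '' C) := by
  refine isClosed_of_closure_subset fun X hX => ?_
  have hcomp : IsCompact (cubic '' (C ∩ closedBall 0 (1 + 4 * (‖X‖ + 1)))) :=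
    ((isCompact_closedBall _ _).inter_left hC).image_of_continuousOn
      (hb.continuousOn_cubic.mono (inter_subset_left.trans hsub))
  have h1 : cubic '' C ∩ ball X 1 ⊆ cubic '' (C ∩ closedBall 0 (1 + 4 * (‖X‖ + 1))) := by
    rintro _ ⟨⟨Z, hZ, rfl⟩, hZX⟩
    refine ⟨Z, ⟨hZ, ?_⟩, rfl⟩
    rw [mem_closedBall_zero_iff]
    have hZ1 : 1 / 2 ≤ (b * Z).re := hsub hZ
    refine norm_le_of_norm_cubic_le (hb.pole_ne (by linarith)) ?_
    have := norm_sub_norm_le (cubic Z) X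
    rw [mem_ball, dist_eq_norm] at hZX
    linarith
  have h2 : X ∈ closure (cubic '' C ∩ ball X 1) := by
    rw [mem_closure_iff_nhdsWithin_neBot] at hX ⊢
    rwa [nhdsWithin_inter_of_mem' (mem_nhdsWithin_of_mem_nhds (ball_mem_nhds X one_pos))]
  have h3 := closure_mono h1 h2
  rw [hcomp.isClosed.closure_eq] at h3
  exact image_mono inter_subset_left h3

theorem isOpen_image_cubic (hb : Admissible b) {c : ℝ} (hc : 1 / 2 ≤ c) :
    IsOpen (cubic '' {Z | c < (b * Z).re}) := by
  have hsub : {Z : ℂ | c < (b * Z).re} ⊆ {Z | 1 / 2 < (b * Z).re} := fun Z hZ =>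
    lt_of_le_of_lt hc hZ
  exact isOpen_image_of_injOn (isOpen_lt continuous_const (by fun_prop))
    (hb.differentiableOn_cubic.mono hsub)
    (hb.injOn_closed.mono fun Z hZ => (show 1 / 2 < (b * Z).re from hsub hZ).le)

end Admissible

/-! ### Connectedness from the boundary, and kernel convergence -/

/-- An analytic boundary point sees only one connected component: it cannot be a limit of two
disjoint open sets that exhaust `U`. -/
theorem IsAnalyticBoundaryPt.not_mem_closure_inter {U A B : Set ℂ} {x : ℂ}
    (hx : IsAnalyticBoundaryPt U x) (hA : IsOpen A) (hB : IsOpen B) (hAB : Disjoint A B)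
    (hU : U = A ∪ B) : ¬ (x ∈ closure A ∧ x ∈ closure B) := by
  rintro ⟨hxA, hxB⟩
  obtain ⟨κ, δ, hδ, hκd, hκi, hκ0, hκU⟩ := hx
  have hmap : 𝓝 x ≤ map κ (𝓝 0) := by
    rw [← hκ0]; exact nhds_le_map_of_injOn isOpen_ball hκd hκi (mem_ball_self hδ)
  have hnb : κ '' ball 0 δ ∈ 𝓝 x := hmap (image_mem_map (ball_mem_nhds 0 hδ))
  have hsub : upperHalfBall δ ⊆ ball 0 δ := fun ζ hζ => by simpa using hζ.1
  have himg : IsPreconnected (κ '' upperHalfBall δ) :=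
    (convex_upperHalfBall δ).isPreconnected.image _ (hκd.continuousOn.mono hsub)
  have hsubU : κ '' upperHalfBall δ ⊆ A ∪ B := by
    rintro _ ⟨ζ, hζ, rfl⟩
    rw [← hU]
    exact (hκU ζ (hsub hζ)).2 hζ.2
  have hmeet : ∀ C : Set ℂ, C ⊆ U → x ∈ closure C → (κ '' upperHalfBall δ ∩ C).Nonempty := by
    intro C hCU hxC
    obtain ⟨y, ⟨ζ, hζ, rfl⟩, hyC⟩ := mem_closure_iff_nhds.1 hxC _ hnb
    exact ⟨κ ζ, ⟨ζ, ⟨by simpa using hζ, (hκU ζ hζ).1 (hCU hyC)⟩, rfl⟩, hyC⟩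
  obtain ⟨y, -, hyA, hyB⟩ := himg A B hA hB hsubU (hmeet A (hU ▸ subset_union_left) hxA)
    (hmeet B (hU ▸ subset_union_right) hxB)
  exact hAB.le_bot ⟨hyA, hyB⟩

/-- An open set with a connected boundary of analytic boundary points is connected. -/
theorem isPreconnected_of_isAnalyticBoundaryPt {U : Set ℂ} (hU : IsOpen U)
    (hconn : IsPreconnected (closure U \ U)) (hx : ∀ x ∈ closure U \ U, IsAnalyticBoundaryPt U x) :
    IsPreconnected U := by
  -- a piece that does not reach the boundary is clopen in the plane
  have clopen : ∀ A B : Set ℂ, IsOpen A → IsOpen B → Disjoint A B → U = A ∪ B → A.Nonempty →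
      closure B ∩ (closure U \ U) = ∅ → ¬ B.Nonempty := by
    rintro A B hA hB hAB hUAB ⟨a, ha⟩ hcl ⟨y, hy⟩
    have hBc : IsClosed B := by
      refine isClosed_of_closure_subset fun z hz => ?_
      have hzU : z ∈ U := by
        by_contra hzU
        exact eq_empty_iff_forall_notMem.1 hcl z
          ⟨hz, closure_mono (hUAB ▸ subset_union_right) hz, hzU⟩
      rcases hUAB.le hzU with hzA | hzB
      · exact absurd hzA (disjoint_left.1 (hAB.symm.closure_left hA) hz)
      · exact hzB
    have := IsClopen.eq_univ ⟨hBc, hB⟩ ⟨y, hy⟩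
    exact hAB.le_bot ⟨ha, this ▸ trivial⟩
  intro A' B' hA' hB' hsub hAne hBne
  by_contra hne
  rw [not_nonempty_iff_eq_empty] at hne
  have hUAB : U = (U ∩ A') ∪ (U ∩ B') := by
    rw [← inter_union_distrib_left, inter_eq_left.2 hsub]
  have hA := hU.inter hA'
  have hB := hU.inter hB'
  have hAB : Disjoint (U ∩ A') (U ∩ B') := by
    rw [disjoint_iff_inter_eq_empty, ← hne]
    ext z
    simp only [mem_inter_iff]
    tauto
  have hcover : closure U \ U ⊆ closure (U ∩ A') ∪ closure (U ∩ B') := by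
    rw [← closure_union, ← hUAB]; exact sdiff_subset
  by_cases h1 : (closure (U ∩ B') ∩ (closure U \ U)) = ∅
  · exact clopen _ _ hA hB hAB hUAB hAne h1 hBne
  by_cases h2 : (closure (U ∩ A') ∩ (closure U \ U)) = ∅
  · exact clopen _ _ hB hA hAB.symm (by rwa [union_comm]) hBne h2 hAne
  rw [inter_comm, ← ne_eq, ← nonempty_iff_ne_empty] at h1 h2
  obtain ⟨x, hxΓ, hxA, hxB⟩ := isPreconnected_closed_iff.1 hconn _ _ isClosed_closure
    isClosed_closure hcover h2 h1
  exact (hx x hxΓ).not_mem_closure_inter hA hB hAB hUAB ⟨hxA, hxB⟩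

/-- **Carathéodory kernel theorem** in the form needed here: if the domains `V j` shrink to a closed
set with interior `U`, then their Riemann maps subconverge to a Riemann map of `U`. -/
theorem exists_isRiemannPair_of_kernel {U K : Set ℂ} {V : ℕ → Set ℂ} (hU : IsOpen U)
    (hUc : IsPreconnected U) (h0 : (0 : ℂ) ∈ U) (hVo : ∀ j, IsOpen (V j))
    (hVc : ∀ j, IsPreconnected (V j)) (hVL : ∀ j, HasContLog (V j)) (hUV : ∀ j, U ⊆ V j)
    {x₀ : ℂ} {η : ℝ} (hη : 0 < η) (hx : ∀ j, ∀ z ∈ V j, η ≤ ‖z - x₀‖)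
    (hK : ∀ x ∉ K, ∃ N ∈ 𝓝 x, ∀ᶠ j in atTop, Disjoint N (V j)) (hKU : interior K ⊆ U) :
    ∃ φ g : ℂ → ℂ, IsRiemannPair U φ g ∧ φ 0 = 0 := by
  have hRM : ∀ j, ∃ φ g : ℂ → ℂ, DifferentiableOn ℂ φ (V j) ∧ DifferentiableOn ℂ g (ball 0 1) ∧
      MapsTo φ (V j) (ball 0 1) ∧ MapsTo g (ball 0 1) (V j) ∧ LeftInvOn g φ (V j) ∧
      LeftInvOn φ g (ball 0 1) ∧ φ 0 = 0 := fun j =>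
    exists_riemann_map (hVo j) (hVc j) (hUV j h0) (hVL j) hη (hx j)
  choose φ g hφd hgd hφm hgm hgφ hφg hφ0 using hRM
  set p : Ultrafilter ℕ := Ultrafilter.of atTop with hp
  have hpa : (p : Filter ℕ) ≤ atTop := Ultrafilter.of_le atTop
  have h0b : (0 : ℂ) ∈ ball (0 : ℂ) 1 := mem_ball_self one_pos
  -- the limit of the maps to the disc
  obtain ⟨Φ, hΦ⟩ := exists_tendstoLocallyUniformlyOn_of_bounded p hU
    (fun j => (hφd j).mono (hUV j)) (M := 1)
    (fun j z hz => (mem_ball_zero_iff.1 (hφm j (hUV j hz))).le)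
  have hΦt : ∀ z ∈ U, Tendsto (fun j => φ j z) p (𝓝 (Φ z)) := fun z hz => hΦ.tendsto_at hz
  have hΦd : DifferentiableOn ℂ Φ U :=
    hΦ.differentiableOn (.of_forall fun j => (hφd j).mono (hUV j)) hU
  have hΦ0 : Φ 0 = 0 := by
    have h1 := hΦt 0 h0
    simp only [hφ0] at h1
    exact tendsto_nhds_unique h1 tendsto_const_nhds
  have hΦlt : ∀ z ∈ U, ‖Φ z‖ < 1 := fun z hz =>
    norm_lt_one_of_norm_le_one hU hUc h0 hΦd hΦ0 (fun w hw =>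
      le_of_tendsto (hΦt w hw).norm (.of_forall fun j =>
        (mem_ball_zero_iff.1 (hφm j (hUV j hw))).le)) hz
  -- the limit of the inverse maps, through the bounded functions `1 / (g j - x₀)`
  have hgx : ∀ j, ∀ z ∈ ball (0 : ℂ) 1, g j z - x₀ ≠ 0 := fun j z hz h => by
    have := hx j _ (hgm j hz); rw [h, norm_zero] at this; linarith
  have hkd : ∀ j, DifferentiableOn ℂ (fun z => (g j z - x₀)⁻¹) (ball 0 1) := fun j =>
    ((hgd j).sub_const x₀).inv (hgx j)
  obtain ⟨k, hk⟩ := exists_tendstoLocallyUniformlyOn_of_bounded p isOpen_ball hkd (M := η⁻¹)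
    (fun j z hz => by rw [norm_inv]; exact inv_anti₀ hη (hx j _ (hgm j hz)))
  have hkt : ∀ z ∈ ball (0 : ℂ) 1, Tendsto (fun j => (g j z - x₀)⁻¹) p (𝓝 (k z)) :=
    fun z hz => hk.tendsto_at hz
  have hg0 : ∀ j, g j 0 = 0 := fun j => by
    have := hgφ j (hUV j h0); rwa [hφ0] at this
  have hx0 : x₀ ≠ 0 := by
    rintro rfl
    exact hgx 0 0 h0b (by rw [hg0, sub_zero])
  have hk0 : ∀ z ∈ ball (0 : ℂ) 1, k z ≠ 0 := by
    refine (eqOn_zero_or_ne_zero_of_tendsto isOpen_ball (convex_ball _ _).isPreconnected hkd hk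
      (fun j z hz => inv_ne_zero (hgx j z hz))).resolve_left fun h => ?_
    have h1 := hkt 0 h0b
    simp only [hg0] at h1
    have h2 := tendsto_nhds_unique h1 tendsto_const_nhds
    rw [h h0b] at h2
    simp [hx0] at h2
  set G : ℂ → ℂ := fun z => x₀ + (k z)⁻¹ with hG
  have hGt : ∀ z ∈ ball (0 : ℂ) 1, Tendsto (fun j => g j z) p (𝓝 (G z)) := by
    intro z hz
    have := ((hkt z hz).inv₀ (hk0 z hz)).const_add x₀
    refine this.congr fun j => ?_
    rw [inv_inv]; ring
  have hGd : DifferentiableOn ℂ G (ball 0 1) :=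
    ((hk.differentiableOn (.of_forall hkd) isOpen_ball).inv hk0).const_add x₀
  have hGK : ∀ z ∈ ball (0 : ℂ) 1, G z ∈ K := by
    intro z hz
    by_contra hn
    obtain ⟨N, hN, hev⟩ := hK _ hn
    obtain ⟨j, hj1, hj2⟩ := ((hGt z hz).eventually hN |>.and (hpa hev)).exists
    exact hj2.le_bot ⟨hj1, hgm j hz⟩
  -- limits commute with evaluation along convergent sequences
  have hcomp : ∀ (u : ℕ → ℂ) (x : ℂ), x ∈ U → Tendsto u p (𝓝 x) →
      Tendsto (fun j => φ j (u j)) p (𝓝 (Φ x)) := fun u x hxU hu =>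
    hΦ.tendsto_comp (hΦd.continuousOn x hxU) hxU (tendsto_nhdsWithin_iff.2
      ⟨hu, hu.eventually (hU.mem_nhds hxU)⟩)
  have hGo : ∀ s ⊆ ball (0 : ℂ) 1, IsOpen s → IsOpen (G '' s) := by
    refine ((hGd.analyticOnNhd isOpen_ball).is_constant_or_isOpen
      (convex_ball _ _).isPreconnected).resolve_left ?_
    rintro ⟨w, hw⟩
    have hG0 : G 0 = 0 := by
      have h1 := hGt 0 h0b
      simp only [hg0] at h1
      exact tendsto_nhds_unique h1 tendsto_const_nhds
    have hhalf : (1 / 2 : ℂ) ∈ ball (0 : ℂ) 1 := by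
      rw [mem_ball_zero_iff]; norm_num
    have h1 := hGt _ hhalf
    rw [hw _ hhalf, ← hw _ h0b, hG0] at h1
    have h2 := hcomp _ _ h0 h1
    simp only [hφg _ hhalf, hΦ0] at h2
    have := tendsto_nhds_unique h2 tendsto_const_nhds
    norm_num at this
  have hGU : MapsTo G (ball 0 1) U := fun z hz =>
    hKU (interior_maximal (image_subset_iff.2 hGK) (hGo _ subset_rfl isOpen_ball)
      (mem_image_of_mem G hz))
  refine ⟨Φ, G, ⟨hU, hΦd, hGd, fun z hz => by simpa using hΦlt z hz, hGU, ?_, ?_⟩, hΦ0⟩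
  · intro z hz
    have hzb : Φ z ∈ ball (0 : ℂ) 1 := by simpa using hΦlt z hz
    have h1 := hk.tendsto_comp (((hk.differentiableOn (.of_forall hkd)
      isOpen_ball).continuousOn) _ hzb) hzb (tendsto_nhdsWithin_iff.2
        ⟨hΦt z hz, (hΦt z hz).eventually (isOpen_ball.mem_nhds hzb)⟩)
    simp only [fun j => hgφ j (hUV j hz)] at h1
    have h2 := tendsto_nhds_unique h1 tendsto_const_nhds
    rw [hG]
    simp only [h2, inv_inv]
    ring
  · intro z hz
    have h1 := hcomp _ _ (hGU hz) (hGt z hz)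
    simp only [hφg _ hz] at h1
    exact tendsto_nhds_unique h1 tendsto_const_nhds

/-! ### Topology of the fundamental tile -/

/-- The complement of the image of the half plane `Re (b Z) ≥ c` under the cubic. -/
def cap (b : ℂ) (c : ℝ) : Set ℂ := (cubic '' {Z | c ≤ (b * Z).re})ᶜ

/-- The fundamental tile in the coordinate `X`: the complement of the image of the open half
plane. -/
def tile (b : ℂ) : Set ℂ := (cubic '' {Z | 1 / 2 < (b * Z).re})ᶜ

/-- The inverse of the univalent cubic on the closed half plane. -/
noncomputable def cubicInv (b : ℂ) : ℂ → ℂ := Function.invFunOn cubic {Z | 1 / 2 ≤ (b * Z).re}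

open Classical in
/-- The self-map of the plane that fixes the tile and moves the point `cubic Z` with
`Re (b Z) = 1 / 2 + d`, `d ≥ 0`, to `cubic Z'`, where `Z'` is the point with
`Re (b Z') = 1 / 2 + s d` and `Im (b Z') = Im (b Z)`. -/
noncomputable def push (b : ℂ) (s : ℝ → ℝ) (X : ℂ) : ℂ :=
  if X ∈ cubic '' {Z | 1 / 2 ≤ (b * Z).re} then
    cubic (cubicInv b X + ((s ((b * cubicInv b X).re - 1 / 2) -
      ((b * cubicInv b X).re - 1 / 2) : ℝ) : ℂ) / b)
  else X

theorem tile_subset_cap (b : ℂ) {c : ℝ} (hc : 1 / 2 < c) : tile b ⊆ cap b c :=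
  compl_subset_compl.2 (image_mono fun _ hZ => lt_of_lt_of_le hc hZ)

namespace Admissible

variable {b : ℂ}

theorem cubicInv_cubic (hb : Admissible b) {Z : ℂ} (hZ : 1 / 2 ≤ (b * Z).re) :
    cubicInv b (cubic Z) = Z :=
  hb.injOn_closed.leftInvOn_invFunOn hZ

theorem continuousOn_cubicInv (hb : Admissible b) :
    ContinuousOn (cubicInv b) (cubic '' {Z | 1 / 2 ≤ (b * Z).re}) := by
  rw [continuousOn_iff_isClosed]
  intro t ht
  refine ⟨_, hb.isClosed_image_cubic (C := {Z | 1 / 2 ≤ (b * Z).re} ∩ t)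
    ((isClosed_le continuous_const (by fun_prop)).inter ht) inter_subset_left, ?_⟩
  ext X
  constructor
  · rintro ⟨hX, Z, hZ, rfl⟩
    rw [mem_preimage, hb.cubicInv_cubic hZ] at hX
    exact ⟨⟨Z, ⟨hZ, hX⟩, rfl⟩, ⟨Z, hZ, rfl⟩⟩
  · rintro ⟨⟨Z, ⟨hZ, hZt⟩, rfl⟩, h⟩
    refine ⟨?_, h⟩
    rw [mem_preimage, hb.cubicInv_cubic hZ]
    exact hZt

theorem re_mul_add_div (hb : Admissible b) (Z w : ℂ) :
    (b * (Z + w / b)).re = (b * Z).re + w.re := by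
  rw [mul_add, mul_div_cancel₀ _ hb.ne_zero, add_re]

theorem cubic_mem_cap_iff (hb : Admissible b) {Z : ℂ} (hZ : 1 / 2 ≤ (b * Z).re) {c : ℝ}
    (hc : 1 / 2 ≤ c) : cubic Z ∈ cap b c ↔ (b * Z).re < c := by
  rw [← not_le, cap, mem_compl_iff, not_iff_not]
  constructor
  · rintro ⟨W, hW, h⟩
    rwa [← hb.injOn_closed (show W ∈ {Z | 1 / 2 ≤ (b * Z).re} from hc.trans hW) hZ h]
  · exact fun h => ⟨Z, h, rfl⟩

theorem cubic_mem_tile_iff (hb : Admissible b) {Z : ℂ} (hZ : 1 / 2 ≤ (b * Z).re) :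
    cubic Z ∈ tile b ↔ (b * Z).re = 1 / 2 := by
  constructor
  · intro h
    by_contra hne
    exact h ⟨Z, lt_of_le_of_ne hZ (Ne.symm hne), rfl⟩
  · rintro h ⟨W, hW, hWe⟩
    have hW' : 1 / 2 < (b * W).re := hW
    rw [hb.injOn_closed (show W ∈ {Z | 1 / 2 ≤ (b * Z).re} from hW'.le) hZ hWe, h] at hW'
    exact lt_irrefl _ hW'

theorem push_cubic (hb : Admissible b) (s : ℝ → ℝ) {Z : ℂ} (hZ : 1 / 2 ≤ (b * Z).re) :
    push b s (cubic Z) =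
      cubic (Z + ((s ((b * Z).re - 1 / 2) - ((b * Z).re - 1 / 2) : ℝ) : ℂ) / b) := by
  rw [push, if_pos ⟨Z, hZ, rfl⟩, hb.cubicInv_cubic hZ]

theorem push_of_mem_tile (hb : Admissible b) {s : ℝ → ℝ} (hs : s 0 = 0) {X : ℂ}
    (hX : X ∈ tile b) : push b s X = X := by
  by_cases h : X ∈ cubic '' {Z | 1 / 2 ≤ (b * Z).re}
  · obtain ⟨Z, hZ, rfl⟩ := h
    rw [hb.push_cubic s hZ, (hb.cubic_mem_tile_iff hZ).1 hX]
    simp [hs]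
  · rw [push, if_neg h]

theorem isClosed_tile (hb : Admissible b) : IsClosed (tile b) :=
  (hb.isOpen_image_cubic le_rfl).isClosed_compl

theorem isClosed_image_closed (hb : Admissible b) :
    IsClosed (cubic '' {Z | 1 / 2 ≤ (b * Z).re}) :=
  hb.isClosed_image_cubic (isClosed_le continuous_const (by fun_prop)) subset_rfl

theorem mem_tile_or (b X : ℂ) : X ∈ tile b ∨ X ∈ cubic '' {Z | 1 / 2 ≤ (b * Z).re} := by
  by_cases h : X ∈ tile b
  · exact Or.inl h
  · rw [tile, notMem_compl_iff] at h
    obtain ⟨Z, hZ, rfl⟩ := h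
    exact Or.inr ⟨Z, (show 1 / 2 < (b * Z).re from hZ).le, rfl⟩

theorem continuousOn_push (hb : Admissible b) {s : ℝ → ℝ} {B : Set ℂ} (hs0 : s 0 = 0)
    (hs : ∀ Z, 1 / 2 ≤ (b * Z).re → cubic Z ∈ B →
      0 ≤ s ((b * Z).re - 1 / 2) ∧ ContinuousAt s ((b * Z).re - 1 / 2)) :
    ContinuousOn (push b s) B := by
  have hBu : B = (B ∩ tile b) ∪ (B ∩ cubic '' {Z | 1 / 2 ≤ (b * Z).re}) := by
    rw [← inter_union_distrib_left, inter_eq_left.2]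
    exact fun X _ => mem_tile_or b X
  have h1 : ContinuousOn (push b s) (B ∩ tile b) :=
    continuousOn_id.congr fun X hX => hb.push_of_mem_tile hs0 hX.2
  have h2 : ContinuousOn (push b s) (B ∩ cubic '' {Z | 1 / 2 ≤ (b * Z).re}) := by
    have hinv : ContinuousOn (cubicInv b) (B ∩ cubic '' {Z | 1 / 2 ≤ (b * Z).re}) :=
      hb.continuousOn_cubicInv.mono inter_subset_right
    have hmap : MapsTo (cubicInv b) (B ∩ cubic '' {Z | 1 / 2 ≤ (b * Z).re})
        {Z | 1 / 2 ≤ (b * Z).re ∧ cubic Z ∈ B} := by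
      rintro _ ⟨hB, Z, hZ, rfl⟩
      rw [hb.cubicInv_cubic hZ]
      exact ⟨hZ, hB⟩
    have hc : ContinuousOn (fun Z : ℂ =>
        cubic (Z + ((s ((b * Z).re - 1 / 2) - ((b * Z).re - 1 / 2) : ℝ) : ℂ) / b))
        {Z | 1 / 2 ≤ (b * Z).re ∧ cubic Z ∈ B} := by
      rintro Z ⟨hZ, hZB⟩
      obtain ⟨hs1, hs2⟩ := hs Z hZ hZB
      refine ContinuousAt.continuousWithinAt ?_
      have hin : ContinuousAt (fun Z : ℂ =>
          Z + ((s ((b * Z).re - 1 / 2) - ((b * Z).re - 1 / 2) : ℝ) : ℂ) / b) Z := by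
        have h3 : ContinuousAt (fun Z : ℂ => (b * Z).re - 1 / 2) Z := by fun_prop
        have h4 : ContinuousAt (fun Z : ℂ => s ((b * Z).re - 1 / 2)) Z :=
          ContinuousAt.comp (f := fun Z : ℂ => (b * Z).re - 1 / 2) hs2 h3
        exact continuousAt_id.add ((continuous_ofReal.continuousAt.comp (h4.sub h3)).div_const b)
      refine ContinuousAt.comp (g := cubic) (continuousAt_cubic (hb.pole_ne ?_)) hin
      rw [hb.re_mul_add_div, ofReal_re]
      linarith
    refine (hc.comp hinv hmap).congr ?_
    rintro _ ⟨-, Z, hZ, rfl⟩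
    rw [Function.comp_apply, hb.push_cubic s hZ, hb.cubicInv_cubic hZ]
  intro X hX
  rw [hBu]
  have aux : ∀ C : Set ℂ, IsClosed C → ContinuousOn (push b s) (B ∩ C) →
      ContinuousWithinAt (push b s) (B ∩ C) X := by
    intro C hC hcont
    by_cases h : X ∈ C
    · exact hcont X ⟨hX, h⟩
    · refine continuousWithinAt_of_notMem_closure fun h' => h ?_
      rw [← hC.closure_eq]
      exact closure_mono inter_subset_right h'
  exact (aux _ hb.isClosed_tile h1).union (aux _ hb.isClosed_image_closed h2)

/-- The region `cap b c` is a copy of the plane: pushing along the family of lines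
`Re (b Z) = const` opens up `[1/2, c)` to `[1/2, ∞)`. -/
theorem exists_retract_cap (hb : Admissible b) {c : ℝ} (hc : 1 / 2 < c) :
    ∃ i r : ℂ → ℂ, ContinuousOn i (cap b c) ∧ Continuous r ∧ (∀ z, r z ∈ cap b c) ∧
      ∀ z ∈ cap b c, r (i z) = z := by
  set e := c - 1 / 2 with he
  have he0 : 0 < e := by linarith
  -- the two pushes are inverse bijections between `[0, e)` and `[0, ∞)`
  refine ⟨push b fun d => e * d / (e - d), push b fun d => e * d / (e + d), ?_, ?_, ?_, ?_⟩
  · refine hb.continuousOn_push (by simp) fun Z hZ hZc => ?_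
    have h1 : (b * Z).re < c := (hb.cubic_mem_cap_iff hZ hc.le).1 hZc
    have h2 : 0 < e - ((b * Z).re - 1 / 2) := by linarith
    have h3 : 0 ≤ (b * Z).re - 1 / 2 := by linarith
    refine ⟨by positivity, ?_⟩
    exact (by fun_prop : ContinuousAt (fun d => e * d) _).div (by fun_prop) h2.ne'
  · rw [← continuousOn_univ]
    refine hb.continuousOn_push (by simp) fun Z hZ _ => ?_
    have h3 : 0 ≤ (b * Z).re - 1 / 2 := by linarith
    refine ⟨by positivity, ?_⟩
    exact (by fun_prop : ContinuousAt (fun d => e * d) _).div (by fun_prop) (by positivity)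
  · intro X
    rcases mem_tile_or b X with hX | ⟨Z, hZ, rfl⟩
    · rw [hb.push_of_mem_tile (by simp) hX]
      exact tile_subset_cap b hc hX
    · have h3 : 0 ≤ (b * Z).re - 1 / 2 := by linarith [show 1 / 2 ≤ (b * Z).re from hZ]
      rw [hb.push_cubic _ hZ, hb.cubic_mem_cap_iff _ hc.le, hb.re_mul_add_div, ofReal_re]
      · have : e * ((b * Z).re - 1 / 2) / (e + ((b * Z).re - 1 / 2)) < e := by
          rw [div_lt_iff₀ (by positivity)]; nlinarith
        linarith
      · rw [hb.re_mul_add_div, ofReal_re]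
        have : 0 ≤ e * ((b * Z).re - 1 / 2) / (e + ((b * Z).re - 1 / 2)) := by positivity
        linarith
  · intro X hX
    rcases mem_tile_or b X with hXt | ⟨Z, hZ, rfl⟩
    · rw [hb.push_of_mem_tile (by simp) hXt, hb.push_of_mem_tile (by simp) hXt]
    · have h1 : (b * Z).re < c := (hb.cubic_mem_cap_iff hZ hc.le).1 hX
      rw [hb.push_cubic _ hZ]
      set d := (b * Z).re - 1 / 2 with hd
      have h2 : 0 < e - d := by linarith
      have h3 : 0 ≤ d := by linarith [show 1 / 2 ≤ (b * Z).re from hZ]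
      have h4 : 0 ≤ e * d / (e - d) := by positivity
      have h5 : (b * (Z + ((e * d / (e - d) - d : ℝ) : ℂ) / b)).re - 1 / 2 = e * d / (e - d) := by
        rw [hb.re_mul_add_div, ofReal_re]; linarith
      have h6 : e * (e * d / (e - d)) / (e + e * d / (e - d)) = d := by
        field_simp
        ring
      rw [hb.push_cubic _ (by linarith), h5, h6, add_assoc, ← add_div, ← ofReal_add]
      simp

theorem hasContLog_cap (hb : Admissible b) {c : ℝ} (hc : 1 / 2 < c) : HasContLog (cap b c) := by
  obtain ⟨i, r, hi, hr, hrA, hri⟩ := hb.exists_retract_cap hc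
  exact hasContLog_of_retract hi hr hrA hri

theorem isPreconnected_cap (hb : Admissible b) {c : ℝ} (hc : 1 / 2 < c) :
    IsPreconnected (cap b c) := by
  obtain ⟨i, r, hi, hr, hrA, hri⟩ := hb.exists_retract_cap hc
  have : cap b c = range r :=
    Subset.antisymm (fun z hz => ⟨i z, hri z hz⟩) (range_subset_iff.2 hrA)
  rw [this]
  exact isPreconnected_range hr

theorem isOpen_cap (hb : Admissible b) {c : ℝ} (hc : 1 / 2 ≤ c) : IsOpen (cap b c) :=
  (hb.isClosed_image_cubic (C := {Z | c ≤ (b * Z).re})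
    (isClosed_le continuous_const (by fun_prop)) fun Z hZ => hc.trans hZ).isOpen_compl

theorem zero_mem_cap (hb : Admissible b) {c : ℝ} (hc : 1 / 2 ≤ c) : (0 : ℂ) ∈ cap b c := by
  rintro ⟨Z, hZ, h⟩
  have hZ' : c ≤ (b * Z).re := hZ
  have hp := hb.pole_ne (Z := Z) (by linarith)
  rw [cubic, div_eq_zero_iff, or_iff_left hp, pow_eq_zero_iff three_ne_zero] at h
  rw [h] at hZ'
  simp at hZ'
  linarith

theorem isAnalyticBoundaryPt (hb : Admissible b) {Z₀ : ℂ} (hZ₀ : (b * Z₀).re = 1 / 2) :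
    IsAnalyticBoundaryPt (cap b (1 / 2)) (cubic Z₀) := by
  have hp := hb.pole_ne (Z := Z₀) (by rw [hZ₀]; norm_num)
  have hd := hb.deriv_ne (Z := Z₀) (by rw [hZ₀]; norm_num)
  have h1 : ∀ᶠ Z in 𝓝 Z₀, (hasDerivAt_cubic hp).localInverse cubic _ Z₀ hd (cubic Z) = Z :=
    ((hasDerivAt_cubic hp).hasStrictFDerivAt_equiv hd).eventually_left_inverse
  have h2 : ∀ᶠ Z : ℂ in 𝓝 Z₀, 1 + 3 * Z ≠ 0 :=
    (by fun_prop : ContinuousAt (fun Z : ℂ => 1 + 3 * Z) Z₀).eventually_ne hp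
  have h3 : ∀ᶠ Z in 𝓝 Z₀, maxRe b Z < 1 / 2 :=
    (continuousAt_maxRe b hp).eventually_lt continuousAt_const (hb.maxRe_lt hZ₀.ge)
  have hc : ContinuousAt (fun ζ : ℂ => Z₀ + I * ζ / b) 0 := by fun_prop
  have hc0 : Z₀ + I * 0 / b = Z₀ := by simp
  obtain ⟨δ, hδ, hball⟩ := Metric.eventually_nhds_iff_ball.1
    (hc.tendsto.eventually (by simp only [hc0]; exact h1.and (h2.and h3)))
  refine ⟨fun ζ => cubic (Z₀ + I * ζ / b), δ, hδ, ?_, ?_, by simp only [hc0], ?_⟩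
  · intro ζ hζ
    have := (hasDerivAt_cubic (hball ζ hζ).2.1).hasDerivAt.differentiableAt
    exact (DifferentiableAt.comp (g := cubic) ζ this (by fun_prop)).differentiableWithinAt
  · intro ζ hζ ζ' hζ' h
    simp only at h
    have e := (hball ζ hζ).1
    rw [h, (hball ζ' hζ').1] at e
    have := hb.ne_zero
    field_simp at e
    simpa using e.symm
  · intro ζ hζ
    have hre : (b * (Z₀ + I * ζ / b)).re = 1 / 2 - ζ.im := by
      rw [hb.re_mul_add_div, hZ₀]; simp; ring
    constructor
    · intro h
      by_contra! hle
      exact h ⟨_, by rw [mem_ofPred_eq, hre]; linarith, rfl⟩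
    · rintro h ⟨W, hW, hWe⟩
      have := hb.eq_of_cubic_eq (hball ζ hζ).2.1 (hball ζ hζ).2.2 hW hWe.symm
      rw [← this, mem_ofPred_eq, hre] at hW
      linarith

theorem tile_eq (b : ℂ) (hb : Admissible b) :
    tile b = cap b (1 / 2) ∪ cubic '' {Z | (b * Z).re = 1 / 2} := by
  ext X
  constructor
  · intro hX
    by_cases h : X ∈ cap b (1 / 2)
    · exact Or.inl h
    · rw [cap, notMem_compl_iff] at h
      obtain ⟨Z, hZ, rfl⟩ := h
      exact Or.inr ⟨Z, (hb.cubic_mem_tile_iff hZ).1 hX, rfl⟩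
  · rintro (hX | ⟨Z, hZ, rfl⟩)
    · exact fun ⟨Z, hZ, h⟩ => hX ⟨Z, (show 1 / 2 < (b * Z).re from hZ).le, h⟩
    · exact (hb.cubic_mem_tile_iff (show _ = _ from hZ).ge).2 hZ

theorem closure_cap (hb : Admissible b) : closure (cap b (1 / 2)) = tile b := by
  rw [hb.tile_eq]
  refine Subset.antisymm ?_ (union_subset subset_closure ?_)
  · rw [← hb.tile_eq]
    refine closure_minimal ?_ hb.isClosed_tile
    rw [hb.tile_eq]
    exact subset_union_left
  · rintro _ ⟨Z, hZ, rfl⟩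
    obtain ⟨κ, δ, hδ, hκd, hκi, hκ0, hκU⟩ := hb.isAnalyticBoundaryPt hZ
    have h0 : (0 : ℂ) ∈ closure (upperHalfBall δ) := by
      rw [mem_closure_iff_nhdsWithin_neBot]
      have := tendsto_add_mul_I (x := 0) (δ := δ) (by simpa using hδ)
      rw [ofReal_zero] at this
      exact this.neBot
    have hκ : ContinuousWithinAt κ (upperHalfBall δ) 0 :=
      ((hκd.differentiableAt (ball_mem_nhds 0 hδ)).continuousAt).continuousWithinAt
    have h1 := hκ.mem_closure h0 (t := cap b (1 / 2)) fun ζ hζ =>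
      (hκU ζ (by simpa using hζ.1)).2 hζ.2
    rwa [hκ0] at h1

theorem disjoint_cap_line (b : ℂ) : Disjoint (cap b (1 / 2)) (cubic '' {Z | (b * Z).re = 1 / 2}) := by
  rw [disjoint_right]
  rintro _ ⟨Z, hZ, rfl⟩ h
  exact h ⟨Z, (show _ = _ from hZ).ge, rfl⟩

theorem tile_diff_cap (hb : Admissible b) :
    tile b \ cap b (1 / 2) = cubic '' {Z | (b * Z).re = 1 / 2} := by
  rw [hb.tile_eq, union_sdiff_left, sdiff_eq_left]
  exact (disjoint_cap_line b).symm

theorem interior_tile (hb : Admissible b) : interior (tile b) = cap b (1 / 2) := by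
  refine Subset.antisymm ?_ (interior_maximal ?_ (hb.isOpen_cap le_rfl))
  · intro X hX
    have hX' := interior_subset hX
    rw [hb.tile_eq] at hX'
    refine hX'.resolve_right ?_
    rintro ⟨Z, hZ, rfl⟩
    have hZ' : (b * Z).re = 1 / 2 := hZ
    -- `cubic (Z + t / b)` with small `t > 0` is outside the tile
    have hc : Tendsto (fun t : ℝ => cubic (Z + (t : ℂ) / b)) (𝓝[>] 0) (𝓝 (cubic Z)) := by
      have h1 : ContinuousAt (fun t : ℝ => Z + (t : ℂ) / b) 0 := by fun_prop
      have h2 : ContinuousAt cubic (Z + ((0 : ℝ) : ℂ) / b) := by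
        simpa using continuousAt_cubic (hb.pole_ne (Z := Z) (by rw [hZ']; norm_num))
      have h3 := ContinuousAt.comp (f := fun t : ℝ => Z + (t : ℂ) / b) h2 h1
      have h4 := h3.tendsto
      simp only [Function.comp_apply, ofReal_zero, zero_div, add_zero] at h4
      exact h4.mono_left nhdsWithin_le_nhds
    obtain ⟨t, ht1, ht2⟩ := ((hc.eventually (isOpen_interior.mem_nhds hX)).and
      self_mem_nhdsWithin).exists
    have ht3 : 0 < t := ht2
    refine interior_subset ht1 ⟨_, ?_, rfl⟩
    rw [mem_ofPred_eq, hb.re_mul_add_div, hZ', ofReal_re]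
    linarith
  · rw [hb.tile_eq]; exact subset_union_left

theorem isPreconnected_boundary (hb : Admissible b) :
    IsPreconnected (cubic '' {Z | (b * Z).re = 1 / 2}) :=
  hb.isPreconnected_line.image _ (hb.continuousOn_cubic.mono fun _ hZ => (show _ = _ from hZ).ge)

theorem isPreconnected_open_tile (hb : Admissible b) : IsPreconnected (cap b (1 / 2)) := by
  refine isPreconnected_of_isAnalyticBoundaryPt (hb.isOpen_cap le_rfl) ?_ ?_ <;>
    rw [hb.closure_cap, hb.tile_diff_cap]
  · exact hb.isPreconnected_boundary
  · rintro _ ⟨Z, hZ, rfl⟩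
    exact hb.isAnalyticBoundaryPt hZ

/-- A disc in the complement of all the regions `cap b c`, `1 / 2 < c ≤ 1`. -/
theorem exists_exterior_ball (hb : Admissible b) : ∃ (x₀ : ℂ) (η : ℝ), 0 < η ∧ x₀ ≠ 0 ∧
    ∀ c ≤ (1 : ℝ), ∀ z ∈ cap b c, η ≤ ‖z - x₀‖ := by
  have hre : (b * (2 / b)).re = 2 := by rw [mul_div_cancel₀ _ hb.ne_zero]; simp
  have hx : cubic (2 / b) ∈ cubic '' {Z | 1 < (b * Z).re} := ⟨_, by
    rw [mem_ofPred_eq, hre]; norm_num, rfl⟩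
  obtain ⟨η, hη, hball⟩ := Metric.isOpen_iff.1 (hb.isOpen_image_cubic (c := 1) (by norm_num)) _ hx
  refine ⟨cubic (2 / b), η, hη, ?_, fun c hc z hz => ?_⟩
  · intro h
    refine hb.zero_mem_cap (c := 1) (by norm_num) ⟨2 / b, ?_, h⟩
    rw [mem_ofPred_eq, hre]; norm_num
  · by_contra! hlt
    obtain ⟨Z, hZ, rfl⟩ := hball (show z ∈ ball _ η by rwa [mem_ball, dist_eq_norm])
    exact hz ⟨Z, hc.trans (show 1 < (b * Z).re from hZ).le, rfl⟩

theorem exists_isRiemannPair (hb : Admissible b) :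
    ∃ φ g : ℂ → ℂ, IsRiemannPair (cap b (1 / 2)) φ g ∧ φ 0 = 0 := by
  obtain ⟨x₀, η, hη, -, hx⟩ := hb.exists_exterior_ball
  have hcj : ∀ j : ℕ, (1 / 2 : ℝ) < 1 / 2 + 1 / (j + 2) ∧ 1 / 2 + 1 / ((j : ℝ) + 2) ≤ 1 := by
    intro j
    have h2 : (0 : ℝ) < j + 2 := by positivity
    refine ⟨by linarith [one_div_pos.2 h2], ?_⟩
    have : 1 / ((j : ℝ) + 2) ≤ 1 / 2 := one_div_le_one_div_of_le two_pos (by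
      linarith [(Nat.cast_nonneg j : (0 : ℝ) ≤ j)])
    linarith
  refine exists_isRiemannPair_of_kernel (K := tile b) (V := fun j => cap b (1 / 2 + 1 / (j + 2)))
    (hb.isOpen_cap le_rfl) hb.isPreconnected_open_tile (hb.zero_mem_cap le_rfl)
    (fun j => hb.isOpen_cap (hcj j).1.le) (fun j => hb.isPreconnected_cap (hcj j).1)
    (fun j => hb.hasContLog_cap (hcj j).1) (fun j => ?_) hη
    (fun j => hx _ (hcj j).2) ?_ hb.interior_tile.le
  · refine Subset.trans ?_ (tile_subset_cap b (hcj j).1)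
    rw [hb.tile_eq]; exact subset_union_left
  · intro x hxK
    rw [tile, notMem_compl_iff] at hxK
    obtain ⟨Z, hZ, rfl⟩ := hxK
    obtain ⟨c, hc1, hc2⟩ := exists_between (show 1 / 2 < (b * Z).re from hZ)
    refine ⟨_, (hb.isOpen_image_cubic hc1.le).mem_nhds ⟨Z, hc2, rfl⟩, ?_⟩
    have hlim : Tendsto (fun j : ℕ => 1 / 2 + 1 / ((j : ℝ) + 2)) atTop (𝓝 (1 / 2 + 0)) := by
      refine Tendsto.const_add _ ?_
      have := (tendsto_one_div_add_atTop_nhds_zero_nat (𝕜 := ℝ)).comp (tendsto_add_atTop_nat 1)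
      refine this.congr fun j => ?_
      simp only [Function.comp_apply, Nat.cast_add, Nat.cast_one]
      norm_num [add_assoc]
    rw [add_zero] at hlim
    filter_upwards [hlim.eventually_lt_const hc1] with j hj
    rw [disjoint_left]
    rintro _ ⟨W, hW, rfl⟩ hn
    exact hn ⟨W, hj.le.trans (show c < (b * W).re from hW).le, rfl⟩

end Admissible

/-! ### Uniformization of the fundamental tile -/

/-- `Φ` and `G` are mutually inverse homeomorphisms between `K` and the closed unit disc without the
boundary point `q`; they carry `U` to the open disc and are holomorphic there. -/
structure IsUniformization (U K : Set ℂ) (q : ℂ) (Φ G : ℂ → ℂ) : Prop where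
  norm_q : ‖q‖ = 1
  diff : DifferentiableOn ℂ Φ U
  diff_inv : DifferentiableOn ℂ G (ball 0 1)
  maps_open : MapsTo Φ U (ball 0 1)
  maps_inv_open : MapsTo G (ball 0 1) U
  cont : ContinuousOn Φ K
  cont_inv : ContinuousOn G (closedBall 0 1 \ {q})
  maps : MapsTo Φ K (closedBall 0 1 \ {q})
  maps_inv : MapsTo G (closedBall 0 1 \ {q}) K
  left_inv : LeftInvOn G Φ K
  right_inv : LeftInvOn Φ G (closedBall 0 1 \ {q})
  map_zero : Φ 0 = 0

/-- The Möbius map `X ↦ X x₀ / (x₀ - X)`, which carries `x₀` to infinity and fixes `0`. -/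
noncomputable def mobius (x₀ X : ℂ) : ℂ := X * x₀ / (x₀ - X)

/-- The inverse of `mobius x₀`. -/
noncomputable def mobiusInv (x₀ Y : ℂ) : ℂ := Y * x₀ / (x₀ + Y)

theorem mobius_add {x₀ X : ℂ} (h : X ≠ x₀) : x₀ + mobius x₀ X = x₀ ^ 2 / (x₀ - X) := by
  have : x₀ - X ≠ 0 := sub_ne_zero.2 h.symm
  rw [mobius]; field_simp; ring

theorem mobius_ne {x₀ X : ℂ} (h0 : x₀ ≠ 0) (h : X ≠ x₀) : x₀ + mobius x₀ X ≠ 0 := by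
  rw [mobius_add h]
  exact div_ne_zero (pow_ne_zero _ h0) (sub_ne_zero.2 h.symm)

theorem sub_mobiusInv {x₀ Y : ℂ} (h : x₀ + Y ≠ 0) : x₀ - mobiusInv x₀ Y = x₀ ^ 2 / (x₀ + Y) := by
  rw [mobiusInv]; field_simp; ring

theorem mobiusInv_ne {x₀ Y : ℂ} (h0 : x₀ ≠ 0) (h : x₀ + Y ≠ 0) : mobiusInv x₀ Y ≠ x₀ := by
  intro e
  have := sub_mobiusInv h
  rw [e, sub_self] at this
  exact div_ne_zero (pow_ne_zero 2 h0) h this.symm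

theorem mobiusInv_mobius {x₀ X : ℂ} (h0 : x₀ ≠ 0) (h : X ≠ x₀) :
    mobiusInv x₀ (mobius x₀ X) = X := by
  have : x₀ - X ≠ 0 := sub_ne_zero.2 h.symm
  rw [mobiusInv, mobius_add h, mobius]; field_simp

theorem mobius_mobiusInv {x₀ Y : ℂ} (h0 : x₀ ≠ 0) (h : x₀ + Y ≠ 0) :
    mobius x₀ (mobiusInv x₀ Y) = Y := by
  rw [mobius, sub_mobiusInv h, mobiusInv]; field_simp

theorem differentiableAt_mobius {x₀ X : ℂ} (h : X ≠ x₀) : DifferentiableAt ℂ (mobius x₀) X := by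
  have : x₀ - X ≠ 0 := sub_ne_zero.2 h.symm
  unfold mobius
  fun_prop (disch := assumption)

theorem differentiableAt_mobiusInv {x₀ Y : ℂ} (h : x₀ + Y ≠ 0) :
    DifferentiableAt ℂ (mobiusInv x₀) Y := by
  unfold mobiusInv
  fun_prop (disch := assumption)

namespace Admissible

variable {b : ℂ}

theorem exists_norm_gt (hb : Admissible b) (M : ℝ) : ∃ X ∈ cap b (1 / 2), M < ‖X‖ := by
  by_contra! h
  have h1 : tile b ⊆ closedBall 0 M := by
    rw [← hb.closure_cap]
    exact closure_minimal (fun X hX => by simpa using h X hX) isClosed_closedBall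
  set t : ℝ := ‖b‖ * (2 + 4 * M) with ht
  set Z : ℂ := ((1 / 2 : ℝ) + t * I) / b with hZ
  have hbZ : b * Z = (1 / 2 : ℝ) + t * I := by rw [hZ, mul_div_cancel₀ _ hb.ne_zero]
  have hre : (b * Z).re = 1 / 2 := by rw [hbZ]; simp
  have h2 := norm_le_of_norm_cubic_le (hb.pole_ne (Z := Z) (by rw [hre]; norm_num))
    (mem_closedBall_zero_iff.1 (h1 ((hb.cubic_mem_tile_iff hre.ge).2 hre)))
  have h3 : t ≤ ‖b * Z‖ := by
    refine le_trans ?_ ((le_abs_self _).trans (abs_im_le_norm _))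
    rw [hbZ]; simp
  rw [norm_mul, ht] at h3
  have h4 := le_of_mul_le_mul_left h3 hb.norm_pos
  linarith

theorem zero_mem_tile (hb : Admissible b) : (0 : ℂ) ∈ tile b := by
  rw [hb.tile_eq]; exact Or.inl (hb.zero_mem_cap le_rfl)

/-- The fundamental tile is uniformized by the closed disc without a boundary point. The Möbius map
with pole at an exterior point `x₀` makes the tile bounded, and sends the cusp, which is infinity in
the coordinate `X`, to the boundary point `-x₀`. -/
theorem exists_isUniformization (hb : Admissible b) :
    ∃ q Φ G, IsUniformization (cap b (1 / 2)) (tile b) q Φ G := by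
  obtain ⟨φ, g, h, hφ0⟩ := hb.exists_isRiemannPair
  obtain ⟨x₀, η, hη, hx0, hx⟩ := hb.exists_exterior_ball
  set U := cap b (1 / 2) with hU
  have hUK : U ⊆ tile b := by rw [hb.tile_eq]; exact subset_union_left
  have hxU : ∀ X ∈ U, η ≤ ‖X - x₀‖ := hx _ (by norm_num)
  have hneK : ∀ X ∈ tile b, X ≠ x₀ := by
    rintro X hX rfl
    have := hx 1 le_rfl X (tile_subset_cap b (by norm_num) hX)
    rw [sub_self, norm_zero] at this
    linarith
  set U' : Set ℂ := {Y | x₀ + Y ≠ 0 ∧ mobiusInv x₀ Y ∈ U} with hU'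
  have hNU : MapsTo (mobius x₀) U U' := fun X hX =>
    ⟨mobius_ne hx0 (hneK X (hUK hX)), by rwa [mobiusInv_mobius hx0 (hneK X (hUK hX))]⟩
  have hcl : closure U' \ {-x₀} = {Y | x₀ + Y ≠ 0 ∧ mobiusInv x₀ Y ∈ tile b} := by
    ext Y
    have hiff : Y ∉ ({-x₀} : Set ℂ) ↔ x₀ + Y ≠ 0 := by
      rw [mem_singleton_iff, not_iff_not, eq_neg_iff_add_eq_zero, add_comm]
    constructor
    · rintro ⟨hY, hYp⟩
      rw [hiff] at hYp
      refine ⟨hYp, ?_⟩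
      rw [← hb.closure_cap]
      exact (differentiableAt_mobiusInv hYp).continuousAt.continuousWithinAt.mem_closure hY
        fun W hW => hW.2
    · rintro ⟨hY, hYK⟩
      refine ⟨?_, hiff.2 hY⟩
      rw [← hb.closure_cap] at hYK
      have := (differentiableAt_mobius (mobiusInv_ne hx0 hY)).continuousAt.continuousWithinAt.mem_closure
        hYK hNU
      rwa [mobius_mobiusInv hx0 hY] at this
  have hbd : (closure U' \ U') \ {-x₀} = mobius x₀ '' (cubic '' {Z | (b * Z).re = 1 / 2}) := by
    rw [sdiff_sdiff_comm, hcl, ← hb.tile_diff_cap]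
    ext Y
    constructor
    · rintro ⟨⟨hY, hYK⟩, hYU⟩
      exact ⟨mobiusInv x₀ Y, ⟨hYK, fun h => hYU ⟨hY, h⟩⟩, mobius_mobiusInv hx0 hY⟩
    · rintro ⟨X, ⟨hXK, hXU⟩, rfl⟩
      have hX := hneK X hXK
      refine ⟨⟨mobius_ne hx0 hX, by rwa [mobiusInv_mobius hx0 hX]⟩, fun h => hXU ?_⟩
      have := h.2
      rwa [mobiusInv_mobius hx0 hX] at this
  have hlineK : cubic '' {Z | (b * Z).re = 1 / 2} ⊆ tile b := by
    rw [hb.tile_eq]; exact subset_union_right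
  have hpair : IsRiemannPair U' (φ ∘ mobiusInv x₀) (mobius x₀ ∘ g) := by
    refine ⟨?_, ?_, ?_, ?_, ?_, ?_, ?_⟩
    · have hc : ContinuousOn (mobiusInv x₀) {Y | x₀ + Y ≠ 0} := fun Y hY =>
        (differentiableAt_mobiusInv hY).continuousAt.continuousWithinAt
      exact hc.isOpen_inter_preimage (isOpen_ne_fun (by fun_prop) (by fun_prop)) h.isOpen
    · exact h.diff.comp (fun Y hY => (differentiableAt_mobiusInv hY.1).differentiableWithinAt)
        fun Y hY => hY.2
    · intro z hz
      exact (differentiableAt_mobius (hneK _ (hUK (h.maps_inv hz)))).comp_differentiableWithinAt z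
        (h.diff_inv z hz)
    · exact fun Y hY => h.maps hY.2
    · exact fun z hz => hNU (h.maps_inv hz)
    · intro Y hY
      simp only [Function.comp_apply, h.left_inv hY.2, mobius_mobiusInv hx0 hY.1]
    · intro z hz
      simp only [Function.comp_apply, mobiusInv_mobius hx0 (hneK _ (hUK (h.maps_inv hz))),
        h.right_inv hz]
  have hbdd : Bornology.IsBounded U' := by
    refine (isBounded_iff_subset_closedBall (-x₀)).2 ⟨‖x₀‖ ^ 2 / η, fun Y hY => ?_⟩
    have h1 := mobius_add (hneK _ (hUK hY.2))
    rw [mobius_mobiusInv hx0 hY.1] at h1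
    rw [mem_closedBall, dist_eq_norm, sub_neg_eq_add, add_comm, h1, norm_div, norm_pow,
      norm_sub_rev]
    exact div_le_div_of_nonneg_left (by positivity) hη (hxU _ hY.2)
  have hp : -x₀ ∈ closure U' \ U' := by
    refine ⟨Metric.mem_closure_iff.2 fun ε hε => ?_, fun h => h.1 (by ring)⟩
    obtain ⟨X, hX, hXn⟩ := hb.exists_norm_gt (‖x₀‖ + ‖x₀‖ ^ 2 / ε)
    refine ⟨mobius x₀ X, hNU hX, ?_⟩
    have h1 : ‖x₀‖ ^ 2 / ε < ‖x₀ - X‖ := by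
      have := norm_sub_norm_le X x₀
      rw [norm_sub_rev] at this
      linarith
    have h2 : 0 < ‖x₀ - X‖ := lt_of_le_of_lt (by positivity) h1
    rw [dist_eq_norm, ← norm_neg, neg_sub, sub_neg_eq_add, add_comm,
      mobius_add (hneK _ (hUK hX)), norm_div, norm_pow, div_lt_iff₀ h2]
    rw [div_lt_iff₀ hε] at h1
    linarith
  obtain ⟨q, Φ, G, hq, hΦφ, hGg, hΦc, hGc, hΦm, hGm, hGΦ, hΦG⟩ := hpair.exists_extension hbdd hp
    (by
      rw [hbd]
      exact hb.isPreconnected_boundary.image _ fun X hX =>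
        (differentiableAt_mobius (hneK _ (hlineK hX))).continuousAt.continuousWithinAt)
    (by
      rw [hbd]
      rintro _ ⟨_, ⟨Z, hZ, rfl⟩, rfl⟩
      obtain ⟨κ, δ, hδ, hκd, hκi, hκ0, hκU⟩ := hb.isAnalyticBoundaryPt hZ
      have hne : ∀ᶠ ζ in 𝓝 (0 : ℂ), κ ζ ≠ x₀ := by
        refine (hκd.differentiableAt (ball_mem_nhds 0 hδ)).continuousAt.eventually_ne ?_
        rw [hκ0]
        exact hneK _ (hlineK ⟨Z, hZ, rfl⟩)
      obtain ⟨δ', hδ', hball⟩ := Metric.eventually_nhds_iff_ball.1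
        (hne.and (ball_mem_nhds (0 : ℂ) hδ))
      refine ⟨mobius x₀ ∘ κ, δ', hδ', ?_, ?_, ?_, ?_⟩
      · intro ζ hζ
        exact (differentiableAt_mobius (hball ζ hζ).1).comp_differentiableWithinAt ζ
          ((hκd ζ (hball ζ hζ).2).mono fun w hw => (hball w hw).2)
      · intro ζ hζ ζ' hζ' he
        simp only [Function.comp_apply] at he
        have e := mobiusInv_mobius hx0 (hball ζ hζ).1
        rw [he, mobiusInv_mobius hx0 (hball ζ' hζ').1] at e
        exact hκi (hball ζ hζ).2 (hball ζ' hζ').2 e.symm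
      · rw [Function.comp_apply, hκ0]
      · intro ζ hζ
        rw [← hκU ζ (hball ζ hζ).2]
        have h1 := hball ζ hζ
        constructor
        · intro h2
          have h3 := h2.2
          rwa [Function.comp_apply, mobiusInv_mobius hx0 h1.1] at h3
        · exact fun h2 => hNU h2)
  rw [hcl] at hΦc hΦm hGm hGΦ
  have hNK : MapsTo (mobius x₀) (tile b) {Y | x₀ + Y ≠ 0 ∧ mobiusInv x₀ Y ∈ tile b} :=
    fun X hX => ⟨mobius_ne hx0 (hneK X hX), by rwa [mobiusInv_mobius hx0 (hneK X hX)]⟩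
  have hqb : ball (0 : ℂ) 1 ⊆ closedBall 0 1 \ {q} := fun z hz => by
    refine ⟨ball_subset_closedBall hz, ?_⟩
    rintro rfl
    rw [mem_ball_zero_iff, hq] at hz
    exact lt_irrefl _ hz
  have hΦU : EqOn (Φ ∘ mobius x₀) φ U := fun X hX => by
    rw [Function.comp_apply, hΦφ (hNU hX), Function.comp_apply,
      mobiusInv_mobius hx0 (hneK X (hUK hX))]
  have hGD : EqOn (mobiusInv x₀ ∘ G) g (ball 0 1) := fun z hz => by
    rw [Function.comp_apply, hGg hz, Function.comp_apply,
      mobiusInv_mobius hx0 (hneK _ (hUK (h.maps_inv hz)))]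
  refine ⟨q, Φ ∘ mobius x₀, mobiusInv x₀ ∘ G, hq, h.diff.congr hΦU, h.diff_inv.congr hGD,
    fun X hX => hΦU hX ▸ h.maps hX, fun z hz => hGD hz ▸ h.maps_inv hz, ?_, ?_, ?_, ?_, ?_, ?_, ?_⟩
  · exact hΦc.comp (fun X hX =>
      (differentiableAt_mobius (hneK X hX)).continuousAt.continuousWithinAt) hNK
  · intro z hz
    exact (differentiableAt_mobiusInv (hGm hz).1).continuousAt.comp_continuousWithinAt (hGc z hz)
  · exact hΦm.comp hNK
  · exact fun z hz => (hGm hz).2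
  · intro X hX
    rw [Function.comp_apply, Function.comp_apply, hGΦ (hNK hX), mobiusInv_mobius hx0 (hneK X hX)]
  · intro z hz
    rw [Function.comp_apply, Function.comp_apply, mobius_mobiusInv hx0 (hGm hz).1, hΦG hz]
  · rw [hΦU (hb.zero_mem_cap le_rfl), hφ0]

end Admissible

/-! ### The reflected ideal triangles -/

theorem norm_eq_one_of_cube {ζ : ℂ} (h : ζ ^ 3 = 1) : ‖ζ‖ = 1 :=
  Complex.norm_eq_one_of_pow_eq_one h three_ne_zero

theorem exists_rotation {z w : ℂ} (h : z ^ 3 = w ^ 3) : ∃ ζ : ℂ, ζ ^ 3 = 1 ∧ z = ζ * w := by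
  by_cases hw : w = 0
  · refine ⟨1, one_pow 3, ?_⟩
    rw [hw, zero_pow three_ne_zero, pow_eq_zero_iff three_ne_zero] at h
    rw [h, hw, mul_zero]
  · exact ⟨z / w, by rw [div_pow, h, div_self (pow_ne_zero 3 hw)], by field_simp⟩

/-- The sign of `side z` tells whether `z` is outside or inside the circle `C₂` with centre `-2` and
radius `√3`: in fact `side z = ‖z + 2‖² - 3`. -/
def side (z : ℂ) : ℝ := normSq z + 4 * z.re + 1

/-- The reflection in the circle `C₂`. -/
noncomputable def refl (z : ℂ) : ℂ := -2 + 3 / (conj z + 2)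

/-- The ideal triangle, closed in the disc. -/
def triangle : Set ℂ := {z | ‖z‖ < 1 ∧ ∀ ζ : ℂ, ζ ^ 3 = 1 → 0 ≤ side (ζ * z)}

/-- The union of the translates of the ideal triangle that are reached after at most `n`
reflections: the points of the disc that the model map takes to the triangle in at most `n` steps. -/
def model : ℕ → Set ℂ
  | 0 => triangle
  | n + 1 => triangle ∪
      {z | ‖z‖ < 1 ∧ ∃ ζ : ℂ, ζ ^ 3 = 1 ∧ side (ζ * z) ≤ 0 ∧ refl (ζ * z) ∈ model n}

/-- The image of `model n` in the quotient of the disc by the rotations of order three, in the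
coordinate `ξ = z³`. -/
def quot (n : ℕ) : Set ℂ := (fun z : ℂ => z ^ 3) '' model n

theorem side_eq (z : ℂ) : side z = normSq (z + 2) - 3 := by
  rw [side, normSq_apply, normSq_apply, add_re, add_im]; norm_num; ring

theorem side_zero : side 0 = 1 := by simp [side]

theorem continuous_side : Continuous side := by
  unfold side
  exact (continuous_normSq.add (continuous_const.mul continuous_re)).add continuous_const

theorem normSq_lt_one {z : ℂ} (h : ‖z‖ < 1) : normSq z < 1 := by
  rw [normSq_eq_norm_sq]; nlinarith [norm_nonneg z]

theorem add_two_ne {z : ℂ} (h : ‖z‖ < 1) : z + 2 ≠ 0 := by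
  intro h2
  rw [eq_neg_of_add_eq_zero_left h2] at h
  norm_num at h

theorem conj_add_two_ne {z : ℂ} (h : ‖z‖ < 1) : conj z + 2 ≠ 0 :=
  add_two_ne (by rwa [norm_conj])

theorem normSq_add_two_pos {z : ℂ} (h : ‖z‖ < 1) : 0 < normSq (z + 2) :=
  normSq_pos.2 (add_two_ne h)

theorem refl_eq {z : ℂ} (h : ‖z‖ < 1) : refl z = -(2 * conj z + 1) / (conj z + 2) := by
  have := conj_add_two_ne h
  rw [refl]; field_simp; ring

theorem normSq_refl {z : ℂ} (h : ‖z‖ < 1) :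
    normSq (refl z) = normSq (2 * z + 1) / normSq (z + 2) := by
  rw [refl_eq h, normSq_div, normSq_neg, ← normSq_conj (2 * z + 1), ← normSq_conj (z + 2)]
  simp [conj_ofNat]

theorem norm_refl_lt_one {z : ℂ} (h : ‖z‖ < 1) : ‖refl z‖ < 1 := by
  have h1 : normSq (refl z) < 1 := by
    rw [normSq_refl h, div_lt_one (normSq_add_two_pos h)]
    have := normSq_lt_one h
    simp only [normSq_apply, add_re, add_im, mul_re, mul_im] at this ⊢
    norm_num
    nlinarith
  rw [normSq_eq_norm_sq] at h1
  nlinarith [norm_nonneg (refl z)]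

theorem refl_refl {z : ℂ} (h : ‖z‖ < 1) : refl (refl z) = z := by
  have h1 := add_two_ne h
  rw [refl]
  have : conj (refl z) + 2 = 3 / (z + 2) := by
    rw [refl]; simp [conj_ofNat]
  rw [this]
  field_simp
  ring

theorem side_refl {z : ℂ} (h : ‖z‖ < 1) : side (refl z) = -3 * side z / normSq (z + 2) := by
  have h1 := (normSq_add_two_pos h).ne'
  have h2 : normSq (refl z + 2) = 9 / normSq (z + 2) := by
    rw [refl, neg_add_cancel_comm, normSq_div, ← normSq_conj (z + 2)]
    simp [conj_ofNat]
    norm_num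
  rw [side_eq, h2, side_eq]
  field_simp
  ring

theorem side_refl_nonneg {z : ℂ} (h : ‖z‖ < 1) (hs : side z ≤ 0) : 0 ≤ side (refl z) := by
  rw [side_refl h]
  exact div_nonneg (by linarith) (normSq_nonneg _)

theorem side_refl_nonpos {z : ℂ} (h : ‖z‖ < 1) (hs : 0 ≤ side z) : side (refl z) ≤ 0 := by
  rw [side_refl h]
  exact div_nonpos_of_nonpos_of_nonneg (by linarith) (normSq_nonneg _)

theorem side_refl_pos {z : ℂ} (h : ‖z‖ < 1) (hs : side z < 0) : 0 < side (refl z) := by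
  rw [side_refl h]
  exact div_pos (by linarith) (normSq_add_two_pos h)

theorem refl_of_side_eq_zero {z : ℂ} (h : ‖z‖ < 1) (hs : side z = 0) : refl z = z := by
  have h1 := conj_add_two_ne h
  have h2 : (z + 2) * (conj z + 2) = 3 := by
    have := mul_conj (z + 2)
    have h3 : normSq (z + 2) = 3 := by linarith [side_eq z]
    rw [h3] at this
    simpa [conj_ofNat] using this
  rw [refl]
  field_simp
  linear_combination -h2

theorem norm_refl_lt {z : ℂ} (h : ‖z‖ < 1) (hs : side z < 0) : ‖refl z‖ < ‖z‖ := by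
  have h1 : normSq (refl z) < normSq z := by
    rw [normSq_refl h, div_lt_iff₀ (normSq_add_two_pos h)]
    have h2 := normSq_lt_one h
    have h3 : normSq z * normSq (z + 2) - normSq (2 * z + 1) = (1 - normSq z) * (-side z) := by
      rw [side]
      simp only [normSq_apply, add_re, add_im, mul_re, mul_im]
      norm_num
      ring
    nlinarith [mul_pos (sub_pos.2 h2) (neg_pos.2 hs)]
  rw [normSq_eq_norm_sq, normSq_eq_norm_sq] at h1
  exact lt_of_pow_lt_pow_left₀ 2 (norm_nonneg z) h1

theorem continuousAt_refl {z : ℂ} (h : ‖z‖ < 1) : ContinuousAt refl z := by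
  have := conj_add_two_ne h
  unfold refl
  exact continuousAt_const.add (continuousAt_const.div
    (continuous_conj.continuousAt.add continuousAt_const) this)

/-- The three rotated copies of the closed half plane cut off by `C₂` are disjoint in the disc. -/
theorem side_rotation_pos {z ζ : ℂ} (hz : ‖z‖ < 1) (hs : side z ≤ 0) (hζ : ζ ^ 3 = 1)
    (hζ1 : ζ ≠ 1) : 0 < side (ζ * z) := by
  by_contra! hle
  have hsum : 1 + ζ + ζ ^ 2 = 0 := by
    have : (ζ - 1) * (1 + ζ + ζ ^ 2) = 0 := by linear_combination hζ
    exact (mul_eq_zero.1 this).resolve_left (sub_ne_zero.2 hζ1)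
  have hn : normSq (ζ * z) = normSq z := by
    rw [normSq_mul, normSq_eq_norm_sq ζ, norm_eq_one_of_cube hζ]; ring
  have hre : z.re + (ζ * z).re = -(ζ ^ 2 * z).re := by
    rw [← add_re, ← neg_re]
    congr 1
    linear_combination z * hsum
  have h1 : (ζ ^ 2 * z).re ≤ ‖z‖ := by
    refine (re_le_norm _).trans ?_
    rw [norm_mul, norm_pow, norm_eq_one_of_cube hζ]; simp
  rw [side, hn] at hle
  rw [side] at hs
  rw [normSq_eq_norm_sq] at hs hle
  nlinarith [sq_pos_of_pos (sub_pos.2 hz)]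

theorem eq_one_of_side_nonpos {z ζ : ℂ} (hz : ‖z‖ < 1) (hs : side z ≤ 0) (hζ : ζ ^ 3 = 1)
    (h : side (ζ * z) ≤ 0) : ζ = 1 := by
  by_contra hne
  exact (side_rotation_pos hz hs hζ hne).not_ge h

theorem norm_rotation {ζ z : ℂ} (hζ : ζ ^ 3 = 1) : ‖ζ * z‖ = ‖z‖ := by
  rw [norm_mul, norm_eq_one_of_cube hζ, one_mul]

/-- A point of the disc with `side z ≤ 0` is determined by its class. -/
theorem eq_of_cube_eq {z w : ℂ} (hz : ‖z‖ < 1) (hs : side z ≤ 0) (hw : side w ≤ 0)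
    (h : w ^ 3 = z ^ 3) : w = z := by
  obtain ⟨ζ, hζ, rfl⟩ := exists_rotation h
  rw [eq_one_of_side_nonpos hz hs hζ hw, one_mul]

theorem norm_lt_one_of_mem_model {n : ℕ} {z : ℂ} (h : z ∈ model n) : ‖z‖ < 1 := by
  cases n with
  | zero => exact h.1
  | succ n => exact h.elim (fun h => h.1) fun h => h.1

theorem triangle_subset_model (n : ℕ) : triangle ⊆ model n := by
  cases n with
  | zero => exact subset_rfl
  | succ n => exact subset_union_left

theorem model_subset_succ (n : ℕ) : model n ⊆ model (n + 1) := by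
  induction n with
  | zero => exact triangle_subset_model 1
  | succ n ih =>
    rintro z (h | ⟨hz, ζ, hζ, hs, h⟩)
    · exact Or.inl h
    · exact Or.inr ⟨hz, ζ, hζ, hs, ih h⟩

theorem model_mono : Monotone model := monotone_nat_of_le_succ model_subset_succ

theorem rotation_mem_triangle {z ζ : ℂ} (hζ : ζ ^ 3 = 1) (h : z ∈ triangle) :
    ζ * z ∈ triangle := by
  refine ⟨by rw [norm_rotation hζ]; exact h.1, fun ζ' hζ' => ?_⟩
  rw [← mul_assoc]
  exact h.2 _ (by rw [mul_pow, hζ, hζ', one_mul])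

theorem rotation_mem_model {n : ℕ} {z ζ : ℂ} (hζ : ζ ^ 3 = 1) (h : z ∈ model n) :
    ζ * z ∈ model n := by
  cases n with
  | zero => exact rotation_mem_triangle hζ h
  | succ n =>
    rcases h with h | ⟨hz, ζ', hζ', hs, h⟩
    · exact Or.inl (rotation_mem_triangle hζ h)
    · have h0 : ζ ≠ 0 := by rintro rfl; norm_num at hζ
      have e : ζ' * ζ⁻¹ * (ζ * z) = ζ' * z := by field_simp
      refine Or.inr ⟨by rwa [norm_rotation hζ], ζ' * ζ⁻¹, ?_, ?_, ?_⟩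
      · rw [mul_pow, hζ', inv_pow, hζ, inv_one, one_mul]
      · rwa [e]
      · rwa [e]

theorem cube_mem_quot_iff {n : ℕ} {z : ℂ} : z ^ 3 ∈ quot n ↔ z ∈ model n := by
  constructor
  · rintro ⟨w, hw, h⟩
    obtain ⟨ζ, hζ, rfl⟩ := exists_rotation h.symm
    exact rotation_mem_model hζ hw
  · exact fun h => ⟨z, h, rfl⟩

theorem mem_model_succ_iff {n : ℕ} {z : ℂ} (hz : ‖z‖ < 1) (hs : side z ≤ 0) :
    z ∈ model (n + 1) ↔ refl z ∈ model n := by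
  constructor
  · rintro (h | ⟨-, ζ, hζ, hs', h⟩)
    · have h0 : side z = 0 := le_antisymm hs (by simpa using h.2 1 (one_pow 3))
      rw [refl_of_side_eq_zero hz h0]
      exact triangle_subset_model n h
    · rwa [eq_one_of_side_nonpos hz hs hζ hs', one_mul] at h
  · exact fun h => Or.inr ⟨hz, 1, one_pow 3, by rwa [one_mul], by rwa [one_mul]⟩

theorem mem_triangle_of_side_eq_zero {z : ℂ} (hz : ‖z‖ < 1) (hs : side z = 0) : z ∈ triangle := by
  refine ⟨hz, fun ζ hζ => ?_⟩
  by_cases h : ζ = 1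
  · rw [h, one_mul, hs]
  · exact (side_rotation_pos hz hs.le hζ h).le

theorem exists_side_neg {z : ℂ} (hz : ‖z‖ < 1) (h : z ∉ triangle) :
    ∃ ζ : ℂ, ζ ^ 3 = 1 ∧ side (ζ * z) < 0 := by
  by_contra! hcon
  exact h ⟨hz, hcon⟩

theorem notMem_triangle {z : ℂ} (hs : side z < 0) : z ∉ triangle := fun h => by
  have := h.2 1 (one_pow 3)
  rw [one_mul] at this
  linarith

theorem zero_mem_triangle : (0 : ℂ) ∈ triangle :=
  ⟨by simp, fun ζ _ => by rw [mul_zero, side_zero]; exact zero_le_one⟩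

theorem zero_mem_model (n : ℕ) : (0 : ℂ) ∈ model n := triangle_subset_model n zero_mem_triangle

theorem zero_mem_quot (n : ℕ) : (0 : ℂ) ∈ quot n := ⟨0, zero_mem_model n, by simp⟩

/-- A function whose zero set in the disc is a hyperbolic geodesic. -/
def geodesicFun (α : ℝ) (β z : ℂ) : ℝ := α * (1 + normSq z) - 2 * (z * conj β).re

theorem side_eq_geodesicFun (z : ℂ) : side z = geodesicFun 1 (-2) z := by
  rw [side, geodesicFun]
  simp
  ring

/-- The reflection in `C₂` carries geodesics to geodesics. -/
theorem exists_geodesicFun_refl (α : ℝ) (β : ℂ) : ∃ (α' : ℝ) (β' : ℂ), ∀ z : ℂ, ‖z‖ < 1 →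
    geodesicFun α' β' z = normSq (z + 2) * geodesicFun α β (refl z) := by
  refine ⟨5 * α + 4 * β.re, ⟨-4 * α - 5 * β.re, 3 * β.im⟩, fun z hz => ?_⟩
  have h0 := (normSq_add_two_pos hz).ne'
  have h1 : (refl z * conj β).re = -((2 * conj z + 1) * (z + 2) * conj β).re / normSq (z + 2) := by
    have h2 : refl z = -((2 * conj z + 1) * (z + 2)) / (normSq (z + 2) : ℝ) := by
      rw [← mul_conj, refl_eq hz]
      have := add_two_ne hz
      have := conj_add_two_ne hz
      rw [map_add, conj_ofNat]
      field_simp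
    rw [h2, div_mul_eq_mul_div, div_ofReal_re]
    congr 1
    rw [neg_mul, neg_re]
  rw [geodesicFun, geodesicFun, h1, normSq_refl hz]
  field_simp
  simp only [normSq_apply, add_re, add_im, mul_re, mul_im, conj_re, conj_im]
  norm_num
  ring

/-- Convexity of the model tiles: a point of the disc outside `model n` is separated from it, after
a rotation, by a geodesic contained in the half plane cut off by `C₂`. -/
theorem exists_separation (n : ℕ) : ∀ z : ℂ, ‖z‖ < 1 → z ∉ model n → ∃ (ζ : ℂ) (α : ℝ) (β : ℂ),
    ζ ^ 3 = 1 ∧ side (ζ * z) < 0 ∧ geodesicFun α β (ζ * z) < 0 ∧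
      (∀ w : ℂ, ‖w‖ < 1 → 0 ≤ side w → 0 ≤ geodesicFun α β w) ∧
      ∀ w ∈ model n, 0 ≤ geodesicFun α β w := by
  induction n with
  | zero =>
    intro z hz h
    obtain ⟨ζ, hζ, hs⟩ := exists_side_neg hz h
    refine ⟨ζ, 1, -2, hζ, hs, ?_, fun w _ h => ?_, fun w hw => ?_⟩ <;>
      rw [← side_eq_geodesicFun]
    · exact hs
    · exact h
    · simpa using hw.2 1 (one_pow 3)
  | succ n ih =>
    intro z hz h
    obtain ⟨ζ, hζ, hs⟩ := exists_side_neg hz fun h' => h (Or.inl h')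
    have hy : ‖ζ * z‖ < 1 := by rwa [norm_rotation hζ]
    have hv : refl (ζ * z) ∉ model n := fun h' => h (Or.inr ⟨hz, ζ, hζ, hs.le, h'⟩)
    obtain ⟨ζ', α, β, hζ', hs', hc, hc1, hc2⟩ := ih _ (norm_refl_lt_one hy) hv
    have hζ1 : ζ' ≠ 1 := by
      rintro rfl
      rw [one_mul] at hs'
      linarith [side_refl_pos hy hs]
    have hrot : ∀ w : ℂ, geodesicFun α (conj ζ' * β) w = geodesicFun α β (ζ' * w) := by
      intro w
      rw [geodesicFun, geodesicFun, normSq_mul, normSq_eq_norm_sq ζ', norm_eq_one_of_cube hζ',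
        map_mul, conj_conj]
      ring_nf
    obtain ⟨α', β', hc'⟩ := exists_geodesicFun_refl α (conj ζ' * β)
    refine ⟨ζ, α', β', hζ, hs, ?_, ?_, ?_⟩
    · rw [hc' _ hy, hrot]
      exact mul_neg_of_pos_of_neg (normSq_add_two_pos hy) hc
    · intro w hw hws
      rw [hc' _ hw, hrot]
      refine mul_nonneg (normSq_nonneg _) (hc1 _ ?_ ?_)
      · rw [norm_rotation hζ']; exact norm_refl_lt_one hw
      · exact (side_rotation_pos (norm_refl_lt_one hw) (side_refl_nonpos hw hws) hζ' hζ1).le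
    · intro w hw
      have hw1 := norm_lt_one_of_mem_model hw
      rw [hc' _ hw1, hrot]
      refine mul_nonneg (normSq_nonneg _) ?_
      rcases le_total (side w) 0 with hws | hws
      · exact hc2 _ (rotation_mem_model hζ' ((mem_model_succ_iff hw1 hws).1 hw))
      · refine hc1 _ ?_ ?_
        · rw [norm_rotation hζ']; exact norm_refl_lt_one hw1
        · exact (side_rotation_pos (norm_refl_lt_one hw1) (side_refl_nonpos hw1 hws) hζ' hζ1).le

theorem geodesicFun_smul_ge {α : ℝ} {β z : ℂ} (h : 0 ≤ geodesicFun α β z) {t : ℝ}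
    (ht : 0 ≤ t) : α * ((1 - t) * (1 - t * normSq z)) ≤ geodesicFun α β (t * z) := by
  have : geodesicFun α β (t * z) =
      t * geodesicFun α β z + α * ((1 - t) * (1 - t * normSq z)) := by
    rw [geodesicFun, geodesicFun, normSq_mul, normSq_ofReal, mul_assoc (t : ℂ), re_ofReal_mul]
    ring
  rw [this]
  linarith [mul_nonneg ht h]

/-- The model tiles are star-shaped about the origin, and shrinking moves them into their
interior. -/
theorem smul_mem_interior_model {n : ℕ} {z : ℂ} (hz : z ∈ model n) {t : ℝ} (ht0 : 0 ≤ t)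
    (ht1 : t < 1) : (t : ℂ) * z ∈ interior (model n) := by
  have hz1 := norm_lt_one_of_mem_model hz
  have hzs := normSq_lt_one hz1
  set ε := (1 - t) * (1 - t * normSq z) with hε
  have hε0 : 0 < ε := mul_pos (by linarith) (by nlinarith [normSq_nonneg z])
  have htz : ‖(t : ℂ) * z‖ < 1 := by
    rw [norm_mul, norm_real, Real.norm_of_nonneg ht0]
    nlinarith [norm_nonneg z]
  rw [mem_interior_iff_mem_nhds, Metric.mem_nhds_iff]
  refine ⟨min (1 - ‖(t : ℂ) * z‖) (ε / 8), lt_min (by linarith) (by linarith), fun w hw => ?_⟩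
  rw [mem_ball, dist_eq_norm, lt_min_iff] at hw
  have hw1 : ‖w‖ < 1 := by
    have := norm_sub_norm_le w (t * z); linarith [hw.1]
  by_contra hn
  obtain ⟨ζ, α, β, hζ, -, hc, hc1, hc2⟩ := exists_separation n w hw1 hn
  have hα : 0 ≤ α := by
    have := hc1 0 (by simp) (by rw [side_zero]; exact zero_le_one)
    simpa [geodesicFun] using this
  -- the geodesic avoids the disc of radius `1 / 4`, which bounds `β` in terms of `α`
  have hβ : ‖β‖ ≤ 3 * α := by
    by_cases hβ0 : β = 0
    · rw [hβ0, norm_zero]; linarith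
    have hβn : 0 < ‖β‖ := norm_pos_iff.2 hβ0
    have hu : ‖β / (4 * ‖β‖)‖ = 1 / 4 := by
      rw [norm_div, norm_mul, norm_real, norm_norm, norm_ofNat]; field_simp
    have h1 := hc1 (β / (4 * ‖β‖)) (by rw [hu]; norm_num) (by
      have := (neg_le_abs _).trans (abs_re_le_norm (β / (4 * ‖β‖)))
      rw [hu] at this
      rw [side]
      linarith [normSq_nonneg (β / (4 * ‖β‖))])
    have h2 : β / (4 * ‖β‖) * conj β = ((‖β‖ / 4 : ℝ) : ℂ) := by
      rw [div_mul_eq_mul_div, mul_conj, normSq_eq_norm_sq]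
      have : (‖β‖ : ℂ) ≠ 0 := by exact_mod_cast hβn.ne'
      push_cast
      field_simp
    rw [geodesicFun, h2, ofReal_re, normSq_eq_norm_sq, hu] at h1
    linarith
  have h3 := geodesicFun_smul_ge (hc2 _ (rotation_mem_model hζ hz)) ht0
  rw [normSq_mul, normSq_eq_norm_sq ζ, norm_eq_one_of_cube hζ, one_pow, one_mul, ← hε] at h3
  have h4 : geodesicFun α β (t * (ζ * z)) - geodesicFun α β (ζ * w) ≤
      α * (‖(t : ℂ) * z‖ ^ 2 - ‖w‖ ^ 2) + 2 * (‖w - t * z‖ * ‖β‖) := by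
    have h5 : (ζ * (w - t * z) * conj β).re ≤ ‖w - t * z‖ * ‖β‖ := by
      refine (re_le_norm _).trans ?_
      rw [norm_mul, norm_mul, norm_eq_one_of_cube hζ, one_mul, norm_conj]
    have h6 : normSq (t * (ζ * z)) = ‖(t : ℂ) * z‖ ^ 2 := by
      rw [normSq_eq_norm_sq, show (t : ℂ) * (ζ * z) = ζ * (t * z) by ring, norm_rotation hζ]
    have h7 : normSq (ζ * w) = ‖w‖ ^ 2 := by rw [normSq_eq_norm_sq, norm_rotation hζ]
    have h8 : (ζ * (w - t * z) * conj β).re =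
        (ζ * w * conj β).re - (t * (ζ * z) * conj β).re := by
      rw [← sub_re]; congr 1; ring
    rw [geodesicFun, geodesicFun, h6, h7]
    rw [h8] at h5
    linarith
  have h5 : ‖(t : ℂ) * z‖ ^ 2 - ‖w‖ ^ 2 ≤ 2 * ‖w - t * z‖ := by
    have h6 := norm_sub_norm_le (t * z) w
    rw [norm_sub_rev] at h6
    nlinarith [norm_nonneg w, norm_nonneg ((t : ℂ) * z), norm_nonneg (w - t * z)]
  have h6 : ‖w - t * z‖ * ‖β‖ ≤ ‖w - t * z‖ * (3 * α) := by gcongr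
  have h7 := mul_le_mul_of_nonneg_left h5 hα
  rcases hα.eq_or_lt with h0 | h0
  · subst h0
    linarith
  · have h8 := mul_lt_mul_of_pos_left hw.2 h0
    linarith

theorem smul_mem_model {n : ℕ} {z : ℂ} (hz : z ∈ model n) {t : ℝ} (ht0 : 0 ≤ t)
    (ht1 : t ≤ 1) : (t : ℂ) * z ∈ model n := by
  rcases ht1.eq_or_lt with rfl | h
  · simpa using hz
  · exact interior_subset (smul_mem_interior_model hz ht0 h)

/-! ### Interiors of the model tiles, and the cube root -/

theorem finite_cube_roots : {ζ : ℂ | ζ ^ 3 = 1}.Finite :=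
  (Finset.finite_toSet (Polynomial.nthRootsFinset 3 (1 : ℂ))).subset fun ζ hζ => by
    rw [Finset.mem_coe, Polynomial.mem_nthRootsFinset three_pos]; exact hζ

theorem isOpenMap_cube : IsOpenMap fun z : ℂ => z ^ 3 := (isOpenQuotientMap_pow 3).isOpenMap

theorem cube_mem_interior_quot_iff {n : ℕ} {z : ℂ} :
    z ^ 3 ∈ interior (quot n) ↔ z ∈ interior (model n) := by
  constructor
  · intro h
    have ho : IsOpen ((fun z : ℂ => z ^ 3) ⁻¹' interior (quot n)) :=
      isOpen_interior.preimage (by fun_prop)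
    exact interior_maximal (fun w hw => cube_mem_quot_iff.1 (interior_subset hw)) ho h
  · intro h
    exact interior_maximal (image_mono interior_subset) (isOpenMap_cube _ isOpen_interior) ⟨z, h, rfl⟩

theorem quot_mono : Monotone quot := fun _ _ h => image_mono (model_mono h)

theorem norm_lt_one_of_mem_quot {n : ℕ} {ξ : ℂ} (h : ξ ∈ quot n) : ‖ξ‖ < 1 := by
  obtain ⟨z, hz, rfl⟩ := h
  simp only [norm_pow]
  exact pow_lt_one₀ (norm_nonneg z) (norm_lt_one_of_mem_model hz) three_ne_zero

theorem exists_real_cube_root {s : ℝ} (h0 : 0 ≤ s) (h1 : s ≤ 1) :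
    ∃ t : ℝ, 0 ≤ t ∧ t ≤ 1 ∧ t ^ 3 = s ∧ (s < 1 → t < 1) := by
  have ht : (s ^ ((3 : ℕ) : ℝ)⁻¹) ^ 3 = s := Real.rpow_inv_natCast_pow h0 three_ne_zero
  refine ⟨s ^ ((3 : ℕ) : ℝ)⁻¹, by positivity, Real.rpow_le_one h0 h1 (by positivity), ht,
    fun h => Real.rpow_lt_one h0 h (by positivity)⟩

theorem smul_mem_interior_quot {n : ℕ} {ξ : ℂ} (hξ : ξ ∈ quot n) {s : ℝ} (h0 : 0 ≤ s)
    (h1 : s < 1) : (s : ℂ) * ξ ∈ interior (quot n) := by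
  obtain ⟨z, hz, rfl⟩ := hξ
  obtain ⟨t, ht0, -, rfl, ht⟩ := exists_real_cube_root h0 h1.le
  have : ((t ^ 3 : ℝ) : ℂ) * z ^ 3 = ((t : ℂ) * z) ^ 3 := by push_cast; ring
  simp only [this]
  exact cube_mem_interior_quot_iff.2 (smul_mem_interior_model hz ht0 (ht h1))

theorem smul_mem_quot {n : ℕ} {ξ : ℂ} (hξ : ξ ∈ quot n) {s : ℝ} (h0 : 0 ≤ s)
    (h1 : s ≤ 1) : (s : ℂ) * ξ ∈ quot n := by
  rcases h1.eq_or_lt with rfl | h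
  · simpa using hξ
  · exact interior_subset (smul_mem_interior_quot hξ h0 h)

theorem hasContLog_quot (n : ℕ) : HasContLog (quot n) :=
  hasContLog_of_star (zero_mem_quot n) fun z hz s h0 h1 => by
    simpa using smul_mem_quot hz h0 h1

theorem isPreconnected_of_star {A : Set ℂ}
    (hs : ∀ z ∈ A, ∀ s : ℝ, 0 ≤ s → s ≤ 1 → (s : ℂ) * z ∈ A) : IsPreconnected A := by
  refine isPreconnected_of_forall 0 fun z hz =>
    ⟨(fun s : ℝ => (s : ℂ) * z) '' Icc 0 1, ?_, ⟨0, by simp, by simp⟩, ⟨1, by simp, by simp⟩,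
      isPreconnected_Icc.image _ (by fun_prop)⟩
  rintro _ ⟨s, hs', rfl⟩
  exact hs z hz s hs'.1 hs'.2

theorem isPreconnected_interior_quot (n : ℕ) :
    IsPreconnected (interior (quot n)) :=
  isPreconnected_of_star fun z hz s hs0 hs1 => by
    rcases hs1.eq_or_lt with rfl | h
    · simpa using hz
    · exact smul_mem_interior_quot (interior_subset hz) hs0 h

theorem zero_mem_interior_quot (n : ℕ) : (0 : ℂ) ∈ interior (quot n) := by
  simpa using smul_mem_interior_quot (zero_mem_quot n) le_rfl one_pos

theorem quot_subset_closure_interior (n : ℕ) : quot n ⊆ closure (interior (quot n)) := by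
  intro ξ hξ
  have hc : Tendsto (fun s : ℝ => (s : ℂ) * ξ) (𝓝[<] 1) (𝓝 ξ) := by
    have : Tendsto (fun s : ℝ => (s : ℂ) * ξ) (𝓝 1) (𝓝 (((1 : ℝ) : ℂ) * ξ)) :=
      (by fun_prop : Continuous fun s : ℝ => (s : ℂ) * ξ).tendsto 1
    rw [ofReal_one, one_mul] at this
    exact this.mono_left nhdsWithin_le_nhds
  refine mem_closure_of_tendsto hc ?_
  filter_upwards [self_mem_nhdsWithin, nhdsWithin_le_nhds (Ioi_mem_nhds (zero_lt_one' ℝ))]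
    with s h1 h0
  exact smul_mem_interior_quot hξ (le_of_lt h0) h1

/-- Near the circle `C₂`, the points of the disc belong to `model (n + 1)`. -/
theorem mem_interior_model_succ_of_side_eq_zero {n : ℕ} {z : ℂ} (hz : ‖z‖ < 1) (hs : side z = 0) :
    z ∈ interior (model (n + 1)) := by
  -- the other two half planes stay away from `z` and from its reflection
  have hnear : ∀ᶠ w in 𝓝 z, ‖w‖ < 1 ∧ (0 ≤ side w → w ∈ triangle) := by
    have h1 : ∀ᶠ w in 𝓝 z, ‖w‖ < 1 := continuous_norm.continuousAt.eventually_lt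
      continuousAt_const hz
    have h2 : ∀ᶠ w in 𝓝 z, ∀ ζ ∈ {ζ : ℂ | ζ ^ 3 = 1}, ζ ≠ 1 → 0 < side (ζ * w) := by
      rw [finite_cube_roots.eventually_all]
      intro ζ hζ
      by_cases hζ1 : ζ = 1
      · exact .of_forall fun w h => absurd hζ1 h
      · have hc : ContinuousAt (fun w => side (ζ * w)) z :=
          (continuous_side.comp (continuous_const.mul continuous_id)).continuousAt
        filter_upwards [hc.eventually (lt_mem_nhds (side_rotation_pos hz hs.le hζ hζ1))] with w hw _
        exact hw
    filter_upwards [h1, h2] with w hw1 hw2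
    refine ⟨hw1, fun h => ⟨hw1, fun ζ hζ => ?_⟩⟩
    by_cases hζ1 : ζ = 1
    · rwa [hζ1, one_mul]
    · exact (hw2 ζ hζ hζ1).le
  have href : ∀ᶠ w in 𝓝 z, ‖refl w‖ < 1 ∧ (0 ≤ side (refl w) → refl w ∈ triangle) := by
    have := continuousAt_refl hz
    rw [ContinuousAt, refl_of_side_eq_zero hz hs] at this
    exact this.eventually hnear
  rw [mem_interior_iff_mem_nhds]
  filter_upwards [hnear, href] with w hw hw'
  rcases le_total 0 (side w) with h | h
  · exact triangle_subset_model _ (hw.2 h)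
  · exact (mem_model_succ_iff hw.1 h).2 (triangle_subset_model n (hw'.2 (side_refl_nonneg hw.1 h)))

theorem mem_interior_model_succ_iff {n : ℕ} {z : ℂ} (hz : ‖z‖ < 1) (hs : side z < 0) :
    z ∈ interior (model (n + 1)) ↔ refl z ∈ interior (model n) := by
  constructor
  · intro h
    have hr := norm_refl_lt_one hz
    have hc : Tendsto refl (𝓝 (refl z)) (𝓝 z) := by
      have := continuousAt_refl hr
      rwa [ContinuousAt, refl_refl hz] at this
    rw [mem_interior_iff_mem_nhds]
    filter_upwards [hc.eventually (isOpen_interior.mem_nhds h),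
      hc.eventually (continuous_side.continuousAt.eventually_lt continuousAt_const hs),
      continuous_norm.continuousAt.eventually_lt continuousAt_const hr] with v hv hvs hv1
    have := (mem_model_succ_iff (norm_refl_lt_one hv1) hvs.le).1 (interior_subset hv)
    rwa [refl_refl hv1] at this
  · intro h
    rw [mem_interior_iff_mem_nhds]
    filter_upwards [(continuousAt_refl hz).eventually (isOpen_interior.mem_nhds h),
      continuous_side.continuousAt.eventually_lt continuousAt_const hs,
      continuous_norm.continuousAt.eventually_lt continuousAt_const hz] with v hv hvs hv1
    exact (mem_model_succ_iff hv1 hvs.le).2 (interior_subset hv)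

theorem rotation_mem_interior_model {n : ℕ} {z ζ : ℂ} (hζ : ζ ^ 3 = 1) :
    ζ * z ∈ interior (model n) ↔ z ∈ interior (model n) := by
  rw [← cube_mem_interior_quot_iff, ← cube_mem_interior_quot_iff, mul_pow, hζ, one_mul]

theorem model_subset_interior_succ (n : ℕ) : model n ⊆ interior (model (n + 1)) := by
  have base : ∀ n, triangle ⊆ interior (model (n + 1)) := by
    intro n z hz
    by_cases h : ∃ ζ : ℂ, ζ ^ 3 = 1 ∧ side (ζ * z) = 0
    · obtain ⟨ζ, hζ, hs⟩ := h
      rw [← rotation_mem_interior_model hζ]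
      exact mem_interior_model_succ_of_side_eq_zero (by rw [norm_rotation hζ]; exact hz.1) hs
    · -- `z` is in the open triangle, where the strict inequalities persist nearby
      push Not at h
      have h2 : ∀ᶠ w in 𝓝 z, ∀ ζ ∈ {ζ : ℂ | ζ ^ 3 = 1}, 0 < side (ζ * w) := by
        rw [finite_cube_roots.eventually_all]
        intro ζ hζ
        have hc : ContinuousAt (fun w => side (ζ * w)) z :=
          (continuous_side.comp (continuous_const.mul continuous_id)).continuousAt
        exact hc.eventually (lt_mem_nhds (lt_of_le_of_ne (hz.2 ζ hζ) (Ne.symm (h ζ hζ))))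
      rw [mem_interior_iff_mem_nhds]
      filter_upwards [h2, continuous_norm.continuousAt.eventually_lt continuousAt_const hz.1]
        with w hw hw1
      exact triangle_subset_model _ ⟨hw1, fun ζ hζ => (hw ζ hζ).le⟩
  induction n with
  | zero => exact base 0
  | succ n ih =>
    rintro z (h | ⟨hz, ζ, hζ, hs, h⟩)
    · exact base _ h
    · rw [← rotation_mem_interior_model hζ]
      have hz' : ‖ζ * z‖ < 1 := by rwa [norm_rotation hζ]
      rcases hs.eq_or_lt with h0 | h0
      · exact mem_interior_model_succ_of_side_eq_zero hz' h0
      · exact (mem_interior_model_succ_iff hz' h0).2 (ih h)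

/-- The reflected triangles fill the disc: reflecting a point outside the triangle brings it closer
to the origin, so a point of smallest modulus outside all the tiles cannot exist. -/
theorem exists_mem_model {z : ℂ} (hz : ‖z‖ < 1) : ∃ n, z ∈ model n := by
  by_contra hn
  set W : Set ℂ := ⋃ n, interior (model n) with hW
  have hWm : ∀ w, w ∈ W ↔ ∃ n, w ∈ model n := fun w => by
    rw [hW, mem_iUnion]
    exact ⟨fun ⟨n, h⟩ => ⟨n, interior_subset h⟩, fun ⟨n, h⟩ => ⟨n + 1, model_subset_interior_succ n h⟩⟩
  have hWo : IsOpen W := isOpen_iUnion fun n => isOpen_interior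
  have hcomp : IsCompact (closedBall 0 ‖z‖ \ W) := (isCompact_closedBall 0 ‖z‖).diff hWo
  obtain ⟨y, ⟨hy, hyW⟩, hmin⟩ := hcomp.exists_isMinOn (f := fun w => ‖w‖)
    ⟨z, by simp, fun h => hn ((hWm z).1 h)⟩ continuous_norm.continuousOn
  have hy1 : ‖y‖ < 1 := lt_of_le_of_lt (by simpa using hy) hz
  obtain ⟨ζ, hζ, hs⟩ := exists_side_neg hy1 fun h => hyW ((hWm y).2 ⟨0, h⟩)
  have hζy : ‖ζ * y‖ < 1 := by rwa [norm_rotation hζ]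
  have hlt := norm_refl_lt hζy hs
  rw [norm_rotation hζ] at hlt
  have hle : ‖refl (ζ * y)‖ ≤ ‖z‖ := hlt.le.trans (by simpa using hy)
  have hnW : refl (ζ * y) ∉ W := fun h => by
    obtain ⟨n, hn⟩ := (hWm _).1 h
    exact hyW ((hWm y).2 ⟨n + 1, Or.inr ⟨hy1, ζ, hζ, hs.le, hn⟩⟩)
  exact absurd (hmin ⟨by simpa using hle, hnW⟩) (not_le.2 hlt)

/-- The branch of the cube root that inverts `z ↦ z³` on the half plane cut off by `C₂`. -/
noncomputable def cubeRoot (ξ : ℂ) : ℂ := -((-ξ) ^ (((3 : ℕ) : ℂ)⁻¹))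

theorem half_norm_lt_neg_re {z : ℂ} (hz : ‖z‖ < 1) (hs : side z ≤ 0) : ‖z‖ / 2 < -z.re := by
  rw [side, normSq_eq_norm_sq] at hs
  nlinarith [sq_pos_of_pos (sub_pos.2 hz)]

theorem cubeRoot_cube {z : ℂ} (hz : ‖z‖ < 1) (hs : side z ≤ 0) : cubeRoot (z ^ 3) = z := by
  have h1 := half_norm_lt_neg_re hz hs
  have h2 : |arg (-z)| < Real.pi / 3 := by
    by_contra! hle
    have h3 := Real.cos_le_cos_of_nonneg_of_le_pi (by positivity) (abs_arg_le_pi (-z)) hle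
    rw [Real.cos_abs, Real.cos_pi_div_three] at h3
    have h4 : ‖-z‖ * Real.cos (arg (-z)) = (-z).re := norm_mul_cos_arg (-z)
    rw [norm_neg, neg_re] at h4
    nlinarith [norm_nonneg z]
  rw [abs_lt] at h2
  rw [cubeRoot, show -z ^ 3 = (-z) ^ 3 by ring,
    pow_cpow_nat_inv three_ne_zero (by push_cast; exact h2.1) (by push_cast; exact h2.2.le), neg_neg]

theorem neg_cube_mem_slitPlane {z : ℂ} (hz : ‖z‖ < 1) (hs : side z ≤ 0) :
    -z ^ 3 ∈ slitPlane := by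
  have h1 := half_norm_lt_neg_re hz hs
  have h2 : z.im ^ 2 < 3 * z.re ^ 2 := by
    have : ‖z‖ ^ 2 = z.re * z.re + z.im * z.im := by rw [← normSq_eq_norm_sq, normSq_apply]
    nlinarith [norm_nonneg z]
  have h3 : z.re < 0 := by linarith [norm_nonneg z]
  have e1 : (-z ^ 3).re = -(z.re ^ 3 - 3 * z.re * z.im ^ 2) := by
    simp [pow_succ]; ring
  have e2 : (-z ^ 3).im = -(z.im * (3 * z.re ^ 2 - z.im ^ 2)) := by
    simp [pow_succ]; ring
  rw [mem_slitPlane_iff, e1, e2]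
  by_cases him : z.im = 0
  · left
    rw [him]
    nlinarith [sq_nonneg z.re, mul_pos (neg_pos.2 h3) (mul_pos (neg_pos.2 h3) (neg_pos.2 h3))]
  · right
    exact neg_ne_zero.2 (mul_ne_zero him (by linarith))

theorem differentiableAt_cubeRoot {z : ℂ} (hz : ‖z‖ < 1) (hs : side z ≤ 0) :
    DifferentiableAt ℂ cubeRoot (z ^ 3) := by
  unfold cubeRoot
  exact ((differentiableAt_id.neg).cpow_const (neg_cube_mem_slitPlane hz hs)).neg

/-! ### Uniformization of the quotient triangle -/

/-- The open ideal triangle. -/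
def openTriangle : Set ℂ := {z | ‖z‖ < 1 ∧ ∀ ζ : ℂ, ζ ^ 3 = 1 → 0 < side (ζ * z)}

/-- The geodesic `C₂ ∩ 𝔻`. -/
def edge : Set ℂ := {z | ‖z‖ < 1 ∧ side z = 0}

/-- The image of the open triangle in the quotient, in the coordinate `ξ = z³`. -/
def quotOpen : Set ℂ := (fun z : ℂ => z ^ 3) '' openTriangle

/-- The closed ideal triangle with its ideal vertices. -/
def closedTriangle : Set ℂ := {z | ‖z‖ ≤ 1 ∧ ∀ ζ : ℂ, ζ ^ 3 = 1 → 0 ≤ side (ζ * z)}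

theorem isOpen_openTriangle : IsOpen openTriangle := by
  have : openTriangle = ball 0 1 ∩ ⋂ ζ ∈ {ζ : ℂ | ζ ^ 3 = 1}, {z | 0 < side (ζ * z)} := by
    ext z; simp [openTriangle]
  rw [this]
  exact isOpen_ball.inter (finite_cube_roots.isOpen_biInter fun ζ _ =>
    isOpen_lt continuous_const (continuous_side.comp (continuous_const.mul continuous_id)))

theorem isClosed_closedTriangle : IsClosed closedTriangle := by
  have : closedTriangle = closedBall 0 1 ∩ ⋂ ζ ∈ {ζ : ℂ | ζ ^ 3 = 1}, {z | 0 ≤ side (ζ * z)} := by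
    ext z; simp [closedTriangle]
  rw [this]
  exact isClosed_closedBall.inter (isClosed_biInter fun ζ _ =>
    isClosed_le continuous_const (continuous_side.comp (continuous_const.mul continuous_id)))

theorem openTriangle_subset : openTriangle ⊆ triangle := fun _ hz =>
  ⟨hz.1, fun ζ hζ => (hz.2 ζ hζ).le⟩

theorem rotation_mem_openTriangle {z ζ : ℂ} (hζ : ζ ^ 3 = 1) (h : z ∈ openTriangle) :
    ζ * z ∈ openTriangle := by
  refine ⟨by rw [norm_rotation hζ]; exact h.1, fun ζ' hζ' => ?_⟩
  rw [← mul_assoc]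
  exact h.2 _ (by rw [mul_pow, hζ, hζ', one_mul])

theorem cube_mem_quotOpen_iff {z : ℂ} : z ^ 3 ∈ quotOpen ↔ z ∈ openTriangle := by
  constructor
  · rintro ⟨w, hw, h⟩
    obtain ⟨ζ, hζ, rfl⟩ := exists_rotation h.symm
    exact rotation_mem_openTriangle hζ hw
  · exact fun h => ⟨z, h, rfl⟩

theorem smul_mem_openTriangle {z : ℂ} (hz : z ∈ closedTriangle) {t : ℝ} (h0 : 0 ≤ t) (h1 : t < 1) :
    (t : ℂ) * z ∈ openTriangle := by
  have hn : normSq z ≤ 1 := by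
    rw [normSq_eq_norm_sq]; exact pow_le_one₀ (norm_nonneg z) hz.1
  refine ⟨?_, fun ζ hζ => ?_⟩
  · rw [norm_mul, norm_real, Real.norm_of_nonneg h0]
    nlinarith [norm_nonneg z, hz.1]
  · have h2 := geodesicFun_smul_ge (by rw [← side_eq_geodesicFun]; exact hz.2 ζ hζ) h0
    rw [normSq_mul, normSq_eq_norm_sq ζ, norm_eq_one_of_cube hζ, ← side_eq_geodesicFun] at h2
    rw [show ζ * (t * z) = t * (ζ * z) by ring]
    refine lt_of_lt_of_le ?_ h2
    have : 0 < 1 - t * normSq z := by nlinarith [normSq_nonneg z]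
    have : 0 < 1 - t := by linarith
    norm_num
    positivity

theorem isOpen_quotOpen : IsOpen quotOpen := isOpenMap_cube _ isOpen_openTriangle

theorem zero_mem_quotOpen : (0 : ℂ) ∈ quotOpen := by
  refine ⟨0, ?_, by simp⟩
  simpa using smul_mem_openTriangle (z := 0) ⟨by simp, fun ζ _ => by
    rw [mul_zero, side_zero]; exact zero_le_one⟩ le_rfl one_pos

theorem smul_mem_quotOpen {ξ : ℂ} (hξ : ξ ∈ quotOpen) {s : ℝ} (h0 : 0 ≤ s) (h1 : s ≤ 1) :
    (s : ℂ) * ξ ∈ quotOpen := by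
  rcases h1.eq_or_lt with rfl | h
  · simpa using hξ
  obtain ⟨z, hz, rfl⟩ := hξ
  obtain ⟨t, ht0, -, rfl, ht⟩ := exists_real_cube_root h0 h1
  have : ((t ^ 3 : ℝ) : ℂ) * z ^ 3 = ((t : ℂ) * z) ^ 3 := by push_cast; ring
  simp only [this]
  exact ⟨_, smul_mem_openTriangle ⟨hz.1.le, fun ζ hζ => (hz.2 ζ hζ).le⟩ ht0 (ht h), rfl⟩

theorem triangle_subset_closedTriangle : triangle ⊆ closedTriangle := fun _ hz => ⟨hz.1.le, hz.2⟩

/-- The ideal vertices of the triangle are the cube roots of unity. -/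
theorem cube_eq_one_of_norm_eq_one {z : ℂ} (hz : z ∈ closedTriangle) (h1 : ‖z‖ = 1) :
    z ^ 3 = 1 := by
  have hn : z.re * z.re + z.im * z.im = 1 := by
    rw [← normSq_apply, normSq_eq_norm_sq, h1, one_pow]
  have h3 : √3 * √3 = 3 := Real.mul_self_sqrt (by norm_num)
  have hre : ∀ ζ : ℂ, ζ ^ 3 = 1 → -(1 / 2) ≤ (ζ * z).re := by
    intro ζ hζ
    have := hz.2 ζ hζ
    rw [side, normSq_eq_norm_sq, norm_rotation hζ, h1] at this
    linarith
  have e1 := hre 1 (one_pow 3)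
  have e2 := hre ⟨-1 / 2, √3 / 2⟩ (by
    apply Complex.ext <;> simp [pow_succ]
    · linear_combination (3 / 8) * h3
    · linear_combination (-√3 / 8) * h3)
  have e3 := hre ⟨-1 / 2, -√3 / 2⟩ (by
    apply Complex.ext <;> simp [pow_succ]
    · linear_combination (3 / 8) * h3
    · linear_combination (√3 / 8) * h3)
  rw [one_mul] at e1
  simp only [mul_re] at e2 e3
  have e4 : 3 * (z.im * z.im) ≤ (1 - z.re) * (1 - z.re) := by
    have f1 : √3 * z.im ≤ 1 - z.re := by linarith
    have f2 : -(1 - z.re) ≤ √3 * z.im := by linarith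
    have f3 : (√3 * z.im) * (√3 * z.im) ≤ (1 - z.re) * (1 - z.re) := by nlinarith
    nlinarith
  have e5 : (1 - z.re) * (2 * z.re + 1) = 0 := by
    have hle : z.re ≤ 1 := by nlinarith [mul_self_nonneg z.im]
    have f1 : 0 ≤ (1 - z.re) * (2 * z.re + 1) := mul_nonneg (by linarith) (by linarith)
    nlinarith
  rcases mul_eq_zero.1 e5 with h | h
  · have hr : z.re = 1 := by linarith
    have hi : z.im = 0 := by rw [hr] at hn; nlinarith
    rw [show z = 1 from Complex.ext hr hi, one_pow]
  · have hr : z.re = -1 / 2 := by linarith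
    have hi : z.im * z.im = 3 / 4 := by rw [hr] at hn; linarith
    apply Complex.ext
    · simp [pow_succ]
      rw [hr]
      linear_combination (3 / 2) * hi
    · simp [pow_succ]
      rw [hr]
      linear_combination (-z.im) * hi

theorem one_mem_closedTriangle : (1 : ℂ) ∈ closedTriangle := by
  refine ⟨by simp, fun ζ hζ => ?_⟩
  rw [mul_one, side, normSq_eq_norm_sq, norm_eq_one_of_cube hζ]
  have h : (ζ - 1) * (1 + ζ + ζ ^ 2) = 0 := by linear_combination hζ
  rcases mul_eq_zero.1 h with h | h
  · rw [sub_eq_zero.1 h]; norm_num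
  · have h1 : ζ ^ 2 = conj ζ := by
      have h2 : ζ * conj ζ = 1 := by
        rw [mul_conj, normSq_eq_norm_sq, norm_eq_one_of_cube hζ]; norm_num
      have h0 : ζ ≠ 0 := by rintro rfl; norm_num at hζ
      apply mul_left_cancel₀ h0
      rw [h2, ← hζ]; ring
    rw [h1] at h
    have := congrArg Complex.re h
    simp at this
    linarith

theorem cube_mem_closure_quotOpen {z : ℂ} (hz : z ∈ closedTriangle) : z ^ 3 ∈ closure quotOpen := by
  have hc : Tendsto (fun t : ℝ => ((t : ℂ) * z) ^ 3) (𝓝[<] 1) (𝓝 (z ^ 3)) := by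
    have : Tendsto (fun t : ℝ => ((t : ℂ) * z) ^ 3) (𝓝 1) (𝓝 ((((1 : ℝ) : ℂ) * z) ^ 3)) :=
      (by fun_prop : Continuous fun t : ℝ => ((t : ℂ) * z) ^ 3).tendsto 1
    rw [ofReal_one, one_mul] at this
    exact this.mono_left nhdsWithin_le_nhds
  refine mem_closure_of_tendsto hc ?_
  filter_upwards [self_mem_nhdsWithin, nhdsWithin_le_nhds (Ioi_mem_nhds (zero_lt_one' ℝ))]
    with t h1 h0
  exact ⟨_, smul_mem_openTriangle hz (le_of_lt h0) h1, rfl⟩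

theorem closure_quotOpen : closure quotOpen = (fun z : ℂ => z ^ 3) '' closedTriangle := by
  refine Subset.antisymm (closure_minimal ?_ ?_) ?_
  · exact image_mono (openTriangle_subset.trans triangle_subset_closedTriangle)
  · have : IsCompact closedTriangle := (isCompact_closedBall (0 : ℂ) 1).of_isClosed_subset
      isClosed_closedTriangle fun z hz => by simpa using hz.1
    exact (this.image (by fun_prop)).isClosed
  · rintro _ ⟨z, hz, rfl⟩
    exact cube_mem_closure_quotOpen hz

theorem closure_quotOpen_diff : closure quotOpen \ {1} = quot 0 := by
  rw [closure_quotOpen]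
  ext ξ
  constructor
  · rintro ⟨⟨z, hz, rfl⟩, h⟩
    refine ⟨z, ⟨lt_of_le_of_ne hz.1 fun h1 => h (cube_eq_one_of_norm_eq_one hz h1), hz.2⟩, rfl⟩
  · intro h
    have h1 := norm_lt_one_of_mem_quot h
    obtain ⟨z, hz, rfl⟩ := h
    refine ⟨⟨z, triangle_subset_closedTriangle hz, rfl⟩, fun h => ?_⟩
    rw [mem_singleton_iff.1 h] at h1
    simp at h1

/-- The boundary of the quotient triangle is the image of the edge. -/
theorem quot_zero_diff : quot 0 \ quotOpen = (fun z : ℂ => z ^ 3) '' edge := by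
  ext ξ
  constructor
  · rintro ⟨⟨z, hz, rfl⟩, h⟩
    have h1 : ∃ ζ : ℂ, ζ ^ 3 = 1 ∧ side (ζ * z) ≤ 0 := by
      by_contra! hcon
      exact h ⟨z, ⟨hz.1, hcon⟩, rfl⟩
    obtain ⟨ζ, hζ, hs⟩ := h1
    refine ⟨ζ * z, ⟨by rw [norm_rotation hζ]; exact hz.1, le_antisymm hs (hz.2 ζ hζ)⟩, ?_⟩
    simp only [mul_pow, hζ, one_mul]
  · rintro ⟨z, ⟨hz, hs⟩, rfl⟩
    refine ⟨⟨z, mem_triangle_of_side_eq_zero hz hs, rfl⟩, fun h => ?_⟩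
    have := (cube_mem_quotOpen_iff.1 h).2 1 (one_pow 3)
    rw [one_mul, hs] at this
    exact lt_irrefl _ this

theorem isPreconnected_edge : IsPreconnected edge := by
  have : edge = (fun y : ℝ => (⟨-2 + √(3 - y ^ 2), y⟩ : ℂ)) '' {y | y ^ 2 < 3 / 4} := by
    ext z
    constructor
    · rintro ⟨hz, hs⟩
      have h1 := normSq_lt_one hz
      rw [side, normSq_apply] at hs
      rw [normSq_apply] at h1
      have hx : -(1 / 2) < z.re := by linarith
      refine ⟨z.im, ?_, ?_⟩
      · have hx1 : z.re < 1 := by nlinarith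
        rw [mem_ofPred_eq]
        nlinarith [mul_pos (show 0 < z.re + 1 / 2 by linarith) (show 0 < z.re + 7 / 2 by linarith)]
      · have : √(3 - z.im ^ 2) = z.re + 2 := by
          rw [Real.sqrt_eq_iff_mul_self_eq_of_pos (by linarith)]; nlinarith
        apply Complex.ext
        · simp only; rw [this]; ring
        · rfl
    · rintro ⟨y, hy, rfl⟩
      have hy' : y ^ 2 < 3 / 4 := hy
      have h1 : √(3 - y ^ 2) * √(3 - y ^ 2) = 3 - y ^ 2 := Real.mul_self_sqrt (by linarith)
      have h0 : 0 ≤ √(3 - y ^ 2) := Real.sqrt_nonneg _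
      have h2 : 3 / 2 < √(3 - y ^ 2) := by nlinarith
      constructor
      · have : normSq (⟨-2 + √(3 - y ^ 2), y⟩ : ℂ) < 1 := by rw [normSq_apply]; nlinarith
        rw [normSq_eq_norm_sq] at this
        nlinarith [norm_nonneg (⟨-2 + √(3 - y ^ 2), y⟩ : ℂ)]
      · rw [side, normSq_apply]; nlinarith
  rw [this]
  have hcv : IsPreconnected {y : ℝ | y ^ 2 < 3 / 4} := by
    have : {y : ℝ | y ^ 2 < 3 / 4} = Ioo (-√(3 / 4)) √(3 / 4) := by
      ext y; rw [mem_ofPred_eq, Real.sq_lt, mem_Ioo]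
    rw [this]; exact isPreconnected_Ioo
  refine hcv.image _ (Continuous.continuousOn ?_)
  have : (fun y : ℝ => (⟨-2 + √(3 - y ^ 2), y⟩ : ℂ)) =
      fun y : ℝ => ((-2 + √(3 - y ^ 2) : ℝ) : ℂ) + (y : ℂ) * I := by
    funext y; rw [← mk_eq_add_mul_I]
  rw [this]
  fun_prop

theorem ne_zero_of_side_eq_zero {z : ℂ} (hs : side z = 0) : z ≠ 0 := by
  rintro rfl
  rw [side_zero] at hs
  exact one_ne_zero hs

theorem isAnalyticBoundaryPt_quotOpen {z₀ : ℂ} (h : z₀ ∈ edge) :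
    IsAnalyticBoundaryPt quotOpen (z₀ ^ 3) := by
  obtain ⟨hz, hs⟩ := h
  set e : ℂ → ℂ := fun ζ => -2 + (z₀ + 2) * exp (-I * ζ) with he
  have he0 : e 0 = z₀ := by simp [e]
  have hed : Differentiable ℂ e := by intro ζ; fun_prop
  have hstrict : HasStrictDerivAt (fun ζ => e ζ ^ 3)
      (3 * e 0 ^ 2 * ((z₀ + 2) * (exp (-I * 0) * (-I * 1)))) 0 := by
    have h1 : HasStrictDerivAt e ((z₀ + 2) * (exp (-I * 0) * (-I * 1))) 0 :=
      ((((hasStrictDerivAt_id (0 : ℂ)).const_mul (-I)).cexp).const_mul (z₀ + 2)).const_add (-2)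
    simpa using h1.fun_pow 3
  have hne : 3 * e 0 ^ 2 * ((z₀ + 2) * (exp (-I * 0) * (-I * 1))) ≠ 0 := by
    rw [he0]
    refine mul_ne_zero (mul_ne_zero three_ne_zero (pow_ne_zero 2 (ne_zero_of_side_eq_zero hs)))
      (mul_ne_zero (add_two_ne hz) ?_)
    simp
  have h1 : ∀ᶠ ζ in 𝓝 (0 : ℂ), hstrict.localInverse _ _ _ hne (e ζ ^ 3) = ζ :=
    (hstrict.hasStrictFDerivAt_equiv hne).eventually_left_inverse
  have hce : ContinuousAt e 0 := hed.continuous.continuousAt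
  have h2 : ∀ᶠ ζ in 𝓝 (0 : ℂ), ‖e ζ‖ < 1 :=
    hce.norm.eventually_lt continuousAt_const (by rwa [he0])
  have h3 : ∀ᶠ ζ in 𝓝 (0 : ℂ), ∀ ω ∈ {ω : ℂ | ω ^ 3 = 1}, ω ≠ 1 → 0 < side (ω * e ζ) := by
    rw [finite_cube_roots.eventually_all]
    intro ω hω
    by_cases hω1 : ω = 1
    · exact .of_forall fun w h => absurd hω1 h
    · have hc : ContinuousAt (fun ζ => side (ω * e ζ)) 0 :=
        (continuous_side.comp (continuous_const.mul hed.continuous)).continuousAt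
      have hlt : 0 < side (ω * e 0) := by rw [he0]; exact side_rotation_pos hz hs.le hω hω1
      filter_upwards [hc.eventually (lt_mem_nhds hlt)] with w hw _
      exact hw
  obtain ⟨δ, hδ, hball⟩ := Metric.eventually_nhds_iff_ball.1 (h1.and (h2.and h3))
  refine ⟨fun ζ => e ζ ^ 3, δ, hδ, (hed.pow 3).differentiableOn, ?_, by simp only [he0], ?_⟩
  · intro ζ hζ ζ' hζ' hee
    have h4 := (hball ζ hζ).1
    rw [show e ζ ^ 3 = e ζ' ^ 3 from hee, (hball ζ' hζ').1] at h4
    exact h4.symm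
  · intro ζ hζ
    obtain ⟨-, h5, h6⟩ := hball ζ hζ
    rw [cube_mem_quotOpen_iff]
    have hside : side (e ζ) = 3 * Real.exp ζ.im ^ 2 - 3 := by
      have h7 : normSq (z₀ + 2) = 3 := by linarith [side_eq z₀]
      rw [side_eq, show e ζ + 2 = (z₀ + 2) * exp (-I * ζ) by simp [e], normSq_mul, h7,
        normSq_eq_norm_sq, norm_exp]
      simp
    have hiff : 0 < side (e ζ) ↔ 0 < ζ.im := by
      rw [hside]
      constructor
      · intro h
        by_contra! hle
        have : Real.exp ζ.im ≤ 1 := Real.exp_le_one_iff.2 hle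
        nlinarith [Real.exp_pos ζ.im]
      · intro h
        have : 1 < Real.exp ζ.im := Real.one_lt_exp_iff.2 h
        nlinarith
    rw [← hiff]
    constructor
    · intro h
      simpa using h.2 1 (one_pow 3)
    · intro h
      refine ⟨h5, fun ω hω => ?_⟩
      by_cases hω1 : ω = 1
      · rwa [hω1, one_mul]
      · exact h6 ω hω hω1

theorem exists_isUniformization_quotOpen : ∃ q Φ G, IsUniformization quotOpen (quot 0) q Φ G := by
  have hsub : quotOpen ⊆ quot 0 := image_mono openTriangle_subset
  obtain ⟨φ, g, hφd, hgd, hφm, hgm, hgφ, hφg, hφ0⟩ := exists_riemann_map isOpen_quotOpen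
    (isPreconnected_of_star fun z hz s => smul_mem_quotOpen hz) zero_mem_quotOpen
    (hasContLog_of_star zero_mem_quotOpen fun z hz s h0 h1 => by
      simpa using smul_mem_quotOpen hz h0 h1) (x₀ := 3) (η := 1) one_pos (fun z hz => by
      have h1 := norm_lt_one_of_mem_quot (hsub hz)
      have h2 := norm_sub_norm_le 3 z
      rw [norm_sub_rev, norm_ofNat] at h2
      linarith)
  have hbd : (closure quotOpen \ quotOpen) \ {1} = (fun z : ℂ => z ^ 3) '' edge := by
    rw [sdiff_sdiff_comm, closure_quotOpen_diff, quot_zero_diff]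
  obtain ⟨q, Φ, G, hq, hΦφ, hGg, hΦc, hGc, hΦm, hGm, hGΦ, hΦG⟩ :=
    IsRiemannPair.exists_extension (p := 1) ⟨isOpen_quotOpen, hφd, hgd, hφm, hgm, hgφ, hφg⟩
    (isBounded_ball.subset fun z hz => mem_ball_zero_iff.2 (norm_lt_one_of_mem_quot (hsub hz)))
    ⟨by simpa using cube_mem_closure_quotOpen one_mem_closedTriangle, fun h => by
      have := norm_lt_one_of_mem_quot (hsub h)
      simp at this⟩
    (by rw [hbd]; exact isPreconnected_edge.image _ (by fun_prop))
    (by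
      rw [hbd]
      rintro _ ⟨z, hz, rfl⟩
      exact isAnalyticBoundaryPt_quotOpen hz)
  rw [closure_quotOpen_diff] at hΦc hΦm hGm hGΦ
  exact ⟨q, Φ, G, hq, hφd.congr hΦφ, hgd.congr hGg, fun z hz => hΦφ hz ▸ hφm hz,
    fun z hz => hGg hz ▸ hgm hz, hΦc, hGc, hΦm, hGm, hGΦ, hΦG, by
      rw [hΦφ zero_mem_quotOpen, hφ0]⟩

/-! ### The conjugacy of the fundamental tiles -/

/-- The reflection in the line `Re (b Z) = 1 / 2`. -/
noncomputable def mirror (b Z : ℂ) : ℂ := (1 - conj (b * Z)) / b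

/-- The points of the plane that the Schwarz reflection takes to the fundamental tile in at most `n`
steps, in the coordinate `X`; in the coordinates `Z` and `X` the Schwarz reflection is
`cubic Z ↦ cubic (mirror b Z)` for `Re (b Z) ≥ 1 / 2`, and the pole of `cubic` is excluded because
its image is the cusp. -/
def tiles (b : ℂ) : ℕ → Set ℂ
  | 0 => tile b
  | n + 1 => tile b ∪ {X | ∃ Z, 1 / 2 ≤ (b * Z).re ∧ 1 + 3 * mirror b Z ≠ 0 ∧
      cubic (mirror b Z) ∈ tiles b n ∧ cubic Z = X}

/-- A conformal conjugacy between the first `n` generations of tiles: `χ` and `ψ` are mutually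
inverse homeomorphisms between `quot n` and `tiles b n`, holomorphic in the interior and extending
`χ₀`, and `χ` carries the model map to the Schwarz reflection. -/
structure Stage (b : ℂ) (χ₀ : ℂ → ℂ) (n : ℕ) (χ ψ : ℂ → ℂ) : Prop where
  maps : MapsTo χ (quot n) (tiles b n)
  maps_inv : MapsTo ψ (tiles b n) (quot n)
  left_inv : LeftInvOn ψ χ (quot n)
  right_inv : LeftInvOn χ ψ (tiles b n)
  cont : ContinuousOn χ (quot n)
  cont_inv : ContinuousOn ψ (tiles b n)
  diff : DifferentiableOn ℂ χ (interior (quot n))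
  maps_interior : MapsTo ψ (interior (tiles b n)) (interior (quot n))
  base : EqOn χ χ₀ (quot 0)
  conjugacy : ∀ z ∈ model n, side z ≤ 0 → ∃ Z, 1 / 2 ≤ (b * Z).re ∧ cubic Z = χ (z ^ 3) ∧
    1 + 3 * mirror b Z ≠ 0 ∧ cubic (mirror b Z) = χ (refl z ^ 3)

theorem tile_subset_tiles (b : ℂ) (n : ℕ) : tile b ⊆ tiles b n := by
  cases n with
  | zero => exact subset_rfl
  | succ n => exact subset_union_left

namespace Admissible

variable {b : ℂ}

theorem mul_mirror (hb : Admissible b) (Z : ℂ) : b * mirror b Z = 1 - conj (b * Z) := by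
  rw [mirror, mul_div_cancel₀ _ hb.ne_zero]

theorem re_mul_mirror (hb : Admissible b) (Z : ℂ) : (b * mirror b Z).re = 1 - (b * Z).re := by
  rw [hb.mul_mirror]; simp

theorem mirror_mirror (hb : Admissible b) (Z : ℂ) : mirror b (mirror b Z) = Z := by
  have := hb.ne_zero
  rw [mirror, hb.mul_mirror]
  simp only [map_sub, map_one, conj_conj]
  field_simp
  ring

theorem mirror_of_re_eq (hb : Admissible b) {Z : ℂ} (h : (b * Z).re = 1 / 2) :
    mirror b Z = Z := by
  apply mul_left_cancel₀ hb.ne_zero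
  rw [hb.mul_mirror]
  apply Complex.ext
  · rw [sub_re, conj_re, h]; norm_num
  · rw [sub_im, conj_im]; simp

theorem continuous_mirror (b : ℂ) : Continuous (mirror b) := by
  unfold mirror
  exact (continuous_const.sub (continuous_conj.comp (continuous_const.mul continuous_id))).div_const b

end Admissible

theorem interior_quot_zero : interior (quot 0) = quotOpen := by
  refine Subset.antisymm ?_
    (interior_maximal (image_mono openTriangle_subset) isOpen_quotOpen)
  intro ξ hξ
  obtain ⟨z, hz, rfl⟩ := interior_subset hξ
  rw [cube_mem_interior_quot_iff] at hξ
  refine ⟨z, ⟨hz.1, fun ζ hζ => lt_of_le_of_ne (hz.2 ζ hζ) fun hs => ?_⟩, rfl⟩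
  -- moving the edge point towards `-2` leaves the triangle
  rw [← rotation_mem_interior_model hζ] at hξ
  set w := ζ * z
  have hc : Tendsto (fun t : ℝ => w - t * (w + 2)) (𝓝[>] 0) (𝓝 w) := by
    have : Tendsto (fun t : ℝ => w - t * (w + 2)) (𝓝 0) (𝓝 (w - (0 : ℝ) * (w + 2))) :=
      (by fun_prop : Continuous fun t : ℝ => w - t * (w + 2)).tendsto 0
    rw [ofReal_zero, zero_mul, sub_zero] at this
    exact this.mono_left nhdsWithin_le_nhds
  obtain ⟨t, ht, ht0, ht1⟩ := ((hc.eventually (isOpen_interior.mem_nhds hξ)).and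
    ((show ∀ᶠ t : ℝ in 𝓝[>] 0, t ∈ Ioi (0 : ℝ) from self_mem_nhdsWithin).and
      (nhdsWithin_le_nhds (Iio_mem_nhds (zero_lt_one' ℝ))))).exists
  have h1 := (interior_subset ht).2 1 (one_pow 3)
  have h2 : normSq (w + 2) = 3 := by linarith [side_eq w]
  rw [one_mul, side_eq, show w - t * (w + 2) + 2 = ((1 - t : ℝ) : ℂ) * (w + 2) by push_cast; ring,
    normSq_mul, normSq_ofReal, h2] at h1
  have h3 : 0 < t := ht0
  have h4 : t < 1 := ht1
  nlinarith

namespace Admissible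

variable {b : ℂ}

/-- The conformal isomorphism of the fundamental tiles, composed from the uniformizations of both
by a disc with one boundary point removed. -/
theorem exists_stage_zero (hb : Admissible b) : ∃ χ ψ, Stage b χ 0 χ ψ ∧ χ 0 = 0 ∧
    ∀ ξ ∈ quot 0, χ ξ ∈ cap b (1 / 2) ↔ ξ ∈ quotOpen := by
  obtain ⟨q₁, Φ₁, G₁, h₁⟩ := hb.exists_isUniformization
  obtain ⟨q₂, Φ₂, G₂, h₂⟩ := exists_isUniformization_quotOpen
  have hn : ∀ q q' : ℂ, ‖q‖ = 1 → ‖q'‖ = 1 → ∀ z : ℂ, ‖q / q' * z‖ = ‖z‖ := by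
    intro q q' h h' z
    rw [norm_mul, norm_div, h, h', div_one, one_mul]
  have h0 : ∀ q : ℂ, ‖q‖ = 1 → q ≠ 0 := fun q h => by rw [← norm_pos_iff, h]; exact one_pos
  have hrot : ∀ q q' : ℂ, ‖q‖ = 1 → ‖q'‖ = 1 →
      MapsTo (fun z => q / q' * z) (closedBall 0 1 \ {q'}) (closedBall 0 1 \ {q}) := by
    rintro q q' h h' z ⟨hz, hzq⟩
    refine ⟨by rw [mem_closedBall_zero_iff, hn q q' h h']; simpa using hz, fun e => hzq ?_⟩
    have hq := h0 q h
    have hq' := h0 q' h'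
    rw [mem_singleton_iff] at e ⊢
    simp only at e
    rw [div_mul_eq_mul_div, div_eq_iff hq'] at e
    exact mul_left_cancel₀ hq e
  have hball : ∀ q q' : ℂ, ‖q‖ = 1 → ‖q'‖ = 1 →
      MapsTo (fun z => q / q' * z) (ball 0 1) (ball 0 1) := by
    intro q q' h h' z hz
    rw [mem_ball_zero_iff] at hz ⊢
    rwa [hn q q' h h']
  have hcancel : ∀ q q' : ℂ, ‖q‖ = 1 → ‖q'‖ = 1 → ∀ z, q / q' * (q' / q * z) = z := by
    intro q q' h h' z
    have hq := h0 q h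
    have hq' := h0 q' h'
    field_simp
  have e₁ := h₁.norm_q
  have e₂ := h₂.norm_q
  have hopen : MapsTo (fun ξ => G₁ (q₁ / q₂ * Φ₂ ξ)) quotOpen (cap b (1 / 2)) := fun ξ hξ =>
    h₁.maps_inv_open (hball _ _ e₁ e₂ (h₂.maps_open hξ))
  have hopen' : MapsTo (fun X => G₂ (q₂ / q₁ * Φ₁ X)) (cap b (1 / 2)) quotOpen := fun X hX =>
    h₂.maps_inv_open (hball _ _ e₂ e₁ (h₁.maps_open hX))
  have hl : LeftInvOn (fun X => G₂ (q₂ / q₁ * Φ₁ X)) (fun ξ => G₁ (q₁ / q₂ * Φ₂ ξ)) (quot 0) := by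
    intro ξ hξ
    simp only
    rw [h₁.right_inv (hrot _ _ e₁ e₂ (h₂.maps hξ)), hcancel _ _ e₂ e₁, h₂.left_inv hξ]
  have hiff : ∀ ξ ∈ quot 0, G₁ (q₁ / q₂ * Φ₂ ξ) ∈ cap b (1 / 2) ↔ ξ ∈ quotOpen := by
    refine fun ξ hξ => ⟨fun h => ?_, fun h => hopen h⟩
    have := hopen' h
    rwa [hl hξ] at this
  have hm : MapsTo (fun ξ => G₁ (q₁ / q₂ * Φ₂ ξ)) (quot 0) (tile b) := fun ξ hξ =>
    h₁.maps_inv (hrot _ _ e₁ e₂ (h₂.maps hξ))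
  refine ⟨fun ξ => G₁ (q₁ / q₂ * Φ₂ ξ), fun X => G₂ (q₂ / q₁ * Φ₁ X),
    ⟨hm, ?_, hl, ?_, ?_, ?_, ?_, ?_, fun _ _ => rfl, ?_⟩, ?_, hiff⟩
  · exact fun X hX => h₂.maps_inv (hrot _ _ e₂ e₁ (h₁.maps hX))
  · intro X hX
    simp only
    rw [h₂.right_inv (hrot _ _ e₂ e₁ (h₁.maps hX)), hcancel _ _ e₁ e₂, h₁.left_inv hX]
  · exact h₁.cont_inv.comp (continuousOn_const.mul h₂.cont)
      fun ξ hξ => hrot _ _ e₁ e₂ (h₂.maps hξ)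
  · exact h₂.cont_inv.comp (continuousOn_const.mul h₁.cont)
      fun X hX => hrot _ _ e₂ e₁ (h₁.maps hX)
  · rw [interior_quot_zero]
    exact h₁.diff_inv.comp (h₂.diff.const_mul _)
      fun ξ hξ => hball _ _ e₁ e₂ (h₂.maps_open hξ)
  · rw [interior_quot_zero, tiles, hb.interior_tile]
    exact hopen'
  · intro z hz hs
    have hs0 : side z = 0 := le_antisymm hs (by simpa using hz.2 1 (one_pow 3))
    have hzq : z ^ 3 ∈ quot 0 := cube_mem_quot_iff.2 hz
    have hnot : z ^ 3 ∉ quotOpen := fun h => by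
      have := (cube_mem_quotOpen_iff.1 h).2 1 (one_pow 3)
      rw [one_mul, hs0] at this
      exact lt_irrefl _ this
    have hline : G₁ (q₁ / q₂ * Φ₂ (z ^ 3)) ∈ tile b \ cap b (1 / 2) :=
      ⟨hm hzq, fun h => hnot ((hiff _ hzq).1 h)⟩
    rw [hb.tile_diff_cap] at hline
    obtain ⟨Z, hZ, hZe⟩ := hline
    have hZ' : (b * Z).re = 1 / 2 := hZ
    refine ⟨Z, hZ'.ge, hZe, ?_⟩
    rw [refl_of_side_eq_zero hz.1 hs0, hb.mirror_of_re_eq hZ']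
    exact ⟨hb.pole_ne (by rw [hZ']; norm_num), hZe⟩
  · simp only
    rw [h₂.map_zero, mul_zero]
    have := h₁.left_inv hb.zero_mem_tile
    rwa [h₁.map_zero] at this

end Admissible

/-! ### Lifting the conjugacy through the cubic -/

theorem param_denom_ne {t : ℂ} (h : 1 + t ^ 3 ≠ 0) : 1 - t + t ^ 2 ≠ 0 := fun h0 => h (by
  linear_combination (1 + t) * h0)

theorem one_add_ne {t : ℂ} (h : 1 + t ^ 3 ≠ 0) : 1 + t ≠ 0 := fun h0 => h (by
  linear_combination (1 - t + t ^ 2) * h0)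

theorem pole_ne_param {t : ℂ} (h : 1 + t ^ 3 ≠ 0) : 1 + 3 * (t / (1 - t + t ^ 2)) ≠ 0 := by
  have h1 := param_denom_ne h
  have h2 : 1 + 3 * (t / (1 - t + t ^ 2)) = (1 + t) ^ 2 / (1 - t + t ^ 2) := by
    field_simp
    ring
  rw [h2]
  exact div_ne_zero (pow_ne_zero 2 (one_add_ne h)) h1

/-- The parametrization `t ↦ t / (1 - t + t²)` turns the cubic into the Koebe function of `t³`. -/
theorem cubic_param {t : ℂ} (h : 1 + t ^ 3 ≠ 0) :
    cubic (t / (1 - t + t ^ 2)) = t ^ 3 / (1 + t ^ 3) ^ 2 := by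
  have h1 := param_denom_ne h
  have h3 := one_add_ne h
  have h2 : 1 + 3 * (t / (1 - t + t ^ 2)) = (1 + t) ^ 2 / (1 - t + t ^ 2) := by
    field_simp
    ring
  rw [cubic, h2, show 1 + t ^ 3 = (1 + t) * (1 - t + t ^ 2) by ring]
  field_simp

/-- The preimages of `t³ / (1 + t³)²` under the cubic correspond to the cube roots of `t³`. -/
theorem exists_param_eq {t W : ℂ} (h : 1 + t ^ 3 ≠ 0) (hW : 1 + 3 * W ≠ 0)
    (he : cubic W = t ^ 3 / (1 + t ^ 3) ^ 2) :
    ∃ ζ : ℂ, ζ ^ 3 = 1 ∧ W = ζ * t / (1 - ζ * t + (ζ * t) ^ 2) := by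
  obtain ⟨ω, hω⟩ : ∃ ω : ℂ, 1 + ω + ω ^ 2 = 0 := by
    refine ⟨⟨-1 / 2, √3 / 2⟩, ?_⟩
    have h3 : √3 * √3 = 3 := Real.mul_self_sqrt (by norm_num)
    apply Complex.ext <;> simp [pow_succ]
    · linear_combination (-1 / 4) * h3
    · ring
  have hω3 : ω ^ 3 = 1 := by linear_combination (ω - 1) * hω
  rw [cubic, div_eq_div_iff hW (pow_ne_zero 2 h)] at he
  have hprod : (W * (1 - t + t ^ 2) - t) * ((W * (1 - ω * t + (ω * t) ^ 2) - ω * t) *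
      (W * (1 - ω ^ 2 * t + (ω ^ 2 * t) ^ 2) - ω ^ 2 * t)) = 0 := by
    have : (W * (1 - t + t ^ 2) - t) * ((W * (1 - ω * t + (ω * t) ^ 2) - ω * t) *
      (W * (1 - ω ^ 2 * t + (ω ^ 2 * t) ^ 2) - ω ^ 2 * t)) =
      W ^ 3 * (1 + t ^ 3) ^ 2 - t ^ 3 * (1 + 3 * W) := by grind
    rw [this, he, sub_self]
  have key : ∀ ζ : ℂ, ζ ^ 3 = 1 → W * (1 - ζ * t + (ζ * t) ^ 2) - ζ * t = 0 →
      W = ζ * t / (1 - ζ * t + (ζ * t) ^ 2) := by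
    intro ζ hζ h0
    have := param_denom_ne (t := ζ * t) (by rwa [mul_pow, hζ, one_mul])
    rw [eq_div_iff this, sub_eq_zero.1 h0]
  rcases mul_eq_zero.1 hprod with h0 | h0
  · exact ⟨1, one_pow 3, key 1 (one_pow 3) (by simpa using h0)⟩
  · rcases mul_eq_zero.1 h0 with h0 | h0
    · exact ⟨ω, hω3, key ω hω3 h0⟩
    · have : (ω ^ 2) ^ 3 = 1 := by rw [← pow_mul, mul_comm, pow_mul, hω3, one_pow]
      exact ⟨ω ^ 2, this, key _ this h0⟩

theorem param_injective {t ζ : ℂ} (hζ : ζ ^ 3 = 1) (h : 1 + t ^ 3 ≠ 0) (h' : t ^ 3 ≠ 1)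
    (he : t / (1 - t + t ^ 2) = ζ * t / (1 - ζ * t + (ζ * t) ^ 2)) : t = 0 ∨ ζ = 1 := by
  rw [div_eq_div_iff (param_denom_ne h)
    (param_denom_ne (t := ζ * t) (by rwa [mul_pow, hζ, one_mul]))] at he
  have h1 : t * ((1 - ζ) * (1 - ζ * t ^ 2)) = 0 := by linear_combination he
  rcases mul_eq_zero.1 h1 with h0 | h0
  · exact Or.inl h0
  rcases mul_eq_zero.1 h0 with h0 | h0
  · exact Or.inr (sub_eq_zero.1 h0).symm
  · exfalso
    have h2 : (1 + t ^ 3) * (t ^ 3 - 1) = 0 := by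
      have : ζ ^ 3 * (t ^ 3) ^ 2 = 1 := by
        have h3 : ζ * t ^ 2 = 1 := (sub_eq_zero.1 h0).symm
        calc ζ ^ 3 * (t ^ 3) ^ 2 = (ζ * t ^ 2) ^ 3 := by ring
          _ = 1 := by rw [h3, one_pow]
      rw [hζ] at this
      linear_combination this
    rcases mul_eq_zero.1 h2 with h3 | h3
    · exact h h3
    · exact h' (sub_eq_zero.1 h3)

/-- `Y` lifts `z ↦ χ (z³)` through the cubic; it maps onto the full preimage and carries the edge
of the triangle into the boundary line. -/
structure IsLift (b : ℂ) (n : ℕ) (χ Y : ℂ → ℂ) : Prop where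
  pole_ne : ∀ z ∈ model n, 1 + 3 * Y z ≠ 0
  cubic_eq : ∀ z ∈ model n, cubic (Y z) = χ (z ^ 3)
  exists_eq : ∀ z ∈ model n, ∀ W, 1 + 3 * W ≠ 0 → cubic W = χ (z ^ 3) →
    ∃ ζ : ℂ, ζ ^ 3 = 1 ∧ W = Y (ζ * z)
  injOn : InjOn Y (model n)
  cont : ContinuousOn Y (model n)
  diff : DifferentiableOn ℂ Y (interior (model n))
  map_zero : Y 0 = 0
  line : ∀ z ∈ edge, (b * Y z).re = 1 / 2

/-- If `χ` omits the critical value `1 / 4`, then it is the Koebe function `s / (1 + s)²` of a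
function `s` with a cube root in the variable `z = ξ^(1/3)`. -/
theorem exists_cube_root_koebe {n : ℕ} {χ : ℂ → ℂ} (hc : ContinuousOn χ (quot n))
    (hd : DifferentiableOn ℂ χ (interior (quot n))) (hi : InjOn χ (quot n)) (h0 : χ 0 = 0)
    (h4 : ∀ ξ ∈ quot n, χ ξ ≠ 1 / 4) :
    ∃ t : ℂ → ℂ, ContinuousOn t (model n) ∧ DifferentiableOn ℂ t (interior (model n)) ∧ t 0 = 0 ∧
      ∀ z ∈ model n, 1 + t z ^ 3 ≠ 0 ∧ t z ^ 3 ≠ 1 ∧ χ (z ^ 3) = t z ^ 3 / (1 + t z ^ 3) ^ 2 ∧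
        (t z = 0 → z = 0) ∧ ∀ ζ : ℂ, ζ ^ 3 = 1 → t (ζ * z) = ζ * t z := by
  set A := quot n with hA
  have h0A : (0 : ℂ) ∈ A := zero_mem_quot n
  have hAn : A ∈ 𝓝 (0 : ℂ) := mem_interior_iff_mem_nhds.1 (zero_mem_interior_quot n)
  -- the square root `k` of `1 - 4 χ`
  obtain ⟨L, hL, hLe⟩ := hasContLog_quot n (fun ξ => 1 - 4 * χ ξ)
    (continuousOn_const.sub (continuousOn_const.mul hc)) (fun ξ hξ h => h4 ξ hξ (by
      linear_combination (-1 / 4) * h))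
  set k : ℂ → ℂ := fun ξ => exp ((L ξ - L 0) / 2) with hk
  have hkc : ContinuousOn k A := ((hL.sub continuousOn_const).div_const 2).cexp
  have hk2 : ∀ ξ ∈ A, k ξ ^ 2 = 1 - 4 * χ ξ := by
    intro ξ hξ
    have e0 : exp (L 0) = 1 := by rw [hLe 0 h0A, h0]; ring
    rw [← hLe ξ hξ, hk]
    simp only
    rw [← Complex.exp_nat_mul, show ((2 : ℕ) : ℂ) * ((L ξ - L 0) / 2) = L ξ - L 0 by push_cast; ring,
      Complex.exp_sub, e0, div_one]
  have hk0 : k 0 = 1 := by simp [hk]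
  have hkne : ∀ ξ, k ξ ≠ 0 := fun ξ => Complex.exp_ne_zero _
  have hkd : DifferentiableOn ℂ k (interior A) := by
    intro ξ hξ
    have hsq : HasStrictDerivAt (fun w : ℂ => w ^ 2) (2 * k ξ) (k ξ) := by
      simpa using hasStrictDerivAt_pow 2 (k ξ)
    refine (differentiableAt_of_lift hsq (mul_ne_zero two_ne_zero (hkne ξ))
      (hkc.continuousAt (mem_interior_iff_mem_nhds.1 hξ))
      (h := fun ξ => 1 - 4 * χ ξ) ?_ ?_).differentiableWithinAt
    · exact ((hd.differentiableAt (isOpen_interior.mem_nhds hξ)).const_mul 4).const_sub 1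
    · filter_upwards [mem_interior_iff_mem_nhds.1 hξ] with w hw using hk2 w hw
  have hk1 : ∀ ξ ∈ A, 1 + k ξ ≠ 0 := by
    intro ξ hξ h
    have e1 := hk2 ξ hξ
    have e2 : χ ξ = χ 0 := by
      rw [h0]
      linear_combination (1 / 4) * e1 - (k ξ - 1) / 4 * h
    rw [hi hξ h0A e2, hk0] at h
    norm_num at h
  set s : ℂ → ℂ := fun ξ => (1 - k ξ) / (1 + k ξ) with hs
  have hs1 : ∀ ξ ∈ A, 1 + s ξ = 2 / (1 + k ξ) := by
    intro ξ hξ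
    have := hk1 ξ hξ
    simp only [hs]
    field_simp
    ring
  have hs1' : ∀ ξ ∈ A, 1 + s ξ ≠ 0 := fun ξ hξ => by
    rw [hs1 ξ hξ]; exact div_ne_zero two_ne_zero (hk1 ξ hξ)
  have hsne1 : ∀ ξ ∈ A, s ξ ≠ 1 := by
    intro ξ hξ h
    have := hk1 ξ hξ
    simp only [hs] at h
    rw [div_eq_one_iff_eq this] at h
    exact hkne ξ (by linear_combination (-1 / 2) * h)
  have hχs : ∀ ξ ∈ A, χ ξ = s ξ / (1 + s ξ) ^ 2 := by
    intro ξ hξ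
    have e1 := hk2 ξ hξ
    have e2 := hk1 ξ hξ
    rw [hs1 ξ hξ]
    simp only [hs]
    field_simp
    linear_combination e1
  have hs0 : s 0 = 0 := by simp [hs, hk0]
  have hsi : InjOn s A := fun ξ hξ ξ' hξ' h => hi hξ hξ' (by rw [hχs ξ hξ, hχs ξ' hξ', h])
  have hsc : ContinuousOn s A := (continuousOn_const.sub hkc).div (continuousOn_const.add hkc) hk1
  have hsd : DifferentiableOn ℂ s (interior A) :=
    (hkd.const_sub 1).div (hkd.const_add 1) fun ξ hξ => hk1 ξ (interior_subset hξ)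
  -- the logarithm of `s ξ / ξ`
  have hmc : ContinuousOn (dslope s 0) A := (continuousOn_dslope hAn).2
    ⟨hsc, hsd.differentiableAt (isOpen_interior.mem_nhds (zero_mem_interior_quot n))⟩
  have hmd : DifferentiableOn ℂ (dslope s 0) (interior A) :=
    (differentiableOn_dslope (isOpen_interior.mem_nhds (zero_mem_interior_quot n))).2 hsd
  have hms : ∀ ξ, ξ * dslope s 0 ξ = s ξ := fun ξ => by
    have := sub_smul_dslope s 0 ξ
    rwa [sub_zero, hs0, sub_zero, smul_eq_mul] at this
  have hmne : ∀ ξ ∈ A, dslope s 0 ξ ≠ 0 := by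
    intro ξ hξ
    by_cases hξ0 : ξ = 0
    · rw [hξ0, dslope_same]
      exact deriv_ne_zero_of_injOn isOpen_interior hsd (hsi.mono interior_subset)
        (zero_mem_interior_quot n)
    · intro h
      have h1 := hms ξ
      rw [h, mul_zero] at h1
      exact hξ0 (hsi hξ h0A (by rw [hs0, ← h1]))
  obtain ⟨ℓ, hℓ, hℓe⟩ := hasContLog_quot n _ hmc hmne
  have hℓd : DifferentiableOn ℂ ℓ (interior A) := by
    intro ξ hξ
    refine (differentiableAt_of_lift (Complex.hasStrictDerivAt_exp (ℓ ξ)) (Complex.exp_ne_zero _)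
      (hℓ.continuousAt (mem_interior_iff_mem_nhds.1 hξ))
      (hmd.differentiableAt (isOpen_interior.mem_nhds hξ)) ?_).differentiableWithinAt
    filter_upwards [mem_interior_iff_mem_nhds.1 hξ] with w hw using hℓe w hw
  have hmapsA : MapsTo (fun z : ℂ => z ^ 3) (model n) A := fun z hz => cube_mem_quot_iff.2 hz
  have ht3 : ∀ z ∈ model n, (z * exp (ℓ (z ^ 3) / 3)) ^ 3 = s (z ^ 3) := by
    intro z hz
    rw [← hms, ← hℓe _ (hmapsA hz), mul_pow, ← Complex.exp_nat_mul]
    congr 2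
    push_cast
    ring
  refine ⟨fun z => z * exp (ℓ (z ^ 3) / 3), ?_, ?_, by simp, fun z hz => ?_⟩
  · exact continuousOn_id.mul ((hℓ.comp (by fun_prop) hmapsA).div_const 3).cexp
  · exact differentiableOn_id.mul (((hℓd.comp (by fun_prop)
      fun z hz => cube_mem_interior_quot_iff.2 hz).div_const 3).cexp)
  · simp only
    rw [ht3 z hz]
    refine ⟨hs1' _ (hmapsA hz), hsne1 _ (hmapsA hz), hχs _ (hmapsA hz), fun h => ?_, fun ζ hζ => ?_⟩
    · exact (mul_eq_zero.1 h).resolve_right (Complex.exp_ne_zero _)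
    · rw [mul_pow, hζ, one_mul, mul_assoc]

namespace Stage

variable {b : ℂ} {χ₀ χ ψ : ℂ → ℂ} {n : ℕ}

/-- A lift exists as long as the critical value has not entered the tiles. -/
theorem exists_isLift (hb : Admissible b) (h : Stage b χ₀ n χ ψ) (h0 : χ₀ 0 = 0)
    (hcap : ∀ ξ ∈ quot 0, χ₀ ξ ∈ cap b (1 / 2) ↔ ξ ∈ quotOpen)
    (hmaps : MapsTo χ₀ (quot 0) (tile b)) (h4 : (1 / 4 : ℂ) ∉ tiles b n) :
    ∃ Y, IsLift b n χ Y := by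
  have hχ0 : χ 0 = 0 := by rw [h.base (zero_mem_quot 0), h0]
  obtain ⟨t, htc, htd, ht0, ht⟩ := exists_cube_root_koebe h.cont h.diff h.left_inv.injOn hχ0
    fun ξ hξ e => h4 (e ▸ h.maps hξ)
  set y : ℂ → ℂ := fun z => t z / (1 - t z + t z ^ 2) with hy
  have hden : ∀ z ∈ model n, 1 - t z + t z ^ 2 ≠ 0 := fun z hz => param_denom_ne (ht z hz).1
  have hyc : ContinuousOn y (model n) :=
    htc.div ((continuousOn_const.sub htc).add (htc.pow 2)) hden
  have hyd : DifferentiableOn ℂ y (interior (model n)) :=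
    htd.div ((htd.const_sub 1).add (htd.pow 2)) fun z hz => hden z (interior_subset hz)
  have hyp : ∀ z ∈ model n, 1 + 3 * y z ≠ 0 := fun z hz => pole_ne_param (ht z hz).1
  have hye : ∀ z ∈ model n, cubic (y z) = χ (z ^ 3) := fun z hz => by
    rw [(ht z hz).2.2.1]; exact cubic_param (ht z hz).1
  have hyr : ∀ z ∈ model n, ∀ ζ : ℂ, ζ ^ 3 = 1 →
      y (ζ * z) = ζ * t z / (1 - ζ * t z + (ζ * t z) ^ 2) := fun z hz ζ hζ => by
    simp only [hy, (ht z hz).2.2.2.2 ζ hζ]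
  have hyex : ∀ z ∈ model n, ∀ W, 1 + 3 * W ≠ 0 → cubic W = χ (z ^ 3) →
      ∃ ζ : ℂ, ζ ^ 3 = 1 ∧ W = y (ζ * z) := by
    intro z hz W hW he
    rw [(ht z hz).2.2.1] at he
    obtain ⟨ζ, hζ, hWe⟩ := exists_param_eq (ht z hz).1 hW he
    exact ⟨ζ, hζ, by rw [hyr z hz ζ hζ, hWe]⟩
  have hyi : InjOn y (model n) := by
    intro z hz w hw he
    have h1 : w ^ 3 = z ^ 3 := by
      refine h.left_inv.injOn (cube_mem_quot_iff.2 hw) (cube_mem_quot_iff.2 hz) ?_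
      rw [← hye w hw, ← hye z hz, he]
    obtain ⟨ζ, hζ, rfl⟩ := exists_rotation h1
    rw [hyr z hz ζ hζ] at he
    rcases param_injective hζ (ht z hz).1 (ht z hz).2.1 he with h2 | h2
    · rw [(ht z hz).2.2.2.1 h2, mul_zero]
    · rw [h2, one_mul]
  -- one of the three rotated copies of the edge is carried into the line
  have hedge : edge ⊆ model n := fun z hz =>
    triangle_subset_model n (mem_triangle_of_side_eq_zero hz.1 hz.2)
  have hex : ∀ z ∈ edge, ∃ ζ : ℂ, ζ ^ 3 = 1 ∧ (b * y (ζ * z)).re = 1 / 2 := by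
    intro z hz
    have hz0 : z ^ 3 ∈ quot 0 := cube_mem_quot_iff.2 (mem_triangle_of_side_eq_zero hz.1 hz.2)
    have hline : χ (z ^ 3) ∈ tile b \ cap b (1 / 2) := by
      rw [h.base hz0]
      refine ⟨hmaps hz0, fun hc => ?_⟩
      have h1 := (cube_mem_quotOpen_iff.1 ((hcap _ hz0).1 hc)).2 1 (one_pow 3)
      rw [one_mul, hz.2] at h1
      exact lt_irrefl _ h1
    rw [hb.tile_diff_cap] at hline
    obtain ⟨W, hW, hWe⟩ := hline
    have hW' : (b * W).re = 1 / 2 := hW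
    obtain ⟨ζ, hζ, rfl⟩ := hyex z (hedge hz) W (hb.pole_ne (by rw [hW']; norm_num)) hWe
    exact ⟨ζ, hζ, hW'⟩
  have huniq : ∀ z ∈ edge, ∀ ζ ζ' : ℂ, ζ ^ 3 = 1 → ζ' ^ 3 = 1 → (b * y (ζ * z)).re = 1 / 2 →
      (b * y (ζ' * z)).re = 1 / 2 → ζ = ζ' := by
    intro z hz ζ ζ' hζ hζ' h1 h2
    have hm := rotation_mem_model hζ (hedge hz)
    have hm' := rotation_mem_model hζ' (hedge hz)
    have he : y (ζ * z) = y (ζ' * z) := by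
      refine hb.injOn h1 h2 ?_
      rw [hye _ hm, hye _ hm', mul_pow, mul_pow, hζ, hζ']
    exact mul_right_cancel₀ (ne_zero_of_side_eq_zero hz.2) (hyi hm hm' he)
  obtain ⟨ζ₀, hζ₀, hline⟩ : ∃ ζ₀ : ℂ, ζ₀ ^ 3 = 1 ∧ ∀ z ∈ edge, (b * y (ζ₀ * z)).re = 1 / 2 := by
    rcases edge.eq_empty_or_nonempty with hE | ⟨z₀, hz₀⟩
    · exact ⟨1, one_pow 3, fun z hz => absurd hz (by rw [hE]; exact notMem_empty z)⟩
    obtain ⟨ζ₀, hζ₀, hl₀⟩ := hex z₀ hz₀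
    refine ⟨ζ₀, hζ₀, ?_⟩
    have hcl : ∀ ζ : ℂ, ζ ^ 3 = 1 →
        ContinuousOn (fun z => (b * y (ζ * z)).re) edge := fun ζ hζ =>
      continuous_re.comp_continuousOn (continuousOn_const.mul (hyc.comp (by fun_prop)
        fun z hz => rotation_mem_model hζ (hedge hz)))
    -- the index `ζ` is locally constant along the edge
    by_contra! hcon
    obtain ⟨z₁, hz₁, hne⟩ := hcon
    have hT : ∀ ζ : ℂ, ζ ^ 3 = 1 →
        ∃ C : Set ℂ, IsClosed C ∧ ∀ z ∈ edge, z ∈ C ↔ (b * y (ζ * z)).re = 1 / 2 := by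
      intro ζ hζ
      obtain ⟨C, hC, hCe⟩ := (continuousOn_iff_isClosed.1 (hcl ζ hζ)) {1 / 2} isClosed_singleton
      refine ⟨C, hC, fun z hz => ?_⟩
      have := Set.ext_iff.1 hCe z
      simp only [mem_inter_iff, mem_preimage, mem_singleton_iff, hz, and_true] at this
      exact this.symm
    choose! C hC hCe using hT
    have hfin : {ζ : ℂ | ζ ^ 3 = 1 ∧ ζ ≠ ζ₀}.Finite := finite_cube_roots.subset fun ζ hζ => hζ.1
    obtain ⟨z, hz, hz1, hz2⟩ := isPreconnected_closed_iff.1 isPreconnected_edge (C ζ₀)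
      (⋃ ζ ∈ {ζ : ℂ | ζ ^ 3 = 1 ∧ ζ ≠ ζ₀}, C ζ) (hC ζ₀ hζ₀)
      (hfin.isClosed_biUnion fun ζ hζ => hC ζ hζ.1) (by
        intro z hz
        obtain ⟨ζ, hζ, hl⟩ := hex z hz
        by_cases hζe : ζ = ζ₀
        · left; rw [hCe ζ₀ hζ₀ z hz, ← hζe]; exact hl
        · right; exact mem_biUnion (show ζ ∈ {ζ : ℂ | ζ ^ 3 = 1 ∧ ζ ≠ ζ₀} from ⟨hζ, hζe⟩)
            ((hCe ζ hζ z hz).2 hl))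
      ⟨z₀, hz₀, (hCe ζ₀ hζ₀ z₀ hz₀).2 hl₀⟩ (by
        obtain ⟨ζ, hζ, hl⟩ := hex z₁ hz₁
        refine ⟨z₁, hz₁, mem_biUnion (show ζ ∈ {ζ : ℂ | ζ ^ 3 = 1 ∧ ζ ≠ ζ₀} from ⟨hζ, ?_⟩)
          ((hCe ζ hζ z₁ hz₁).2 hl)⟩
        rintro rfl
        exact hne hl)
    obtain ⟨ζ, ⟨hζ, hζne⟩, hzC⟩ := mem_iUnion₂.1 hz2
    exact hζne (huniq z hz ζ ζ₀ hζ hζ₀ ((hCe ζ hζ z hz).1 hzC) ((hCe ζ₀ hζ₀ z hz).1 hz1))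
  have hm₀ : ∀ z ∈ model n, ζ₀ * z ∈ model n := fun z hz => rotation_mem_model hζ₀ hz
  have hcube : ∀ z : ℂ, (ζ₀ * z) ^ 3 = z ^ 3 := fun z => by rw [mul_pow, hζ₀, one_mul]
  have hζ0 : ζ₀ ≠ 0 := by rintro rfl; norm_num at hζ₀
  refine ⟨fun z => y (ζ₀ * z), fun z hz => hyp _ (hm₀ z hz), fun z hz => ?_, fun z hz W hW he => ?_,
    fun z hz w hw he => mul_left_cancel₀ hζ0 (hyi (hm₀ z hz) (hm₀ w hw) he),
    hyc.comp (by fun_prop) hm₀, hyd.comp (by fun_prop) (fun z hz =>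
      (rotation_mem_interior_model hζ₀).2 hz), ?_, hline⟩
  · simp only [hye _ (hm₀ z hz), hcube]
  · obtain ⟨ζ, hζ, rfl⟩ := hyex z hz W hW he
    refine ⟨ζ * ζ₀⁻¹, by rw [mul_pow, hζ, inv_pow, hζ₀, inv_one, one_mul], ?_⟩
    congr 1
    field_simp
  · simp [hy, ht0]

end Stage

/-! ### Position of the lift relative to the line -/

/-- `χ₀` is a conformal conjugacy of the fundamental tiles that fixes `0` and respects their
interiors. -/
structure IsBase (b : ℂ) (χ₀ ψ₀ : ℂ → ℂ) : Prop where
  stage : Stage b χ₀ 0 χ₀ ψ₀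
  map_zero : χ₀ 0 = 0
  cap_iff : ∀ ξ ∈ quot 0, χ₀ ξ ∈ cap b (1 / 2) ↔ ξ ∈ quotOpen

/-- The cubic is open, as it is not locally constant. -/
theorem nhds_le_map_cubic {W : ℂ} (hW : 1 + 3 * W ≠ 0) : 𝓝 (cubic W) ≤ map cubic (𝓝 W) := by
  have hne : ∀ᶠ V : ℂ in 𝓝 W, 1 + 3 * V ≠ 0 :=
    (by fun_prop : ContinuousAt (fun Z : ℂ => 1 + 3 * Z) W).eventually_ne hW
  have han : AnalyticAt ℂ cubic W := analyticAt_iff_eventually_differentiableAt.2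
    (hne.mono fun V hV => (hasDerivAt_cubic hV).hasDerivAt.differentiableAt)
  refine han.eventually_constant_or_nhds_le_map_nhds.resolve_left fun h => ?_
  have h1 : ∀ᶠ V in 𝓝 W, V ∈ ({0, -1 / 2} : Set ℂ) := by
    filter_upwards [h.eventually_nhds, hne] with V hV hVne
    have h2 : HasDerivAt cubic 0 V := (hasDerivAt_const V (cubic W)).congr_of_eventuallyEq hV
    have h3 := (hasDerivAt_cubic hVne).hasDerivAt.unique h2
    rw [div_eq_zero_iff, or_iff_left (pow_ne_zero 2 hVne), mul_eq_zero, mul_eq_zero,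
      or_iff_right three_ne_zero, pow_eq_zero_iff two_ne_zero] at h3
    rcases h3 with h3 | h3
    · exact Or.inl h3
    · right
      rw [mem_singleton_iff]
      linear_combination (1 / 2) * h3
  exact infinite_of_mem_nhds W h1 (Set.toFinite ({0, -1 / 2} : Set ℂ))

theorem notMem_quot_zero {z : ℂ} (hs : side z < 0) : z ^ 3 ∉ quot 0 := fun h =>
  notMem_triangle hs (cube_mem_quot_iff (n := 0).1 h)

theorem edge_subset_model (n : ℕ) : edge ⊆ model n := fun _ hz =>
  triangle_subset_model n (mem_triangle_of_side_eq_zero hz.1 hz.2)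

/-- A map that becomes continuous after passing to cubes is continuous if it has a continuous left
inverse. -/
theorem continuousOn_of_cube {P Y : ℂ → ℂ} {A M : Set ℂ} (hM : ∀ z ∈ M, ∀ ζ : ℂ, ζ ^ 3 = 1 → ζ * z ∈ M)
    (hP : MapsTo P A M) (hY : ContinuousOn Y M) (hi : InjOn Y M) (hYP : ∀ W ∈ A, Y (P W) = W)
    (hc : ContinuousOn (fun W => P W ^ 3) A) : ContinuousOn P A := by
  intro W hW
  rw [ContinuousWithinAt, tendsto_iff_ultrafilter]
  intro u hu
  have hu3 : Tendsto (fun V => P V ^ 3) u (𝓝 (P W ^ 3)) := (hc W hW).mono_left hu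
  have huA : A ∈ (u : Filter ℂ) := hu self_mem_nhdsWithin
  -- the ultrafilter is bounded, hence convergent
  have hbd : ∀ᶠ V in (u : Filter ℂ), P V ∈ closedBall (0 : ℂ) (1 + ‖P W ^ 3‖ + 1) := by
    filter_upwards [hu3.norm.eventually_lt_const (lt_add_one ‖P W ^ 3‖)] with V hV
    rw [mem_closedBall_zero_iff]
    rw [norm_pow] at hV
    by_contra! hlt
    have h0 : 0 ≤ ‖P W ^ 3‖ := norm_nonneg _
    have h1 : (1 : ℝ) ≤ ‖P V‖ := by linarith
    have h2 : ‖P V‖ ≤ ‖P V‖ ^ 3 := le_self_pow₀ h1 three_ne_zero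
    linarith
  obtain ⟨y, -, hy⟩ := (isCompact_closedBall (0 : ℂ) (1 + ‖P W ^ 3‖ + 1)).ultrafilter_le_nhds
    (u.map P) (le_principal_iff.2 hbd)
  have hy' : Tendsto P u (𝓝 y) := hy
  have hcube : y ^ 3 = P W ^ 3 := tendsto_nhds_unique (hy'.pow 3) hu3
  obtain ⟨ζ, hζ, rfl⟩ := exists_rotation hcube
  have hyM := hM _ (hP hW) ζ hζ
  have hYt : Tendsto (fun V => Y (P V)) u (𝓝 (Y (ζ * P W))) :=
    (hY _ hyM).tendsto.comp (tendsto_nhdsWithin_iff.2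
      ⟨hy', Filter.mem_of_superset huA fun V hV => hP hV⟩)
  have hid : Tendsto (fun V => Y (P V)) u (𝓝 W) := by
    refine Tendsto.congr' (f₁ := id) ?_ (hu.trans nhdsWithin_le_nhds)
    filter_upwards [huA] with V hV
    rw [hYP V hV, id]
  have he : Y (ζ * P W) = Y (P W) := by rw [tendsto_nhds_unique hYt hid, hYP W hW]
  rwa [hi hyM (hP hW) he] at hy'

/-- Two conjugacies that agree on the fundamental tile agree, by the identity theorem. -/
theorem eqOn_quot {n : ℕ} {f g : ℂ → ℂ} (hf : ContinuousOn f (quot n)) (hg : ContinuousOn g (quot n))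
    (hfd : DifferentiableOn ℂ f (interior (quot n)))
    (hgd : DifferentiableOn ℂ g (interior (quot n))) (h : EqOn f g (quot 0)) :
    EqOn f g (quot n) := by
  have h1 : EqOn f g (interior (quot n)) :=
    (hfd.analyticOnNhd isOpen_interior).eqOn_of_preconnected_of_eventuallyEq
      (hgd.analyticOnNhd isOpen_interior) (isPreconnected_interior_quot n)
      (zero_mem_interior_quot n) (by
        filter_upwards [mem_interior_iff_mem_nhds.1 (zero_mem_interior_quot 0)] with ξ hξ
          using h hξ)
  exact h1.of_subset_closure hf hg interior_subset (quot_subset_closure_interior n)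

section

variable {b : ℂ} {χ₀ ψ₀ χ ψ Y : ℂ → ℂ} {n : ℕ}

theorem IsBase.exists_eq (hB : IsBase b χ₀ ψ₀) {X : ℂ} (hX : X ∈ tile b) :
    ∃ ξ ∈ quot 0, χ₀ ξ = X :=
  ⟨ψ₀ X, hB.stage.maps_inv hX, hB.stage.right_inv hX⟩

namespace Stage

theorem mem_tile_iff (h : Stage b χ₀ n χ ψ) (hB : IsBase b χ₀ ψ₀) {ξ : ℂ} (hξ : ξ ∈ quot n) :
    χ ξ ∈ tile b ↔ ξ ∈ quot 0 := by
  constructor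
  · intro hX
    obtain ⟨ξ', hξ', he⟩ := hB.exists_eq hX
    rw [← h.base hξ'] at he
    rwa [← h.left_inv.injOn (quot_mono (Nat.zero_le n) hξ') hξ he]
  · intro h0
    rw [h.base h0]
    exact hB.stage.maps h0

theorem inv_mem_quot_zero (h : Stage b χ₀ n χ ψ) (hB : IsBase b χ₀ ψ₀) {X : ℂ} (hX : X ∈ tile b) :
    ψ X ∈ quot 0 := by
  have hX' := tile_subset_tiles b n hX
  rw [← h.mem_tile_iff hB (h.maps_inv hX'), h.right_inv hX']
  exact hX

theorem mem_edge_of_re_eq (hb : Admissible b) (h : Stage b χ₀ n χ ψ) (hB : IsBase b χ₀ ψ₀)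
    (hY : IsLift b n χ Y) {z : ℂ} (hz : z ∈ model n) (hre : (b * Y z).re = 1 / 2) : z ∈ edge := by
  have hzq := cube_mem_quot_iff.2 hz
  have h1 : χ (z ^ 3) ∈ tile b \ cap b (1 / 2) := by
    rw [hb.tile_diff_cap, ← hY.cubic_eq z hz]
    exact ⟨_, hre, rfl⟩
  have h2 := (h.mem_tile_iff hB hzq).1 h1.1
  have h3 : z ^ 3 ∈ quot 0 \ quotOpen := by
    refine ⟨h2, fun h4 => h1.2 ?_⟩
    rw [h.base h2]
    exact (hB.cap_iff _ h2).2 h4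
  rw [quot_zero_diff] at h3
  obtain ⟨c, hc, hce⟩ := h3
  have hce' : c ^ 3 = z ^ 3 := hce
  have hcm := edge_subset_model n hc
  have h4 : Y c = Y z := by
    refine hb.injOn (hY.line c hc) hre ?_
    rw [hY.cubic_eq c hcm, hY.cubic_eq z hz, hce']
  rwa [← hY.injOn hcm hz h4]

theorem re_lt (hb : Admissible b) (h : Stage b χ₀ n χ ψ) (hB : IsBase b χ₀ ψ₀)
    (hY : IsLift b n χ Y) {z : ℂ} (hz : z ∈ model n) (hs : 0 < side z) :
    (b * Y z).re < 1 / 2 := by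
  have hA : IsPreconnected {z | z ∈ model n ∧ 0 < side z} := by
    refine isPreconnected_of_star fun w ⟨hw, hws⟩ t h0 h1 => ⟨smul_mem_model hw h0 h1, ?_⟩
    rw [side_eq_geodesicFun] at hws ⊢
    rcases h0.eq_or_lt with rfl | h0
    · simp [geodesicFun]
    have hn := normSq_lt_one (norm_lt_one_of_mem_model hw)
    have h2 : geodesicFun 1 (-2) (t * w) =
        t * geodesicFun 1 (-2) w + (1 - t) * (1 - t * normSq w) := by
      rw [geodesicFun, geodesicFun, normSq_mul, normSq_ofReal, mul_assoc (t : ℂ), re_ofReal_mul]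
      ring
    rw [h2]
    have : 0 ≤ (1 - t) * (1 - t * normSq w) :=
      mul_nonneg (by linarith) (by nlinarith [normSq_nonneg w])
    linarith [mul_pos h0 hws]
  by_contra! hge
  have hc : ContinuousOn (fun z => (b * Y z).re) {z | z ∈ model n ∧ 0 < side z} :=
    continuous_re.comp_continuousOn (continuousOn_const.mul (hY.cont.mono fun z hz => hz.1))
  obtain ⟨w, ⟨hw, hws⟩, hwe⟩ := hA.intermediate_value
    (show (0 : ℂ) ∈ {z | z ∈ model n ∧ 0 < side z} from
      ⟨zero_mem_model n, by rw [side_zero]; exact one_pos⟩) ⟨hz, hs⟩ hc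
    (show (1 / 2 : ℝ) ∈ Icc (b * Y 0).re (b * Y z).re from
      ⟨by rw [hY.map_zero, mul_zero, zero_re]; norm_num, hge⟩)
  have := (mem_edge_of_re_eq hb h hB hY hw hwe).2
  linarith

/-- The lift carries the half plane cut off by `C₂` into the half plane `Re (b Z) > 1 / 2`: of the
three preimages under the cubic, exactly one lies there, and it is not on the other side. -/
theorem lt_re (hb : Admissible b) (h : Stage b χ₀ n χ ψ) (hB : IsBase b χ₀ ψ₀)
    (hY : IsLift b n χ Y) {z : ℂ} (hz : z ∈ model n) (hs : side z < 0) :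
    1 / 2 < (b * Y z).re := by
  have hX : χ (z ^ 3) ∉ tile b := fun hX =>
    notMem_quot_zero hs ((h.mem_tile_iff hB (cube_mem_quot_iff.2 hz)).1 hX)
  rw [tile, notMem_compl_iff] at hX
  obtain ⟨W, hW, hWe⟩ := hX
  have hW' : 1 / 2 < (b * W).re := hW
  obtain ⟨ζ, hζ, rfl⟩ := hY.exists_eq z hz W (hb.pole_ne (by linarith)) hWe
  by_cases hζ1 : ζ = 1
  · rwa [hζ1, one_mul] at hW'
  · have := re_lt hb h hB hY (rotation_mem_model hζ hz)
      (side_rotation_pos (norm_lt_one_of_mem_model hz) hs.le hζ hζ1)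
    linarith

theorem side_nonneg (hb : Admissible b) (h : Stage b χ₀ n χ ψ) (hB : IsBase b χ₀ ψ₀)
    (hY : IsLift b n χ Y) {z : ℂ} (hz : z ∈ model n) (hre : (b * Y z).re ≤ 1 / 2) :
    0 ≤ side z := by
  by_contra! hlt
  linarith [lt_re hb h hB hY hz hlt]

theorem re_le (hb : Admissible b) (h : Stage b χ₀ n χ ψ) (hB : IsBase b χ₀ ψ₀)
    (hY : IsLift b n χ Y) {z : ℂ} (hz : z ∈ model n) (hs : 0 ≤ side z) :
    (b * Y z).re ≤ 1 / 2 := by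
  rcases hs.eq_or_lt with h0 | h0
  · exact (hY.line z ⟨norm_lt_one_of_mem_model hz, h0.symm⟩).le
  · exact (re_lt hb h hB hY hz h0).le

/-- The inverse of a lift. -/
theorem exists_lift_inv (h : Stage b χ₀ n χ ψ) (hY : IsLift b n χ Y) :
    ∃ P : ℂ → ℂ, (∀ W, 1 + 3 * W ≠ 0 → cubic W ∈ tiles b n →
        P W ∈ model n ∧ Y (P W) = W ∧ P W ^ 3 = ψ (cubic W)) ∧
      (∀ z ∈ model n, P (Y z) = z) ∧
      ContinuousOn P {W | 1 + 3 * W ≠ 0 ∧ cubic W ∈ tiles b n} := by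
  have hex : ∀ W, 1 + 3 * W ≠ 0 → cubic W ∈ tiles b n → ∃ z ∈ model n, Y z = W := by
    intro W hW hX
    obtain ⟨z, hz, hze⟩ := h.maps_inv hX
    have hze' : z ^ 3 = ψ (cubic W) := hze
    obtain ⟨ζ, hζ, he⟩ := hY.exists_eq z hz W hW (by rw [hze', h.right_inv hX])
    exact ⟨ζ * z, rotation_mem_model hζ hz, he.symm⟩
  have hP : ∀ W, 1 + 3 * W ≠ 0 → cubic W ∈ tiles b n →
      Function.invFunOn Y (model n) W ∈ model n ∧ Y (Function.invFunOn Y (model n) W) = W ∧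
        Function.invFunOn Y (model n) W ^ 3 = ψ (cubic W) := by
    intro W hW hX
    have h1 := Function.invFunOn_mem (hex W hW hX)
    have h2 := Function.invFunOn_eq (hex W hW hX)
    refine ⟨h1, h2, ?_⟩
    have h3 := hY.cubic_eq _ h1
    rw [h2] at h3
    rw [h3, h.left_inv (cube_mem_quot_iff.2 h1)]
  refine ⟨Function.invFunOn Y (model n), hP, fun z hz => hY.injOn.leftInvOn_invFunOn hz, ?_⟩
  refine continuousOn_of_cube (fun z hz ζ hζ => rotation_mem_model hζ hz)
    (fun W hW => (hP W hW.1 hW.2).1) hY.cont hY.injOn (fun W hW => (hP W hW.1 hW.2).2.1) ?_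
  have hc : ContinuousOn cubic {W | 1 + 3 * W ≠ 0 ∧ cubic W ∈ tiles b n} := fun W hW =>
    (continuousAt_cubic hW.1).continuousWithinAt
  exact (h.cont_inv.comp hc fun W hW => hW.2).congr fun W hW => (hP W hW.1 hW.2).2.2

end Stage

end

/-! ### Extension to the next generation of tiles -/

theorem continuousOn_of_pieces {f : ℂ → ℂ} {B C₁ C₂ : Set ℂ} (hB : B = C₁ ∪ C₂)
    (h1 : B ∩ closure C₁ ⊆ C₁) (h2 : B ∩ closure C₂ ⊆ C₂) (hf1 : ContinuousOn f C₁)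
    (hf2 : ContinuousOn f C₂) : ContinuousOn f B := by
  intro x hx
  have aux : ∀ C : Set ℂ, B ∩ closure C ⊆ C → ContinuousOn f C → ContinuousWithinAt f C x := by
    intro C hC hfC
    by_cases h : x ∈ closure C
    · exact hfC x (hC ⟨hx, h⟩)
    · exact continuousWithinAt_of_notMem_closure h
  rw [hB]
  exact (aux C₁ h1 hf1).union (aux C₂ h2 hf2)

theorem cubeRoot_pow (ξ : ℂ) : cubeRoot ξ ^ 3 = ξ := by
  rw [cubeRoot, neg_pow, cpow_nat_inv_pow _ three_ne_zero]
  ring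

theorem exists_of_mem_quot_succ {n : ℕ} {ξ : ℂ} (h : ξ ∈ quot (n + 1)) :
    ξ ∈ quot 0 ∨ ∃ z ∈ model (n + 1), side z < 0 ∧ z ^ 3 = ξ := by
  obtain ⟨z, hz, rfl⟩ := h
  by_cases h0 : z ∈ triangle
  · exact Or.inl ⟨z, h0, rfl⟩
  · obtain ⟨ζ, hζ, hs⟩ := exists_side_neg (norm_lt_one_of_mem_model hz) h0
    exact Or.inr ⟨ζ * z, rotation_mem_model hζ hz, hs, by simp only [mul_pow, hζ, one_mul]⟩

/-- The part of `quot n` in which the model map is defined. -/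
def quotDom (n : ℕ) : Set ℂ := (fun z : ℂ => z ^ 3) '' {z | z ∈ model n ∧ side z ≤ 0}

/-- The part of `tiles b n` in which the Schwarz reflection is defined. -/
def tilesDom (b : ℂ) (n : ℕ) : Set ℂ :=
  {X | ∃ Z, 1 / 2 ≤ (b * Z).re ∧ 1 + 3 * mirror b Z ≠ 0 ∧ cubic (mirror b Z) ∈ tiles b n ∧
    cubic Z = X}

theorem quot_succ_eq (n : ℕ) : quot (n + 1) = quot 0 ∪ quotDom (n + 1) := by
  refine Subset.antisymm (fun ξ hξ => ?_) (union_subset (quot_mono (Nat.zero_le _)) ?_)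
  · rcases exists_of_mem_quot_succ hξ with h | ⟨z, hz, hs, rfl⟩
    · exact Or.inl h
    · exact Or.inr ⟨z, ⟨hz, hs.le⟩, rfl⟩
  · rintro _ ⟨z, ⟨hz, -⟩, rfl⟩
    exact ⟨z, hz, rfl⟩

theorem quot_inter_closure_quot_zero (n : ℕ) : quot n ∩ closure (quot 0) ⊆ quot 0 := by
  rintro ξ ⟨hξ, hcl⟩
  rw [← closure_quotOpen_diff]
  refine ⟨?_, fun h => ?_⟩
  · have h1 : quot 0 ⊆ closure quotOpen := by rw [← closure_quotOpen_diff]; exact sdiff_subset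
    simpa using closure_mono h1 hcl
  · have := norm_lt_one_of_mem_quot hξ
    rw [mem_singleton_iff.1 h] at this
    simp at this

theorem quot_inter_closure_quotDom (n : ℕ) : quot n ∩ closure (quotDom n) ⊆ quotDom n := by
  rintro ξ ⟨hξ, hcl⟩
  have hcomp : IsCompact {z : ℂ | ‖z‖ ≤ 1 ∧ side z ≤ 0} := by
    refine (isCompact_closedBall (0 : ℂ) 1).of_isClosed_subset ?_ fun z hz => by simpa using hz.1
    exact (isClosed_le continuous_norm continuous_const).inter
      (isClosed_le continuous_side continuous_const)
  have h1 : closure (quotDom n) ⊆ (fun z : ℂ => z ^ 3) '' {z : ℂ | ‖z‖ ≤ 1 ∧ side z ≤ 0} :=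
    closure_minimal (image_mono fun z hz => ⟨(norm_lt_one_of_mem_model hz.1).le, hz.2⟩)
      (hcomp.image (by fun_prop)).isClosed
  obtain ⟨z, ⟨-, hs⟩, rfl⟩ := h1 hcl
  exact ⟨z, ⟨cube_mem_quot_iff.1 hξ, hs⟩, rfl⟩

/-- A conjugacy of the first `n` generations of tiles together with a lift `Y` through the cubic and
the inverse `P` of the lift. -/
structure LiftedStage (b : ℂ) (χ₀ ψ₀ : ℂ → ℂ) (n : ℕ) (χ ψ Y P : ℂ → ℂ) : Prop where
  adm : Admissible b
  base : IsBase b χ₀ ψ₀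
  stage : Stage b χ₀ n χ ψ
  lift : IsLift b n χ Y
  inv : ∀ W, 1 + 3 * W ≠ 0 → cubic W ∈ tiles b n →
    P W ∈ model n ∧ Y (P W) = W ∧ P W ^ 3 = ψ (cubic W)
  inv_lift : ∀ z ∈ model n, P (Y z) = z
  cont_inv : ContinuousOn P {W | 1 + 3 * W ≠ 0 ∧ cubic W ∈ tiles b n}

/-- The lift of the extended conjugacy on the half plane cut off by `C₂`, by reflection. -/
noncomputable def reflLift (b : ℂ) (Y : ℂ → ℂ) (z : ℂ) : ℂ := mirror b (Y (refl z))

open Classical in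
/-- The extension of a conjugacy to the next generation of tiles. -/
noncomputable def nextMap (b : ℂ) (χ Y : ℂ → ℂ) (ξ : ℂ) : ℂ :=
  if ξ ∈ quot 0 then χ ξ else cubic (reflLift b Y (cubeRoot ξ))

open Classical in
/-- The inverse of `nextMap`. -/
noncomputable def nextInv (b : ℂ) (ψ P : ℂ → ℂ) (X : ℂ) : ℂ :=
  if X ∈ tile b then ψ X else refl (P (mirror b (cubicInv b X))) ^ 3

theorem refl_mem_of_mem_succ {n : ℕ} {z : ℂ} (hz : z ∈ model (n + 1)) (hs : side z ≤ 0) :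
    refl z ∈ model n :=
  (mem_model_succ_iff (norm_lt_one_of_mem_model hz) hs).1 hz

namespace LiftedStage

variable {b : ℂ} {χ₀ ψ₀ χ ψ Y P : ℂ → ℂ} {n : ℕ}

theorem mirror_reflLift (S : LiftedStage b χ₀ ψ₀ n χ ψ Y P) (z : ℂ) :
    mirror b (reflLift b Y z) = Y (refl z) :=
  S.adm.mirror_mirror _

theorem half_le_re_reflLift (S : LiftedStage b χ₀ ψ₀ n χ ψ Y P) {z : ℂ} (hz : z ∈ model (n + 1))
    (hs : side z ≤ 0) : 1 / 2 ≤ (b * reflLift b Y z).re := by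
  rw [reflLift, S.adm.re_mul_mirror]
  have := S.stage.re_le S.adm S.base S.lift (refl_mem_of_mem_succ hz hs)
    (side_refl_nonneg (norm_lt_one_of_mem_model hz) hs)
  linarith

theorem nextMap_of_mem {ξ : ℂ} (hξ : ξ ∈ quot 0) : nextMap b χ Y ξ = χ ξ := if_pos hξ

theorem nextMap_cube (S : LiftedStage b χ₀ ψ₀ n χ ψ Y P) {z : ℂ} (hz : z ∈ model (n + 1))
    (hs : side z ≤ 0) : nextMap b χ Y (z ^ 3) = cubic (reflLift b Y z) := by
  have hz1 := norm_lt_one_of_mem_model hz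
  rcases hs.eq_or_lt with h0 | h0
  · have he : z ∈ edge := ⟨hz1, h0⟩
    rw [nextMap_of_mem (cube_mem_quot_iff.2 (edge_subset_model 0 he)), reflLift,
      refl_of_side_eq_zero hz1 h0, S.adm.mirror_of_re_eq (S.lift.line z he),
      S.lift.cubic_eq z (edge_subset_model n he)]
  · rw [nextMap, if_neg (notMem_quot_zero h0), cubeRoot_cube hz1 hs]

theorem nextInv_of_mem {X : ℂ} (hX : X ∈ tile b) : nextInv b ψ P X = ψ X := if_pos hX

theorem nextInv_cubic (S : LiftedStage b χ₀ ψ₀ n χ ψ Y P) {Z : ℂ} (hZ : 1 / 2 ≤ (b * Z).re)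
    (hp : 1 + 3 * mirror b Z ≠ 0) (hm : cubic (mirror b Z) ∈ tiles b n) :
    nextInv b ψ P (cubic Z) = refl (P (mirror b Z)) ^ 3 := by
  by_cases hX : cubic Z ∈ tile b
  · have hre := (S.adm.cubic_mem_tile_iff hZ).1 hX
    have he := S.adm.mirror_of_re_eq hre
    rw [he] at hp hm ⊢
    obtain ⟨h1, h2, h3⟩ := S.inv Z hp hm
    have hedge := S.stage.mem_edge_of_re_eq S.adm S.base S.lift h1 (by rw [h2]; exact hre)
    rw [nextInv_of_mem hX, refl_of_side_eq_zero hedge.1 hedge.2, h3]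
  · rw [nextInv, if_neg hX, S.adm.cubicInv_cubic hZ]

/-- The point of the model that corresponds to `cubic Z`. -/
theorem refl_inv_mem (S : LiftedStage b χ₀ ψ₀ n χ ψ Y P) {Z : ℂ} (hZ : 1 / 2 ≤ (b * Z).re)
    (hp : 1 + 3 * mirror b Z ≠ 0) (hm : cubic (mirror b Z) ∈ tiles b n) :
    refl (P (mirror b Z)) ∈ model (n + 1) ∧ side (refl (P (mirror b Z))) ≤ 0 ∧
      refl (refl (P (mirror b Z))) = P (mirror b Z) := by
  obtain ⟨h1, h2, -⟩ := S.inv _ hp hm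
  have hn := norm_lt_one_of_mem_model h1
  have hs := S.stage.side_nonneg S.adm S.base S.lift h1 (by
    rw [h2, S.adm.re_mul_mirror]; linarith)
  have hr := refl_refl hn
  have hs' := side_refl_nonpos hn hs
  exact ⟨(mem_model_succ_iff (norm_refl_lt_one hn) hs').2 (by rwa [hr]), hs', hr⟩

theorem maps (S : LiftedStage b χ₀ ψ₀ n χ ψ Y P) :
    MapsTo (nextMap b χ Y) (quot (n + 1)) (tiles b (n + 1)) := by
  intro ξ hξ
  rcases exists_of_mem_quot_succ hξ with h0 | ⟨z, hz, hs, rfl⟩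
  · rw [nextMap_of_mem h0, S.stage.base h0]
    exact tile_subset_tiles b _ (S.base.stage.maps h0)
  · rw [S.nextMap_cube hz hs.le]
    have hr := refl_mem_of_mem_succ hz hs.le
    refine Or.inr ⟨_, S.half_le_re_reflLift hz hs.le, ?_, ?_, rfl⟩ <;> rw [S.mirror_reflLift]
    · exact S.lift.pole_ne _ hr
    · rw [S.lift.cubic_eq _ hr]
      exact S.stage.maps (cube_mem_quot_iff.2 hr)

theorem maps_inv (S : LiftedStage b χ₀ ψ₀ n χ ψ Y P) :
    MapsTo (nextInv b ψ P) (tiles b (n + 1)) (quot (n + 1)) := by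
  rintro X (hX | ⟨Z, hZ, hp, hm, rfl⟩)
  · rw [nextInv_of_mem hX]
    exact quot_mono (Nat.zero_le _) (S.stage.inv_mem_quot_zero S.base hX)
  · rw [S.nextInv_cubic hZ hp hm]
    exact cube_mem_quot_iff.2 (S.refl_inv_mem hZ hp hm).1

theorem left_inv (S : LiftedStage b χ₀ ψ₀ n χ ψ Y P) :
    LeftInvOn (nextInv b ψ P) (nextMap b χ Y) (quot (n + 1)) := by
  intro ξ hξ
  rcases exists_of_mem_quot_succ hξ with h0 | ⟨z, hz, hs, rfl⟩
  · have h1 := quot_mono (Nat.zero_le n) h0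
    rw [nextMap_of_mem h0, nextInv_of_mem ((S.stage.mem_tile_iff S.base h1).2 h0),
      S.stage.left_inv h1]
  · have hr := refl_mem_of_mem_succ hz hs.le
    rw [S.nextMap_cube hz hs.le, S.nextInv_cubic (S.half_le_re_reflLift hz hs.le)] <;>
      rw [S.mirror_reflLift]
    · rw [S.inv_lift _ hr, refl_refl (norm_lt_one_of_mem_model hz)]
    · exact S.lift.pole_ne _ hr
    · rw [S.lift.cubic_eq _ hr]
      exact S.stage.maps (cube_mem_quot_iff.2 hr)

theorem right_inv (S : LiftedStage b χ₀ ψ₀ n χ ψ Y P) :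
    LeftInvOn (nextMap b χ Y) (nextInv b ψ P) (tiles b (n + 1)) := by
  rintro X (hX | ⟨Z, hZ, hp, hm, rfl⟩)
  · rw [nextInv_of_mem hX, nextMap_of_mem (S.stage.inv_mem_quot_zero S.base hX),
      S.stage.right_inv (tile_subset_tiles b n hX)]
  · obtain ⟨h1, h2, h3⟩ := S.refl_inv_mem hZ hp hm
    rw [S.nextInv_cubic hZ hp hm, S.nextMap_cube h1 h2, reflLift, h3, (S.inv _ hp hm).2.1,
      S.adm.mirror_mirror]

theorem cont (S : LiftedStage b χ₀ ψ₀ n χ ψ Y P) :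
    ContinuousOn (nextMap b χ Y) (quot (n + 1)) := by
  refine continuousOn_of_pieces (quot_succ_eq n) (quot_inter_closure_quot_zero _)
    (quot_inter_closure_quotDom _) ?_ ?_
  · exact (S.stage.cont.mono (quot_mono (Nat.zero_le n))).congr fun ξ hξ => nextMap_of_mem hξ
  · have h1 : ContinuousOn (fun ξ => refl (cubeRoot ξ)) (quotDom (n + 1)) := by
      rintro _ ⟨z, ⟨hz, hs⟩, rfl⟩
      have hz1 := norm_lt_one_of_mem_model hz
      have h2 := (differentiableAt_cubeRoot hz1 hs).continuousAt
      exact (ContinuousAt.comp (g := refl) (by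
        rw [cubeRoot_cube hz1 hs]; exact continuousAt_refl hz1) h2).continuousWithinAt
    have h2 : MapsTo (fun ξ => refl (cubeRoot ξ)) (quotDom (n + 1)) (model n) := by
      rintro _ ⟨z, ⟨hz, hs⟩, rfl⟩
      simp only
      rw [cubeRoot_cube (norm_lt_one_of_mem_model hz) hs]
      exact refl_mem_of_mem_succ hz hs
    have h3 := (Admissible.continuous_mirror b).comp_continuousOn (S.lift.cont.comp h1 h2)
    have h4 : ContinuousOn (cubic ∘ fun ξ => reflLift b Y (cubeRoot ξ)) (quotDom (n + 1)) := by
      refine S.adm.continuousOn_cubic.comp h3 ?_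
      rintro _ ⟨z, ⟨hz, hs⟩, rfl⟩
      have := S.half_le_re_reflLift hz hs
      rw [← cubeRoot_cube (norm_lt_one_of_mem_model hz) hs] at this
      exact this
    refine h4.congr ?_
    rintro _ ⟨z, ⟨hz, hs⟩, rfl⟩
    simp only [Function.comp_apply]
    rw [cubeRoot_cube (norm_lt_one_of_mem_model hz) hs, S.nextMap_cube hz hs]

theorem cont_nextInv (S : LiftedStage b χ₀ ψ₀ n χ ψ Y P) :
    ContinuousOn (nextInv b ψ P) (tiles b (n + 1)) := by
  have hdom : tilesDom b n ⊆ cubic '' {Z | 1 / 2 ≤ (b * Z).re} := by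
    rintro _ ⟨Z, hZ, -, -, rfl⟩
    exact ⟨Z, hZ, rfl⟩
  refine continuousOn_of_pieces (C₁ := tile b) (C₂ := tilesDom b n) rfl ?_ ?_ ?_ ?_
  · rw [S.adm.isClosed_tile.closure_eq]; exact inter_subset_right
  · rintro X ⟨hX | hX, hcl⟩
    · obtain ⟨Z, hZ, rfl⟩ := closure_minimal hdom S.adm.isClosed_image_closed hcl
      have hre := (S.adm.cubic_mem_tile_iff hZ).1 hX
      refine ⟨Z, hZ, ?_, ?_, rfl⟩ <;> rw [S.adm.mirror_of_re_eq hre]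
      · exact S.adm.pole_ne (by rw [hre]; norm_num)
      · exact tile_subset_tiles b n hX
    · exact hX
  · exact (S.stage.cont_inv.mono (tile_subset_tiles b n)).congr fun X hX => nextInv_of_mem hX
  · have h1 : ContinuousOn (fun X => mirror b (cubicInv b X)) (tilesDom b n) :=
      (Admissible.continuous_mirror b).comp_continuousOn (S.adm.continuousOn_cubicInv.mono hdom)
    have h2 : MapsTo (fun X => mirror b (cubicInv b X)) (tilesDom b n)
        {W | 1 + 3 * W ≠ 0 ∧ cubic W ∈ tiles b n} := by
      rintro _ ⟨Z, hZ, hp, hm, rfl⟩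
      simp only
      rw [S.adm.cubicInv_cubic hZ]
      exact ⟨hp, hm⟩
    have h3 := S.cont_inv.comp h1 h2
    have h4 : ContinuousOn (refl ∘ (P ∘ fun X => mirror b (cubicInv b X))) (tilesDom b n) :=
      fun X hX => ContinuousAt.comp_continuousWithinAt
        (f := P ∘ fun X => mirror b (cubicInv b X)) (g := refl)
        (continuousAt_refl (norm_lt_one_of_mem_model (S.inv _ (h2 hX).1 (h2 hX).2).1)) (h3 X hX)
    refine (h4.pow 3).congr ?_
    rintro _ ⟨Z, hZ, hp, hm, rfl⟩
    rw [S.nextInv_cubic hZ hp hm]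
    simp only [Pi.pow_apply, Function.comp_apply, S.adm.cubicInv_cubic hZ]

/-- Off the edge the extended map is holomorphic, being a composition with two reflections. -/
theorem differentiableAt_of_side_neg (S : LiftedStage b χ₀ ψ₀ n χ ψ Y P) {z : ℂ}
    (hz : z ∈ interior (model (n + 1))) (hs : side z < 0) :
    DifferentiableAt ℂ (nextMap b χ Y) (z ^ 3) := by
  have hzm := interior_subset hz
  have hz1 := norm_lt_one_of_mem_model hzm
  have hr := (mem_interior_model_succ_iff hz1 hs).1 hz
  have hroot := differentiableAt_cubeRoot hz1 hs.le
  have hrz := cubeRoot_cube hz1 hs.le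
  -- `refl` is the conjugate of a holomorphic map
  have hconj : ∀ w : ℂ, refl w = conj (-2 + 3 / (w + 2)) := fun w => by
    rw [refl]; simp [conj_ofNat]
  have hY : DifferentiableAt ℂ (fun ξ => conj (Y (conj (-2 + 3 / (cubeRoot ξ + 2))))) (z ^ 3) := by
    have h1 : DifferentiableAt ℂ (conj ∘ Y ∘ conj) (-2 + 3 / (cubeRoot (z ^ 3) + 2)) := by
      refine differentiableAt_conj_conj_iff.2 ?_
      rw [← hconj, hrz]
      exact S.lift.diff.differentiableAt (isOpen_interior.mem_nhds hr)
    have hne : cubeRoot (z ^ 3) + 2 ≠ 0 := by rw [hrz]; exact add_two_ne hz1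
    have h2 : DifferentiableAt ℂ (fun ξ => -2 + 3 / (cubeRoot ξ + 2)) (z ^ 3) :=
      ((differentiableAt_const 3).div (hroot.add_const 2) hne).const_add (-2)
    exact DifferentiableAt.comp (g := conj ∘ Y ∘ conj) _ h1 h2
  have hL : DifferentiableAt ℂ (fun ξ => reflLift b Y (cubeRoot ξ)) (z ^ 3) := by
    have : (fun ξ => reflLift b Y (cubeRoot ξ)) =
        fun ξ => (1 - conj b * conj (Y (conj (-2 + 3 / (cubeRoot ξ + 2))))) / b := by
      funext ξ
      rw [reflLift, mirror, map_mul, hconj]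
    rw [this]
    exact ((hY.const_mul _).const_sub 1).div_const b
  have hF : DifferentiableAt ℂ cubic (reflLift b Y (cubeRoot (z ^ 3))) := by
    rw [hrz]
    exact (hasDerivAt_cubic (S.adm.pole_ne (by
      linarith [S.half_le_re_reflLift hzm hs.le]))).hasDerivAt.differentiableAt
  refine (DifferentiableAt.comp (g := cubic)
    (f := fun ξ => reflLift b Y (cubeRoot ξ)) _ hF hL).congr_of_eventuallyEq ?_
  have hc : Tendsto cubeRoot (𝓝 (z ^ 3)) (𝓝 z) := by
    have := hroot.continuousAt
    rwa [ContinuousAt, hrz] at this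
  filter_upwards [hc.eventually (isOpen_interior.mem_nhds hz),
    hc.eventually (continuous_side.continuousAt.eventually_lt continuousAt_const hs)] with ξ h1 h2
  rw [Function.comp_apply, ← S.nextMap_cube (interior_subset h1) h2.le, cubeRoot_pow]

theorem differentiableAt_of_mem_quotOpen (S : LiftedStage b χ₀ ψ₀ n χ ψ Y P) {ξ : ℂ}
    (hξ : ξ ∈ quotOpen) : DifferentiableAt ℂ (nextMap b χ Y) ξ := by
  have hsub : quotOpen ⊆ interior (quot n) := by
    rw [← interior_quot_zero]; exact interior_mono (quot_mono (Nat.zero_le n))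
  refine (S.stage.diff.differentiableAt (isOpen_interior.mem_nhds
    (hsub hξ))).congr_of_eventuallyEq ?_
  filter_upwards [isOpen_quotOpen.mem_nhds hξ] with w hw
  exact nextMap_of_mem (image_mono openTriangle_subset hw)

/-- Across the edge the extended map is holomorphic, because circles are removable for continuous
functions. -/
theorem diff (S : LiftedStage b χ₀ ψ₀ n χ ψ Y P) :
    DifferentiableOn ℂ (nextMap b χ Y) (interior (quot (n + 1))) := by
  have key : ∀ z ∈ interior (model (n + 1)), (∀ ζ : ℂ, ζ ^ 3 = 1 → side (ζ * z) ≠ 0) →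
      DifferentiableAt ℂ (nextMap b χ Y) (z ^ 3) := by
    intro z hz hne
    by_cases hneg : ∃ ζ : ℂ, ζ ^ 3 = 1 ∧ side (ζ * z) < 0
    · obtain ⟨ζ, hζ, hs⟩ := hneg
      have := S.differentiableAt_of_side_neg ((rotation_mem_interior_model hζ).2 hz) hs
      rwa [mul_pow, hζ, one_mul] at this
    · push Not at hneg
      refine S.differentiableAt_of_mem_quotOpen ⟨z, ⟨norm_lt_one_of_mem_model (interior_subset hz),
        fun ζ hζ => lt_of_le_of_ne (hneg ζ hζ) (hne ζ hζ).symm⟩, rfl⟩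
  intro ξ hξ
  obtain ⟨z, hz, rfl⟩ := interior_subset hξ
  rw [cube_mem_interior_quot_iff] at hξ
  refine DifferentiableAt.differentiableWithinAt ?_
  by_cases hne : ∀ ζ : ℂ, ζ ^ 3 = 1 → side (ζ * z) ≠ 0
  · exact key z hξ hne
  push Not at hne
  obtain ⟨ζ, hζ, hs⟩ := hne
  rw [← rotation_mem_interior_model hζ] at hξ
  change DifferentiableAt ℂ (nextMap b χ Y) (z ^ 3)
  rw [show z ^ 3 = (ζ * z) ^ 3 by rw [mul_pow, hζ, one_mul] ]
  set w := ζ * z with hw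
  have hw1 : ‖w‖ < 1 := norm_lt_one_of_mem_model (interior_subset hξ)
  have hnear : ∀ᶠ v in 𝓝 w, v ∈ interior (model (n + 1)) ∧
      ∀ ω ∈ {ω : ℂ | ω ^ 3 = 1}, ω ≠ 1 → side (ω * v) ≠ 0 := by
    refine (isOpen_interior.eventually_mem hξ).and ?_
    rw [finite_cube_roots.eventually_all]
    intro ω hω
    by_cases hω1 : ω = 1
    · exact .of_forall fun v h => absurd hω1 h
    · have hc : ContinuousAt (fun v => side (ω * v)) w :=
        (continuous_side.comp (continuous_const.mul continuous_id)).continuousAt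
      filter_upwards [hc.eventually_ne (side_rotation_pos hw1 hs.le hω hω1).ne'] with v hv _
      exact hv
  obtain ⟨ε, hε, hball⟩ := Metric.eventually_nhds_iff_ball.1 hnear
  have hT : DifferentiableOn ℂ (fun v => nextMap b χ Y (v ^ 3)) (ball w ε) := by
    refine differentiableOn_of_off_circle isOpen_ball (c := -2) (r := √3) (by positivity) ?_ ?_
    · exact S.cont.comp (by fun_prop) fun v hv =>
        cube_mem_quot_iff.2 (interior_subset (hball v hv).1)
    · intro v hv hvne
      refine DifferentiableAt.comp (g := nextMap b χ Y) v (key v (hball v hv).1 fun ω hω => ?_)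
        (by fun_prop)
      by_cases hω1 : ω = 1
      · rw [hω1, one_mul]
        intro h0
        apply hvne
        rw [side_eq, normSq_eq_norm_sq] at h0
        rw [sub_neg_eq_add, ← Real.sqrt_sq (norm_nonneg (v + 2))]
        congr 1
        linarith
      · exact (hball v hv).2 ω hω hω1
  have hroot := differentiableAt_cubeRoot hw1 hs.le
  have hrw := cubeRoot_cube hw1 hs.le
  have hT' := hT.differentiableAt (ball_mem_nhds w hε)
  rw [← hrw] at hT'
  refine (DifferentiableAt.comp (g := fun v => nextMap b χ Y (v ^ 3)) _ hT'
    hroot).congr_of_eventuallyEq ?_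
  exact .of_forall fun ξ => by simp only [Function.comp_apply, cubeRoot_pow]

theorem maps_interior (S : LiftedStage b χ₀ ψ₀ n χ ψ Y P) :
    MapsTo (nextInv b ψ P) (interior (tiles b (n + 1))) (interior (quot (n + 1))) := by
  intro X hX
  by_cases hXt : X ∈ tile b
  · by_cases hXc : X ∈ cap b (1 / 2)
    · rw [nextInv_of_mem hXt]
      refine interior_mono (quot_mono (Nat.le_succ n)) (S.stage.maps_interior ?_)
      refine interior_mono (tile_subset_tiles b n) ?_
      rwa [S.adm.interior_tile]
    · have hline : X ∈ tile b \ cap b (1 / 2) := ⟨hXt, hXc⟩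
      rw [S.adm.tile_diff_cap] at hline
      obtain ⟨Z, hZ, rfl⟩ := hline
      have hre : (b * Z).re = 1 / 2 := hZ
      have hm := S.adm.mirror_of_re_eq hre
      have hp := S.adm.pole_ne (Z := Z) (by rw [hre]; norm_num)
      have hXm := tile_subset_tiles b n hXt
      obtain ⟨h1, h2, -⟩ := S.inv Z hp hXm
      have hedge := S.stage.mem_edge_of_re_eq S.adm S.base S.lift h1 (by rw [h2]; exact hre)
      rw [S.nextInv_cubic hre.ge (by rwa [hm]) (by rwa [hm]), hm,
        refl_of_side_eq_zero hedge.1 hedge.2]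
      exact cube_mem_interior_quot_iff.2 (mem_interior_model_succ_of_side_eq_zero hedge.1 hedge.2)
  · obtain ⟨Z, hZ, hp, hm, rfl⟩ := (interior_subset hX).resolve_left hXt
    have hZ' : 1 / 2 < (b * Z).re :=
      lt_of_le_of_ne hZ fun h => hXt ((S.adm.cubic_mem_tile_iff hZ).2 h.symm)
    -- a neighbourhood of `mirror b Z` is mapped into `tiles b n`
    have hnear : ∀ᶠ V in 𝓝 Z, cubic (mirror b V) ∈ tiles b n := by
      have hc := continuousAt_cubic (S.adm.pole_ne (Z := Z) (by linarith))
      filter_upwards [hc.eventually (isOpen_interior.mem_nhds hX),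
        hc.eventually (S.adm.isClosed_tile.isOpen_compl.mem_nhds hXt),
        (isOpen_lt continuous_const (by fun_prop : Continuous fun V : ℂ => (b * V).re)).mem_nhds hZ']
        with V h1 h2 h3
      obtain ⟨V', hV', -, hm', he⟩ := (interior_subset h1).resolve_left h2
      rwa [S.adm.injOn_closed hV' (show 1 / 2 < (b * V).re from h3).le he] at hm'
    have hint : cubic (mirror b Z) ∈ interior (tiles b n) := by
      rw [mem_interior_iff_mem_nhds]
      refine nhds_le_map_cubic hp ?_
      rw [Filter.mem_map]
      have hmc : Tendsto (mirror b) (𝓝 (mirror b Z)) (𝓝 Z) := by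
        have := (Admissible.continuous_mirror b).tendsto (mirror b Z)
        rwa [S.adm.mirror_mirror] at this
      filter_upwards [hmc.eventually hnear] with W hW
      rwa [S.adm.mirror_mirror] at hW
    have h1 := S.stage.maps_interior hint
    obtain ⟨h2, h3, h4⟩ := S.inv _ hp hm
    rw [← h4, cube_mem_interior_quot_iff] at h1
    obtain ⟨h5, h6, h7⟩ := S.refl_inv_mem hZ hp hm
    rw [S.nextInv_cubic hZ hp hm, cube_mem_interior_quot_iff]
    refine (mem_interior_model_succ_iff (norm_lt_one_of_mem_model h5)
      (lt_of_le_of_ne h6 fun h8 => ?_)).2 (by rwa [h7])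
    -- on the edge the point would belong to the fundamental tile
    have h9 : refl (P (mirror b Z)) ∈ edge := ⟨norm_lt_one_of_mem_model h5, h8⟩
    have h10 := S.lift.line _ h9
    rw [← refl_of_side_eq_zero h9.1 h9.2, h7, h3, S.adm.re_mul_mirror] at h10
    linarith

theorem eqOn (S : LiftedStage b χ₀ ψ₀ n χ ψ Y P) : EqOn (nextMap b χ Y) χ (quot n) :=
  eqOn_quot (S.cont.mono (quot_mono (Nat.le_succ n))) S.stage.cont
    (S.diff.mono (interior_mono (quot_mono (Nat.le_succ n)))) S.stage.diff
    fun _ hξ => nextMap_of_mem hξ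

theorem next (S : LiftedStage b χ₀ ψ₀ n χ ψ Y P) :
    Stage b χ₀ (n + 1) (nextMap b χ Y) (nextInv b ψ P) where
  maps := S.maps
  maps_inv := S.maps_inv
  left_inv := S.left_inv
  right_inv := S.right_inv
  cont := S.cont
  cont_inv := S.cont_nextInv
  diff := S.diff
  maps_interior := S.maps_interior
  base := fun ξ hξ => by rw [nextMap_of_mem hξ, S.stage.base hξ]
  conjugacy := by
    intro z hz hs
    have hr := refl_mem_of_mem_succ hz hs
    refine ⟨reflLift b Y z, S.half_le_re_reflLift hz hs, (S.nextMap_cube hz hs).symm, ?_, ?_⟩ <;>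
      rw [S.mirror_reflLift]
    · exact S.lift.pole_ne _ hr
    · rw [S.eqOn (cube_mem_quot_iff.2 hr), S.lift.cubic_eq _ hr]

end LiftedStage

/-- The conjugacy extends to the next generation of tiles as long as the critical value `1 / 4` has
not been reached. -/
theorem Stage.exists_next {b : ℂ} {χ₀ ψ₀ χ ψ : ℂ → ℂ} {n : ℕ} (hb : Admissible b)
    (hB : IsBase b χ₀ ψ₀) (h : Stage b χ₀ n χ ψ) (h4 : (1 / 4 : ℂ) ∉ tiles b n) :
    ∃ χ' ψ', Stage b χ₀ (n + 1) χ' ψ' := by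
  obtain ⟨Y, hY⟩ := h.exists_isLift hb hB.map_zero hB.cap_iff hB.stage.maps h4
  obtain ⟨P, h1, h2, h3⟩ := h.exists_lift_inv hY
  exact ⟨_, _, LiftedStage.next ⟨hb, hB, h, hY, h1, h2, h3⟩⟩

/-! ### Conjugacies in planar coordinates -/

theorem tiles_subset_succ (b : ℂ) (n : ℕ) : tiles b n ⊆ tiles b (n + 1) := by
  induction n with
  | zero => exact tile_subset_tiles b 1
  | succ n ih =>
    rintro X (h | ⟨Z, hZ, hp, hm, rfl⟩)
    · exact Or.inl h
    · exact Or.inr ⟨Z, hZ, hp, ih hm, rfl⟩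

theorem tiles_mono (b : ℂ) : Monotone (tiles b) := monotone_nat_of_le_succ (tiles_subset_succ b)

theorem cap_subset_tile (b : ℂ) : cap b (1 / 2) ⊆ tile b :=
  compl_subset_compl.2 (image_mono fun Z (hZ : 1 / 2 < (b * Z).re) => hZ.le)

theorem Admissible.tilesDom_eq {b : ℂ} (hb : Admissible b) (n : ℕ) :
    tilesDom b n = tiles b (n + 1) \ cap b (1 / 2) := by
  refine Subset.antisymm ?_ ?_
  · rintro _ ⟨Z, hZ, hp, hm, rfl⟩
    exact ⟨Or.inr ⟨Z, hZ, hp, hm, rfl⟩, fun h => h ⟨Z, hZ, rfl⟩⟩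
  · rintro X ⟨hX | hX, hc⟩
    · have h : X ∈ tile b \ cap b (1 / 2) := ⟨hX, hc⟩
      rw [hb.tile_diff_cap] at h
      obtain ⟨Z, hZ, rfl⟩ := h
      have hZ' : (b * Z).re = 1 / 2 := hZ
      refine ⟨Z, hZ'.ge, ?_, ?_, rfl⟩ <;> rw [hb.mirror_of_re_eq hZ']
      · exact hb.pole_ne (by rw [hZ']; norm_num)
      · exact tile_subset_tiles b n hX
    · exact hX

theorem quotOpen_subset (n : ℕ) : quotOpen ⊆ quot n :=
  (image_mono openTriangle_subset).trans (quot_mono (Nat.zero_le n))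

theorem exists_side_nonpos {z : ℂ} (hz : ‖z‖ < 1) (h : z ^ 3 ∉ quotOpen) :
    ∃ w : ℂ, ‖w‖ < 1 ∧ side w ≤ 0 ∧ w ^ 3 = z ^ 3 := by
  by_contra! hcon
  refine h ⟨z, ⟨hz, fun ζ hζ => ?_⟩, rfl⟩
  by_contra! hle
  exact hcon (ζ * z) (by rwa [norm_rotation hζ]) hle (by rw [mul_pow, hζ, one_mul])

theorem cube_notMem_quotOpen {z : ℂ} (hs : side z ≤ 0) : z ^ 3 ∉ quotOpen := fun h => by
  have := (cube_mem_quotOpen_iff.1 h).2 1 (one_pow 3)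
  rw [one_mul] at this
  linarith

namespace Stage

variable {b : ℂ} {χ₀ ψ₀ χ ψ χ' ψ' : ℂ → ℂ} {m n : ℕ}

theorem eqOn_of_le (h : Stage b χ₀ m χ ψ) (h' : Stage b χ₀ n χ' ψ') (hmn : m ≤ n) :
    EqOn χ' χ (quot m) :=
  eqOn_quot (h'.cont.mono (quot_mono hmn)) h.cont
    (h'.diff.mono (interior_mono (quot_mono hmn))) h.diff
    (h'.base.trans h.base.symm)

theorem image (h : Stage b χ₀ n χ ψ) : χ '' quot n = tiles b n :=
  Subset.antisymm h.maps.image_subset fun X hX => ⟨ψ X, h.maps_inv hX, h.right_inv hX⟩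

theorem eqOn_inv_of_le (h : Stage b χ₀ m χ ψ) (h' : Stage b χ₀ n χ' ψ') (hmn : m ≤ n) :
    EqOn ψ' ψ (tiles b m) := by
  intro X hX
  have h1 := h.maps_inv hX
  have h2 : χ' (ψ X) = X := by rw [h.eqOn_of_le h' hmn h1, h.right_inv hX]
  rw [← h2, h'.left_inv (quot_mono hmn h1), h2]

theorem cap_iff (h : Stage b χ₀ n χ ψ) (hB : IsBase b χ₀ ψ₀) {ξ : ℂ} (hξ : ξ ∈ quot n) :
    χ ξ ∈ cap b (1 / 2) ↔ ξ ∈ quotOpen := by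
  constructor
  · intro hc
    have h0 := (h.mem_tile_iff hB hξ).1 (cap_subset_tile b hc)
    rwa [h.base h0, hB.cap_iff ξ h0] at hc
  · intro ho
    have h0 : ξ ∈ quot 0 := quotOpen_subset 0 ho
    rwa [h.base h0, hB.cap_iff ξ h0]

theorem injOn (h : Stage b χ₀ n χ ψ) : InjOn χ (quot n) := h.left_inv.injOn

theorem differentiableAt_inv (h : Stage b χ₀ n χ ψ) {X : ℂ} (hX : X ∈ interior (tiles b n)) :
    DifferentiableAt ℂ ψ X := by
  have := differentiableAt_of_leftInvOn isOpen_interior h.diff (h.injOn.mono interior_subset)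
    (h.left_inv.mono interior_subset) (h.maps_interior hX)
  rwa [h.right_inv (interior_subset hX)] at this

end Stage

/-- The data of a conformal conjugacy in the coordinates `X` and `ξ`: `χ` and `ψ` are mutually
inverse homeomorphisms between `G` and `T`, the Schwarz reflection maps `T \ cap b (1 / 2)` to `T'`,
the model map maps `G \ quotOpen` to `G'`, and `χ` intertwines them. -/
structure IsConjugacy (b : ℂ) (T T' G G' : Set ℂ) (χ ψ : ℂ → ℂ) : Prop where
  subset_ball : G ⊆ ball 0 1
  quotOpen_subset : quotOpen ⊆ G'
  subset : G' ⊆ G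
  cap_subset : cap b (1 / 2) ⊆ T
  maps : MapsTo χ G T
  maps_inv : MapsTo ψ T G
  left_inv : LeftInvOn ψ χ G
  right_inv : LeftInvOn χ ψ T
  cont : ContinuousOn χ G
  cont_inv : ContinuousOn ψ T
  diff_inv : ∀ X ∈ interior T, DifferentiableAt ℂ ψ X
  image : χ '' G' = T'
  cap_iff : ∀ ξ ∈ G, χ ξ ∈ cap b (1 / 2) ↔ ξ ∈ quotOpen
  conjugacy : ∀ z : ℂ, side z ≤ 0 → z ^ 3 ∈ G → refl z ^ 3 ∈ G' ∧ ∃ Z, 1 / 2 ≤ (b * Z).re ∧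
    cubic Z = χ (z ^ 3) ∧ 1 + 3 * mirror b Z ≠ 0 ∧ cubic (mirror b Z) = χ (refl z ^ 3)

theorem Stage.isConjugacy {b : ℂ} {χ₀ ψ₀ χ ψ χ' ψ' : ℂ → ℂ} {n : ℕ} (hB : IsBase b χ₀ ψ₀)
    (h : Stage b χ₀ n χ ψ) (h' : Stage b χ₀ (n + 1) χ' ψ') :
    IsConjugacy b (tiles b (n + 1)) (tiles b n) (quot (n + 1)) (quot n) χ' ψ' where
  subset_ball := fun ξ hξ => by simpa using norm_lt_one_of_mem_quot hξ
  quotOpen_subset := quotOpen_subset n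
  subset := quot_mono (Nat.le_succ n)
  cap_subset := (cap_subset_tile b).trans (tile_subset_tiles b _)
  maps := h'.maps
  maps_inv := h'.maps_inv
  left_inv := h'.left_inv
  right_inv := h'.right_inv
  cont := h'.cont
  cont_inv := h'.cont_inv
  diff_inv := fun _ => h'.differentiableAt_inv
  image := by rw [(h.eqOn_of_le h' (Nat.le_succ n)).image_eq, h.image]
  cap_iff := fun _ => h'.cap_iff hB
  conjugacy := fun z hs hz => by
    rw [cube_mem_quot_iff] at hz
    exact ⟨cube_mem_quot_iff.2 (refl_mem_of_mem_succ hz hs), h'.conjugacy z hz hs⟩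

namespace Admissible

variable {b : ℂ}

theorem exists_isBase (hb : Admissible b) : ∃ χ₀ ψ₀, IsBase b χ₀ ψ₀ := by
  obtain ⟨χ, ψ, h1, h2, h3⟩ := hb.exists_stage_zero
  exact ⟨χ, ψ, h1, h2, h3⟩

theorem exists_stage (hb : Admissible b) {χ₀ ψ₀ : ℂ → ℂ} (hB : IsBase b χ₀ ψ₀) (n : ℕ)
    (h : ∀ m < n, (1 / 4 : ℂ) ∉ tiles b m) : ∃ χ ψ, Stage b χ₀ n χ ψ := by
  induction n with
  | zero => exact ⟨χ₀, ψ₀, hB.stage⟩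
  | succ n ih =>
    obtain ⟨χ, ψ, hS⟩ := ih fun m hm => h m (hm.trans (Nat.lt_succ_self n))
    exact hS.exists_next hb hB (h n (Nat.lt_succ_self n))

/-- If the critical value is not reached in `n` steps, the conjugacy extends to the tiles of
generation at most `n + 1`. -/
theorem exists_isConjugacy (hb : Admissible b) {n : ℕ} (h : (1 / 4 : ℂ) ∉ tiles b n) :
    ∃ χ ψ, IsConjugacy b (tiles b (n + 1)) (tiles b n) (quot (n + 1)) (quot n) χ ψ := by
  obtain ⟨χ₀, ψ₀, hB⟩ := hb.exists_isBase
  have hm : ∀ m ≤ n, (1 / 4 : ℂ) ∉ tiles b m := fun m hm h' => h (tiles_mono b hm h')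
  obtain ⟨χ, ψ, hS⟩ := hb.exists_stage hB n fun m hmn => hm m hmn.le
  obtain ⟨χ', ψ', hS'⟩ := hS.exists_next hb hB h
  exact ⟨χ', ψ', hS.isConjugacy hB hS'⟩

/-- If the critical value is never reached, the conjugacies of the finite stages fit together to a
conjugacy defined on the whole disc. -/
theorem exists_isConjugacy_iUnion (hb : Admissible b) (h : ∀ n, (1 / 4 : ℂ) ∉ tiles b n) :
    ∃ χ ψ, IsConjugacy b (⋃ n, tiles b n) (⋃ n, tiles b n) (ball 0 1) (ball 0 1) χ ψ := by
  obtain ⟨χ₀, ψ₀, hB⟩ := hb.exists_isBase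
  choose χ ψ hS using fun n => hb.exists_stage hB n fun m _ => h m
  have hball : ∀ ξ ∈ ball (0 : ℂ) 1, ∃ n, ξ ∈ quot n := by
    intro ξ hξ
    obtain ⟨z, rfl⟩ := IsAlgClosed.exists_pow_nat_eq ξ three_pos
    rw [mem_ball_zero_iff, norm_pow, pow_lt_one_iff_of_nonneg (norm_nonneg z) three_ne_zero] at hξ
    obtain ⟨n, hn⟩ := exists_mem_model hξ
    exact ⟨n, cube_mem_quot_iff.2 hn⟩
  choose! k hk using hball
  have htiles : ∀ X ∈ ⋃ n, tiles b n, ∃ n, X ∈ tiles b n := fun X hX => mem_iUnion.1 hX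
  choose! l hl using htiles
  have hχ : ∀ n, EqOn (fun ξ => χ (k ξ) ξ) (χ n) (quot n) := by
    intro n ξ hξ
    have hξ' : ξ ∈ ball (0 : ℂ) 1 := by simpa using norm_lt_one_of_mem_quot hξ
    rcases le_total n (k ξ) with hle | hle
    · exact (hS n).eqOn_of_le (hS _) hle hξ
    · exact ((hS _).eqOn_of_le (hS n) hle (hk ξ hξ')).symm
  have hψ : ∀ n, EqOn (fun X => ψ (l X) X) (ψ n) (tiles b n) := by
    intro n X hX
    have hX' := mem_iUnion_of_mem n hX
    rcases le_total n (l X) with hle | hle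
    · exact (hS n).eqOn_inv_of_le (hS _) hle hX
    · exact ((hS _).eqOn_inv_of_le (hS n) hle (hl X hX')).symm
  have hmaps : MapsTo (fun ξ => χ (k ξ) ξ) (ball 0 1) (⋃ n, tiles b n) := fun ξ hξ =>
    mem_iUnion_of_mem (k ξ) ((hS _).maps (hk ξ hξ))
  have hmaps' : MapsTo (fun X => ψ (l X) X) (⋃ n, tiles b n) (ball 0 1) := fun X hX => by
    simpa using norm_lt_one_of_mem_quot ((hS (l X)).maps_inv (hl X hX))
  have hleft : LeftInvOn (fun X => ψ (l X) X) (fun ξ => χ (k ξ) ξ) (ball 0 1) := fun ξ hξ => by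
    have h1 := hk ξ hξ
    exact (hψ (k ξ) ((hS _).maps h1)).trans ((hS _).left_inv h1)
  have hright : LeftInvOn (fun ξ => χ (k ξ) ξ) (fun X => ψ (l X) X) (⋃ n, tiles b n) :=
    fun X hX => by
      have h1 := hl X hX
      exact (hχ (l X) ((hS _).maps_inv h1)).trans ((hS _).right_inv h1)
  have hdiff : DifferentiableOn ℂ (fun ξ => χ (k ξ) ξ) (ball 0 1) := by
    intro ξ hξ
    have h1 : ξ ∈ interior (quot (k ξ + 1)) := by
      obtain ⟨z, hz, hzξ⟩ := hk ξ hξ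
      have := cube_mem_interior_quot_iff.2 (model_subset_interior_succ _ hz)
      rwa [show z ^ 3 = ξ from hzξ] at this
    have h2 := (hS (k ξ + 1)).diff.differentiableAt (isOpen_interior.mem_nhds h1)
    refine (h2.congr_of_eventuallyEq ?_).differentiableWithinAt
    filter_upwards [mem_interior_iff_mem_nhds.1 h1] with w hw using hχ _ hw
  have hdiff' : ∀ X ∈ ⋃ n, tiles b n, DifferentiableAt ℂ (fun X => ψ (l X) X) X := by
    intro X hX
    have := differentiableAt_of_leftInvOn isOpen_ball hdiff hleft.injOn hleft (hmaps' hX)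
    have e := hright hX
    dsimp only at e this
    rwa [e] at this
  refine ⟨_, _, ⟨subset_rfl, ?_, subset_rfl, ?_, hmaps, hmaps', hleft, hright, hdiff.continuousOn,
    fun X hX => (hdiff' X hX).continuousAt.continuousWithinAt,
    fun X hX => hdiff' X (interior_subset hX), ?_, ?_, ?_⟩⟩
  · exact fun ξ hξ => by simpa using norm_lt_one_of_mem_quot (quotOpen_subset 0 hξ)
  · exact (cap_subset_tile b).trans (subset_iUnion (tiles b) 0)
  · exact Subset.antisymm hmaps.image_subset fun X hX => ⟨_, hmaps' hX, hright hX⟩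
  · exact fun ξ hξ => (hS _).cap_iff hB (hk ξ hξ)
  · intro z hs hz
    have h1 := cube_mem_quot_iff.1 (hk _ hz)
    have h2 := model_subset_succ _ h1
    have h3 := cube_mem_quot_iff.2 (refl_mem_of_mem_succ h2 hs)
    obtain ⟨Z, hZ, hc, hp, hm⟩ := (hS _).conjugacy z h2 hs
    refine ⟨by simpa using norm_lt_one_of_mem_quot h3, Z, hZ, ?_, hp, ?_⟩
    · rw [hc]
      exact (hχ _ (cube_mem_quot_iff.2 h2)).symm
    · rw [hm]
      exact (hχ _ (quot_mono (Nat.le_succ _) h3)).symm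

end Admissible

/-! ### Coordinates on the sphere -/

/-- The coordinate `X = 1 / (w + 2)` on the sphere without the cusp `-2`, as a map from the plane. -/
noncomputable def ofX (X : ℂ) : Sphere :=
  if X = 0 then OnePoint.infty else ((X⁻¹ - 2 : ℂ) : Sphere)

/-- The coordinate `X = 1 / (w + 2)`, as a function on the sphere. -/
noncomputable def toX : Sphere → ℂ
  | OnePoint.infty => 0
  | OnePoint.some w => (w + 2)⁻¹

/-- The coordinate `Z = 1 / (u - 1)` on the sphere without `1`, as a map from the plane. -/
noncomputable def ofZ (Z : ℂ) : Sphere :=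
  if Z = 0 then OnePoint.infty else ((1 + Z⁻¹ : ℂ) : Sphere)

theorem ofX_zero : ofX 0 = OnePoint.infty := if_pos rfl

theorem ofX_of_ne {X : ℂ} (h : X ≠ 0) : ofX X = ((X⁻¹ - 2 : ℂ) : Sphere) := if_neg h

theorem ofZ_of_ne {Z : ℂ} (h : Z ≠ 0) : ofZ Z = ((1 + Z⁻¹ : ℂ) : Sphere) := if_neg h

theorem toX_coe (w : ℂ) : toX (w : Sphere) = (w + 2)⁻¹ := rfl

theorem toX_infty : toX OnePoint.infty = 0 := rfl

theorem toX_ofX (X : ℂ) : toX (ofX X) = X := by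
  by_cases h : X = 0
  · rw [h, ofX_zero, toX_infty]
  · rw [ofX_of_ne h, toX_coe, sub_add_cancel, inv_inv]

theorem ofX_injective : Function.Injective ofX := Function.LeftInverse.injective toX_ofX

theorem ofX_ne (X : ℂ) : ofX X ≠ ((-2 : ℂ) : Sphere) := by
  by_cases h : X = 0
  · rw [h, ofX_zero]
    exact OnePoint.infty_ne_coe _
  · rw [ofX_of_ne h, Ne, OnePoint.coe_eq_coe]
    intro h2
    exact inv_ne_zero h (by linear_combination h2)

theorem ofX_inv {w : ℂ} (h : w + 2 ≠ 0) : ofX (w + 2)⁻¹ = (w : Sphere) := by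
  rw [ofX_of_ne (inv_ne_zero h), inv_inv, add_sub_cancel_right]

theorem ofX_toX {x : Sphere} (h : x ≠ ((-2 : ℂ) : Sphere)) : ofX (toX x) = x := by
  induction x using OnePoint.rec with
  | infty => rw [toX_infty, ofX_zero]
  | coe w =>
    rw [toX_coe, ofX_inv]
    intro h2
    exact h (by rw [OnePoint.coe_eq_coe]; linear_combination h2)

theorem range_ofX : range ofX = {((-2 : ℂ) : Sphere)}ᶜ :=
  Subset.antisymm (range_subset_iff.2 fun X => ofX_ne X) fun x hx => ⟨toX x, ofX_toX hx⟩

theorem continuous_ofX : Continuous ofX := by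
  rw [continuous_iff_continuousAt]
  intro X
  by_cases h : X = 0
  · subst h
    rw [continuousAt_iff_punctured_nhds, ofX_zero]
    have h1 : Tendsto (fun X : ℂ => X⁻¹ - 2) (𝓝[≠] 0) (cocompact ℂ) := by
      rw [← Metric.cobounded_eq_cocompact]
      simp only [sub_eq_add_neg]
      exact (tendsto_add_const_cobounded (-2 : ℂ)).comp tendsto_inv₀_nhdsNE_zero
    have h2 : Tendsto ((↑) : ℂ → Sphere) (cocompact ℂ) (𝓝 OnePoint.infty) := by
      rw [← coclosedCompact_eq_cocompact]
      exact OnePoint.tendsto_coe_infty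
    refine (h2.comp h1).congr' ?_
    filter_upwards [self_mem_nhdsWithin] with X hX
    exact (ofX_of_ne hX).symm
  · have h1 : ContinuousAt (fun X : ℂ => ((X⁻¹ - 2 : ℂ) : Sphere)) X :=
      OnePoint.continuous_coe.continuousAt.comp ((continuousAt_inv₀ h).sub continuousAt_const)
    refine h1.congr ?_
    filter_upwards [isOpen_ne.mem_nhds h] with Y hY
    exact (ofX_of_ne hY).symm

theorem continuousAt_toX {x : Sphere} (h : x ≠ ((-2 : ℂ) : Sphere)) : ContinuousAt toX x := by
  induction x using OnePoint.rec with
  | infty =>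
    rw [OnePoint.continuousAt_infty', coclosedCompact_eq_cocompact, ← Metric.cobounded_eq_cocompact]
    exact tendsto_inv₀_cobounded.comp (tendsto_add_const_cobounded (2 : ℂ))
  | coe w =>
    rw [OnePoint.continuousAt_coe]
    have h2 : w + 2 ≠ 0 := fun h2 => h (by rw [OnePoint.coe_eq_coe]; linear_combination h2)
    exact (continuousAt_id.add continuousAt_const).inv₀ h2

theorem isOpenEmbedding_ofX : Topology.IsOpenEmbedding ofX := by
  refine .of_continuous_injective_isOpenMap continuous_ofX ofX_injective fun U hU => ?_
  have : ofX '' U = {((-2 : ℂ) : Sphere)}ᶜ ∩ toX ⁻¹' U := by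
    ext x
    constructor
    · rintro ⟨X, hX, rfl⟩
      exact ⟨ofX_ne X, by rwa [mem_preimage, toX_ofX]⟩
    · rintro ⟨hx, hX⟩
      exact ⟨_, hX, ofX_toX hx⟩
  rw [this]
  exact ContinuousOn.isOpen_inter_preimage
    (fun x hx => (continuousAt_toX hx).continuousWithinAt) isClosed_singleton.isOpen_compl hU

theorem interior_image_ofX (T : Set ℂ) : interior (ofX '' T) = ofX '' interior T := by
  refine Subset.antisymm ?_
    (interior_maximal (image_mono interior_subset) (isOpenEmbedding_ofX.isOpenMap _ isOpen_interior))
  intro x hx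
  obtain ⟨X, -, rfl⟩ := interior_subset hx
  refine ⟨X, interior_maximal (t := ofX ⁻¹' interior (ofX '' T)) ?_
    (isOpen_interior.preimage continuous_ofX) hx, rfl⟩
  intro Y hY
  obtain ⟨Y', hY', he⟩ := interior_subset hY
  rwa [← ofX_injective he]

/-- Holomorphy on the sphere can be checked in the coordinate `X`. -/
theorem holomorphicAt_ofX {f : Sphere → Q} {ψ : ℂ → ℂ} {T : Set ℂ} {X : ℂ} (hX : X ∈ interior T)
    (hf : ∀ Y ∈ T, coordQ (f (ofX Y)) = ψ Y) (hψ : DifferentiableAt ℂ ψ X) :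
    HolomorphicAt f (ofX X) := by
  have hT : ∀ᶠ Y in 𝓝 X, coordQ (f (ofX Y)) = ψ Y := by
    filter_upwards [mem_interior_iff_mem_nhds.1 hX] with Y hY using hf Y hY
  by_cases h : X = 0
  · subst h
    rw [ofX_zero]
    have h1 : DifferentiableAt ℂ (fun w : ℂ => w / (1 + 2 * w)) 0 := by
      fun_prop (disch := simp)
    have h0 : (fun w : ℂ => w / (1 + 2 * w)) 0 = 0 := by simp
    rw [← h0] at hψ
    refine (DifferentiableAt.comp (g := ψ) (f := fun w : ℂ => w / (1 + 2 * w)) _ hψ h1).congr_of_eventuallyEq ?_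
    have h2 : Tendsto (fun w : ℂ => w / (1 + 2 * w)) (𝓝 0) (𝓝 0) := by
      simpa using h1.continuousAt.tendsto
    have h3 : ∀ᶠ w : ℂ in 𝓝 0, 1 + 2 * w ≠ 0 :=
      ContinuousAt.eventually_ne (g := fun w : ℂ => 1 + 2 * w) (by fun_prop) (by simp)
    filter_upwards [h2.eventually hT, h3] with w hw hw'
    rw [Function.comp_apply, ← hw]
    congr 2
    by_cases hw0 : w = 0
    · simp [hw0, ofX_zero, invCoord]
    · rw [invCoord, if_neg hw0, ofX_of_ne (div_ne_zero hw0 hw'), OnePoint.coe_eq_coe]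
      field_simp
      ring
  · have h0 : X⁻¹ - 2 + 2 ≠ 0 := by rw [sub_add_cancel]; exact inv_ne_zero h
    rw [ofX_of_ne h]
    have hc : DifferentiableAt ℂ (fun w : ℂ => (w + 2)⁻¹) (X⁻¹ - 2) :=
      (differentiableAt_id.add_const 2).inv h0
    have he : (fun w : ℂ => (w + 2)⁻¹) (X⁻¹ - 2) = X := by simp
    have hψ' : DifferentiableAt ℂ ψ ((fun w : ℂ => (w + 2)⁻¹) (X⁻¹ - 2)) := by rwa [he]
    refine (DifferentiableAt.comp (g := ψ) (f := fun w : ℂ => (w + 2)⁻¹) _ hψ' hc).congr_of_eventuallyEq ?_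
    have h2 : Tendsto (fun w : ℂ => (w + 2)⁻¹) (𝓝 (X⁻¹ - 2)) (𝓝 X) := by
      have := hc.continuousAt.tendsto
      dsimp only at this he
      rwa [he] at this
    have h3 : ∀ᶠ w : ℂ in 𝓝 (X⁻¹ - 2), w + 2 ≠ 0 :=
      ContinuousAt.eventually_ne (g := fun w : ℂ => w + 2) (by fun_prop) h0
    filter_upwards [h2.eventually hT, h3] with w hw hw'
    rw [Function.comp_apply, ← hw, ofX_inv hw']

theorem cheb_one_add_inv {Z : ℂ} (h : Z ≠ 0) : cheb (1 + Z⁻¹) = (cubic Z)⁻¹ - 2 := by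
  rw [cheb, cubic, inv_div]
  field_simp
  ring

theorem cheb_one : cheb 1 = -2 := by rw [cheb]; norm_num

theorem cubic_zero : cubic 0 = 0 := by simp [cubic]

theorem cubic_ne_zero {Z : ℂ} (h : Z ≠ 0) (hp : 1 + 3 * Z ≠ 0) : cubic Z ≠ 0 :=
  div_ne_zero (pow_ne_zero 3 h) hp

theorem chebSphere_ofZ {Z : ℂ} (hp : 1 + 3 * Z ≠ 0) : chebSphere (ofZ Z) = ofX (cubic Z) := by
  by_cases h : Z = 0
  · rw [h, cubic_zero, ofX_zero, ofZ, if_pos rfl]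
    rfl
  · rw [ofZ_of_ne h, ofX_of_ne (cubic_ne_zero h hp), ← cheb_one_add_inv h]
    rfl

theorem chebSphere_ofZ_pole {Z : ℂ} (hp : 1 + 3 * Z = 0) :
    chebSphere (ofZ Z) = ((-2 : ℂ) : Sphere) := by
  have h : Z ≠ 0 := by rintro rfl; simp at hp
  rw [ofZ_of_ne h]
  change ((cheb (1 + Z⁻¹) : ℂ) : Sphere) = _
  rw [cheb_one_add_inv h, cubic, hp]
  simp

/-! ### The disc `Δ_a` as a half plane -/

theorem norm_lt_iff {b Z : ℂ} (h : Z ≠ 0) :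
    ‖1 + Z⁻¹ - (b + 1)‖ < ‖b‖ ↔ 1 / 2 < (b * Z).re := by
  have e : 1 + Z⁻¹ - (b + 1) = (1 - b * Z) / Z := by field_simp; ring
  rw [e, norm_div, div_lt_iff₀ (norm_pos_iff.2 h), ← norm_mul,
    ← sq_lt_sq₀ (norm_nonneg _) (norm_nonneg _), Complex.sq_norm, Complex.sq_norm, normSq_apply,
    normSq_apply, sub_re, sub_im, one_re, one_im]
  constructor <;> intro h <;> nlinarith

theorem norm_le_iff {b Z : ℂ} (h : Z ≠ 0) :
    ‖1 + Z⁻¹ - (b + 1)‖ ≤ ‖b‖ ↔ 1 / 2 ≤ (b * Z).re := by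
  have e : 1 + Z⁻¹ - (b + 1) = (1 - b * Z) / Z := by field_simp; ring
  rw [e, norm_div, div_le_iff₀ (norm_pos_iff.2 h), ← norm_mul,
    ← sq_le_sq₀ (norm_nonneg _) (norm_nonneg _), Complex.sq_norm, Complex.sq_norm, normSq_apply,
    normSq_apply, sub_re, sub_im, one_re, one_im]
  constructor <;> intro h <;> nlinarith

theorem ne_zero_of_re {b Z : ℂ} (h : 1 / 2 ≤ (b * Z).re) : Z ≠ 0 := by
  rintro rfl
  rw [mul_zero, zero_re] at h
  norm_num at h

theorem exists_eq_one_add_inv {u : ℂ} (h : u ≠ 1) : ∃ Z : ℂ, Z ≠ 0 ∧ 1 + Z⁻¹ = u :=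
  ⟨(u - 1)⁻¹, inv_ne_zero (sub_ne_zero.2 h), by rw [inv_inv]; ring⟩

theorem admissible_of_mem_parameterSpace {a : ℂ} (ha : a ∈ parameterSpace) :
    Admissible (a - 1) := by
  obtain ⟨⟨-, -, hinj⟩, h1, h2⟩ := ha
  refine ⟨by rw [sub_re, one_re]; linarith, by rw [sub_re, one_re]; linarith, ?_⟩
  have hmem : ∀ Z : ℂ, ((a - 1) * Z).re = 1 / 2 → 1 + Z⁻¹ ∈ sphere a ‖a - 1‖ := by
    intro Z hZ
    have h0 := ne_zero_of_re hZ.ge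
    have h3 := (norm_le_iff h0).2 hZ.ge
    have h4 := mt (norm_lt_iff h0).1 hZ.not_gt
    rw [sub_add_cancel] at h3 h4
    rw [mem_sphere_iff_norm]
    exact le_antisymm h3 (not_lt.1 h4)
  intro Z hZ W hW h
  have hZ0 := ne_zero_of_re (b := a - 1) (show _ = _ from hZ).ge
  have hW0 := ne_zero_of_re (b := a - 1) (show _ = _ from hW).ge
  have := hinj (hmem Z hZ) (hmem W hW) (by
    rw [cheb_one_add_inv hZ0, cheb_one_add_inv hW0, h])
  exact inv_injective (add_left_cancel this)

section

variable {a : ℂ}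

theorem Omega_eq (hb : Admissible (a - 1)) :
    Omega a = ofX '' (cubic '' {Z | 1 / 2 < ((a - 1) * Z).re}) := by
  rw [Omega, image_image]
  have hchar : ∀ Z : ℂ, Z ≠ 0 → (1 + Z⁻¹ ∈ disk a ↔ 1 / 2 < ((a - 1) * Z).re) := by
    intro Z h0
    rw [disk, mem_ball_iff_norm, ← norm_lt_iff h0, sub_add_cancel]
  ext x
  constructor
  · rintro ⟨u, hu, rfl⟩
    have hu1 : u ≠ 1 := by
      rintro rfl
      rw [disk, mem_ball_iff_norm, norm_sub_rev] at hu
      exact lt_irrefl _ hu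
    obtain ⟨Z, h0, rfl⟩ := exists_eq_one_add_inv hu1
    have hZ := (hchar Z h0).1 hu
    refine ⟨Z, hZ, ?_⟩
    dsimp only
    rw [ofX_of_ne (cubic_ne_zero h0 (hb.pole_ne (by linarith))), cheb_one_add_inv h0]
  · rintro ⟨Z, hZ, rfl⟩
    have hZ' : 1 / 2 < ((a - 1) * Z).re := hZ
    have h0 := ne_zero_of_re hZ'.le
    refine ⟨1 + Z⁻¹, (hchar Z h0).2 hZ, ?_⟩
    dsimp only
    rw [ofX_of_ne (cubic_ne_zero h0 (hb.pole_ne (by linarith))), cheb_one_add_inv h0]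

theorem fundamentalTile_eq (hb : Admissible (a - 1)) :
    fundamentalTile a = ofX '' tile (a - 1) := by
  rw [fundamentalTile, Omega_eq hb, tile, image_compl_eq_range_sdiff_image ofX_injective,
    range_ofX, sdiff_eq, sdiff_eq, inter_comm]

/-- The points of the closed disc are `1` and the points with `Re (b Z) ≥ 1 / 2`. -/
theorem mem_closedBall_iff_re {u : ℂ} : u ∈ closedBall a ‖a - 1‖ ↔
    u = 1 ∨ ∃ Z, 1 / 2 ≤ ((a - 1) * Z).re ∧ 1 + Z⁻¹ = u := by
  have hchar : ∀ Z : ℂ, Z ≠ 0 → (1 + Z⁻¹ ∈ closedBall a ‖a - 1‖ ↔ 1 / 2 ≤ ((a - 1) * Z).re) := by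
    intro Z h0
    rw [mem_closedBall_iff_norm, ← norm_le_iff h0, sub_add_cancel]
  constructor
  · intro hu
    by_cases hu1 : u = 1
    · exact Or.inl hu1
    · obtain ⟨Z, h0, rfl⟩ := exists_eq_one_add_inv hu1
      exact Or.inr ⟨Z, (hchar Z h0).1 hu, rfl⟩
  · rintro (rfl | ⟨Z, hZ, rfl⟩)
    · rw [mem_closedBall_iff_norm, norm_sub_rev]
    · exact (hchar Z (ne_zero_of_re hZ)).2 hZ

theorem cheb_of_re (hb : Admissible (a - 1)) {Z : ℂ} (hZ : 1 / 2 ≤ ((a - 1) * Z).re) :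
    ((cheb (1 + Z⁻¹) : ℂ) : Sphere) = ofX (cubic Z) := by
  have h0 := ne_zero_of_re hZ
  rw [ofX_of_ne (cubic_ne_zero h0 (hb.pole_ne (by linarith))), cheb_one_add_inv h0]

theorem closure_Omega (hb : Admissible (a - 1)) : closure (Omega a) =
    insert ((-2 : ℂ) : Sphere) (ofX '' (cubic '' {Z | 1 / 2 ≤ ((a - 1) * Z).re})) := by
  have hc : Continuous fun u : ℂ => ((cheb u : ℂ) : Sphere) :=
    OnePoint.continuous_coe.comp (by unfold cheb; fun_prop)
  have h1 : closure (Omega a) = (fun u : ℂ => ((cheb u : ℂ) : Sphere)) '' closedBall a ‖a - 1‖ := by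
    rw [Omega, disk, ← closure_ball a hb.norm_pos.ne', image_closure_of_isCompact ?_ hc.continuousOn]
    rw [closure_ball a hb.norm_pos.ne']
    exact isCompact_closedBall _ _
  rw [h1]
  ext x
  constructor
  · rintro ⟨u, hu, rfl⟩
    rcases mem_closedBall_iff_re.1 hu with rfl | ⟨Z, hZ, rfl⟩
    · left
      simp only [cheb_one]
    · exact Or.inr ⟨_, ⟨Z, hZ, rfl⟩, (cheb_of_re hb hZ).symm⟩
  · rintro (rfl | ⟨_, ⟨Z, hZ, rfl⟩, rfl⟩)
    · refine ⟨1, mem_closedBall_iff_re.2 (Or.inl rfl), ?_⟩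
      simp only [cheb_one]
    · exact ⟨_, mem_closedBall_iff_re.2 (Or.inr ⟨Z, hZ, rfl⟩), cheb_of_re hb hZ⟩

theorem injOn_chebSphere (hb : Admissible (a - 1)) :
    InjOn chebSphere ((fun u : ℂ => (u : Sphere)) '' closedBall a ‖a - 1‖) := by
  have hne : ∀ Z, 1 / 2 ≤ ((a - 1) * Z).re → ((cheb (1 + Z⁻¹) : ℂ) : Sphere) ≠
      ((cheb 1 : ℂ) : Sphere) := by
    intro Z hZ
    rw [cheb_of_re hb hZ, cheb_one]
    exact ofX_ne _
  rintro _ ⟨u, hu, rfl⟩ _ ⟨v, hv, rfl⟩ h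
  have h' : ((cheb u : ℂ) : Sphere) = ((cheb v : ℂ) : Sphere) := h
  rcases mem_closedBall_iff_re.1 hu with rfl | ⟨Z, hZ, rfl⟩ <;>
    rcases mem_closedBall_iff_re.1 hv with rfl | ⟨W, hW, rfl⟩
  · rfl
  · exact absurd h'.symm (hne W hW)
  · exact absurd h' (hne Z hZ)
  · rw [cheb_of_re hb hZ, cheb_of_re hb hW] at h'
    rw [hb.injOn_closed hZ hW (ofX_injective h')]

theorem sigma_cheb (hb : Admissible (a - 1)) {u : ℂ} (hu : u ∈ closedBall a ‖a - 1‖) :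
    sigma a ((cheb u : ℂ) : Sphere) = chebSphere (circleReflection a ‖a - 1‖ (u : Sphere)) := by
  rw [sigma]
  congr 2
  exact (injOn_chebSphere hb).leftInvOn_invFunOn (mem_image_of_mem _ hu)

theorem circleReflection_ofZ (hb : Admissible (a - 1)) {Z : ℂ} (hZ : 1 / 2 ≤ ((a - 1) * Z).re) :
    circleReflection a ‖a - 1‖ ((1 + Z⁻¹ : ℂ) : Sphere) = ofZ (mirror (a - 1) Z) := by
  have h0 := ne_zero_of_re hZ
  have hb0 := hb.ne_zero
  have hiff : 1 + Z⁻¹ = a ↔ mirror (a - 1) Z = 0 := by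
    rw [mirror, div_eq_zero_iff, or_iff_left hb0, sub_eq_zero,
      show (1 : ℂ) = conj ((a - 1) * Z) ↔ 1 = (a - 1) * Z by
        rw [← (starRingEnd ℂ).injective.eq_iff (a := 1) (b := (a - 1) * Z), map_one] ]
    constructor
    · rintro h
      rw [← h, add_sub_cancel_left, inv_mul_cancel₀ h0]
    · intro h
      field_simp
      linear_combination h
  change (if 1 + Z⁻¹ = a then _ else _) = _
  by_cases h : 1 + Z⁻¹ = a
  · rw [if_pos h, ofZ, if_pos (hiff.1 h)]
  · have hm := mt hiff.2 h
    rw [if_neg h, ofZ_of_ne hm, OnePoint.coe_eq_coe, EuclideanGeometry.inversion, dist_eq_norm,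
      vsub_eq_sub, vadd_eq_add, Complex.real_smul, div_pow]
    push_cast
    rw [← Complex.mul_conj', ← Complex.mul_conj', mirror]
    have h1 : 1 + Z⁻¹ - a ≠ 0 := sub_ne_zero.2 h
    have h2 : conj (1 + Z⁻¹ - a) ≠ 0 := (map_ne_zero _).2 h1
    have h3 : conj Z ≠ 0 := (map_ne_zero _).2 h0
    have h4 : conj (1 + Z⁻¹ - a) = (1 - conj ((a - 1) * Z)) / conj Z := by
      simp only [map_sub, map_add, map_one, map_inv₀, map_mul]
      field_simp
      ring
    have h5 : 1 - conj ((a - 1) * Z) ≠ 0 := fun h5 => h2 (by rw [h4, h5, zero_div])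
    rw [div_mul_eq_mul_div, mul_comm (1 + Z⁻¹ - a), mul_div_mul_right _ _ h1, h4]
    simp only [map_mul] at h5 ⊢
    field_simp
    ring

/-- In the coordinates `Z` and `X` the Schwarz reflection is `cubic Z ↦ cubic (mirror Z)`. -/
theorem sigma_ofX (hb : Admissible (a - 1)) {Z : ℂ} (hZ : 1 / 2 ≤ ((a - 1) * Z).re) :
    sigma a (ofX (cubic Z)) = chebSphere (ofZ (mirror (a - 1) Z)) := by
  rw [← cheb_of_re hb hZ, sigma_cheb hb (mem_closedBall_iff_re.2 (Or.inr ⟨Z, hZ, rfl⟩)),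
    circleReflection_ofZ hb hZ]

theorem sigma_cusp (hb : Admissible (a - 1)) :
    sigma a ((-2 : ℂ) : Sphere) = ((-2 : ℂ) : Sphere) := by
  have h1 : (1 : ℂ) ≠ a := by
    have := hb.ne_zero
    intro h
    rw [← h, sub_self] at this
    exact this rfl
  rw [← cheb_one, sigma_cheb hb (mem_closedBall_iff_re.2 (Or.inl rfl))]
  have : circleReflection a ‖a - 1‖ ((1 : ℂ) : Sphere) = ((1 : ℂ) : Sphere) := by
    change (if (1 : ℂ) = a then _ else _) = _
    rw [if_neg h1, OnePoint.coe_eq_coe]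
    exact EuclideanGeometry.inversion_of_mem_sphere (by
      rw [mem_sphere_iff_norm, norm_sub_rev])
  rw [this]
  rfl

theorem cusp_notMem (hb : Admissible (a - 1)) (n : ℕ) :
    ((-2 : ℂ) : Sphere) ∉ sigmaPreimage a n := by
  induction n with
  | zero => exact fun h => h.2 rfl
  | succ n ih =>
    rintro ⟨-, h⟩
    rw [sigma_cusp hb] at h
    exact ih h

theorem mem_sigmaPreimage_succ (hb : Admissible (a - 1)) {n : ℕ} {x : Sphere} :
    x ∈ sigmaPreimage a (n + 1) ↔ ∃ Z, 1 / 2 ≤ ((a - 1) * Z).re ∧ 1 + 3 * mirror (a - 1) Z ≠ 0 ∧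
      ofX (cubic (mirror (a - 1) Z)) ∈ sigmaPreimage a n ∧ ofX (cubic Z) = x := by
  constructor
  · rintro ⟨hx, hs⟩
    rw [closure_Omega hb] at hx
    rcases hx with rfl | ⟨_, ⟨Z, hZ, rfl⟩, rfl⟩
    · rw [sigma_cusp hb] at hs
      exact absurd hs (cusp_notMem hb n)
    · rw [sigma_ofX hb hZ] at hs
      by_cases hp : 1 + 3 * mirror (a - 1) Z = 0
      · rw [chebSphere_ofZ_pole hp] at hs
        exact absurd hs (cusp_notMem hb n)
      · rw [chebSphere_ofZ hp] at hs
        exact ⟨Z, hZ, hp, hs, rfl⟩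
  · rintro ⟨Z, hZ, hp, hs, rfl⟩
    refine ⟨?_, by rwa [sigma_ofX hb hZ, chebSphere_ofZ hp]⟩
    rw [closure_Omega hb]
    exact Or.inr ⟨_, ⟨Z, hZ, rfl⟩, rfl⟩

theorem iUnion_sigmaPreimage_succ (hb : Admissible (a - 1)) {n : ℕ}
    (h : ⋃ k ∈ Icc 0 n, sigmaPreimage a k = ofX '' tiles (a - 1) n) :
    ⋃ k ∈ Icc 1 (n + 1), sigmaPreimage a k = ofX '' tilesDom (a - 1) n := by
  have hmem : ∀ X, X ∈ tiles (a - 1) n ↔ ∃ k ≤ n, ofX X ∈ sigmaPreimage a k := by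
    intro X
    rw [← ofX_injective.mem_set_image, ← h]
    simp
  ext x
  simp only [mem_iUnion, mem_Icc, exists_prop]
  constructor
  · rintro ⟨k, ⟨hk1, hk2⟩, hx⟩
    obtain ⟨k, rfl⟩ := Nat.exists_eq_add_of_le' hk1
    obtain ⟨Z, hZ, hp, hs, rfl⟩ := (mem_sigmaPreimage_succ hb).1 hx
    exact ⟨_, ⟨Z, hZ, hp, (hmem _).2 ⟨k, by omega, hs⟩, rfl⟩, rfl⟩
  · rintro ⟨_, ⟨Z, hZ, hp, hs, rfl⟩, rfl⟩
    obtain ⟨k, hk, hs⟩ := (hmem _).1 hs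
    exact ⟨k + 1, ⟨by omega, by omega⟩, (mem_sigmaPreimage_succ hb).2 ⟨Z, hZ, hp, hs, rfl⟩⟩

theorem iUnion_sigmaPreimage (hb : Admissible (a - 1)) (n : ℕ) :
    ⋃ k ∈ Icc 0 n, sigmaPreimage a k = ofX '' tiles (a - 1) n := by
  induction n with
  | zero =>
    rw [Icc_self, biUnion_singleton]
    exact fundamentalTile_eq hb
  | succ n ih =>
    have h1 : ⋃ k ∈ Icc 0 (n + 1), sigmaPreimage a k =
        sigmaPreimage a 0 ∪ ⋃ k ∈ Icc 1 (n + 1), sigmaPreimage a k := by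
      rw [← Set.insert_Icc_add_one_left_eq_Icc (Nat.zero_le (n + 1)), biUnion_insert, zero_add]
    rw [h1, iUnion_sigmaPreimage_succ hb ih, tiles, image_union]
    congr 1
    exact fundamentalTile_eq hb

theorem iUnion_Icc_one_sigmaPreimage (hb : Admissible (a - 1)) (n : ℕ) :
    ⋃ k ∈ Icc 1 (n + 1), sigmaPreimage a k =
      ofX '' (tiles (a - 1) (n + 1) \ cap (a - 1) (1 / 2)) := by
  rw [iUnion_sigmaPreimage_succ hb (iUnion_sigmaPreimage hb n), hb.tilesDom_eq]

theorem tilingSet_eq (hb : Admissible (a - 1)) : tilingSet a = ofX '' ⋃ n, tiles (a - 1) n := by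
  rw [tilingSet, image_iUnion]
  refine Subset.antisymm (iUnion_mono fun n => ?_) (iUnion_subset fun n => ?_) <;>
    rw [← iUnion_sigmaPreimage hb]
  · exact subset_biUnion_of_mem (u := sigmaPreimage a) (show n ∈ Icc 0 n by simp)
  · exact iUnion₂_subset fun k _ => subset_iUnion (sigmaPreimage a) k

theorem tilingSet_diff_interior (hb : Admissible (a - 1)) :
    tilingSet a \ interior (fundamentalTile a) =
      ofX '' ((⋃ n, tiles (a - 1) n) \ cap (a - 1) (1 / 2)) := by
  rw [tilingSet_eq hb, fundamentalTile_eq hb, interior_image_ofX, hb.interior_tile,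
    image_sdiff ofX_injective]

theorem ofX_one_quarter : ofX (1 / 4) = ((2 : ℂ) : Sphere) := by
  rw [ofX_of_ne (by norm_num)]
  norm_num

/-- The free critical value lies in the quadrature domain. -/
theorem one_quarter_notMem_tile {b : ℂ} (hb : Admissible b) : (1 / 4 : ℂ) ∉ tile b := by
  rw [tile, notMem_compl_iff]
  refine ⟨1, ?_, ?_⟩
  · rw [mem_ofPred_eq, mul_one]
    exact hb.half_lt
  · rw [cubic]; norm_num

end

/-! ### The coordinate of the quotient surface -/

theorem coordQ_toQ (z : 𝔻) : coordQ (toQ z) = (z : ℂ) ^ 3 := rfl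

theorem exists_toQ (q : Q) : ∃ z : 𝔻, toQ z = q := Quotient.exists_rep q

theorem coe_omega : (omega : ℂ) = exp (2 * Real.pi * I / (3 : ℕ)) := by
  rw [omega, Circle.coe_exp]
  push_cast
  ring_nf

theorem coordQ_injective : Function.Injective coordQ := by
  intro p q h
  obtain ⟨z, rfl⟩ := exists_toQ p
  obtain ⟨w, rfl⟩ := exists_toQ q
  rw [coordQ_toQ, coordQ_toQ] at h
  obtain ⟨ζ, hζ, he⟩ := exists_rotation h
  have hprim := Complex.isPrimitiveRoot_exp 3 three_ne_zero
  rw [← coe_omega] at hprim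
  obtain ⟨k, -, rfl⟩ := hprim.eq_pow_of_pow_eq_one hζ
  refine Quotient.sound ⟨⟨omega ^ k, k, zpow_natCast _ _⟩, ?_⟩
  apply UnitDisc.coe_injective
  change ((omega ^ k : Circle) : ℂ) * (w : ℂ) = (z : ℂ)
  rw [he, Circle.coe_pow]

theorem range_coordQ : range coordQ = ball 0 1 := by
  ext ξ
  rw [mem_ball_zero_iff]
  constructor
  · rintro ⟨q, rfl⟩
    obtain ⟨z, rfl⟩ := exists_toQ q
    rw [coordQ_toQ, norm_pow]
    exact pow_lt_one₀ (norm_nonneg _) z.norm_lt_one three_ne_zero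
  · intro hξ
    obtain ⟨z, rfl⟩ := IsAlgClosed.exists_pow_nat_eq ξ three_pos
    rw [norm_pow, pow_lt_one_iff_of_nonneg (norm_nonneg z) three_ne_zero] at hξ
    exact ⟨toQ (UnitDisc.mk z hξ), rfl⟩

theorem norm_coordQ_lt_one (q : Q) : ‖coordQ q‖ < 1 := by
  simpa [range_coordQ] using mem_range_self (f := coordQ) q

theorem continuous_coordQ : Continuous coordQ :=
  Continuous.quotient_lift (UnitDisc.continuous_coe.pow 3) _

theorem isOpenEmbedding_coordQ : Topology.IsOpenEmbedding coordQ := by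
  refine .of_continuous_injective_isOpenMap continuous_coordQ coordQ_injective fun U hU => ?_
  have hV : IsOpen (toQ ⁻¹' U) := hU.preimage continuous_quotient_mk'
  have hcoe : IsOpen ((fun z : 𝔻 => (z : ℂ)) '' (toQ ⁻¹' U)) := by
    obtain ⟨V, hVo, hVe⟩ := UnitDisc.isEmbedding_coe.isOpen_iff.1 hV
    have : (fun z : 𝔻 => (z : ℂ)) '' (toQ ⁻¹' U) = V ∩ ball 0 1 := by
      rw [← hVe]
      ext z
      constructor
      · rintro ⟨z, hz, rfl⟩
        exact ⟨hz, by simpa using z.norm_lt_one⟩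
      · rintro ⟨hz, hz1⟩
        exact ⟨UnitDisc.mk z (by simpa using hz1), hz, rfl⟩
    rw [this]
    exact hVo.inter isOpen_ball
  have : coordQ '' U = (fun z : ℂ => z ^ 3) '' ((fun z : 𝔻 => (z : ℂ)) '' (toQ ⁻¹' U)) := by
    ext ξ
    constructor
    · rintro ⟨q, hq, rfl⟩
      obtain ⟨z, rfl⟩ := exists_toQ q
      exact ⟨_, ⟨z, hq, rfl⟩, rfl⟩
    · rintro ⟨_, ⟨z, hz, rfl⟩, rfl⟩
      exact ⟨_, hz, rfl⟩
  rw [this]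
  exact isOpenMap_cube _ hcoe

instance : Nonempty Q := ⟨toQ default⟩

/-- The point of `𝒬` with a given coordinate in the unit disc. -/
noncomputable def ofCoord (ξ : ℂ) : Q := Function.invFun coordQ ξ

theorem coordQ_ofCoord {ξ : ℂ} (h : ‖ξ‖ < 1) : coordQ (ofCoord ξ) = ξ := by
  apply Function.invFun_eq
  rw [← mem_range, range_coordQ]
  simpa using h

theorem ofCoord_coordQ (q : Q) : ofCoord (coordQ q) = q :=
  Function.leftInverse_invFun coordQ_injective q

theorem side_eq_dist (z : 𝔻) : side z = dist (z : ℂ) (centre 1) ^ 2 - 3 := by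
  rw [side_eq, normSq_eq_norm_sq, dist_eq_norm]
  simp [centre]

theorem dist_le_iff (z : 𝔻) : dist (z : ℂ) (centre 1) ≤ √3 ↔ side z ≤ 0 := by
  rw [side_eq_dist, Real.le_sqrt dist_nonneg (by norm_num), sub_nonpos]

theorem mem_disc2_union_geodesic2 (z : 𝔻) : z ∈ disc2 ∪ geodesic2 ↔ side z ≤ 0 := by
  rw [← dist_le_iff, le_iff_lt_or_eq]
  rfl

theorem coe_rho2 (z : 𝔻) : (rho2 z : ℂ) = refl z := by
  rw [rho2, UnitDisc.coe_mk, EuclideanGeometry.inversion, dist_eq_norm, vsub_eq_sub, vadd_eq_add,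
    Complex.real_smul, div_pow, Real.sq_sqrt (by norm_num), refl]
  have h : (centre 1 : ℂ) = -2 := rfl
  have h1 := add_two_ne z.norm_lt_one
  have h2 := conj_add_two_ne z.norm_lt_one
  have h3 : ((‖(z : ℂ) + 2‖ : ℝ) : ℂ) ^ 2 = (z + 2) * (conj (z : ℂ) + 2) := by
    rw [← Complex.mul_conj', map_add, conj_ofNat]
  rw [h, sub_neg_eq_add]
  push_cast
  rw [h3]
  field_simp
  ring

theorem mem_rhoDomain_iff {q : Q} : q ∈ rhoDomain ↔
    ∃ z : ℂ, ‖z‖ < 1 ∧ side z ≤ 0 ∧ coordQ q = z ^ 3 := by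
  constructor
  · rintro ⟨z, hz, rfl⟩
    exact ⟨z, z.norm_lt_one, (mem_disc2_union_geodesic2 z).1 hz, rfl⟩
  · rintro ⟨z, hz, hs, hq⟩
    refine ⟨UnitDisc.mk z hz, (mem_disc2_union_geodesic2 _).2 hs, coordQ_injective ?_⟩
    rw [coordQ_toQ, hq, UnitDisc.coe_mk]

/-- In the coordinate of `𝒬` the model map is `z³ ↦ (refl z)³` for `side z ≤ 0`. -/
theorem rho_eq {q : Q} {z : ℂ} (hz : ‖z‖ < 1) (hs : side z ≤ 0) (hq : coordQ q = z ^ 3) :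
    rho q = ofCoord (refl z ^ 3) := by
  have hex : q ∈ toQ '' (disc2 ∪ geodesic2) := mem_rhoDomain_iff.2 ⟨z, hz, hs, hq⟩
  have h1 := Function.invFunOn_mem hex
  have h2 := Function.invFunOn_eq hex
  set w := Function.invFunOn toQ (disc2 ∪ geodesic2) q with hw
  rw [mem_disc2_union_geodesic2] at h1
  have hwz : (w : ℂ) = z := by
    refine eq_of_cube_eq hz hs h1 ?_
    rw [← hq, ← h2, coordQ_toQ]
  rw [rho, ← hw, ← ofCoord_coordQ (toQ (rho2 w)), coordQ_toQ, coe_rho2, hwz]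

theorem rhoDomain_eq : rhoDomain = coordQ ⁻¹' (ball 0 1 \ quotOpen) := by
  ext q
  rw [mem_rhoDomain_iff]
  constructor
  · rintro ⟨z, hz, hs, hq⟩
    refine ⟨by simpa using norm_coordQ_lt_one q, ?_⟩
    rw [hq]
    exact cube_notMem_quotOpen hs
  · rintro ⟨-, hq⟩
    obtain ⟨z, rfl⟩ := exists_toQ q
    obtain ⟨w, hw, hs, he⟩ := exists_side_nonpos z.norm_lt_one hq
    exact ⟨w, hw, hs, he.symm⟩

/-- The three circles bounding the ideal triangle are the rotations of `C₂`. -/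
theorem mem_idealTriangle_iff (z : 𝔻) : z ∈ idealTriangle ↔ (z : ℂ) ∈ triangle := by
  have h3 : ((√3 : ℝ) : ℂ) ^ 2 = 3 := by
    rw [← ofReal_pow, Real.sq_sqrt (by norm_num)]; norm_num
  set ω : ℂ := ⟨-1 / 2, √3 / 2⟩ with hω
  have hωe : ω = -1 / 2 + √3 / 2 * I := by
    apply Complex.ext <;> simp [hω]
  have hω2 : ω ^ 2 = -1 - ω := by
    rw [hωe]
    linear_combination (1 / 4 : ℂ) * I ^ 2 * h3 + 3 / 4 * I_sq
  have hω3 : ω ^ 3 = 1 := by linear_combination (ω - 1) * hω2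
  have hroots : ∀ ζ : ℂ, ζ ^ 3 = 1 ↔ ζ = 1 ∨ ζ = ω ∨ ζ = ω ^ 2 := by
    intro ζ
    constructor
    · intro h
      have : (ζ - 1) * ((ζ - ω) * (ζ - ω ^ 2)) = 0 := by
        linear_combination h + (-ζ ^ 2 + ζ) * hω2 + (ζ - 1) * hω3
      simpa [sub_eq_zero] using this
    · rintro (rfl | rfl | rfl)
      · exact one_pow 3
      · exact hω3
      · linear_combination (ω ^ 3 + 1) * hω3
  have hdist : ∀ ζ c : ℂ, ζ ^ 3 = 1 → ζ * c = -2 → (√3 ≤ dist (z : ℂ) c ↔ 0 ≤ side (ζ * z)) := by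
    intro ζ c hζ hc
    have e : dist (z : ℂ) c = ‖ζ * z + 2‖ := by
      rw [dist_eq_norm, ← norm_rotation hζ, mul_sub, hc, sub_neg_eq_add]
    rw [e, side_eq, normSq_eq_norm_sq, sub_nonneg, Real.sqrt_le_left (norm_nonneg _)]
  have hc0 : (centre 0 : ℂ) = -2 * ω ^ 2 := by
    rw [hω2, hωe]
    apply Complex.ext <;> simp [centre] <;> ring
  have hc2 : (centre 2 : ℂ) = -2 * ω := by
    rw [hωe]
    apply Complex.ext <;> simp [centre] <;> ring
  have h0 := hdist ω (centre 0) hω3 (by rw [hc0]; linear_combination -2 * hω3)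
  have h1 := hdist 1 (centre 1) (one_pow 3) (by simp [centre])
  have h2 := hdist (ω ^ 2) (centre 2) ((hroots _).2 (Or.inr (Or.inr rfl)))
    (by rw [hc2]; linear_combination -2 * hω3)
  constructor
  · intro h
    refine ⟨z.norm_lt_one, fun ζ hζ => ?_⟩
    rcases (hroots ζ).1 hζ with rfl | rfl | rfl
    · exact h1.1 (h 1)
    · exact h0.1 (h 0)
    · exact h2.1 (h 2)
  · rintro ⟨-, h⟩ i
    fin_cases i
    · exact h0.2 (h ω hω3)
    · exact h1.2 (h 1 (one_pow 3))
    · exact h2.2 (h (ω ^ 2) ((hroots _).2 (Or.inr (Or.inr rfl))))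

theorem rhoPreimage_zero : rhoPreimage 0 = coordQ ⁻¹' quot 0 := by
  ext q
  obtain ⟨z, rfl⟩ := exists_toQ q
  rw [mem_preimage, coordQ_toQ, cube_mem_quot_iff]
  constructor
  · rintro ⟨w, hw, h⟩
    have h1 := congrArg coordQ h
    rw [coordQ_toQ, coordQ_toQ] at h1
    rw [← cube_mem_quot_iff, ← h1, cube_mem_quot_iff]
    exact (mem_idealTriangle_iff w).1 hw
  · exact fun h => ⟨z, (mem_idealTriangle_iff z).2 h, rfl⟩

theorem mem_rhoPreimage_succ {n : ℕ} {q : Q} : q ∈ rhoPreimage (n + 1) ↔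
    ∃ z : ℂ, ‖z‖ < 1 ∧ side z ≤ 0 ∧ coordQ q = z ^ 3 ∧ ofCoord (refl z ^ 3) ∈ rhoPreimage n := by
  constructor
  · rintro ⟨hq, h⟩
    obtain ⟨z, hz, hs, hqz⟩ := mem_rhoDomain_iff.1 hq
    exact ⟨z, hz, hs, hqz, by rwa [← rho_eq hz hs hqz]⟩
  · rintro ⟨z, hz, hs, hqz, h⟩
    exact ⟨mem_rhoDomain_iff.2 ⟨z, hz, hs, hqz⟩, by rwa [rho_eq hz hs hqz]⟩

theorem iUnion_rhoPreimage_succ {n : ℕ} (h : ⋃ k ∈ Icc 0 n, rhoPreimage k = coordQ ⁻¹' quot n) :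
    ⋃ k ∈ Icc 1 (n + 1), rhoPreimage k = coordQ ⁻¹' quotDom (n + 1) := by
  have hmem : ∀ z : ℂ, ‖z‖ < 1 → (z ∈ model n ↔ ∃ k ≤ n, ofCoord (z ^ 3) ∈ rhoPreimage k) := by
    intro z hz
    have h1 : ‖z ^ 3‖ < 1 := by
      rw [norm_pow]; exact pow_lt_one₀ (norm_nonneg z) hz three_ne_zero
    have h2 : ofCoord (z ^ 3) ∈ coordQ ⁻¹' quot n ↔ z ∈ model n := by
      rw [mem_preimage, coordQ_ofCoord h1, cube_mem_quot_iff]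
    rw [← h2, ← h]
    simp
  ext q
  simp only [mem_iUnion, mem_Icc, exists_prop]
  constructor
  · rintro ⟨k, ⟨hk1, hk2⟩, hx⟩
    obtain ⟨k, rfl⟩ := Nat.exists_eq_add_of_le' hk1
    obtain ⟨z, hz, hs, hq, hr⟩ := mem_rhoPreimage_succ.1 hx
    refine ⟨z, ⟨(mem_model_succ_iff hz hs).2 ?_, hs⟩, hq.symm⟩
    exact (hmem _ (norm_refl_lt_one hz)).2 ⟨k, by omega, hr⟩
  · rintro ⟨z, ⟨hz, hs⟩, hq⟩
    have hz1 := norm_lt_one_of_mem_model hz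
    obtain ⟨k, hk, hr⟩ := (hmem _ (norm_refl_lt_one hz1)).1 ((mem_model_succ_iff hz1 hs).1 hz)
    exact ⟨k + 1, ⟨by omega, by omega⟩, mem_rhoPreimage_succ.2 ⟨z, hz1, hs, hq.symm, hr⟩⟩

theorem iUnion_rhoPreimage (n : ℕ) : ⋃ k ∈ Icc 0 n, rhoPreimage k = coordQ ⁻¹' quot n := by
  induction n with
  | zero => rw [Icc_self, biUnion_singleton, rhoPreimage_zero]
  | succ n ih =>
    have h1 : ⋃ k ∈ Icc 0 (n + 1), rhoPreimage k =
        rhoPreimage 0 ∪ ⋃ k ∈ Icc 1 (n + 1), rhoPreimage k := by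
      rw [← Set.insert_Icc_add_one_left_eq_Icc (Nat.zero_le (n + 1)), biUnion_insert, zero_add]
    rw [h1, iUnion_rhoPreimage_succ ih, rhoPreimage_zero, quot_succ_eq, preimage_union]

theorem quotDom_eq (n : ℕ) : quotDom n = quot n \ quotOpen := by
  refine Subset.antisymm ?_ ?_
  · rintro _ ⟨z, ⟨hz, hs⟩, rfl⟩
    exact ⟨⟨z, hz, rfl⟩, cube_notMem_quotOpen hs⟩
  · rintro _ ⟨⟨z, hz, rfl⟩, h⟩
    obtain ⟨w, hw, hs, he⟩ := exists_side_nonpos (norm_lt_one_of_mem_model hz) h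
    refine ⟨w, ⟨?_, hs⟩, he⟩
    rw [← cube_mem_quot_iff, he, cube_mem_quot_iff]
    exact hz

theorem iUnion_Icc_one_rhoPreimage (n : ℕ) :
    ⋃ k ∈ Icc 1 (n + 1), rhoPreimage k = coordQ ⁻¹' (quot (n + 1) \ quotOpen) := by
  rw [iUnion_rhoPreimage_succ (iUnion_rhoPreimage n), quotDom_eq]

/-- A conjugacy in the coordinates `X` and `ξ` is a conformal conjugacy of the maps of the sphere
and of `𝒬`. -/
theorem IsConjugacy.conformallyConjugate {a : ℂ} (hb : Admissible (a - 1)) {T T' G G' : Set ℂ}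
    {χ ψ : ℂ → ℂ} (h : IsConjugacy (a - 1) T T' G G' χ ψ) :
    ConformallyConjugate (sigma a) (ofX '' (T \ cap (a - 1) (1 / 2))) (ofX '' T') rho
      (coordQ ⁻¹' (G \ quotOpen)) (coordQ ⁻¹' G') := by
  have hlt : ∀ ξ ∈ G, ‖ξ‖ < 1 := fun ξ hξ => by simpa using h.subset_ball hξ
  have hT'T : T' ⊆ T := by
    rw [← h.image]
    exact (h.maps.mono_left h.subset).image_subset
  have hcapT' : cap (a - 1) (1 / 2) ⊆ T' := by
    intro X hX
    have hXT := h.cap_subset hX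
    rw [← h.right_inv hXT, h.cap_iff _ (h.maps_inv hXT)] at hX
    rw [← h.image]
    exact ⟨_, h.quotOpen_subset hX, h.right_inv hXT⟩
  have hinvT' : MapsTo ψ T' G' := by
    rw [← h.image]
    rintro _ ⟨ξ, hξ, rfl⟩
    rwa [h.left_inv (h.subset hξ)]
  have hu : T \ cap (a - 1) (1 / 2) ∪ T' = T :=
    Subset.antisymm (union_subset sdiff_subset hT'T) fun X hX => by
      by_cases hc : X ∈ cap (a - 1) (1 / 2)
      · exact Or.inr (hcapT' hc)
      · exact Or.inl ⟨hX, hc⟩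
  have hu' : G \ quotOpen ∪ G' = G :=
    Subset.antisymm (union_subset sdiff_subset h.subset) fun X hX => by
      by_cases hc : X ∈ quotOpen
      · exact Or.inr (h.quotOpen_subset hc)
      · exact Or.inl ⟨hX, hc⟩
  -- the dynamics at corresponding points
  have key : ∀ q : Q, coordQ q ∈ G \ quotOpen → ∃ z : ℂ, refl z ^ 3 ∈ G' ∧
      rho q = ofCoord (refl z ^ 3) ∧ sigma a (ofX (χ (coordQ q))) = ofX (χ (refl z ^ 3)) := by
    intro q hq
    obtain ⟨z, hz, hs, hqz⟩ := mem_rhoDomain_iff.1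
      (rhoDomain_eq ▸ ⟨h.subset_ball hq.1, hq.2⟩ : q ∈ rhoDomain)
    obtain ⟨hr, Z, hZ, hc, hp, hm⟩ := h.conjugacy z hs (hqz ▸ hq.1)
    refine ⟨z, hr, rho_eq hz hs hqz, ?_⟩
    rw [hqz, ← hc, sigma_ofX hb hZ, chebSphere_ofZ hp, hm]
  have hcoord : ∀ X ∈ T, coordQ (ofCoord (ψ X)) = ψ X := fun X hX =>
    coordQ_ofCoord (hlt _ (h.maps_inv hX))
  have hdom : ∀ X ∈ T \ cap (a - 1) (1 / 2), ψ X ∈ G \ quotOpen := by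
    rintro X ⟨hX, hc⟩
    refine ⟨h.maps_inv hX, ?_⟩
    rwa [← h.cap_iff _ (h.maps_inv hX), h.right_inv hX]
  refine ⟨?_, ?_, ⟨fun x => ofCoord (ψ (toX x)), fun q => ofX (χ (coordQ q)), ofX '' T,
    coordQ ⁻¹' G, ?_, ?_, ?_, ?_⟩, ?_, ?_, ?_, ?_, ?_, ?_, ?_, ?_⟩
  · rintro _ ⟨X, hX, rfl⟩
    have h1 := hdom X hX
    rw [← hcoord X hX.1] at h1
    obtain ⟨z, hr, -, hs⟩ := key _ h1
    rw [hcoord X hX.1, h.right_inv hX.1] at hs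
    rw [hs, ← h.image]
    exact mem_image_of_mem _ (mem_image_of_mem _ hr)
  · intro q hq
    obtain ⟨z, hr, hρ, -⟩ := key q hq
    rw [hρ, mem_preimage, coordQ_ofCoord (hlt _ (h.subset hr))]
    exact hr
  · rintro _ ⟨X, hX, rfl⟩
    rw [mem_preimage, toX_ofX, hcoord X hX]
    exact h.maps_inv hX
  · intro q hq
    exact mem_image_of_mem _ (h.maps hq)
  · rintro _ ⟨X, hX, rfl⟩
    rw [toX_ofX, hcoord X hX, h.right_inv hX]
  · intro q hq
    rw [toX_ofX, h.left_inv hq, ofCoord_coordQ]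
  · rw [← image_union, hu]
  · rw [← preimage_union, hu']
  · refine Subset.antisymm ?_ ?_
    · rintro _ ⟨_, ⟨X, hX, rfl⟩, rfl⟩
      change ofCoord (ψ (toX (ofX X))) ∈ _
      rw [mem_preimage, toX_ofX, hcoord X hX.1]
      exact hdom X hX
    · intro q hq
      refine ⟨_, ⟨χ (coordQ q), ⟨h.maps hq.1, fun hc => hq.2 ((h.cap_iff _ hq.1).1 hc)⟩, rfl⟩, ?_⟩
      change ofCoord (ψ (toX (ofX _))) = q
      rw [toX_ofX, h.left_inv hq.1, ofCoord_coordQ]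
  · refine Subset.antisymm ?_ ?_
    · rintro _ ⟨_, ⟨X, hX, rfl⟩, rfl⟩
      change ofCoord (ψ (toX (ofX X))) ∈ _
      rw [mem_preimage, toX_ofX, hcoord X (hT'T hX)]
      exact hinvT' hX
    · intro q hq
      refine ⟨_, ⟨χ (coordQ q), ?_, rfl⟩, ?_⟩
      · rw [← h.image]
        exact mem_image_of_mem _ hq
      · change ofCoord (ψ (toX (ofX _))) = q
        rw [toX_ofX, h.left_inv (h.subset hq), ofCoord_coordQ]
  · change ContinuousOn (fun x => ofCoord (ψ (toX x))) (ofX '' T)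
    rw [isOpenEmbedding_coordQ.isEmbedding.continuousOn_iff]
    have h1 : ContinuousOn toX (ofX '' T) := by
      rintro _ ⟨X, -, rfl⟩
      exact (continuousAt_toX (ofX_ne X)).continuousWithinAt
    refine (h.cont_inv.comp h1 ?_).congr ?_
    · rintro _ ⟨X, hX, rfl⟩
      rwa [toX_ofX]
    · rintro _ ⟨X, hX, rfl⟩
      simp only [Function.comp_apply, toX_ofX]
      exact hcoord X hX
  · change ContinuousOn (fun q => ofX (χ (coordQ q))) (coordQ ⁻¹' G)
    exact continuous_ofX.comp_continuousOn
      (h.cont.comp continuous_coordQ.continuousOn fun q hq => hq)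
  · intro x hx
    change x ∈ interior (ofX '' T) at hx
    rw [interior_image_ofX] at hx
    obtain ⟨X, hX, rfl⟩ := hx
    refine holomorphicAt_ofX hX (fun Y hY => ?_) (h.diff_inv X hX)
    change coordQ (ofCoord (ψ (toX (ofX Y)))) = ψ Y
    rw [toX_ofX, hcoord Y hY]
  · rintro _ ⟨X, hX, rfl⟩
    change ofCoord (ψ (toX (sigma a (ofX X)))) = rho (ofCoord (ψ (toX (ofX X))))
    have h1 := hdom X hX
    rw [← hcoord X hX.1] at h1
    obtain ⟨z, hr, hρ, hs⟩ := key _ h1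
    rw [hcoord X hX.1, h.right_inv hX.1] at hs
    rw [hs, toX_ofX, toX_ofX, hρ, h.left_inv (h.subset hr)]

/-! ### The two cases -/

theorem conformallyConjugate_of_mem {a : ℂ} (ha : a ∈ connectednessLocus) :
    ConformallyConjugate (sigma a) (tilingSet a \ interior (fundamentalTile a)) (tilingSet a)
      rho rhoDomain univ := by
  obtain ⟨haS, h2⟩ := ha
  have hb := admissible_of_mem_parameterSpace haS
  rw [tilingSet_eq hb, ← ofX_one_quarter, ofX_injective.mem_set_image] at h2
  obtain ⟨χ, ψ, h⟩ := hb.exists_isConjugacy_iUnion fun n hn => h2 (mem_iUnion_of_mem n hn)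
  have huniv : coordQ ⁻¹' ball 0 1 = univ :=
    eq_univ_of_forall fun q => by simpa using norm_coordQ_lt_one q
  rw [tilingSet_diff_interior hb, tilingSet_eq hb, rhoDomain_eq, ← huniv]
  exact h.conformallyConjugate hb

theorem conformallyConjugate_of_notMem {a : ℂ} (haS : a ∈ parameterSpace)
    (ha : a ∉ connectednessLocus) :
    ConformallyConjugate (sigma a) (⋃ n ∈ Icc 1 (depth a), sigmaPreimage a n)
      (⋃ n ∈ Icc 0 (depth a - 1), sigmaPreimage a n) rho
      (⋃ n ∈ Icc 1 (depth a), rhoPreimage n) (⋃ n ∈ Icc 0 (depth a - 1), rhoPreimage n) := by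
  have hb := admissible_of_mem_parameterSpace haS
  have h0 : ((2 : ℂ) : Sphere) ∉ sigmaPreimage a 0 := by
    change _ ∉ fundamentalTile a
    rw [fundamentalTile_eq hb, ← ofX_one_quarter, ofX_injective.mem_set_image]
    exact one_quarter_notMem_tile hb
  have h2 : ((2 : ℂ) : Sphere) ∈ tilingSet a := by
    by_contra h
    exact ha ⟨haS, h⟩
  obtain ⟨k, hk⟩ := mem_iUnion.1 h2
  have hne : {n : ℕ | 1 ≤ n ∧ ((2 : ℂ) : Sphere) ∈ sigmaPreimage a n}.Nonempty :=
    ⟨k, Nat.one_le_iff_ne_zero.2 fun h => h0 (h ▸ hk), hk⟩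
  obtain ⟨n, hn⟩ := Nat.exists_eq_add_of_le' (Nat.sInf_mem hne).1
  have hdepth : depth a = n + 1 := hn
  -- the critical value needs exactly `n + 1` steps
  have hquarter : (1 / 4 : ℂ) ∉ tiles (a - 1) n := by
    rw [← ofX_injective.mem_set_image, ← iUnion_sigmaPreimage hb, ofX_one_quarter]
    simp only [mem_iUnion, mem_Icc, exists_prop, not_exists, not_and]
    intro m hm hmem
    have hm1 : 1 ≤ m := Nat.one_le_iff_ne_zero.2 fun h => h0 (h ▸ hmem)
    have : depth a ≤ m := Nat.sInf_le ⟨hm1, hmem⟩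
    omega
  obtain ⟨χ, ψ, h⟩ := hb.exists_isConjugacy hquarter
  rw [hdepth, Nat.add_sub_cancel, iUnion_Icc_one_sigmaPreimage hb, iUnion_sigmaPreimage hb,
    iUnion_Icc_one_rhoPreimage, iUnion_rhoPreimage]
  exact h.conformallyConjugate hb

end SchwarzCubic

theorem mainTheorem11 :
    (∀ a ∈ SchwarzCubic.connectednessLocus,
      SchwarzCubic.ConformallyConjugate (SchwarzCubic.sigma a)
        (SchwarzCubic.tilingSet a \ interior (SchwarzCubic.fundamentalTile a))
        (SchwarzCubic.tilingSet a)
        SchwarzCubic.rho SchwarzCubic.rhoDomain Set.univ) ∧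
    (∀ a ∈ SchwarzCubic.parameterSpace \ SchwarzCubic.connectednessLocus,
      SchwarzCubic.ConformallyConjugate (SchwarzCubic.sigma a)
        (⋃ n ∈ Set.Icc 1 (SchwarzCubic.depth a), SchwarzCubic.sigmaPreimage a n)
        (⋃ n ∈ Set.Icc 0 (SchwarzCubic.depth a - 1), SchwarzCubic.sigmaPreimage a n)
        SchwarzCubic.rho
        (⋃ n ∈ Set.Icc 1 (SchwarzCubic.depth a), SchwarzCubic.rhoPreimage n)
        (⋃ n ∈ Set.Icc 0 (SchwarzCubic.depth a - 1), SchwarzCubic.rhoPreimage n)) :=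
  ⟨fun _ ha => SchwarzCubic.conformallyConjugate_of_mem ha,
    fun _ ha => SchwarzCubic.conformallyConjugate_of_notMem ha.1 ha.2⟩
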